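/- **Conventions.** Let $n\ge 4$. For a Riemannian metric $g$ in dimension $n$ let $R_{ijkl}$ be the curvature tensor, $Ric_{ik}=R_{ijkl}g^{jl}$, $R=g^{ik}Ric_{ik}$, $P_{ij}=\frac1{n-2}\big(Ric_{ij}-\frac{R}{2(n-1)}g_{ij}\big)$ the Schouten tensor and $W_{ijkl}$ the Weyl tensor (the trace-free part of $R_{ijkl}$). A *contraction* is a formal tensor product of iterated covariant derivatives of $R$, $W$, $P$ and of scalar functions $\psi,\upsilon$, with a pattern according to which indices are contracted against each other by $g^{-1}$; it is *complete* if no index is free, and a *vector field* if exactly one index is free. Its *length* is its number of factors. An *internal contraction* is a pair of contracted indices in the same factor. A factor $\nabla^{(m)}R$, $\nabla^{(m)}W$ or $\nabla^{(m)}P$ contributes $-(m+2)$ to the weight, a factor $\nabla^{(p)}\psi$ or $\nabla^{(p)}\upsilon$ contributes $-p$. An equation between formal linear combinations (with real coefficients) of complete contractions *holds modulo length $\ge N$* if, after adding to one side a suitable linear combination of complete contractions of length $\ge N$, with factors $\nabla^{(m)}R$, $\nabla^{(p)}\psi$, $\nabla^{(p)}\upsilon$ only (and only factors $\nabla^{(m)}R$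 if the equation does not involve $\psi,\upsilon$), both sides take the same values for every Riemannian metric in dimension $n$ and all smooth functions $\psi,\upsilon$. **Form (1).** Fix integers $\tau,q,a\ge0$. A complete contraction or vector field is in form (1) if it is $$contr\big(\nabla^{(m_1)}R_{ijkl}\otimes\dots\otimes\nabla^{(m_s)}R_{ijkl}\otimes\nabla^{(p_1)}\psi\otimes\dots\otimes\nabla^{(p_q)}\psi\otimes\underbrace{\nabla\upsilon\otimes\dots\otimes\nabla\upsilon}_{a}\big)$$ with length $\tau+a$, without internal contractions, where no two factors $\nabla\upsilon$ are contracted against each other, no factor $\nabla\upsilon$ contains the free index, and $p\ge2$ for every factor $\nabla^{(p)}\psi$ which is not contracted against a factor $\nabla\upsilon$. **Weylify.** For $C$ in form (1), $Weylify[C]$ arises as follows. Let $r_{a_1},\dots,r_{a_x}$ ($x\ge 0$) be the indices of a factor that are contracted against factors $\nabla\upsilon$. A factor $\nabla^{(m)}_{r_1\dots r_m}R_{r_{m+1}\dots r_{m+4}}$ is replaced by $c\,\nabla^{r_{a_1}\dots r_{a_x}}\nabla^{(m)}_{r_1\dots r_m}W_{r_{m+1}\dots r_{m+4}}$, where $c=\frac{n-2}{n-3}$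 if one of $r_{m+1},\dots,r_{m+4}$ is contracted against a factor $\nabla\upsilon$, and $c=1$ otherwise. A factor $\nabla^{(p)}_{r_1\dots r_p}\psi$ with $p\ge2$ is replaced by $\nabla^{r_{a_1}\dots r_{a_x}}\nabla^{(p-2)}_{r_1\dots r_{p-2}}P_{r_{p-1}r_p}$, and an expression $\nabla_i\psi\nabla^i\upsilon$ by $P^b{}_b$. All factors $\nabla\upsilon$ are erased. The operation is extended linearly. **Form (2).** A complete contraction is in form (2) if each of its factors is $P^b{}_b$, or $\nabla^{f_1\dots f_y}\nabla^{(m)}_{r_1\dots r_m}W_{ijkl}$, or $\nabla^{f_1\dots f_y}\nabla^{(u)}_{r_1\dots r_u}P_{ij}$, where in the last two cases each of $f_1,\dots,f_y$ ($y\ge0$) is contracted against one of the indices $r_1,\dots,l$ (respectively $r_1,\dots,j$) of the same factor and no two of the latter indices are contracted between themselves. Let $\delta_W$ and $\delta_P$ be the numbers of internal contractions in the factors $\nabla^{(m)}W$ and in the factors $\nabla^{(u)}P$ (including the factors $P^b{}_b$). For a vector field $C^i$, $div_iC^i$ is the sum, over all factors, of the complete contractions in which $\nabla_i$ hits that factor;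 $Xdiv_iC^i$ is the part of this sum in which $\nabla_i$ hits neither the factor containing the free index ${}^i$ nor any factor $\nabla\upsilon$. **Lemma.** Let $0\le w\le n$. Let $C^l$ $(l\in L)$ be finitely many complete contractions of weight $-w$ and $C^{r,i}$ $(r\in R)$ finitely many vector fields of weight $-w+1$ (their divergences have weight $-w$), all in form (1) with the same $\tau,q,a$. Suppose that $$\sum_{l\in L}a_lC^l-Xdiv_i\sum_{r\in R}a_rC^{r,i}=0$$ modulo length $\ge\tau+a+1$. Then $$\sum_{l\in L}a_l\,Weylify[C^l]-div_i\sum_{r\in R}a_r\,Weylify[C^{r,i}]=\sum_{d\in D^1}a_dC^d+\sum_{d\in D^2}a_dC^d$$ modulo length $\ge\tau+1$, where all $C^d$ are complete contractions in form (2) of length $\tau$ and weight $-w$; those with $d\in D^1$ have fewer than $q$ factors $\nabla^{(u)}P$, and those with $d\in D^2$ have exactly $q$ factors $\nabla^{(u)}P$ and $\delta_W+\delta_P\ge a+1$. -/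

import Mathlib

open scoped ContDiff

namespace RiemContr

/-! ### Formal contractions, in abstract index notation -/

/-- The tensors which occur: the curvature tensor `R_{ijkl}`, the Weyl tensor `W_{ijkl}`, the
Schouten tensor `P_{ij}`, and two scalar functions `ψ` and `υ`. -/
inductive Kind where
  | R | W | P | psi | ups
  deriving DecidableEq

/-- The number of internal indices (the indices which are not derivative indices). -/
def Kind.arity : Kind → ℕ
  | .R => 4
  | .W => 4
  | .P => 2
  | .psi => 0
  | .ups => 0

/-- An iterated covariant derivative of one of the tensors above, written with named lower indices.
The list `idx` holds the derivative indices `r₁, …, r_m` (`r₁` is the outermost derivative),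
followed by the internal indices. For example `∇_r R_{ijkl}` is `⟨.R, [r, i, j, k, l]⟩`. -/
structure Factor where
  kind : Kind
  idx : List ℕ

/-- The names of the internal indices of a factor. -/
def Factor.internal (F : Factor) : List ℕ := F.idx.drop (F.idx.length - F.kind.arity)

/-- A (complete or partial) contraction: a tensor product of factors, where two indices are
contracted against each other (with the inverse metric) when they bear the same name. Its length
is the number of its factors, that is, the length of the list. -/
abbrev Contr := List Factor

/-- All the indices of a contraction. -/
def Contr.labels (C : Contr) : List ℕ := C.flatMap Factor.idx

/-- Every factor has at least its internal indices. -/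
def Contr.WellFormed (C : Contr) : Prop := ∀ F ∈ C, F.kind.arity ≤ F.idx.length

/-- Complete contractions: every name that occurs, occurs exactly twice. -/
def Contr.IsComplete (C : Contr) : Prop :=
  C.WellFormed ∧ ∀ l ∈ C.labels, C.labels.count l = 2

/-- Partial contractions with exactly one free index (vector fields). The free index always bears
the name `0`; every other name that occurs, occurs exactly twice. -/
def Contr.IsVector (C : Contr) : Prop :=
  C.WellFormed ∧ C.labels.count 0 = 1 ∧ ∀ l ∈ C.labels, l ≠ 0 → C.labels.count l = 2

/-- The number of factors of a given kind. -/
def Contr.numKind (k : Kind) (C : Contr) : ℕ := C.countP (fun F => F.kind = k)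

/-- Minus the weight of a factor: `m + 2` for `∇^{(m)}R`, `∇^{(m)}W` and `∇^{(m)}P`, and `p` for
`∇^{(p)}ψ` and `∇^{(p)}υ`. -/
def Factor.wt (F : Factor) : ℕ :=
  match F.kind with
  | .R => F.idx.length - 2
  | .W => F.idx.length - 2
  | .P => F.idx.length
  | .psi => F.idx.length
  | .ups => F.idx.length

/-- A complete contraction `C` has weight `-(C.wt)`. For a vector field, `C.wt` is one less than
that of its divergence. -/
def Contr.wt (C : Contr) : ℕ := (C.map Factor.wt).sum

/-- The number of internal contractions of a factor: the names which it bears twice. -/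
def Factor.numInternal (F : Factor) : ℕ := (F.idx.toFinset.filter (fun l => F.idx.count l = 2)).card

/-- The number of internal contractions in all the factors of a given kind. -/
def Contr.delta (k : Kind) (C : Contr) : ℕ :=
  ((C.filter (fun F => F.kind = k)).map Factor.numInternal).sum

/-- The indices of the factors `∇υ`. -/
def Contr.upsLabels (C : Contr) : List ℕ := Contr.labels (C.filter (fun F => F.kind = .ups))

/-- The form `contr(∇^{(m₁)}R ⊗ ⋯ ⊗ ∇^{(m_s)}R ⊗ ∇^{(p₁)}ψ ⊗ ⋯ ⊗ ∇^{(p_q)}ψ ⊗ ∇υ ⊗ ⋯ ⊗ ∇υ)` of the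
contractions on which `Weylify` acts, with `q` factors `∇^{(p)}ψ`, `a` factors `∇υ` and length
`τ + a`. -/
structure Contr.IsCurvatureForm (τ q a : ℕ) (C : Contr) : Prop where
  kinds : ∀ F ∈ C, F.kind = .R ∨ F.kind = .psi ∨ F.kind = .ups
  /-- the function `υ` is differentiated exactly once in each factor -/
  ups_once : ∀ F ∈ C, F.kind = .ups → F.idx.length = 1
  num_psi : C.numKind .psi = q
  num_ups : C.numKind .ups = a
  len : C.length = τ + a
  /-- there are no internal contractions -/
  no_internal : ∀ F ∈ C, F.idx.Nodup
  /-- no two factors `∇υ` contract against each other -/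
  ups_apart : C.upsLabels.Nodup
  /-- no factor `∇υ` contains the free index -/
  ups_not_free : ∀ l ∈ C.upsLabels, C.labels.count l ≠ 1
  /-- a factor `∇^{(p)}ψ` which is not contracted against a factor `∇υ` has `p ≥ 2` -/
  psi_twice : ∀ F ∈ C, F.kind = .psi → (∀ l ∈ F.idx, l ∉ C.upsLabels) → 2 ≤ F.idx.length

/-- The factors `∇^{f₁…f_y}∇^{(m)}_{r₁…r_m}W_{ijkl}`, `∇^{f₁…f_y}∇^{(u)}_{r₁…r_u}P_{ij}` and `P^b_b`.
In the first two each of `f₁, …, f_y` is contracted against one of the indices of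
`∇^{(m)}_{r₁…r_m}W_{ijkl}`, respectively of `∇^{(u)}_{r₁…r_u}P_{ij}`, and no two of the latter are
contracted between themselves. -/
def Factor.IsWeylForm (F : Factor) : Prop :=
  (F.kind = .P ∧ ∃ b, F.idx = [b, b]) ∨
  ((F.kind = .W ∨ F.kind = .P) ∧
    ∃ f r : List ℕ, F.idx = f ++ r ∧ F.kind.arity ≤ r.length ∧ r.Nodup ∧ ∀ l ∈ f, l ∈ r)

/-- Products of `τ` factors `∇^{f₁…f_y}∇^{(m)}W`, `∇^{f₁…f_y}∇^{(u)}P`, `P^b_b` as above. -/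
def Contr.IsWeylForm (τ : ℕ) (C : Contr) : Prop :=
  C.length = τ ∧ ∀ F ∈ C, F.IsWeylForm

/-! ### Formal linear combinations and the operations on them -/

/-- Formal linear combinations of contractions with real coefficients. -/
abbrev LinComb := Contr →₀ ℝ

/-- The contraction in which the `p`-th factor is hit by a covariant derivative `∇^i`, contracted
against the free index `i` (which bears the name `0`). -/
def Contr.hit (C : Contr) (p : ℕ) : Contr := C.modify p (fun F => ⟨F.kind, 0 :: F.idx⟩)

/-- The divergence of a vector field (Leibniz rule; the metric is parallel). -/
noncomputable def Contr.div (C : Contr) : LinComb :=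
  ∑ p : Fin C.length, Finsupp.single (C.hit p) 1

/-- The part of the divergence in which the derivative hits neither the factor with the free index
nor any factor `∇υ`. -/
noncomputable def Contr.xdiv (C : Contr) : LinComb :=
  ∑ p : Fin C.length,
    if 0 ∈ (C.get p).idx ∨ (C.get p).kind = .ups then 0 else Finsupp.single (C.hit p) 1

noncomputable def LinComb.div (L : LinComb) : LinComb := L.sum fun C c => c • C.div

noncomputable def LinComb.xdiv (L : LinComb) : LinComb := L.sum fun C c => c • C.xdiv

/-- `Weylify` on a factor, up to a constant: `u` are the indices of the factors `∇υ`. A factor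
`∇^{(m)}_{r₁…r_m}R_{ijkl}` whose indices `r_{a₁}, …, r_{a_x}` are contracted against factors `∇υ`
becomes `∇^{r_{a₁}…r_{a_x}}∇^{(m)}_{r₁…r_m}W_{ijkl}`; a factor `∇^{(p)}_{r₁…r_p}ψ`, `p ≥ 2`, becomes
`∇^{r_{a₁}…r_{a_x}}∇^{(p-2)}_{r₁…r_{p-2}}P_{r_{p-1}r_p}`; a factor `∇_bψ` contracted against a factor
`∇^bυ` becomes `P^b_b`. -/
def Factor.weyl (u : List ℕ) (F : Factor) : Factor :=
  match F.kind with
  | .R => ⟨.W, F.idx.filter (fun l => l ∈ u) ++ F.idx⟩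
  | .psi => ⟨.P, F.idx.filter (fun l => l ∈ u) ++ F.idx⟩
  | _ => F

/-- The constant for the same step: `(n - 2)/(n - 3)` for a factor `∇^{(m)}R_{ijkl}` one of whose
internal indices is contracted against a factor `∇υ`, and `1` otherwise. -/
noncomputable def Factor.weylCoeff (n : ℕ) (u : List ℕ) (F : Factor) : ℝ :=
  if F.kind = .R ∧ ∃ l ∈ F.internal, l ∈ u then ((n : ℝ) - 2) / ((n : ℝ) - 3) else 1

/-- All factors are replaced and the factors `∇υ` are erased. -/
def Contr.weyl (C : Contr) : Contr :=
  (C.filter (fun F => F.kind ≠ .ups)).map (Factor.weyl C.upsLabels)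

noncomputable def Contr.weylCoeff (n : ℕ) (C : Contr) : ℝ :=
  (C.map (Factor.weylCoeff n C.upsLabels)).prod

/-- The operation `Weylify`, extended to linear combinations. -/
noncomputable def LinComb.weylify (n : ℕ) (L : LinComb) : LinComb :=
  L.sum fun C c => Finsupp.single C.weyl (c * C.weylCoeff n)

/-! ### The values of contractions -/

/-- Coordinate space. -/
abbrev E (n : ℕ) := EuclideanSpace ℝ (Fin n)

/-- A smooth Riemannian metric `g_{ij} dx^i dx^j` on an open set of `ℝⁿ`, that is, a Riemannian
metric in a coordinate chart. -/
structure LocalMetric (n : ℕ) where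
  U : Set (E n)
  isOpen : IsOpen U
  g : E n → Matrix (Fin n) (Fin n) ℝ
  smooth : ∀ i j, ContDiffOn ℝ ∞ (fun x => g x i j) U
  posDef : ∀ x ∈ U, (g x).PosDef

/-- The partial derivative `∂_k f`. -/
noncomputable def pd {n : ℕ} (k : Fin n) (f : E n → ℝ) (x : E n) : ℝ :=
  fderiv ℝ f x (EuclideanSpace.single k 1)

/-- The components of a field of covariant tensors (of one fixed rank, the other values being
irrelevant). -/
abbrev Components (n : ℕ) := List (Fin n) → E n → ℝ

namespace LocalMetric

variable {n : ℕ} (G : LocalMetric n)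

/-- The inverse metric `g^{ij}`. -/
noncomputable def ginv (x : E n) (i j : Fin n) : ℝ := (G.g x)⁻¹ i j

/-- The Christoffel symbols `Γ^k_{ij}`. -/
noncomputable def christoffel (k i j : Fin n) (x : E n) : ℝ :=
  (1 / 2) * ∑ l, G.ginv x k l *
    (pd i (fun y => G.g y j l) x + pd j (fun y => G.g y i l) x - pd l (fun y => G.g y i j) x)

/-- The covariant derivative of a covariant tensor; the new index is the first one. -/
noncomputable def nabla (T : Components n) : Components n
  | [], _ => 0
  | k :: v, x => pd k (T v) x -
      ∑ s : Fin v.length, ∑ l : Fin n, G.christoffel l k (v.get s) x * T (v.set s l) x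

/-- The curvature tensor `R_{ijkl}`, with the sign for which `g_{ik}g_{jl} - g_{il}g_{jk}` is the
curvature of the unit sphere. -/
noncomputable def riem (i j k l : Fin n) (x : E n) : ℝ :=
  ∑ m, G.g x i m *
    (pd k (G.christoffel m l j) x - pd l (G.christoffel m k j) x
      + ∑ p, (G.christoffel m k p x * G.christoffel p l j x
        - G.christoffel m l p x * G.christoffel p k j x))

/-- The Ricci tensor `Ric_{ik} = R_{ijkl} g^{jl}`. -/
noncomputable def ricci (i k : Fin n) (x : E n) : ℝ :=
  ∑ j, ∑ l, G.ginv x j l * G.riem i j k l x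

/-- The scalar curvature. -/
noncomputable def scalar (x : E n) : ℝ := ∑ i, ∑ k, G.ginv x i k * G.ricci i k x

/-- The Schouten tensor. -/
noncomputable def schouten (i j : Fin n) (x : E n) : ℝ :=
  1 / ((n : ℝ) - 2) * (G.ricci i j x - G.scalar x / (2 * ((n : ℝ) - 1)) * G.g x i j)

/-- The Weyl tensor, the trace-free part of the curvature tensor. -/
noncomputable def weyl (i j k l : Fin n) (x : E n) : ℝ :=
  G.riem i j k l x + (G.schouten j k x * G.g x i l + G.schouten i l x * G.g x j k
    - G.schouten j l x * G.g x i k - G.schouten i k x * G.g x j l)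

/-- The undifferentiated tensors. -/
noncomputable def base (ψ υ : E n → ℝ) : Kind → Components n
  | .R, [i, j, k, l] => G.riem i j k l
  | .W, [i, j, k, l] => G.weyl i j k l
  | .P, [i, j] => G.schouten i j
  | .psi, [] => ψ
  | .ups, [] => υ
  | _, _ => 0

/-- The component, with indices `v`, of the iterated covariant derivative `∇^{(m)}T`, where `T` is
the tensor of the given kind and `m + arity` is the number of indices. -/
noncomputable def comp (ψ υ : E n → ℝ) (k : Kind) (v : List (Fin n)) (x : E n) : ℝ :=
  (G.nabla)^[v.length - k.arity] (G.base ψ υ k) v x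

/-- The components of the tensor product of the factors, before any contraction. -/
noncomputable def tensorProd (ψ υ : E n → ℝ) : Contr → List (Fin n) → E n → ℝ
  | [], _, _ => 1
  | F :: C, v, x => G.comp ψ υ F.kind (v.take F.idx.length) x *
      tensorProd ψ υ C (v.drop F.idx.length) x

/-- The value of a complete contraction: any two indices of the tensor product which bear the same
name are contracted with the inverse metric. -/
noncomputable def eval (ψ υ : E n → ℝ) (C : Contr) (x : E n) : ℝ :=
  ∑ c : Fin C.labels.length → Fin n,
    (∏ s : Fin C.labels.length, ∏ t : Fin C.labels.length,
      if s < t ∧ C.labels.get s = C.labels.get t then G.ginv x (c s) (c t) else 1) *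
    G.tensorProd ψ υ C (List.ofFn c) x

/-- The value of a linear combination of complete contractions. -/
noncomputable def evalLin (ψ υ : E n → ℝ) (L : LinComb) (x : E n) : ℝ :=
  L.sum fun C c => c * G.eval ψ υ C x

end LocalMetric

/-- The local equation `A = B` in dimension `n`: it holds for every Riemannian metric on a coordinate
chart, all smooth functions `ψ` and `υ`, and at every point. -/
def LocallyEqual (n : ℕ) (A B : LinComb) : Prop :=
  ∀ (G : LocalMetric n) (ψ υ : E n → ℝ), ContDiffOn ℝ ∞ ψ G.U → ContDiffOn ℝ ∞ υ G.U →
    ∀ x ∈ G.U, G.evalLin ψ υ A x = G.evalLin ψ υ B x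

/-- The local equation `A = B` holds modulo complete contractions of length `≥ N`, with factors of
the kinds in `S`: it holds once some linear combination of such contractions is added. -/
def EqualModLength (n : ℕ) (S : Set Kind) (N : ℕ) (A B : LinComb) : Prop :=
  ∃ J : LinComb, (∀ C ∈ J.support, C.IsComplete ∧ N ≤ C.length ∧ ∀ F ∈ C, F.kind ∈ S) ∧
    LocallyEqual n A (B + J)

end RiemContr

/-!
The hypothesis is an identity between tensors, and the conclusion is an identity between other tensors.
The bridge is a purely formal statement: the linear combination `∑ a_l C^l - Xdiv ∑ a_r C^{r,i}`
vanishes as a consequence of the linear symmetries of its factors alone, and these symmetries survive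
`Weylify`, up to the error terms in the conclusion.
Below, the contractions with `IsCurvatureForm` are said to be in the first form, those with `IsWeylForm`
in the second form.

*Leading parts.* The identity is applied to the metrics `δ + t H` and the functions `t ψ`, `t υ`. In
the limit `t → 0` the longer contractions disappear, and every factor is replaced by its linearization,
in which covariant derivatives commute. The derivatives of `H`, `ψ`, `υ` at a point are arbitrary, so
the leading part vanishes as a polynomial in these derivatives (`leadingPart_eq_zero`).

*Recovering contractions from leading parts.* The linearized curvature determines the perturbation of
the metric up to an infinitesimal diffeomorphism. Algebraically, a function with the symmetries of the
derivatives of a curvature tensor is recovered from its symmetrization (`CurvLike.reconstruct`). So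
there is a substitution which expresses the derivatives of the metric through formal curvature factors,
and a linear map from the polynomials in these factors to the classes of weylified contractions modulo
error terms, which sends the leading part of `C` to a multiple of `Weylify[C]` (`weylMap_leadingPart`).
The values of the indices serve as their names, and the multiple is the number of ways to give
different values to the names. It is not zero since the weight bounds the number of names by `w ≤ n`,
and it is the same for all contractions under consideration. Consequently a vanishing leading part
makes the weylified linear combination an error term (`mkQ_weylify_eq_zero`).

*Symmetries of weylified factors.* The linear map exists because the weylified factors have the
symmetries of the original ones, modulo error terms.
Derivatives commute modulo longer contractions (`cls_deriv_perm`). A factor `∇^{(u)}P` is symmetric in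
all indices, because the Cotton tensor is a multiple of the divergence of the Weyl tensor, so that the
difference has fewer factors `∇^{(u)}P` (`ErrorSpace.cls_P_perm`). For a factor `∇^{(m)}W` the point
is the second Bianchi identity (`WeylSlot.second`), which for the Weyl tensor holds only up to products
of the metric and the Cotton tensor. If the metric bears no index that belongs to a factor `∇υ`, the
term has one more internal contraction and is an error term. Otherwise the Cotton tensors which the
metric leaves behind have to be compared with the divergences of the Weyl tensor in the other two terms
of the identity, and they cancel precisely because of the constant `(n - 2)/(n - 3)`. With the Bianchi
identities at hand the weylified factors are curvature-like (`weylCls_curvLike`).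

*Divergences.* Finally, `div` of a weylified vector field agrees with `Weylify` of `Xdiv`
(`mkQ_div_weylify`): if the derivative hits the factor with the free index, the result has an
additional internal contraction and is an error term, the factors `∇υ` are no longer there, and in all
other cases `∇_i` only has to be commuted with the new derivatives.

All identities between contractions are verified in an orthonormal frame, where a contraction becomes a
sum over the values of the names of its indices (`LocalMetric.eval_eq_val`). Commutators of covariant
derivatives are tensor fields built from the curvature tensor, and their complete contractions are
brought into the form of linear combinations of contractions of curvature factors
(`CurvField.exists_linComb`).
-/

namespace RiemContr

/-! ### Partial derivatives and derivations on components -/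

section PartialDerivatives

variable {n : ℕ} {U : Set (E n)} {f h : E n → ℝ}

theorem pd_contDiffOn (hU : IsOpen U) (hf : ContDiffOn ℝ ∞ f U) (k : Fin n) :
    ContDiffOn ℝ ∞ (pd k f) U := by
  have h1 : ContDiffOn ℝ ∞ (fderiv ℝ f) U := hf.fderiv_of_isOpen hU (by simp)
  exact h1.clm_apply contDiffOn_const

theorem differentiableAt_of_contDiffOn (hU : IsOpen U) (hf : ContDiffOn ℝ ∞ f U) {x : E n}
    (hx : x ∈ U) : DifferentiableAt ℝ f x :=
  (hf.contDiffAt (hU.mem_nhds hx)).differentiableAt (by simp)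

theorem pd_congr (hU : IsOpen U) (hfh : ∀ x ∈ U, f x = h x) {x : E n} (hx : x ∈ U) (k : Fin n) :
    pd k f x = pd k h x := by
  have : f =ᶠ[nhds x] h := Filter.eventuallyEq_of_mem (hU.mem_nhds hx) hfh
  unfold pd
  rw [this.fderiv_eq]

theorem pd_add {x : E n} (hf : DifferentiableAt ℝ f x) (hh : DifferentiableAt ℝ h x) (k : Fin n) :
    pd k (fun y => f y + h y) x = pd k f x + pd k h x := by
  unfold pd
  rw [fderiv_fun_add hf hh]
  rfl

theorem pd_sub {x : E n} (hf : DifferentiableAt ℝ f x) (hh : DifferentiableAt ℝ h x) (k : Fin n) :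
    pd k (fun y => f y - h y) x = pd k f x - pd k h x := by
  unfold pd
  rw [fderiv_fun_sub hf hh]
  rfl

theorem pd_mul {x : E n} (hf : DifferentiableAt ℝ f x) (hh : DifferentiableAt ℝ h x) (k : Fin n) :
    pd k (fun y => f y * h y) x = pd k f x * h x + f x * pd k h x := by
  unfold pd
  rw [fderiv_fun_mul hf hh]
  simp only [add_apply, smul_apply, smul_eq_mul]
  ring

theorem pd_const_mul {x : E n} (hf : DifferentiableAt ℝ f x) (c : ℝ) (k : Fin n) :
    pd k (fun y => c * f y) x = c * pd k f x := by
  unfold pd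
  rw [fderiv_const_mul hf]
  rfl

theorem pd_const (c : ℝ) (k : Fin n) (x : E n) : pd k (fun _ => c) x = 0 := by
  simp [pd]

theorem pd_sum {ι : Type*} (s : Finset ι) {F : ι → E n → ℝ} {x : E n}
    (hF : ∀ i ∈ s, DifferentiableAt ℝ (F i) x) (k : Fin n) :
    pd k (fun y => ∑ i ∈ s, F i y) x = ∑ i ∈ s, pd k (F i) x := by
  unfold pd
  rw [fderiv_fun_sum hF]
  simp

theorem pd_comm (hU : IsOpen U) (hf : ContDiffOn ℝ ∞ f U) {x : E n} (hx : x ∈ U) (k l : Fin n) :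
    pd k (pd l f) x = pd l (pd k f) x := by
  have hc : ContDiffAt ℝ ∞ f x := hf.contDiffAt (hU.mem_nhds hx)
  have hs : IsSymmSndFDerivAt ℝ f x := by
    apply hc.isSymmSndFDerivAt
    simp [minSmoothness_of_isRCLikeNormedField]
    exact WithTop.coe_le_coe.2 le_top
  have h1 : ContDiffOn ℝ ∞ (fderiv ℝ f) U := hf.fderiv_of_isOpen hU (by simp)
  have hd : DifferentiableAt ℝ (fderiv ℝ f) x :=
    (h1.contDiffAt (hU.mem_nhds hx)).differentiableAt (by simp)
  have key : ∀ a b : Fin n, pd a (pd b f) x =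
      fderiv ℝ (fderiv ℝ f) x (EuclideanSpace.single a 1) (EuclideanSpace.single b 1) := by
    intro a b
    unfold pd
    rw [fderiv_clm_apply hd (differentiableAt_const _)]
    simp
  rw [key, key]
  exact hs _ _

end PartialDerivatives

/-- The derivation on tensor components induced by the matrix `M`: the sum, over all slots, of the
terms in which `M` acts on that slot. -/
def der {n : ℕ} (M : Fin n → Fin n → ℝ) : (List (Fin n) → ℝ) → List (Fin n) → ℝ
  | _, [] => 0
  | T, a :: v => ∑ m, M m a * T (m :: v) + der M (fun w => T (a :: w)) v

section Der

variable {n : ℕ} (M N : Fin n → Fin n → ℝ)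

theorem der_eq_sum (T : List (Fin n) → ℝ) (v : List (Fin n)) :
    der M T v = ∑ s : Fin v.length, ∑ l : Fin n, M l (v.get s) * T (v.set s l) := by
  induction v generalizing T with
  | nil => simp [der]
  | cons a v ih =>
    simp only [der, ih]
    exact (Fin.sum_univ_succ (fun s : Fin (v.length + 1) =>
      ∑ l, M l ((a :: v).get s) * T ((a :: v).set s l))).symm

theorem der_add (T S : List (Fin n) → ℝ) (v : List (Fin n)) :
    der M (fun w => T w + S w) v = der M T v + der M S v := by
  simp only [der_eq_sum, mul_add, Finset.sum_add_distrib]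

theorem der_smul (c : ℝ) (T : List (Fin n) → ℝ) (v : List (Fin n)) :
    der M (fun w => c * T w) v = c * der M T v := by
  simp only [der_eq_sum, Finset.mul_sum]
  refine Finset.sum_congr rfl fun s _ => Finset.sum_congr rfl fun l _ => by ring

theorem der_mul_const (c : ℝ) (T : List (Fin n) → ℝ) (v : List (Fin n)) :
    der M (fun w => T w * c) v = der M T v * c := by
  simp only [mul_comm _ c, der_smul]

theorem der_sum {ι : Type*} (s : Finset ι) (T : ι → List (Fin n) → ℝ) (v : List (Fin n)) :
    der M (fun w => ∑ i ∈ s, T i w) v = ∑ i ∈ s, der M (T i) v := by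
  simp only [der_eq_sum, Finset.mul_sum]
  rw [eq_comm, Finset.sum_comm]
  refine Finset.sum_congr rfl fun t _ => ?_
  rw [Finset.sum_comm]

theorem der_zero (v : List (Fin n)) : der M (fun _ => 0) v = 0 := by
  simp [der_eq_sum]

theorem der_congr {T S : List (Fin n) → ℝ} {v : List (Fin n)}
    (h : ∀ w : List (Fin n), w.length = v.length → T w = S w) : der M T v = der M S v := by
  simp only [der_eq_sum]
  refine Finset.sum_congr rfl fun s _ => Finset.sum_congr rfl fun l _ => ?_
  rw [h _ (by simp)]

theorem der_append (T : List (Fin n) → ℝ) (v w : List (Fin n)) :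
    der M T (v ++ w) = der M (fun v' => T (v' ++ w)) v + der M (fun w' => T (v ++ w')) w := by
  induction v generalizing T with
  | nil => simp [der]
  | cons a v ih =>
    simp only [List.cons_append, der, ih]
    ring

theorem der_sub_matrix (T : List (Fin n) → ℝ) (v : List (Fin n)) :
    der (fun i j => M i j - N i j) T v = der M T v - der N T v := by
  simp only [der_eq_sum, sub_mul, Finset.sum_sub_distrib]

/-- The commutator of two such derivations is the one induced by the commutator matrix. -/
theorem der_commutator (T : List (Fin n) → ℝ) (v : List (Fin n)) :
    der M (der N T) v - der N (der M T) v =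
      der (fun p a => ∑ m, (N p m * M m a - M p m * N m a)) T v := by
  induction v generalizing T with
  | nil => simp [der]
  | cons a v ih =>
    have e1 : ∀ A B : Fin n → Fin n → ℝ, der A (der B T) (a :: v) =
        ∑ m, ∑ p, A m a * (B p m * T (p :: v)) + ∑ m, A m a * der B (fun w => T (m :: w)) v
        + ∑ m, B m a * der A (fun w => T (m :: w)) v
        + der A (der B (fun w => T (a :: w))) v := by
      intro A B
      have : (fun w => der B T (a :: w)) = fun w => ∑ m, B m a * T (m :: w)
          + der B (fun w => T (a :: w)) w := by
        funext w; simp only [der]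
      simp only [der]
      rw [der_add, der_sum]
      simp only [der_smul, mul_add, Finset.sum_add_distrib, Finset.mul_sum]
      ring
    rw [e1 M N, e1 N M]
    simp only [der]
    rw [← ih (fun w => T (a :: w))]
    have e2 : ∑ p, (∑ m, (N p m * M m a - M p m * N m a)) * T (p :: v) =
        (∑ m, ∑ p, M m a * (N p m * T (p :: v))) - ∑ m, ∑ p, N m a * (M p m * T (p :: v)) := by
      rw [Finset.sum_comm, Finset.sum_comm (f := fun m p => N m a * (M p m * T (p :: v))),
        ← Finset.sum_sub_distrib]
      refine Finset.sum_congr rfl fun p _ => ?_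
      rw [← Finset.sum_sub_distrib, Finset.sum_mul]
      refine Finset.sum_congr rfl fun m _ => by ring
    rw [e2]
    ring

theorem pd_der {U : Set (E n)} (hU : IsOpen U) {M : Fin n → Fin n → E n → ℝ} {T : Components n}
    {x : E n} (hx : x ∈ U) (v : List (Fin n)) (hM : ∀ i j, ContDiffOn ℝ ∞ (M i j) U)
    (hT : ∀ w : List (Fin n), w.length = v.length → ContDiffOn ℝ ∞ (T w) U) (k : Fin n) :
    pd k (fun y => der (fun i j => M i j y) (fun w => T w y) v) x =
      der (fun i j => pd k (M i j) x) (fun w => T w x) v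
      + der (fun i j => M i j x) (fun w => pd k (T w) x) v := by
  simp only [der_eq_sum]
  have dM := fun i j => differentiableAt_of_contDiffOn hU (hM i j) hx
  have dT := fun w hw => differentiableAt_of_contDiffOn hU (hT w hw) hx
  have d1 : ∀ (s : Fin v.length) (l : Fin n), DifferentiableAt ℝ
      (fun y => M l (v.get s) y * T (v.set s l) y) x := fun s l =>
    (dM _ _).mul (dT _ (by simp))
  rw [pd_sum _ (fun s _ => DifferentiableAt.fun_sum fun l _ => d1 s l), ← Finset.sum_add_distrib]
  refine Finset.sum_congr rfl fun s _ => ?_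
  rw [pd_sum _ (fun l _ => d1 s l), ← Finset.sum_add_distrib]
  refine Finset.sum_congr rfl fun l _ => ?_
  rw [pd_mul (dM _ _) (dT _ (by simp))]

theorem der_contDiffOn {U : Set (E n)} {M : Fin n → Fin n → E n → ℝ} {T : Components n}
    (v : List (Fin n)) (hM : ∀ i j, ContDiffOn ℝ ∞ (M i j) U)
    (hT : ∀ w : List (Fin n), w.length = v.length → ContDiffOn ℝ ∞ (T w) U) :
    ContDiffOn ℝ ∞ (fun y => der (fun i j => M i j y) (fun w => T w y) v) U := by
  simp only [der_eq_sum]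
  exact ContDiffOn.sum fun s _ => ContDiffOn.sum fun l _ => (hM _ _).mul (hT _ (by simp))

end Der

/-! ### Index operations on components: transpositions, traces and products -/

/-- Exchange the entries in positions `p` and `p + 1`. -/
def swapAt {α : Type*} : ℕ → List α → List α
  | 0, a :: b :: l => b :: a :: l
  | p + 1, a :: l => a :: swapAt p l
  | _, l => l

@[simp] theorem swapAt_zero_cons {α : Type*} (a b : α) (l : List α) :
    swapAt 0 (a :: b :: l) = b :: a :: l := rfl

@[simp] theorem swapAt_succ_cons {α : Type*} (p : ℕ) (a : α) (l : List α) :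
    swapAt (p + 1) (a :: l) = a :: swapAt p l := rfl

@[simp] theorem length_swapAt {α : Type*} (p : ℕ) (l : List α) :
    (swapAt p l).length = l.length := by
  induction p generalizing l with
  | zero => rcases l with _ | ⟨a, _ | ⟨b, l⟩⟩ <;> rfl
  | succ p ih => rcases l with _ | ⟨a, l⟩ <;> simp [swapAt, ih]

theorem map_swapAt {α β : Type*} (f : α → β) (p : ℕ) (l : List α) :
    (swapAt p l).map f = swapAt p (l.map f) := by
  induction p generalizing l with
  | zero => rcases l with _ | ⟨a, _ | ⟨b, l⟩⟩ <;> rfl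
  | succ p ih => rcases l with _ | ⟨a, l⟩ <;> simp [swapAt, ih]

theorem swapAt_append {α : Type*} (ρ : List α) (a b : α) (l : List α) :
    swapAt ρ.length (ρ ++ a :: b :: l) = ρ ++ b :: a :: l := by
  induction ρ with
  | nil => rfl
  | cons c ρ ih => simp [ih]

theorem swapAt_perm {α : Type*} (p : ℕ) (l : List α) : (swapAt p l).Perm l := by
  induction p generalizing l with
  | zero =>
    rcases l with _ | ⟨a, _ | ⟨b, l⟩⟩
    · exact List.Perm.refl _
    · exact List.Perm.refl _
    · exact List.Perm.swap _ _ _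
  | succ p ih =>
    rcases l with _ | ⟨a, l⟩
    · exact List.Perm.refl _
    · exact (ih l).cons a

theorem der_swapAt {n : ℕ} (M : Fin n → Fin n → ℝ) (p : ℕ) (T : List (Fin n) → ℝ)
    (v : List (Fin n)) : der M (fun w => T (swapAt p w)) v = der M T (swapAt p v) := by
  induction p generalizing T v with
  | zero =>
    rcases v with _ | ⟨a, _ | ⟨b, l⟩⟩
    · rfl
    · simp [der, swapAt]
    · simp only [der, swapAt_zero_cons]
      ring
  | succ p ih =>
    rcases v with _ | ⟨a, l⟩
    · rfl
    · simp only [der, swapAt_succ_cons]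
      rw [ih (fun w => T (a :: w)) l]

namespace LocalMetric

variable {n : ℕ} (G : LocalMetric n)

theorem nabla_cons (T : Components n) (k : Fin n) (v : List (Fin n)) (x : E n) :
    G.nabla T (k :: v) x =
      pd k (T v) x - der (fun l a => G.christoffel l k a x) (fun w => T w x) v := by
  rw [der_eq_sum]
  rfl

theorem nabla_congr {T S : Components n} {r : ℕ}
    (h : ∀ v : List (Fin n), v.length = r → ∀ x ∈ G.U, T v x = S v x) (v : List (Fin n))
    (hv : v.length = r + 1) {x : E n} (hx : x ∈ G.U) : G.nabla T v x = G.nabla S v x := by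
  rcases v with _ | ⟨k, v⟩
  · simp at hv
  simp only [List.length_cons, add_left_inj] at hv
  rw [nabla_cons, nabla_cons, pd_congr G.isOpen (h v hv) hx,
    der_congr _ (fun w hw => h w (hw.trans hv) x hx)]

theorem nabla_iterate_congr {T S : Components n} {r : ℕ} (m : ℕ)
    (h : ∀ v : List (Fin n), v.length = r → ∀ x ∈ G.U, T v x = S v x) :
    ∀ v : List (Fin n), v.length = r + m → ∀ x ∈ G.U, G.nabla^[m] T v x = G.nabla^[m] S v x := by
  induction m with
  | zero => simpa using h
  | succ m ih =>
    intro v hv x hx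
    rw [Function.iterate_succ_apply', Function.iterate_succ_apply']
    exact G.nabla_congr ih v hv hx

theorem g_symm {x : E n} (hx : x ∈ G.U) (i j : Fin n) : G.g x i j = G.g x j i := by
  have := (G.posDef x hx).isHermitian
  simpa using this.apply j i

theorem isUnit_det {x : E n} (hx : x ∈ G.U) : IsUnit (G.g x).det :=
  isUnit_iff_ne_zero.2 (G.posDef x hx).det_pos.ne'

theorem ginv_symm {x : E n} (hx : x ∈ G.U) (i j : Fin n) : G.ginv x i j = G.ginv x j i := by
  have := (G.posDef x hx).isHermitian.inv
  simpa [ginv] using this.apply j i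

theorem sum_g_ginv {x : E n} (hx : x ∈ G.U) (i k : Fin n) :
    ∑ j, G.g x i j * G.ginv x j k = if i = k then 1 else 0 := by
  have := Matrix.mul_nonsing_inv (G.g x) (G.isUnit_det hx)
  rw [← Matrix.one_apply, ← this, Matrix.mul_apply]
  rfl

theorem sum_ginv_g {x : E n} (hx : x ∈ G.U) (i k : Fin n) :
    ∑ j, G.ginv x i j * G.g x j k = if i = k then 1 else 0 := by
  have := Matrix.nonsing_inv_mul (G.g x) (G.isUnit_det hx)
  rw [← Matrix.one_apply, ← this, Matrix.mul_apply]
  rfl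

end LocalMetric

/-- Determinants of matrices of smooth functions are smooth. -/
theorem contDiffOn_det {V : Type*} [NormedAddCommGroup V] [NormedSpace ℝ V] {n : ℕ} {U : Set V}
    {A : V → Matrix (Fin n) (Fin n) ℝ} (hA : ∀ i j, ContDiffOn ℝ ∞ (fun x => A x i j) U) :
    ContDiffOn ℝ ∞ (fun x => (A x).det) U := by
  simp only [Matrix.det_apply]
  refine ContDiffOn.sum fun σ _ => ?_
  simp only [Units.smul_def, zsmul_eq_mul]
  exact contDiffOn_const.mul (contDiffOn_prod fun i _ => hA _ _)

theorem contDiffOn_inv_apply {V : Type*} [NormedAddCommGroup V] [NormedSpace ℝ V] {n : ℕ}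
    {U : Set V} {A : V → Matrix (Fin n) (Fin n) ℝ}
    (hA : ∀ i j, ContDiffOn ℝ ∞ (fun x => A x i j) U) (hdet : ∀ x ∈ U, (A x).det ≠ 0)
    (i j : Fin n) : ContDiffOn ℝ ∞ (fun x => (A x)⁻¹ i j) U := by
  have : (fun x => (A x)⁻¹ i j) = fun x => ((A x).det)⁻¹ * (A x).adjugate i j := by
    funext x
    rw [Matrix.inv_def, Matrix.smul_apply, smul_eq_mul, Ring.inverse_eq_inv']
  rw [this]
  refine ((contDiffOn_det hA).inv hdet).mul ?_
  simp only [Matrix.adjugate_apply]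
  refine contDiffOn_det fun k l => ?_
  simp only [Matrix.updateRow_apply]
  split_ifs
  · exact contDiffOn_const
  · exact hA k l

namespace LocalMetric

variable {n : ℕ} (G : LocalMetric n)

theorem ginv_contDiffOn (i j : Fin n) : ContDiffOn ℝ ∞ (fun x => G.ginv x i j) G.U :=
  contDiffOn_inv_apply G.smooth (fun x hx => (G.posDef x hx).det_pos.ne') i j

theorem christoffel_contDiffOn (k i j : Fin n) : ContDiffOn ℝ ∞ (G.christoffel k i j) G.U := by
  unfold christoffel
  refine contDiffOn_const.mul (ContDiffOn.sum fun l _ => (G.ginv_contDiffOn k l).mul ?_)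
  exact ((pd_contDiffOn G.isOpen (G.smooth _ _) _).add
    (pd_contDiffOn G.isOpen (G.smooth _ _) _)).sub (pd_contDiffOn G.isOpen (G.smooth _ _) _)

theorem christoffel_symm {x : E n} (hx : x ∈ G.U) (k i j : Fin n) :
    G.christoffel k i j x = G.christoffel k j i x := by
  unfold christoffel
  congr 1
  refine Finset.sum_congr rfl fun l _ => ?_
  rw [pd_congr G.isOpen (fun y hy => G.g_symm hy i j) hx l]
  ring

/-- A family of components of rank `r` which is smooth on the chart. -/
def SmoothComp (r : ℕ) (T : Components n) : Prop :=
  ∀ v : List (Fin n), v.length = r → ContDiffOn ℝ ∞ (T v) G.U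

theorem SmoothComp.nabla {G : LocalMetric n} {r : ℕ} {T : Components n} (hT : G.SmoothComp r T) :
    G.SmoothComp (r + 1) (G.nabla T) := by
  intro v hv
  rcases v with _ | ⟨k, v⟩
  · simp at hv
  simp only [List.length_cons, add_left_inj] at hv
  have : G.nabla T (k :: v) = fun x => pd k (T v) x -
      der (fun l a => G.christoffel l k a x) (fun w => T w x) v := by
    funext x; exact G.nabla_cons T k v x
  rw [this]
  exact (pd_contDiffOn G.isOpen (hT v hv) k).sub
    (der_contDiffOn v (fun i j => G.christoffel_contDiffOn _ _ _) fun w hw => hT w (hw.trans hv))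

theorem SmoothComp.nabla_iterate {G : LocalMetric n} {r : ℕ} {T : Components n}
    (hT : G.SmoothComp r T) (m : ℕ) : G.SmoothComp (r + m) (G.nabla^[m] T) := by
  induction m with
  | zero => simpa using hT
  | succ m ih => rw [Function.iterate_succ_apply']; exact ih.nabla

theorem SmoothComp.diff {G : LocalMetric n} {r : ℕ} {T : Components n} (hT : G.SmoothComp r T)
    {v : List (Fin n)} (hv : v.length = r) {x : E n} (hx : x ∈ G.U) :
    DifferentiableAt ℝ (T v) x := differentiableAt_of_contDiffOn G.isOpen (hT v hv) hx

/-! ### Covariant derivatives of the index operations -/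

theorem nabla_swapAt (T : Components n) (p : ℕ) (v : List (Fin n)) (hv : v ≠ []) (x : E n) :
    G.nabla (fun w => T (swapAt p w)) v x = G.nabla T (swapAt (p + 1) v) x := by
  rcases v with _ | ⟨k, v⟩
  · exact absurd rfl hv
  rw [nabla_cons, swapAt_succ_cons, nabla_cons, ← der_swapAt]

theorem nabla_add {r : ℕ} {T S : Components n} (hT : G.SmoothComp r T) (hS : G.SmoothComp r S)
    {v : List (Fin n)} (hv : v.length = r + 1) {x : E n} (hx : x ∈ G.U) :
    G.nabla (fun w y => T w y + S w y) v x = G.nabla T v x + G.nabla S v x := by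
  rcases v with _ | ⟨k, v⟩
  · simp at hv
  simp only [List.length_cons, add_left_inj] at hv
  rw [nabla_cons, nabla_cons, nabla_cons, pd_add (hT.diff hv hx) (hS.diff hv hx), der_add]
  ring

theorem nabla_smul {r : ℕ} {T : Components n} (hT : G.SmoothComp r T) (c : ℝ)
    {v : List (Fin n)} (hv : v.length = r + 1) {x : E n} (hx : x ∈ G.U) :
    G.nabla (fun w y => c * T w y) v x = c * G.nabla T v x := by
  rcases v with _ | ⟨k, v⟩
  · simp at hv
  simp only [List.length_cons, add_left_inj] at hv
  rw [nabla_cons, nabla_cons, pd_const_mul (hT.diff hv hx), der_smul]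
  ring

theorem nabla_zero (v : List (Fin n)) (x : E n) : G.nabla (fun _ _ => 0) v x = 0 := by
  rcases v with _ | ⟨k, v⟩
  · rfl
  rw [nabla_cons, pd_const, der_zero, sub_zero]

/-- Leibniz rule for tensor products; the slots of the first factor come first. -/
theorem nabla_mul {r s : ℕ} {T S : Components n} (hT : G.SmoothComp r T) (hS : G.SmoothComp s S)
    (k : Fin n) {v w : List (Fin n)} (hv : v.length = r) (hw : w.length = s) {x : E n}
    (hx : x ∈ G.U) :
    G.nabla (fun u y => T (u.take r) y * S (u.drop r) y) (k :: (v ++ w)) x =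
      G.nabla T (k :: v) x * S w x + T v x * G.nabla S (k :: w) x := by
  rw [nabla_cons, nabla_cons, nabla_cons, der_append]
  have e1 : (v ++ w).take r = v := by rw [← hv]; simp
  have e2 : (v ++ w).drop r = w := by rw [← hv]; simp
  rw [e1, e2, pd_mul (hT.diff hv hx) (hS.diff hw hx)]
  have e3 : der (fun l a => G.christoffel l k a x)
      (fun v' => T ((v' ++ w).take r) x * S ((v' ++ w).drop r) x) v =
      der (fun l a => G.christoffel l k a x) (fun v' => T v' x) v * S w x := by
    rw [← der_mul_const]
    refine der_congr _ fun u hu => ?_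
    have hu' : u.length = r := hu.trans hv
    rw [← hu']; simp
  have e4 : der (fun l a => G.christoffel l k a x)
      (fun w' => T ((v ++ w').take r) x * S ((v ++ w').drop r) x) w =
      T v x * der (fun l a => G.christoffel l k a x) (fun w' => S w' x) w := by
    rw [← der_smul]
    refine der_congr _ fun u hu => ?_
    rw [← hv]; simp
  rw [e3, e4]
  ring

/-- The metric, as a family of components of rank `2`. -/
def metric : Components n
  | [i, j] => fun x => G.g x i j
  | _ => fun _ => 0

theorem metric_smooth : G.SmoothComp 2 G.metric := by
  intro v hv
  match v, hv with
  | [i, j], _ => exact G.smooth i j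

theorem sum_g_christoffel {x : E n} (hx : x ∈ G.U) (j k i : Fin n) :
    ∑ l, G.g x j l * G.christoffel l k i x = (1 / 2) *
      (pd k (fun y => G.g y i j) x + pd i (fun y => G.g y k j) x - pd j (fun y => G.g y k i) x) := by
  have : ∀ F : Fin n → ℝ, ∑ l, G.g x j l * ((1 / 2) * ∑ m, G.ginv x l m * F m) = (1 / 2) * F j := by
    intro F
    have h1 : ∑ l, G.g x j l * ((1 / 2) * ∑ m, G.ginv x l m * F m) =
        (1 / 2) * ∑ m, (∑ l, G.g x j l * G.ginv x l m) * F m := by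
      simp only [Finset.mul_sum, Finset.sum_mul]
      rw [Finset.sum_comm]
      refine Finset.sum_congr rfl fun m _ => Finset.sum_congr rfl fun l _ => by ring
    rw [h1]
    simp [G.sum_g_ginv hx]
  unfold christoffel
  exact this _

theorem nabla_metric {v : List (Fin n)} (hv : v.length = 3) {x : E n} (hx : x ∈ G.U) :
    G.nabla G.metric v x = 0 := by
  match v, hv with
  | [k, i, j], _ =>
    rw [nabla_cons]
    have h1 := G.sum_g_christoffel hx j k i
    have h2 := G.sum_g_christoffel hx i k j
    have h3 := pd_congr G.isOpen (fun y hy => G.g_symm hy i j) hx k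
    have h4 := pd_congr G.isOpen (fun y hy => G.g_symm hy k j) hx i
    have h5 := pd_congr G.isOpen (fun y hy => G.g_symm hy k i) hx j
    have h6 : ∑ m, G.christoffel m k i x * G.g x m j = ∑ l, G.g x j l * G.christoffel l k i x :=
      Finset.sum_congr rfl fun m _ => by rw [G.g_symm hx m j]; ring
    have h7 : ∑ m, G.christoffel m k j x * G.g x i m = ∑ l, G.g x i l * G.christoffel l k j x :=
      Finset.sum_congr rfl fun m _ => by ring
    simp only [der, metric]
    rw [h6, h7, h1, h2, h3, h4, h5]
    ring

theorem pd_ginv {x : E n} (hx : x ∈ G.U) (k i j : Fin n) :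
    pd k (fun y => G.ginv y i j) x =
      - ∑ l, (G.christoffel i k l x * G.ginv x l j + G.christoffel j k l x * G.ginv x i l) := by
  -- differentiate `g⁻¹ g = 1`, and multiply by `g⁻¹` from the right
  have dg := fun a b => differentiableAt_of_contDiffOn G.isOpen (G.smooth a b) hx
  have di := fun a b => differentiableAt_of_contDiffOn G.isOpen (G.ginv_contDiffOn a b) hx
  have hpdg : ∀ a b, pd k (fun y => G.g y a b) x = ∑ m, G.christoffel m k a x * G.g x m b
      + ∑ m, G.christoffel m k b x * G.g x a m := by
    intro a b
    have := G.nabla_metric (v := [k, a, b]) rfl hx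
    rw [nabla_cons] at this
    simp only [der, metric] at this
    linarith
  have h1 : ∀ b, ∑ a, pd k (fun y => G.ginv y i a) x * G.g x a b =
      - ∑ a, G.ginv x i a * pd k (fun y => G.g y a b) x := by
    intro b
    have h : pd k (fun y => ∑ a, G.ginv y i a * G.g y a b) x = 0 := by
      rw [pd_congr G.isOpen (fun y hy => G.sum_ginv_g hy i b) hx, pd_const]
    rw [pd_sum _ (fun a _ => (di i a).fun_mul (dg a b))] at h
    simp only [pd_mul (di _ _) (dg _ _), Finset.sum_add_distrib] at h
    linarith
  have h2 : pd k (fun y => G.ginv y i j) x =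
      ∑ b, (∑ a, pd k (fun y => G.ginv y i a) x * G.g x a b) * G.ginv x b j := by
    have : ∑ b, (∑ a, pd k (fun y => G.ginv y i a) x * G.g x a b) * G.ginv x b j =
        ∑ a, pd k (fun y => G.ginv y i a) x * ∑ b, G.g x a b * G.ginv x b j := by
      simp only [Finset.mul_sum, Finset.sum_mul]
      rw [Finset.sum_comm]
      refine Finset.sum_congr rfl fun m _ => Finset.sum_congr rfl fun l _ => by ring
    rw [this]
    simp [G.sum_g_ginv hx]
  rw [h2]
  simp only [h1, hpdg]
  have e1 : ∑ b, (- ∑ a, G.ginv x i a * (∑ m, G.christoffel m k a x * G.g x m b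
      + ∑ m, G.christoffel m k b x * G.g x a m)) * G.ginv x b j =
      - (∑ a, G.ginv x i a * ∑ m, G.christoffel m k a x * ∑ b, G.g x m b * G.ginv x b j)
      - ∑ b, (∑ m, G.christoffel m k b x * ∑ a, G.ginv x i a * G.g x a m) * G.ginv x b j := by
    have a1 : ∑ a, G.ginv x i a * ∑ m, G.christoffel m k a x * ∑ b, G.g x m b * G.ginv x b j =
        ∑ b, (∑ a, G.ginv x i a * ∑ m, G.christoffel m k a x * G.g x m b) * G.ginv x b j := by
      simp only [Finset.mul_sum, Finset.sum_mul]
      rw [Finset.sum_comm_cycle]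
      refine Finset.sum_congr rfl fun _ _ => Finset.sum_congr rfl fun _ _ =>
        Finset.sum_congr rfl fun _ _ => by ring
    have a2 : ∀ b, ∑ m, G.christoffel m k b x * ∑ a, G.ginv x i a * G.g x a m =
        ∑ a, G.ginv x i a * ∑ m, G.christoffel m k b x * G.g x a m := by
      intro b
      simp only [Finset.mul_sum]
      rw [Finset.sum_comm]
      refine Finset.sum_congr rfl fun _ _ => Finset.sum_congr rfl fun _ _ => by ring
    rw [a1]
    simp only [a2]
    rw [← Finset.sum_neg_distrib, ← Finset.sum_sub_distrib]
    refine Finset.sum_congr rfl fun b _ => ?_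
    simp only [mul_add, Finset.sum_add_distrib]
    ring
  rw [e1]
  simp only [G.sum_g_ginv hx, G.sum_ginv_g hx, mul_ite, mul_one, mul_zero, Finset.sum_ite_eq,
    Finset.sum_ite_eq', Finset.mem_univ, if_true, Finset.sum_add_distrib]
  have e2 : ∑ a, G.ginv x i a * G.christoffel j k a x = ∑ a, G.christoffel j k a x * G.ginv x i a :=
    Finset.sum_congr rfl fun _ _ => by ring
  rw [e2]
  ring

end LocalMetric
end RiemContr

namespace RiemContr

/-! ### Traces and their covariant derivatives -/

namespace LocalMetric

variable {n : ℕ} (G : LocalMetric n)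

/-- The trace, with the inverse metric, over two adjacent slots which are inserted in position
`p`. -/
noncomputable def trAt (p : ℕ) (T : Components n) : Components n := fun v x =>
  ∑ i, ∑ j, G.ginv x i j * T (v.take p ++ i :: j :: v.drop p) x

theorem length_insert_pair {α : Type*} (p : ℕ) (v : List α) (i j : α) :
    (v.take p ++ i :: j :: v.drop p).length = v.length + 2 := by
  simp only [List.length_append, List.length_cons, List.length_take, List.length_drop]
  omega

theorem SmoothComp.trAt {G : LocalMetric n} {r : ℕ} {T : Components n}
    (hT : G.SmoothComp (r + 2) T) (p : ℕ) : G.SmoothComp r (G.trAt p T) := by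
  intro v hv
  refine ContDiffOn.sum fun i _ => ContDiffOn.sum fun j _ => (G.ginv_contDiffOn i j).mul ?_
  exact hT _ (by rw [length_insert_pair, hv])

theorem SmoothComp.swapAt {G : LocalMetric n} {r : ℕ} {T : Components n}
    (hT : G.SmoothComp r T) (p : ℕ) : G.SmoothComp r (fun v => T (swapAt p v)) :=
  fun v hv => hT _ (by simpa using hv)

theorem SmoothComp.mul {G : LocalMetric n} {r s : ℕ} {T S : Components n}
    (hT : G.SmoothComp r T) (hS : G.SmoothComp s S) :
    G.SmoothComp (r + s) (fun v x => T (v.take r) x * S (v.drop r) x) :=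
  fun v hv => (hT _ (by simp [hv])).mul (hS _ (by simp [hv]))

theorem SmoothComp.add {G : LocalMetric n} {r : ℕ} {T S : Components n}
    (hT : G.SmoothComp r T) (hS : G.SmoothComp r S) :
    G.SmoothComp r (fun v x => T v x + S v x) :=
  fun v hv => (hT v hv).add (hS v hv)

theorem SmoothComp.smul {G : LocalMetric n} {r : ℕ} {T : Components n}
    (hT : G.SmoothComp r T) (c : ℝ) : G.SmoothComp r (fun v x => c * T v x) :=
  fun v hv => contDiffOn_const.mul (hT v hv)

theorem SmoothComp.congr {G : LocalMetric n} {r : ℕ} {T S : Components n}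
    (hT : G.SmoothComp r T)
    (h : ∀ v : List (Fin n), v.length = r → ∀ x ∈ G.U, S v x = T v x) : G.SmoothComp r S :=
  fun v hv => (hT v hv).congr (h v hv)

/-- Covariant differentiation commutes with traces, since the inverse metric is parallel. -/
theorem nabla_trAt {r : ℕ} {T : Components n} (hT : G.SmoothComp (r + 2) T) (p : ℕ)
    {v : List (Fin n)} (hv : v.length = r + 1) (hp : p ≤ r) {x : E n} (hx : x ∈ G.U) :
    G.nabla (G.trAt p T) v x = G.trAt (p + 1) (G.nabla T) v x := by
  rcases v with _ | ⟨k, v⟩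
  · simp at hv
  simp only [List.length_cons, add_left_inj] at hv
  have hlen : ∀ i j, (v.take p ++ i :: j :: v.drop p).length = r + 2 := fun i j => by
    rw [length_insert_pair, hv]
  rw [nabla_cons]
  simp only [trAt, List.take_succ_cons, List.drop_succ_cons, List.cons_append, nabla_cons]
  have d1 : ∀ i j, DifferentiableAt ℝ (fun y => G.ginv y i j *
      T (v.take p ++ i :: j :: v.drop p) y) x := fun i j =>
    (differentiableAt_of_contDiffOn G.isOpen (G.ginv_contDiffOn i j) hx).fun_mul
      (hT.diff (hlen i j) hx)
  have e1 : pd k (fun y => ∑ i, ∑ j, G.ginv y i j * T (v.take p ++ i :: j :: v.drop p) y) x =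
      ∑ i, ∑ j, (pd k (fun y => G.ginv y i j) x * T (v.take p ++ i :: j :: v.drop p) x
        + G.ginv x i j * pd k (T (v.take p ++ i :: j :: v.drop p)) x) := by
    rw [pd_sum _ (fun i _ => DifferentiableAt.fun_sum fun j _ => d1 i j)]
    refine Finset.sum_congr rfl fun i _ => ?_
    rw [pd_sum _ (fun j _ => d1 i j)]
    refine Finset.sum_congr rfl fun j _ => ?_
    rw [pd_mul (differentiableAt_of_contDiffOn G.isOpen (G.ginv_contDiffOn i j) hx)
      (hT.diff (hlen i j) hx)]
  have hM : (trAt G p T v) = fun y => ∑ i, ∑ j, G.ginv y i j *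
      T (v.take p ++ i :: j :: v.drop p) y := rfl
  rw [hM, e1]
  set M : Fin n → Fin n → ℝ := fun l a => G.christoffel l k a x with hMdef
  obtain ⟨v1, v2, rfl, hv1⟩ : ∃ v1 v2, v = v1 ++ v2 ∧ v1.length = p :=
    ⟨v.take p, v.drop p, (List.take_append_drop p v).symm, by simp; omega⟩
  have t1 : (v1 ++ v2).take p = v1 := by rw [← hv1]; simp
  have t2 : (v1 ++ v2).drop p = v2 := by rw [← hv1]; simp
  rw [t1, t2]
  have e2 : der M (fun w => ∑ i, ∑ j, G.ginv x i j * T (w.take p ++ i :: j :: w.drop p) x)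
      (v1 ++ v2) = ∑ i, ∑ j, G.ginv x i j *
        (der M (fun w => T (w ++ i :: j :: v2) x) v1 + der M (fun w => T (v1 ++ i :: j :: w) x) v2)
        := by
    rw [der_sum]
    refine Finset.sum_congr rfl fun i _ => ?_
    rw [der_sum]
    refine Finset.sum_congr rfl fun j _ => ?_
    rw [der_smul, der_append]
    congr 2
    · refine der_congr _ fun w hw => ?_
      rw [← hv1, ← hw]; simp
    · refine der_congr _ fun w hw => ?_
      rw [← hv1]; simp
  rw [e2]
  have e3 : ∀ i j, der M (fun w => T w x) (v1 ++ i :: j :: v2) =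
      der M (fun w => T (w ++ i :: j :: v2) x) v1 + der M (fun w => T (v1 ++ i :: j :: w) x) v2
      + ∑ m, M m i * T (v1 ++ m :: j :: v2) x + ∑ m, M m j * T (v1 ++ i :: m :: v2) x := by
    intro i j
    rw [der_append]
    simp only [der]
    ring
  simp only [e3, G.pd_ginv hx]
  have e4 : ∑ i, ∑ j, G.ginv x i j * ∑ m, M m i * T (v1 ++ m :: j :: v2) x =
      ∑ i, ∑ j, (∑ l, M i l * G.ginv x l j) * T (v1 ++ i :: j :: v2) x := by
    simp only [Finset.mul_sum, Finset.sum_mul]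
    rw [Finset.sum_comm]
    rw [Finset.sum_comm (γ := Fin n) (f := fun i j => ∑ l, M i l * G.ginv x l j *
      T (v1 ++ i :: j :: v2) x)]
    refine Finset.sum_congr rfl fun j _ => ?_
    rw [Finset.sum_comm]
    refine Finset.sum_congr rfl fun _ _ => Finset.sum_congr rfl fun _ _ => by ring
  have e5 : ∑ i, ∑ j, G.ginv x i j * ∑ m, M m j * T (v1 ++ i :: m :: v2) x =
      ∑ i, ∑ j, (∑ l, M j l * G.ginv x i l) * T (v1 ++ i :: j :: v2) x := by
    simp only [Finset.mul_sum, Finset.sum_mul]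
    refine Finset.sum_congr rfl fun j _ => ?_
    rw [Finset.sum_comm]
    refine Finset.sum_congr rfl fun _ _ => Finset.sum_congr rfl fun _ _ => by ring
  have e6 : ∀ i j, -∑ l, (G.christoffel i k l x * G.ginv x l j + G.christoffel j k l x * G.ginv x i l)
      = - (∑ l, M i l * G.ginv x l j) - ∑ l, M j l * G.ginv x i l := by
    intro i j
    rw [Finset.sum_add_distrib]
    simp only [hMdef]
    ring
  simp only [e6]
  simp only [mul_sub, mul_add, Finset.sum_add_distrib, sub_mul, neg_mul,
    Finset.sum_sub_distrib, Finset.sum_neg_distrib]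
  rw [e4, e5]
  ring

/-! ### The Ricci identity and the symmetries of the curvature tensor -/

/-- The curvature tensor `R^m_{jkl}` as an operator. -/
noncomputable def curvOp (m j k l : Fin n) (x : E n) : ℝ :=
  pd k (G.christoffel m l j) x - pd l (G.christoffel m k j) x
    + ∑ p, (G.christoffel m k p x * G.christoffel p l j x
      - G.christoffel m l p x * G.christoffel p k j x)

theorem riem_eq (i j k l : Fin n) (x : E n) :
    G.riem i j k l x = ∑ m, G.g x i m * G.curvOp m j k l x := rfl

theorem curvOp_eq {x : E n} (hx : x ∈ G.U) (m j k l : Fin n) :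
    G.curvOp m j k l x = ∑ i, G.ginv x m i * G.riem i j k l x := by
  simp only [riem_eq, Finset.mul_sum]
  rw [Finset.sum_comm]
  have : ∀ p, ∑ i, G.ginv x m i * (G.g x i p * G.curvOp p j k l x) =
      (∑ i, G.ginv x m i * G.g x i p) * G.curvOp p j k l x := by
    intro p
    rw [Finset.sum_mul]
    refine Finset.sum_congr rfl fun _ _ => by ring
  simp [this, G.sum_ginv_g hx]

theorem curvOp_contDiffOn (m j k l : Fin n) : ContDiffOn ℝ ∞ (G.curvOp m j k l) G.U := by
  have hc := G.christoffel_contDiffOn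
  exact ((pd_contDiffOn G.isOpen (hc _ _ _) _).sub (pd_contDiffOn G.isOpen (hc _ _ _) _)).add
    (ContDiffOn.sum fun p _ => ((hc _ _ _).mul (hc _ _ _)).sub ((hc _ _ _).mul (hc _ _ _)))

theorem riem_contDiffOn (i j k l : Fin n) : ContDiffOn ℝ ∞ (G.riem i j k l) G.U :=
  ContDiffOn.sum fun m _ => (G.smooth _ _).mul (G.curvOp_contDiffOn m j k l)

/-- The Ricci identity. -/
theorem nabla_nabla_sub {r : ℕ} {T : Components n} (hT : G.SmoothComp r T) (k l : Fin n)
    {v : List (Fin n)} (hv : v.length = r) {x : E n} (hx : x ∈ G.U) :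
    G.nabla (G.nabla T) (k :: l :: v) x - G.nabla (G.nabla T) (l :: k :: v) x =
      - der (fun m j => G.curvOp m j k l x) (fun w => T w x) v := by
  have e : ∀ a b : Fin n, G.nabla (G.nabla T) (a :: b :: v) x =
      pd a (pd b (T v)) x - der (fun i j => pd a (G.christoffel i b j) x) (fun w => T w x) v
      - der (fun i j => G.christoffel i b j x) (fun w => pd a (T w) x) v
      - ∑ m, G.christoffel m a b x * G.nabla T (m :: v) x
      - der (fun i j => G.christoffel i a j x) (fun w => pd b (T w) x) v
      + der (fun i j => G.christoffel i a j x)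
          (der (fun i j => G.christoffel i b j x) (fun w => T w x)) v := by
    intro a b
    rw [nabla_cons]
    have h1 : G.nabla T (b :: v) = fun y => pd b (T v) y -
        der (fun i j => G.christoffel i b j y) (fun w => T w y) v := by
      funext y; exact G.nabla_cons T b v y
    have hT' : ∀ w : List (Fin n), w.length = v.length → ContDiffOn ℝ ∞ (T w) G.U :=
      fun w hw => hT w (hw.trans hv)
    have hG := fun i j => G.christoffel_contDiffOn i b j
    rw [h1, pd_sub (differentiableAt_of_contDiffOn G.isOpen (pd_contDiffOn G.isOpen (hT v hv) b) hx)
      (differentiableAt_of_contDiffOn G.isOpen (der_contDiffOn v hG hT') hx),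
      pd_der G.isOpen hx v hG hT']
    simp only [der]
    have h2 : (fun w => G.nabla T (b :: w) x) = fun w => pd b (T w) x +
        (-1) * der (fun i j => G.christoffel i b j x) (fun w => T w x) w := by
      funext w; rw [nabla_cons]; ring
    rw [h2, der_add, der_smul]
    ring
  rw [e k l, e l k, pd_comm G.isOpen (hT v hv) hx k l]
  have hs : ∑ m, G.christoffel m k l x * G.nabla T (m :: v) x =
      ∑ m, G.christoffel m l k x * G.nabla T (m :: v) x :=
    Finset.sum_congr rfl fun m _ => by rw [G.christoffel_symm hx]
  rw [hs]
  have hc := der_commutator (fun i j => G.christoffel i k j x) (fun i j => G.christoffel i l j x)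
    (fun w => T w x) v
  have hm : (fun m j => G.curvOp m j k l x) = fun p a =>
      (pd k (G.christoffel p l a) x - pd l (G.christoffel p k a) x) -
      ∑ m, (G.christoffel p l m x * G.christoffel m k a x
        - G.christoffel p k m x * G.christoffel m l a x) := by
    funext p a
    simp only [curvOp, Finset.sum_sub_distrib]
    ring
  rw [hm, der_sub_matrix, der_sub_matrix, ← hc]
  ring

theorem riem_antisymm_right (i j k l : Fin n) (x : E n) :
    G.riem i j k l x = - G.riem i j l k x := by
  simp only [riem_eq, curvOp, ← Finset.sum_neg_distrib]
  refine Finset.sum_congr rfl fun m _ => ?_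
  simp only [Finset.sum_sub_distrib]
  ring

theorem riem_antisymm_left {x : E n} (hx : x ∈ G.U) (i j k l : Fin n) :
    G.riem i j k l x = - G.riem j i k l x := by
  have h := G.nabla_nabla_sub G.metric_smooth k l (v := [j, i]) rfl hx
  have hz : ∀ a b : Fin n, G.nabla (G.nabla G.metric) [a, b, j, i] x = 0 := by
    intro a b
    rw [G.nabla_congr (S := fun _ _ => 0) (r := 3) (fun v hv y hy => G.nabla_metric hv hy) _ rfl hx,
      nabla_zero]
  rw [hz, hz] at h
  simp only [der, metric] at h
  rw [riem_eq, riem_eq]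
  have e1 : ∑ m, G.g x i m * G.curvOp m j k l x = ∑ m, G.curvOp m j k l x * G.g x m i :=
    Finset.sum_congr rfl fun m _ => by rw [G.g_symm hx]; ring
  have e2 : ∑ m, G.g x j m * G.curvOp m i k l x = ∑ m, G.curvOp m i k l x * G.g x j m :=
    Finset.sum_congr rfl fun m _ => by ring
  rw [e1, e2]
  linarith

theorem curvOp_bianchi {x : E n} (hx : x ∈ G.U) (m j k l : Fin n) :
    G.curvOp m j k l x + G.curvOp m k l j x + G.curvOp m l j k x = 0 := by
  have hs : ∀ a b c : Fin n, pd a (G.christoffel m b c) x = pd a (G.christoffel m c b) x :=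
    fun a b c => pd_congr G.isOpen (fun y hy => G.christoffel_symm hy m b c) hx a
  have hs' : ∀ p a b : Fin n, G.christoffel p a b x = G.christoffel p b a x :=
    fun p a b => G.christoffel_symm hx p a b
  unfold curvOp
  rw [hs k l j, hs l j k, hs j k l]
  have : ∑ p, (G.christoffel m k p x * G.christoffel p l j x
      - G.christoffel m l p x * G.christoffel p k j x) +
    ∑ p, (G.christoffel m l p x * G.christoffel p j k x
      - G.christoffel m j p x * G.christoffel p l k x) +
    ∑ p, (G.christoffel m j p x * G.christoffel p k l x
      - G.christoffel m k p x * G.christoffel p j l x) = 0 := by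
    rw [← Finset.sum_add_distrib, ← Finset.sum_add_distrib]
    refine Finset.sum_eq_zero fun p _ => ?_
    rw [hs' p l j, hs' p k j, hs' p l k]
    ring
  linarith

/-- The first Bianchi identity. -/
theorem riem_bianchi {x : E n} (hx : x ∈ G.U) (i j k l : Fin n) :
    G.riem i j k l x + G.riem i k l j x + G.riem i l j k x = 0 := by
  simp only [riem_eq, ← Finset.sum_add_distrib, ← mul_add, G.curvOp_bianchi hx, mul_zero,
    Finset.sum_const_zero]

theorem riem_pair_symm {x : E n} (hx : x ∈ G.U) (i j k l : Fin n) :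
    G.riem i j k l x = G.riem k l i j x := by
  have b := G.riem_bianchi hx
  have l := G.riem_antisymm_left hx
  have r := fun i j k l => G.riem_antisymm_right i j k l x
  rename_i l'
  have b1 := b i j k l'
  have b2 := b j k l' i
  have b3 := b k l' i j
  have b4 := b l' i j k
  have := l i j k l'
  have := l i k l' j
  have := l i l' j k
  have := l j k l' i
  have := l j l' i k
  have := l k l' i j
  have := r i j k l'
  have := r i k l' j
  have := r i l' j k
  have := r j k l' i
  have := r j l' i k
  have := r k l' i j
  have := r j i k l'
  have := r k i l' j
  have := r l' i j k
  have := r k j l' i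
  have := r l' j i k
  have := r l' k i j
  have := r j k i l'
  linarith

/-- The curvature tensor, as a family of components of rank `4`. -/
noncomputable def curv : Components n
  | [i, j, k, l] => G.riem i j k l
  | _ => 0

theorem curv_smooth : G.SmoothComp 4 G.curv := by
  intro v hv
  match v, hv with
  | [i, j, k, l], _ => exact G.riem_contDiffOn i j k l

/-- The second Bianchi identity. It follows from the Ricci identities for a one-form and its
covariant derivative. -/
theorem nabla_curv_bianchi {x : E n} (hx : x ∈ G.U) (e i j k l : Fin n) :
    G.nabla G.curv [e, i, j, k, l] x + G.nabla G.curv [k, i, j, l, e] x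
      + G.nabla G.curv [l, i, j, e, k] x = 0 := by
  -- the one-form `dx^q`
  let T : Fin n → Components n := fun q v _ => if v = [q] then 1 else 0
  have hT : ∀ q, G.SmoothComp 1 (T q) := fun q v _ => contDiffOn_const
  let A : Fin n → Components n := fun q => G.nabla (G.nabla (T q))
  have hA : ∀ q, G.SmoothComp 3 (A q) := fun q => (hT q).nabla.nabla
  let C : Fin n → Components n := fun q =>
    G.trAt 0 (fun u y => T q (u.take 1) y * G.curv (u.drop 1) y)
  have hTC : ∀ q, G.SmoothComp 5 (fun u y => T q (u.take 1) y * G.curv (u.drop 1) y) :=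
    fun q => (hT q).mul G.curv_smooth
  have hC : ∀ q, G.SmoothComp 3 (C q) := fun q => (hTC q).trAt 0
  have hCval : ∀ (S : Fin n → ℝ) (j k l : Fin n), ∀ y ∈ G.U,
      ∑ m, ∑ i, G.ginv y m i * (S m * G.curv [i, j, k, l] y) =
      ∑ m, G.curvOp m j k l y * S m := by
    intro S j k l y hy
    refine Finset.sum_congr rfl fun m _ => ?_
    rw [G.curvOp_eq hy, Finset.sum_mul]
    refine Finset.sum_congr rfl fun i _ => ?_
    simp only [curv]
    ring
  have h1 : ∀ q, ∀ v : List (Fin n), v.length = 3 → ∀ y ∈ G.U, A q v y =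
      A q (swapAt 0 v) y + (-1) * C q (swapAt 0 (swapAt 1 v)) y := by
    intro q v hv y hy
    match v, hv with
    | [k, l, j], _ =>
      have := G.nabla_nabla_sub (hT q) k l (v := [j]) rfl hy
      simp only [der] at this
      have hc := hCval (fun m => T q [m] y) j k l y hy
      simp only [swapAt_zero_cons, swapAt_succ_cons]
      have hc' : C q [j, k, l] y = ∑ m, G.curvOp m j k l y * T q [m] y := hc
      rw [hc']
      change G.nabla (G.nabla (T q)) [k, l, j] y = G.nabla (G.nabla (T q)) [l, k, j] y + _
      linarith
  have h2 : ∀ q (e k l : Fin n), G.nabla (A q) [e, k, l, j] x = G.nabla (A q) [e, l, k, j] x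
      - G.nabla (C q) [e, j, k, l] x := by
    intro q e k l
    have hs1 : G.SmoothComp 3 (fun v => A q (swapAt 0 v)) := (hA q).swapAt 0
    have hs2 : G.SmoothComp 3 (fun v => C q (swapAt 0 (swapAt 1 v))) :=
      SmoothComp.swapAt (T := fun v => C q (swapAt 0 v)) ((hC q).swapAt 0) 1
    rw [G.nabla_congr (h1 q) [e, k, l, j] rfl hx,
      G.nabla_add (S := fun v y => (-1) * C q (swapAt 0 (swapAt 1 v)) y) hs1 (hs2.smul _) rfl hx,
      G.nabla_smul (T := fun v => C q (swapAt 0 (swapAt 1 v))) hs2 _ rfl hx,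
      G.nabla_swapAt _ _ _ (by simp),
      G.nabla_swapAt (fun v => C q (swapAt 0 v)) 1 _ (by simp), G.nabla_swapAt _ _ _ (by simp)]
    simp only [swapAt_zero_cons, swapAt_succ_cons]
    ring
  have h3 : ∀ q (e k l : Fin n), G.nabla (C q) [e, j, k, l] x =
      ∑ m, G.curvOp m j k l x * G.nabla (T q) [e, m] x
      + ∑ i, G.ginv x q i * G.nabla G.curv [e, i, j, k, l] x := by
    intro q e k l
    rw [G.nabla_trAt (hTC q) 0 rfl (by omega) hx]
    have e1 : ∀ m i, G.nabla (fun u y => T q (u.take 1) y * G.curv (u.drop 1) y)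
        (e :: ([m] ++ [i, j, k, l])) x = G.nabla (T q) (e :: [m]) x * G.curv [i, j, k, l] x
        + T q [m] x * G.nabla G.curv (e :: [i, j, k, l]) x :=
      fun m i => G.nabla_mul (hT q) G.curv_smooth e rfl rfl hx
    simp only [List.singleton_append] at e1
    simp only [trAt, zero_add, List.take_succ_cons, List.take_zero, List.drop_succ_cons,
      List.drop_zero, List.singleton_append, e1, mul_add, Finset.sum_add_distrib]
    rw [hCval (fun m => G.nabla (T q) [e, m] x) j k l x hx]
    congr 1
    rw [Finset.sum_eq_single q]
    · simp [T]
    · intro b _ hb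
      simp [T, hb]
    · simp
  have h4 : ∀ q (e k l : Fin n), G.nabla (A q) [e, k, l, j] x - G.nabla (A q) [k, e, l, j] x =
      - (∑ m, G.curvOp m l e k x * G.nabla (T q) [m, j] x
        + ∑ m, G.curvOp m j e k x * G.nabla (T q) [l, m] x) := by
    intro q e k l
    have := G.nabla_nabla_sub (hT q).nabla e k (v := [l, j]) rfl hx
    simp only [der, add_zero] at this
    exact this
  have h5 : ∀ q, ∑ m, G.curvOp m l e k x * G.nabla (T q) [m, j] x
      + ∑ m, G.curvOp m e k l x * G.nabla (T q) [m, j] x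
      + ∑ m, G.curvOp m k l e x * G.nabla (T q) [m, j] x = 0 := by
    intro q
    rw [← Finset.sum_add_distrib, ← Finset.sum_add_distrib]
    refine Finset.sum_eq_zero fun m _ => ?_
    rw [← add_mul, ← add_mul, G.curvOp_bianchi hx m l e k, zero_mul]
  set S : Fin n → ℝ := fun i => G.nabla G.curv [e, i, j, k, l] x + G.nabla G.curv [k, i, j, l, e] x
      + G.nabla G.curv [l, i, j, e, k] x with hS
  have h6 : ∀ q, ∑ i, G.ginv x q i * S i = 0 := by
    intro q
    simp only [hS, mul_add, Finset.sum_add_distrib]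
    linarith [h2 q e k l, h2 q k l e, h2 q l e k, h3 q e k l, h3 q k l e, h3 q l e k,
      h4 q e k l, h4 q k l e, h4 q l e k, h5 q]
  have h7 : ∑ q, G.g x i q * ∑ i, G.ginv x q i * S i = S i := by
    simp only [Finset.mul_sum]
    rw [Finset.sum_comm]
    have : ∀ p, ∑ q, G.g x i q * (G.ginv x q p * S p) = (∑ q, G.g x i q * G.ginv x q p) * S p := by
      intro p
      rw [Finset.sum_mul]
      exact Finset.sum_congr rfl fun _ _ => by ring
    simp [this, G.sum_g_ginv hx]
  simp only [h6, mul_zero, Finset.sum_const_zero] at h7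
  exact h7.symm

end LocalMetric
end RiemContr

namespace RiemContr

/-! ### Iterated covariant derivatives of the index operations -/

namespace LocalMetric

variable {n : ℕ} (G : LocalMetric n)

theorem nabla_iterate_swapAt {r : ℕ} (T : Components n) (p m : ℕ) :
    ∀ v : List (Fin n), v.length = r + m → ∀ x ∈ G.U,
      G.nabla^[m] (fun w => T (swapAt p w)) v x = G.nabla^[m] T (swapAt (p + m) v) x := by
  induction m with
  | zero => intros; rfl
  | succ m ih =>
    intro v hv x hx
    rw [Function.iterate_succ_apply', Function.iterate_succ_apply', G.nabla_congr ih v hv hx,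
      nabla_swapAt _ _ _ _ (by rintro rfl; simp at hv)]
    rfl

theorem nabla_iterate_add {r : ℕ} {T S : Components n} (hT : G.SmoothComp r T)
    (hS : G.SmoothComp r S) (m : ℕ) : ∀ v : List (Fin n), v.length = r + m → ∀ x ∈ G.U,
      G.nabla^[m] (fun w y => T w y + S w y) v x = G.nabla^[m] T v x + G.nabla^[m] S v x := by
  induction m with
  | zero => intros; rfl
  | succ m ih =>
    intro v hv x hx
    simp only [Function.iterate_succ_apply']
    rw [G.nabla_congr ih v hv hx, nabla_add _ (hT.nabla_iterate m) (hS.nabla_iterate m) hv hx]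

theorem nabla_iterate_smul {r : ℕ} {T : Components n} (hT : G.SmoothComp r T) (c : ℝ) (m : ℕ) :
    ∀ v : List (Fin n), v.length = r + m → ∀ x ∈ G.U,
      G.nabla^[m] (fun w y => c * T w y) v x = c * G.nabla^[m] T v x := by
  induction m with
  | zero => intros; rfl
  | succ m ih =>
    intro v hv x hx
    simp only [Function.iterate_succ_apply']
    rw [G.nabla_congr ih v hv hx, nabla_smul _ (hT.nabla_iterate m) c hv hx]

theorem nabla_iterate_trAt {r : ℕ} {T : Components n} (hT : G.SmoothComp (r + 2) T) {p : ℕ}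
    (hp : p ≤ r) (m : ℕ) : ∀ v : List (Fin n), v.length = r + m → ∀ x ∈ G.U,
      G.nabla^[m] (G.trAt p T) v x = G.trAt (p + m) (G.nabla^[m] T) v x := by
  induction m with
  | zero => intros; rfl
  | succ m ih =>
    intro v hv x hx
    simp only [Function.iterate_succ_apply']
    have h2 : G.SmoothComp (r + m + 2) (G.nabla^[m] T) := by
      have := hT.nabla_iterate m
      rwa [show r + 2 + m = r + m + 2 by omega] at this
    rw [G.nabla_congr ih v hv hx, nabla_trAt _ h2 (p + m) hv (by omega) hx]
    rfl

theorem nabla_iterate_mul_metric {r : ℕ} {T : Components n} (hT : G.SmoothComp r T) (m : ℕ) :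
    ∀ v : List (Fin n), v.length = r + 2 + m → ∀ x ∈ G.U,
      G.nabla^[m] (fun w y => T (w.take r) y * G.metric (w.drop r) y) v x =
      G.nabla^[m] T (v.take (r + m)) x * G.metric (v.drop (r + m)) x := by
  induction m with
  | zero => intros; rfl
  | succ m ih =>
    intro v hv x hx
    simp only [Function.iterate_succ_apply']
    rw [G.nabla_congr ih v hv hx]
    rcases v with _ | ⟨k, v⟩
    · simp at hv
    obtain ⟨v1, v2, rfl, hv1⟩ : ∃ v1 v2, v = v1 ++ v2 ∧ v1.length = r + m :=
      ⟨v.take (r + m), v.drop (r + m), (List.take_append_drop _ v).symm, by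
        simp only [List.length_cons] at hv; simp; omega⟩
    have hv2 : v2.length = 2 := by simp at hv; omega
    rw [nabla_mul _ (hT.nabla_iterate m) G.metric_smooth k hv1 hv2 hx,
      G.nabla_metric (by simp [hv2]) hx, mul_zero, add_zero]
    have e1 : (k :: (v1 ++ v2)).take (r + (m + 1)) = k :: v1 := by
      rw [show r + (m + 1) = v1.length + 1 by omega]; simp
    have e2 : (k :: (v1 ++ v2)).drop (r + (m + 1)) = v2 := by
      rw [show r + (m + 1) = v1.length + 1 by omega]; simp
    rw [e1, e2]

/-! ### The Ricci, Schouten and Weyl tensors as index operations on the curvature tensor -/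

/-- The Ricci tensor `R_{ijkl} g^{jl}`, as a trace of the curvature tensor. The last two slots are
exchanged, so that the slots of `j` and `l` are adjacent. -/
noncomputable def ricciComp : Components n := G.trAt 1 (fun v => G.curv (swapAt 2 v))

/-- The product of the scalar curvature and the metric. -/
noncomputable def scalarMetric : Components n := fun v x =>
  G.trAt 0 G.ricciComp (v.take 0) x * G.metric (v.drop 0) x

/-- The Schouten tensor, as a family of components of rank `2`. -/
noncomputable def schoutenComp : Components n := fun v x =>
  1 / ((n : ℝ) - 2) * (G.ricciComp v x + (- 1 / (2 * ((n : ℝ) - 1))) * G.scalarMetric v x)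

/-- The tensor `P_{ij} g_{kl}`; the other terms of the Weyl tensor arise from it by transpositions. -/
noncomputable def schoutenMetric : Components n := fun v x =>
  G.schoutenComp (v.take 2) x * G.metric (v.drop 2) x

/-- The Weyl tensor, as a family of components of rank `4`. -/
noncomputable def weylComp : Components n := fun v x =>
  (((G.curv v x + G.schoutenMetric (swapAt 1 (swapAt 0 v)) x)
    + G.schoutenMetric (swapAt 1 (swapAt 2 v)) x)
    + (-1) * G.schoutenMetric (swapAt 1 (swapAt 2 (swapAt 0 v))) x)
    + (-1) * G.schoutenMetric (swapAt 1 v) x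

theorem ricciComp_smooth : G.SmoothComp 2 G.ricciComp :=
  SmoothComp.trAt (T := fun v => G.curv (swapAt 2 v)) (G.curv_smooth.swapAt 2) 1

theorem scalarMetric_smooth : G.SmoothComp 2 G.scalarMetric := by
  have := (SmoothComp.trAt (r := 0) G.ricciComp_smooth 0).mul G.metric_smooth
  rwa [zero_add] at this

theorem schoutenComp_smooth : G.SmoothComp 2 G.schoutenComp :=
  (G.ricciComp_smooth.add (G.scalarMetric_smooth.smul _)).smul _

theorem schoutenMetric_smooth : G.SmoothComp 4 G.schoutenMetric :=
  G.schoutenComp_smooth.mul G.metric_smooth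

theorem base_R (ψ υ : E n → ℝ) {v : List (Fin n)} (hv : v.length = 4) (x : E n) :
    G.base ψ υ .R v x = G.curv v x := by
  match v, hv with
  | [i, j, k, l], _ => rfl

theorem base_P (ψ υ : E n → ℝ) {v : List (Fin n)} (hv : v.length = 2) (x : E n) :
    G.base ψ υ .P v x = G.schoutenComp v x := by
  match v, hv with
  | [i, j], _ =>
    have h1 : G.ricciComp [i, j] x = G.ricci i j x := rfl
    have h2 : G.scalarMetric [i, j] x = G.scalar x * G.g x i j := rfl
    change G.schouten i j x = _
    rw [schouten, schoutenComp, h1, h2]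
    ring

theorem base_W (ψ υ : E n → ℝ) {v : List (Fin n)} (hv : v.length = 4) (x : E n) :
    G.base ψ υ .W v x = G.weylComp v x := by
  match v, hv with
  | [i, j, k, l], _ =>
    have h : ∀ a b c d, G.schoutenMetric [a, b, c, d] x = G.schouten a b x * G.g x c d := by
      intro a b c d
      have : G.schoutenComp [a, b] x = G.schouten a b x :=
        (G.base_P (fun _ => 0) (fun _ => 0) (v := [a, b]) rfl x).symm
      rw [← this]
      rfl
    change G.weyl i j k l x = _
    simp only [weylComp, swapAt_zero_cons, swapAt_succ_cons, h, weyl]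
    simp only [curv]
    ring

theorem comp_R (ψ υ : E n → ℝ) {m : ℕ} {v : List (Fin n)} (hv : v.length = 4 + m) {x : E n}
    (hx : x ∈ G.U) : G.comp ψ υ .R v x = G.nabla^[m] G.curv v x := by
  have hm : v.length - Kind.R.arity = m := by rw [hv]; simp [Kind.arity]
  rw [comp, hm]
  exact G.nabla_iterate_congr m (fun w hw y _ => G.base_R ψ υ hw y) v hv x hx

theorem comp_P (ψ υ : E n → ℝ) {m : ℕ} {v : List (Fin n)} (hv : v.length = 2 + m) {x : E n}
    (hx : x ∈ G.U) : G.comp ψ υ .P v x = G.nabla^[m] G.schoutenComp v x := by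
  have hm : v.length - Kind.P.arity = m := by rw [hv]; simp [Kind.arity]
  rw [comp, hm]
  exact G.nabla_iterate_congr m (fun w hw y _ => G.base_P ψ υ hw y) v hv x hx

theorem comp_W (ψ υ : E n → ℝ) {m : ℕ} {v : List (Fin n)} (hv : v.length = 4 + m) {x : E n}
    (hx : x ∈ G.U) : G.comp ψ υ .W v x = G.nabla^[m] G.weylComp v x := by
  have hm : v.length - Kind.W.arity = m := by rw [hv]; simp [Kind.arity]
  rw [comp, hm]
  exact G.nabla_iterate_congr m (fun w hw y _ => G.base_W ψ υ hw y) v hv x hx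

theorem swapAt_append_add {α : Type*} (a : List α) (p : ℕ) (b : List α) :
    swapAt (p + a.length) (a ++ b) = a ++ swapAt p b := by
  induction a with
  | nil => rfl
  | cons c a ih =>
    rw [List.length_cons, ← add_assoc, List.cons_append, swapAt_succ_cons, ih, List.cons_append]

theorem trAt_append_add (a : List (Fin n)) (p : ℕ) (b : List (Fin n)) (T : Components n) (x : E n) :
    G.trAt (p + a.length) T (a ++ b) x =
      ∑ i, ∑ j, G.ginv x i j * T (a ++ (b.take p ++ i :: j :: b.drop p)) x := by
  have h1 : (a ++ b).take (p + a.length) = a ++ b.take p := by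
    rw [add_comm, List.take_length_add_append]
  have h2 : (a ++ b).drop (p + a.length) = b.drop p := by
    rw [add_comm, List.drop_length_add_append]
  simp only [trAt, h1, h2, List.append_assoc]

/-- The iterated covariant derivatives of the Schouten tensor in terms of those of the curvature
tensor. -/
theorem comp_P_eq (ψ υ : E n → ℝ) (α : List (Fin n)) (i k : Fin n) {x : E n} (hx : x ∈ G.U) :
    G.comp ψ υ .P (α ++ [i, k]) x = 1 / ((n : ℝ) - 2) *
      ((∑ j, ∑ l, G.ginv x j l * G.comp ψ υ .R (α ++ [i, j, k, l]) x) - 1 / (2 * ((n : ℝ) - 1)) *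
        ((∑ a, ∑ b, G.ginv x a b * ∑ j, ∑ l, G.ginv x j l * G.comp ψ υ .R (α ++ [a, j, b, l]) x)
          * G.g x i k)) := by
  have hcs : G.SmoothComp 4 (fun v => G.curv (swapAt 2 v)) := G.curv_smooth.swapAt 2
  have hric : ∀ a b : Fin n, G.nabla^[α.length] G.ricciComp (α ++ [a, b]) x =
      ∑ j, ∑ l, G.ginv x j l * G.comp ψ υ .R (α ++ [a, j, b, l]) x := by
    intro a b
    rw [ricciComp, G.nabla_iterate_trAt hcs (by omega) α.length _ (by simp [add_comm]) x hx,
      trAt_append_add]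
    refine Finset.sum_congr rfl fun j _ => Finset.sum_congr rfl fun l _ => ?_
    rw [G.nabla_iterate_swapAt (r := 4) _ 2 α.length _ (by simp [add_comm]) x hx,
      swapAt_append_add, G.comp_R ψ υ (m := α.length) (by simp [add_comm]) hx]
    rfl
  have hsc : G.nabla^[α.length] G.scalarMetric (α ++ [i, k]) x =
      (∑ a, ∑ b, G.ginv x a b * ∑ j, ∑ l, G.ginv x j l * G.comp ψ υ .R (α ++ [a, j, b, l]) x)
          * G.g x i k := by
    have hs : G.SmoothComp 0 (G.trAt 0 G.ricciComp) := SmoothComp.trAt (r := 0) G.ricciComp_smooth 0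
    have := G.nabla_iterate_mul_metric hs α.length (α ++ [i, k]) (by simp [add_comm]) x hx
    have e0 : (fun (w : List (Fin n)) y => G.trAt 0 G.ricciComp (w.take 0) y * G.metric (w.drop 0) y)
      = G.scalarMetric := rfl
    rw [e0] at this
    rw [this]
    have h1 : (α ++ [i, k]).take (0 + α.length) = α ++ [] := by simp
    have h2 : (α ++ [i, k]).drop (0 + α.length) = [i, k] := by simp
    rw [h1, h2, G.nabla_iterate_trAt (r := 0) G.ricciComp_smooth le_rfl α.length _ (by simp) x hx,
      trAt_append_add]
    simp only [List.take_nil, List.drop_nil, List.nil_append, hric]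
    rfl
  rw [G.comp_P ψ υ (m := α.length) (by simp [add_comm]) hx]
  have hl : (α ++ [i, k]).length = 2 + α.length := by simp [add_comm]
  have e := G.nabla_iterate_smul (G.ricciComp_smooth.add (G.scalarMetric_smooth.smul
    (- 1 / (2 * ((n : ℝ) - 1))))) (1 / ((n : ℝ) - 2)) α.length _ hl x hx
  have e' := G.nabla_iterate_add G.ricciComp_smooth (G.scalarMetric_smooth.smul
    (- 1 / (2 * ((n : ℝ) - 1)))) α.length _ hl x hx
  have e'' := G.nabla_iterate_smul G.scalarMetric_smooth (- 1 / (2 * ((n : ℝ) - 1)))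
    α.length _ hl x hx
  rw [e', e'', hric, hsc] at e
  refine e.trans ?_
  ring

/-- The iterated covariant derivatives of the Weyl tensor in terms of those of the curvature
tensor and of the Schouten tensor. -/
theorem comp_W_eq (ψ υ : E n → ℝ) (α : List (Fin n)) (i j k l : Fin n) {x : E n} (hx : x ∈ G.U) :
    G.comp ψ υ .W (α ++ [i, j, k, l]) x = G.comp ψ υ .R (α ++ [i, j, k, l]) x
      + (G.comp ψ υ .P (α ++ [j, k]) x * G.g x i l + G.comp ψ υ .P (α ++ [i, l]) x * G.g x j k
      - G.comp ψ υ .P (α ++ [j, l]) x * G.g x i k - G.comp ψ υ .P (α ++ [i, k]) x * G.g x j l) := by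
  have hS := G.schoutenMetric_smooth
  have hl : ∀ a b c d : Fin n, (α ++ [a, b, c, d]).length = 4 + α.length := by
    intros; simp [add_comm]
  have hSg : ∀ a b c d : Fin n, G.nabla^[α.length] G.schoutenMetric (α ++ [a, b, c, d]) x =
      G.comp ψ υ .P (α ++ [a, b]) x * G.g x c d := by
    intro a b c d
    have := G.nabla_iterate_mul_metric G.schoutenComp_smooth α.length (α ++ [a, b, c, d])
      (by simp [add_comm]) x hx
    have e0 : (fun (w : List (Fin n)) y => G.schoutenComp (w.take 2) y * G.metric (w.drop 2) y)
      = G.schoutenMetric := rfl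
    rw [e0] at this
    rw [this, G.comp_P ψ υ (m := α.length) (by simp [add_comm]) hx]
    have h1 : (α ++ [a, b, c, d]).take (2 + α.length) = α ++ [a, b] := by
      rw [add_comm, List.take_length_add_append]; rfl
    have h2 : (α ++ [a, b, c, d]).drop (2 + α.length) = [c, d] := by
      rw [add_comm, List.drop_length_add_append]; rfl
    rw [h1, h2]
    rfl
  let S1 : Components n := fun v => G.schoutenMetric (swapAt 1 v)
  have hS1 : G.SmoothComp 4 S1 := hS.swapAt 1
  let S12 : Components n := fun v => S1 (swapAt 2 v)
  have hS12 : G.SmoothComp 4 S12 := hS1.swapAt 2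
  let S10 : Components n := fun v => S1 (swapAt 0 v)
  have hS10 : G.SmoothComp 4 S10 := hS1.swapAt 0
  let S120 : Components n := fun v => S12 (swapAt 0 v)
  have hS120 : G.SmoothComp 4 S120 := hS12.swapAt 0
  have s1 : ∀ v : List (Fin n), v.length = 4 → G.nabla^[α.length] S1 (α ++ v) x =
      G.nabla^[α.length] G.schoutenMetric (α ++ swapAt 1 v) x := by
    intro v hv
    rw [G.nabla_iterate_swapAt (r := 4) _ 1 α.length _ (by simp [add_comm, hv]) x hx,
      swapAt_append_add]
  have s12 : ∀ v : List (Fin n), v.length = 4 → G.nabla^[α.length] S12 (α ++ v) x =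
      G.nabla^[α.length] G.schoutenMetric (α ++ swapAt 1 (swapAt 2 v)) x := by
    intro v hv
    rw [G.nabla_iterate_swapAt (r := 4) S1 2 α.length _ (by simp [add_comm, hv]) x hx,
      swapAt_append_add, s1 _ (by simp [hv])]
  have s10 : ∀ v : List (Fin n), v.length = 4 → G.nabla^[α.length] S10 (α ++ v) x =
      G.nabla^[α.length] G.schoutenMetric (α ++ swapAt 1 (swapAt 0 v)) x := by
    intro v hv
    rw [G.nabla_iterate_swapAt (r := 4) S1 0 α.length _ (by simp [add_comm, hv]) x hx,
      swapAt_append_add, s1 _ (by simp [hv])]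
  have s120 : ∀ v : List (Fin n), v.length = 4 → G.nabla^[α.length] S120 (α ++ v) x =
      G.nabla^[α.length] G.schoutenMetric (α ++ swapAt 1 (swapAt 2 (swapAt 0 v))) x := by
    intro v hv
    rw [G.nabla_iterate_swapAt (r := 4) S12 0 α.length _ (by simp [add_comm, hv]) x hx,
      swapAt_append_add, s12 _ (by simp [hv])]
  have hW : G.weylComp = fun v x => (((G.curv v x + S10 v x) + S12 v x) + (-1) * S120 v x)
    + (-1) * S1 v x := rfl
  rw [G.comp_W ψ υ (hl i j k l) hx, G.comp_R ψ υ (hl i j k l) hx, hW,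
    G.nabla_iterate_add (T := fun v x => ((G.curv v x + S10 v x) + S12 v x) + (-1) * S120 v x)
      (S := fun v x => (-1) * S1 v x)
      (((G.curv_smooth.add hS10).add hS12).add (hS120.smul _)) (hS1.smul _) _ _ (hl i j k l) x hx,
    G.nabla_iterate_add (T := fun v x => (G.curv v x + S10 v x) + S12 v x)
      (S := fun v x => (-1) * S120 v x)
      ((G.curv_smooth.add hS10).add hS12) (hS120.smul _) _ _ (hl i j k l) x hx,
    G.nabla_iterate_add (T := fun v x => G.curv v x + S10 v x)
      (G.curv_smooth.add hS10) hS12 _ _ (hl i j k l) x hx,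
    G.nabla_iterate_add G.curv_smooth hS10 _ _ (hl i j k l) x hx,
    G.nabla_iterate_smul hS1 _ _ _ (hl i j k l) x hx,
    G.nabla_iterate_smul hS120 _ _ _ (hl i j k l) x hx,
    s1 _ rfl, s10 _ rfl, s12 _ rfl, s120 _ rfl]
  simp only [swapAt_zero_cons, swapAt_succ_cons, hSg]
  ring

end LocalMetric

/-! ### Tensor fields built from the curvature tensor -/

/-- `CurvField N r X`: the tensor field `X`, of rank `r`, arises from iterated covariant derivatives
of the curvature tensor and from the metric by tensor products, traces, permutations of the indices
and linear combinations, with exactly `N` curvature factors in each product. -/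
inductive CurvField {n : ℕ} : ℕ → ℕ → (LocalMetric n → Components n) → Prop
  | curv (m : ℕ) : CurvField 1 (4 + m) (fun G => G.nabla^[m] G.curv)
  | metric : CurvField 0 2 (fun G => G.metric)
  | zero (N r : ℕ) : CurvField N r (fun _ _ _ => 0)
  | add {N r : ℕ} {X Y : LocalMetric n → Components n} (hX : CurvField N r X)
      (hY : CurvField N r Y) : CurvField N r (fun G v x => X G v x + Y G v x)
  | smul {N r : ℕ} {X : LocalMetric n → Components n} (c : ℝ) (hX : CurvField N r X) :
      CurvField N r (fun G v x => c * X G v x)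
  | mul {N M r s : ℕ} {X Y : LocalMetric n → Components n} (hX : CurvField N r X)
      (hY : CurvField M s Y) :
      CurvField (N + M) (r + s) (fun G v x => X G (v.take r) x * Y G (v.drop r) x)
  | trAt {N r : ℕ} {X : LocalMetric n → Components n} (p : ℕ) (hp : p ≤ r)
      (hX : CurvField N (r + 2) X) : CurvField N r (fun G => G.trAt p (X G))
  | swapAt {N r : ℕ} {X : LocalMetric n → Components n} (p : ℕ) (hX : CurvField N r X) :
      CurvField N r (fun G v => X G (swapAt p v))
  | congr {N r : ℕ} {X Y : LocalMetric n → Components n} (hX : CurvField N r X)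
      (h : ∀ G (v : List (Fin n)), v.length = r → ∀ x ∈ G.U, Y G v x = X G v x) :
      CurvField N r Y

/-- Move the first entry to the position `p`. -/
def moveTo {α : Type*} : ℕ → List α → List α
  | 0, v => v
  | p + 1, v => swapAt p (moveTo p v)

/-- Move the entry in the position `q + p` to the position `q`. -/
def moveFrom {α : Type*} (q : ℕ) : ℕ → List α → List α
  | 0, v => v
  | p + 1, v => moveFrom q p (swapAt (q + p) v)

theorem moveTo_cons {α : Type*} (k : α) (v w : List α) :
    moveTo v.length (k :: (v ++ w)) = v ++ k :: w := by
  induction v using List.reverseRecOn generalizing w with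
  | nil => rfl
  | append_singleton v b ih =>
    rw [List.length_append, List.length_singleton, moveTo, List.append_assoc, List.singleton_append,
      ih, swapAt_append, List.append_assoc, List.singleton_append]

theorem moveFrom_append {α : Type*} (a v w : List α) (k : α) :
    moveFrom a.length v.length (a ++ (v ++ k :: w)) = a ++ k :: (v ++ w) := by
  induction v using List.reverseRecOn generalizing w with
  | nil => rfl
  | append_singleton v b ih =>
    rw [List.length_append, List.length_singleton, moveFrom, ← List.length_append,
      List.append_assoc, List.singleton_append, ← List.append_assoc, swapAt_append,
      List.append_assoc, ih, List.append_assoc, List.singleton_append]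

namespace CurvField

variable {n N M r s : ℕ} {X Y : LocalMetric n → Components n}

theorem moveTo (hX : CurvField N r X) (p : ℕ) :
    CurvField N r (fun G v => X G (moveTo p v)) := by
  induction p generalizing X with
  | zero => exact hX
  | succ p ih => exact ih (hX.swapAt p)

theorem moveFrom (hX : CurvField N r X) (q p : ℕ) :
    CurvField N r (fun G v => X G (moveFrom q p v)) := by
  induction p generalizing X with
  | zero => exact hX
  | succ p ih => exact (ih hX).swapAt (q + p)

theorem sum {ι : Type*} (t : Finset ι) {X : ι → LocalMetric n → Components n}
    (hX : ∀ i ∈ t, CurvField N r (X i)) : CurvField N r (fun G v x => ∑ i ∈ t, X i G v x) := by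
  classical
  induction t using Finset.induction_on with
  | empty => simpa using CurvField.zero N r
  | insert a t ha ih =>
    simp only [Finset.sum_insert ha]
    exact (hX a (Finset.mem_insert_self _ _)).add
      (ih fun i hi => hX i (Finset.mem_insert_of_mem hi))

theorem smooth (hX : CurvField N r X) (G : LocalMetric n) : G.SmoothComp r (X G) := by
  induction hX with
  | curv m => exact G.curv_smooth.nabla_iterate m
  | metric => exact G.metric_smooth
  | zero => exact fun _ _ => contDiffOn_const
  | add _ _ h1 h2 => exact h1.add h2
  | smul c _ h => exact h.smul c
  | mul _ _ h1 h2 => exact h1.mul h2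
  | trAt p _ _ h => exact h.trAt p
  | swapAt p _ h => exact h.swapAt p
  | congr _ e h => exact h.congr (e G)

/-- By the Leibniz rule, and since the metric is parallel. -/
theorem nabla (hX : CurvField N r X) : CurvField N (r + 1) (fun G => G.nabla (X G)) := by
  induction hX with
  | curv m =>
    have := CurvField.curv (n := n) (m + 1)
    simp only [Function.iterate_succ_apply', ← add_assoc] at this
    exact this
  | metric => exact (CurvField.zero 0 3).congr fun G v hv x hx => G.nabla_metric hv hx
  | zero N r => exact (CurvField.zero N (r + 1)).congr fun G v hv x hx => G.nabla_zero v x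
  | add h1 h2 i1 i2 =>
    exact (i1.add i2).congr fun G v hv x hx => G.nabla_add (h1.smooth G) (h2.smooth G) hv hx
  | smul c h i => exact (i.smul c).congr fun G v hv x hx => G.nabla_smul (h.smooth G) c hv hx
  | @mul N M r s X Y h1 h2 i1 i2 =>
    have t1 := i1.mul h2
    have t2 := (h1.mul i2).moveTo r
    rw [show r + 1 + s = r + s + 1 by omega] at t1
    refine (t1.add t2).congr fun G v hv x hx => ?_
    rcases v with _ | ⟨k, v⟩
    · simp at hv
    obtain ⟨v1, v2, rfl, hv1⟩ : ∃ v1 v2, v = v1 ++ v2 ∧ v1.length = r :=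
      ⟨v.take r, v.drop r, (List.take_append_drop _ v).symm, by
        simp only [List.length_cons] at hv; simp; omega⟩
    have hv2 : v2.length = s := by simp at hv; omega
    rw [G.nabla_mul (h1.smooth G) (h2.smooth G) k hv1 hv2 hx]
    subst hv1
    rw [moveTo_cons]
    simp
  | @trAt N r X p hp h i =>
    refine (CurvField.trAt (p + 1) (by omega) i).congr fun G v hv x hx => ?_
    exact G.nabla_trAt (h.smooth G) p hv hp hx
  | swapAt p h i =>
    refine (i.swapAt (p + 1)).congr fun G v hv x hx => ?_
    exact G.nabla_swapAt _ p v (by rintro rfl; simp at hv) x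
  | congr h e i =>
    exact i.congr fun G v hv x hx => G.nabla_congr (e G) v hv hx

theorem nabla_iterate (hX : CurvField N r X) (m : ℕ) :
    CurvField N (r + m) (fun G => G.nabla^[m] (X G)) := by
  induction m with
  | zero => exact hX
  | succ m ih =>
    simp only [Function.iterate_succ_apply']
    exact ih.nabla

theorem der_eq_sum_range (T : List (Fin n) → ℝ) (A : Fin n → Fin n → ℝ) (d : Fin n)
    (v : List (Fin n)) :
    der A T v = ∑ s ∈ Finset.range v.length, ∑ l : Fin n, A l (v.getD s d) * T (v.set s l) := by
  rw [der_eq_sum, Finset.sum_range]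
  simp

/-- The commutator of two covariant derivatives of a field with `N` curvature factors has `N + 1`
curvature factors. -/
theorem commutator (hX : CurvField N r X) :
    CurvField (N + 1) (r + 2) (fun G v x => G.nabla (G.nabla (X G)) v x -
      G.nabla (G.nabla (X G)) (RiemContr.swapAt 0 v) x) := by
  have main : ∀ t < r, ∃ Y : LocalMetric n → Components n, CurvField (N + 1) (r + 2) Y ∧
      ∀ G : LocalMetric n, ∀ x ∈ G.U, ∀ (k l : Fin n) (w : List (Fin n)), w.length = r →
        Y G (k :: l :: w) x = ∑ m, G.curvOp m (w.getD t k) k l x * X G (w.set t m) x := by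
    intro t ht
    have h1 := (CurvField.curv (n := n) 0).mul (hX.moveTo t)
    have h2 := ((((h1.swapAt 1).swapAt 2).swapAt 3).swapAt 2).swapAt 1
    rw [show 1 + N = N + 1 by omega, show 4 + 0 + r = (r + 2) + 2 by omega] at h2
    have h3 := ((CurvField.trAt 0 (by omega) h2).moveFrom 2 t)
    refine ⟨_, h3, fun G x hx k l w hw => ?_⟩
    obtain ⟨ρ, j, σ, rfl, hρ⟩ : ∃ ρ j σ, w = ρ ++ j :: σ ∧ ρ.length = t := by
      have htw : t < w.length := by omega
      exact ⟨w.take t, w[t], w.drop (t + 1), by simp, by simp; omega⟩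
    have e1 : RiemContr.moveFrom 2 t (k :: l :: (ρ ++ j :: σ)) = k :: l :: j :: (ρ ++ σ) := by
      subst hρ
      exact moveFrom_append [k, l] ρ σ j
    have e2 : ∀ m, RiemContr.moveTo t (m :: (ρ ++ σ)) = ρ ++ m :: σ := by
      intro m; subst hρ; exact moveTo_cons m ρ σ
    have e3 : (ρ ++ j :: σ).getD t k = j := by subst hρ; simp
    have e4 : ∀ m, (ρ ++ j :: σ).set t m = ρ ++ m :: σ := by intro m; subst hρ; simp
    simp only [e1, LocalMetric.trAt, List.take_zero, List.drop_zero, List.nil_append,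
      swapAt_zero_cons, swapAt_succ_cons, Function.iterate_zero, id, add_zero,
      List.take_succ_cons, List.drop_succ_cons, e2, e3, e4]
    rw [Finset.sum_comm]
    refine Finset.sum_congr rfl fun m _ => ?_
    rw [G.curvOp_eq hx, Finset.sum_mul]
    refine Finset.sum_congr rfl fun i _ => ?_
    rw [G.ginv_symm hx i m]
    simp only [LocalMetric.curv]
    ring
  choose! Y hY hYv using main
  refine ((CurvField.sum (Finset.range r) (X := fun t => Y t)
    fun t ht => hY t (Finset.mem_range.1 ht)).smul (-1)).congr fun G v hv x hx => ?_
  match v, hv with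
  | k :: l :: w, hv =>
    have hw : w.length = r := by simpa using hv
    rw [swapAt_zero_cons, G.nabla_nabla_sub (hX.smooth G) k l hw hx, der_eq_sum_range _ _ k, hw]
    have : ∀ t ∈ Finset.range r, Y t G (k :: l :: w) x =
        ∑ m, G.curvOp m (w.getD t k) k l x * X G (w.set t m) x :=
      fun t ht => hYv t (Finset.mem_range.1 ht) G x hx k l w hw
    rw [Finset.sum_congr rfl this]
    ring

theorem ricciComp : CurvField 1 2 (fun G : LocalMetric n => G.ricciComp) :=
  CurvField.trAt 1 (by omega) ((CurvField.curv 0).swapAt 2)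

theorem schoutenComp : CurvField 1 2 (fun G : LocalMetric n => G.schoutenComp) := by
  have h := (CurvField.trAt (r := 0) 0 le_rfl (ricciComp (n := n))).mul CurvField.metric
  exact (ricciComp.add ((show CurvField 1 2 (fun G : LocalMetric n => G.scalarMetric) from
    h).smul _)).smul _

theorem weylComp : CurvField 1 4 (fun G : LocalMetric n => G.weylComp) := by
  have h : CurvField 1 4 (fun G : LocalMetric n => G.schoutenMetric) :=
    (schoutenComp (n := n)).mul CurvField.metric
  exact (((((CurvField.curv 0).add ((h.swapAt 1).swapAt 0)).add ((h.swapAt 1).swapAt 2)).add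
    ((((h.swapAt 1).swapAt 2).swapAt 0).smul (-1))).add ((h.swapAt 1).smul (-1)))

end CurvField

end RiemContr

namespace RiemContr

/-! ### Sums over the values of bound indices -/

/-- The sum of `F` over all values of the indices in the list `A`; the coloring `c` gives the values
of the other indices. -/
def sumOver {R : Type*} [AddCommMonoid R] {n : ℕ} :
    List ℕ → ((ℕ → Fin n) → R) → (ℕ → Fin n) → R
  | [], F, c => F c
  | a :: A, F, c => ∑ v, sumOver A F (Function.update c a v)

section SumOver

variable {R : Type*} [AddCommMonoid R] {n : ℕ}

theorem sumOver_perm {A A' : List ℕ} (h : A.Perm A') (F : (ℕ → Fin n) → R) (c : ℕ → Fin n) :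
    sumOver A F c = sumOver A' F c := by
  induction h generalizing c with
  | nil => rfl
  | cons a _ ih => simp only [sumOver, ih]
  | swap a b A =>
    simp only [sumOver]
    by_cases hab : a = b
    · subst hab; rfl
    · rw [Finset.sum_comm]
      refine Finset.sum_congr rfl fun v _ => Finset.sum_congr rfl fun w _ => ?_
      rw [Function.update_comm hab]
  | trans _ _ i1 i2 => rw [i1, i2]

theorem sumOver_append (A B : List ℕ) (F : (ℕ → Fin n) → R) (c : ℕ → Fin n) :
    sumOver (A ++ B) F c = sumOver A (sumOver B F) c := by
  induction A generalizing c with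
  | nil => rfl
  | cons a A ih => simp only [List.cons_append, sumOver, ih]

theorem sumOver_congr {A : List ℕ} {F H : (ℕ → Fin n) → R} (h : ∀ c, F c = H c) (c : ℕ → Fin n) :
    sumOver A F c = sumOver A H c := by
  rw [show F = H from funext h]

theorem sumOver_add (A : List ℕ) (F H : (ℕ → Fin n) → R) (c : ℕ → Fin n) :
    sumOver A (fun d => F d + H d) c = sumOver A F c + sumOver A H c := by
  induction A generalizing c with
  | nil => rfl
  | cons a A ih => simp only [sumOver, ih, Finset.sum_add_distrib]

theorem sumOver_zero (A : List ℕ) (c : ℕ → Fin n) :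
    sumOver A (fun _ => (0 : R)) c = 0 := by
  induction A generalizing c with
  | nil => rfl
  | cons a A ih => simp [sumOver, ih]

theorem sumOver_sum {ι : Type*} (s : Finset ι) (A : List ℕ) (F : ι → (ℕ → Fin n) → R)
    (c : ℕ → Fin n) : sumOver A (fun d => ∑ i ∈ s, F i d) c = ∑ i ∈ s, sumOver A (F i) c := by
  induction A generalizing c with
  | nil => rfl
  | cons a A ih =>
    simp only [sumOver, ih]
    rw [Finset.sum_comm]

theorem map_sumOver {S : Type*} [AddCommMonoid S] (f : R →+ S) (A : List ℕ) (F : (ℕ → Fin n) → R)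
    (c : ℕ → Fin n) : f (sumOver A F c) = sumOver A (fun d => f (F d)) c := by
  induction A generalizing c with
  | nil => rfl
  | cons a A ih => simp only [sumOver, map_sum, ih]

theorem sumOver_mul_left (b : ℝ) (A : List ℕ) (F : (ℕ → Fin n) → ℝ) (c : ℕ → Fin n) :
    sumOver A (fun d => b * F d) c = b * sumOver A F c :=
  (map_sumOver (AddMonoidHom.mulLeft b) A F c).symm

theorem sumOver_congr_of_eqOn {A : List ℕ} {F H : (ℕ → Fin n) → R} {c : ℕ → Fin n}
    (h : ∀ d : ℕ → Fin n, (∀ l, l ∉ A → d l = c l) → F d = H d) :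
    sumOver A F c = sumOver A H c := by
  induction A generalizing c with
  | nil => exact h c fun _ _ => rfl
  | cons a A ih =>
    simp only [sumOver]
    refine Finset.sum_congr rfl fun v _ => ih fun d hd => h d fun l hl => ?_
    simp only [List.mem_cons, not_or] at hl
    rw [hd l hl.2, Function.update_of_ne hl.1]

/-- The function `F` of colorings depends only on the values of the indices in `s`. -/
def DependsOnly {R : Type*} {n : ℕ} (F : (ℕ → Fin n) → R) (s : List ℕ) : Prop :=
  ∀ c d : ℕ → Fin n, (∀ l ∈ s, c l = d l) → F c = F d

theorem DependsOnly.sumOver_eq {F : (ℕ → Fin n) → R} {s A : List ℕ} (h : DependsOnly F s)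
    {c d : ℕ → Fin n} (hcd : ∀ l ∈ s, l ∉ A → c l = d l) : sumOver A F c = sumOver A F d := by
  induction A generalizing c d with
  | nil => exact h c d fun l hl => hcd l hl (by simp)
  | cons a A ih =>
    refine Finset.sum_congr rfl fun v _ => ih fun l hl hlA => ?_
    by_cases hla : l = a
    · subst hla; simp
    · rw [Function.update_of_ne hla, Function.update_of_ne hla]
      exact hcd l hl (by simp [hla, hlA])

theorem sumOver_mul {A B : List ℕ} {F H : (ℕ → Fin n) → ℝ} {s t : List ℕ} (hF : DependsOnly F s)
    (hH : DependsOnly H t) (hs : ∀ l ∈ s, l ∉ B) (ht : ∀ l ∈ t, l ∉ A) (c : ℕ → Fin n) :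
    sumOver A F c * sumOver B H c = sumOver (A ++ B) (fun d => F d * H d) c := by
  rw [sumOver_append]
  have h1 : ∀ d, sumOver B (fun d => F d * H d) d = F d * sumOver B H d := by
    intro d
    rw [← sumOver_mul_left]
    refine sumOver_congr_of_eqOn fun d' hd' => ?_
    rw [hF d' d fun l hl => hd' l (hs l hl)]
  have h2 : sumOver A (fun d => F d * sumOver B H d) c =
      sumOver A (fun d => sumOver B H c * F d) c := by
    refine sumOver_congr_of_eqOn fun d hd => ?_
    rw [hH.sumOver_eq (c := d) (d := c) fun l hl _ => hd l (ht l hl), mul_comm]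
  rw [sumOver_congr h1, h2, sumOver_mul_left, mul_comm]

theorem sumOver_map {σ : ℕ → ℕ} (hσ : Function.Injective σ) (A : List ℕ) (F : (ℕ → Fin n) → R)
    (c : ℕ → Fin n) : sumOver (A.map σ) (fun d => F (d ∘ σ)) c = sumOver A F (c ∘ σ) := by
  induction A generalizing c with
  | nil => rfl
  | cons a A ih =>
    simp only [List.map_cons, sumOver, ih]
    refine Finset.sum_congr rfl fun v _ => ?_
    rw [Function.update_comp_eq_of_injective _ hσ]

theorem sumOver_prod {A : List ℕ} (hA : A.Nodup) (h : ℕ → Fin n → ℝ) (c : ℕ → Fin n) :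
    sumOver A (fun d => (A.map fun l => h l (d l)).prod) c = (A.map fun l => ∑ v, h l v).prod := by
  induction A generalizing c with
  | nil => rfl
  | cons a A ih =>
    have ha := (List.nodup_cons.1 hA).1
    simp only [List.map_cons, List.prod_cons, sumOver]
    rw [Finset.sum_mul]
    refine Finset.sum_congr rfl fun v _ => ?_
    rw [← ih (List.nodup_cons.1 hA).2 (Function.update c a v), ← sumOver_mul_left]
    refine sumOver_congr_of_eqOn fun d hd => ?_
    rw [hd a ha, Function.update_self]

end SumOver

/-! ### Components in an orthonormal frame -/

/-- The components of a tensor with respect to the frame `e_a = ∑ e^u_a ∂_u`. -/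
def frame {n : ℕ} (e : Matrix (Fin n) (Fin n) ℝ) : (List (Fin n) → ℝ) → List (Fin n) → ℝ
  | T, [] => T []
  | T, a :: v => ∑ u, e u a * frame e (fun w => T (u :: w)) v

section Frame

variable {n : ℕ} (e : Matrix (Fin n) (Fin n) ℝ)

theorem frame_congr {T S : List (Fin n) → ℝ} {v : List (Fin n)}
    (h : ∀ w : List (Fin n), w.length = v.length → T w = S w) : frame e T v = frame e S v := by
  induction v generalizing T S with
  | nil => exact h [] rfl
  | cons a v ih =>
    simp only [frame]
    refine Finset.sum_congr rfl fun u _ => ?_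
    rw [ih fun w hw => h (u :: w) (by simp [hw])]

theorem frame_add (T S : List (Fin n) → ℝ) (v : List (Fin n)) :
    frame e (fun w => T w + S w) v = frame e T v + frame e S v := by
  induction v generalizing T S with
  | nil => rfl
  | cons a v ih => simp only [frame, ih, mul_add, Finset.sum_add_distrib]

theorem frame_smul (b : ℝ) (T : List (Fin n) → ℝ) (v : List (Fin n)) :
    frame e (fun w => b * T w) v = b * frame e T v := by
  induction v generalizing T with
  | nil => rfl
  | cons a v ih =>
    simp only [frame, ih, Finset.mul_sum]
    exact Finset.sum_congr rfl fun u _ => by ring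

theorem frame_zero (v : List (Fin n)) : frame e (fun _ => 0) v = 0 := by
  induction v with
  | nil => rfl
  | cons a v ih => simp [frame, ih]

theorem frame_append (T : List (Fin n) → ℝ) (v w : List (Fin n)) :
    frame e T (v ++ w) = frame e (fun v' => frame e (fun w' => T (v' ++ w')) w) v := by
  induction v generalizing T with
  | nil => rfl
  | cons a v ih => simp only [List.cons_append, frame, ih]

theorem frame_sum {ι : Type*} (s : Finset ι) (T : ι → List (Fin n) → ℝ) (v : List (Fin n)) :
    frame e (fun w => ∑ i ∈ s, T i w) v = ∑ i ∈ s, frame e (T i) v := by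
  induction v generalizing T with
  | nil => rfl
  | cons a v ih =>
    simp only [frame, ih, Finset.mul_sum]
    rw [Finset.sum_comm]

theorem frame_mul (T S : List (Fin n) → ℝ) (v w : List (Fin n)) :
    frame e (fun u => T (u.take v.length) * S (u.drop v.length)) (v ++ w) =
      frame e T v * frame e S w := by
  have h : ∀ v' : List (Fin n), v'.length = v.length →
      frame e (fun w' => T ((v' ++ w').take v.length) * S ((v' ++ w').drop v.length)) w =
      frame e S w * T v' := by
    intro v' hv'
    rw [mul_comm, ← frame_smul]
    refine frame_congr e fun w' _ => ?_
    rw [← hv']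
    simp
  rw [frame_append, frame_congr e h, frame_smul, mul_comm]

theorem frame_swapAt (T : List (Fin n) → ℝ) (p : ℕ) (v : List (Fin n)) :
    frame e (fun w => T (swapAt p w)) v = frame e T (swapAt p v) := by
  induction p generalizing T v with
  | zero =>
    rcases v with _ | ⟨a, _ | ⟨b, l⟩⟩
    · rfl
    · simp [frame, swapAt]
    · simp only [frame, swapAt_zero_cons, Finset.mul_sum]
      rw [Finset.sum_comm]
      refine Finset.sum_congr rfl fun _ _ => Finset.sum_congr rfl fun _ _ => by ring
  | succ p ih =>
    rcases v with _ | ⟨a, l⟩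
    · rfl
    · simp only [frame, swapAt_succ_cons]
      refine Finset.sum_congr rfl fun u _ => ?_
      rw [ih (fun w => T (u :: w)) l]

theorem frame_one (T : List (Fin n) → ℝ) (v : List (Fin n)) :
    frame (1 : Matrix (Fin n) (Fin n) ℝ) T v = T v := by
  induction v generalizing T with
  | nil => rfl
  | cons a v ih => simp [frame, ih, Matrix.one_apply]

theorem frame_map_eq_sum (T : List (Fin n) → ℝ) (L : List ℕ) (d : ℕ → Fin n) :
    frame e T (L.map d) = ∑ c : Fin L.length → Fin n,
      (∏ s, e (c s) (d (L.get s))) * T (List.ofFn c) := by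
  induction L generalizing T with
  | nil => simp [frame]
  | cons a L ih =>
    simp only [List.map_cons, frame, ih, List.length_cons]
    rw [← (Fin.consEquiv (fun _ => Fin n)).sum_comp, Fintype.sum_prod_type]
    refine Finset.sum_congr rfl fun u _ => ?_
    rw [Finset.mul_sum]
    refine Finset.sum_congr rfl fun c _ => ?_
    simp only [Fin.consEquiv_apply, Fin.prod_univ_succ, List.ofFn_succ, Fin.cons_zero,
      Fin.cons_succ, List.get_cons_zero]
    have : ∀ s : Fin L.length, (a :: L).get s.succ = L.get s := fun _ => rfl
    simp only [this]
    ring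

/-- Traces are sums over a frame which is orthonormal with respect to the inverse matrix. -/
theorem frame_trace {M : Fin n → Fin n → ℝ} (hM : ∀ i j, M i j = ∑ a, e i a * e j a) (p : ℕ)
    (T : List (Fin n) → ℝ) (v : List (Fin n)) :
    frame e (fun w => ∑ i, ∑ j, M i j * T (w.take p ++ i :: j :: w.drop p)) v =
      ∑ a, frame e T (v.take p ++ a :: a :: v.drop p) := by
  induction p generalizing T v with
  | zero =>
    simp only [List.take_zero, List.drop_zero, List.nil_append, frame, frame_sum, frame_smul, hM,
      Finset.sum_mul, Finset.mul_sum]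
    rw [Finset.sum_comm_cycle]
    refine Finset.sum_congr rfl fun _ _ => Finset.sum_congr rfl fun _ _ =>
      Finset.sum_congr rfl fun _ _ => by ring
  | succ p ih =>
    rcases v with _ | ⟨b, v⟩
    · simpa [frame] using ih T []
    · simp only [List.take_succ_cons, List.drop_succ_cons, List.cons_append, frame]
      rw [Finset.sum_comm]
      refine Finset.sum_congr rfl fun u _ => ?_
      rw [← Finset.mul_sum]
      congr 1
      exact ih (fun w => T (u :: w)) v

theorem card_get_eq (L : List ℕ) (l : ℕ) :
    (Finset.univ.filter fun s : Fin L.length => L.get s = l).card = L.count l := by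
  have := Fin.card_filter_univ_eq_vector_get_eq_count l (⟨L, rfl⟩ : List.Vector ℕ L.length)
  exact this

/-- The complete contraction, with the matrix `M = e eᵀ`, of a tensor along a pairing of its slots is
a sum over the values of the names of its indices. -/
theorem sum_contract {M : Fin n → Fin n → ℝ} (hM : ∀ i j, M i j = ∑ a, e i a * e j a)
    (T : List (Fin n) → ℝ) {L : List ℕ} (hL : ∀ l ∈ L, L.count l = 2) (c₀ : ℕ → Fin n) :
    ∑ c : Fin L.length → Fin n,
      (∏ s, ∏ t, if s < t ∧ L.get s = L.get t then M (c s) (c t) else 1) * T (List.ofFn c) =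
    sumOver L.dedup (fun d => frame e T (L.map d)) c₀ := by
  simp only [frame_map_eq_sum]
  rw [sumOver_sum]
  refine Finset.sum_congr rfl fun c _ => ?_
  have h1 : sumOver L.dedup (fun d => (∏ s, e (c s) (d (L.get s))) * T (List.ofFn c)) c₀ =
      T (List.ofFn c) * sumOver L.dedup (fun d => ∏ s, e (c s) (d (L.get s))) c₀ := by
    rw [← sumOver_mul_left]
    exact sumOver_congr (fun d => mul_comm _ _) _
  rw [h1, mul_comm]
  congr 1
  have hmaps : ∀ s ∈ (Finset.univ : Finset (Fin L.length)), L.get s ∈ L.dedup.toFinset := by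
    intro s _
    simp
  have h2 : ∀ d : ℕ → Fin n, ∏ s, e (c s) (d (L.get s)) =
      (L.dedup.map fun l => ∏ s ∈ Finset.univ.filter (fun s => L.get s = l), e (c s) (d l)).prod := by
    intro d
    rw [← List.prod_toFinset _ L.nodup_dedup, ← Finset.prod_fiberwise_of_maps_to hmaps]
    refine Finset.prod_congr rfl fun l _ => Finset.prod_congr rfl fun s hs => ?_
    rw [(Finset.mem_filter.1 hs).2]
  rw [sumOver_congr h2, sumOver_prod L.nodup_dedup
    (fun l v => ∏ s ∈ Finset.univ.filter (fun s => L.get s = l), e (c s) v),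
    ← List.prod_toFinset _ L.nodup_dedup, ← Finset.prod_fiberwise_of_maps_to hmaps]
  refine Finset.prod_congr rfl fun l hl => ?_
  have hl' : L.count l = 2 := hL l (by simpa using hl)
  rw [← card_get_eq] at hl'
  obtain ⟨s, t, hst, hset⟩ : ∃ s t : Fin L.length, s < t ∧
      (Finset.univ.filter fun s : Fin L.length => L.get s = l) = {s, t} := by
    obtain ⟨s, t, hne, h⟩ := Finset.card_eq_two.1 hl'
    rcases lt_or_gt_of_ne hne with h' | h'
    · exact ⟨s, t, h', h⟩
    · exact ⟨t, s, h', by rw [h, Finset.pair_comm]⟩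
  have hmem : ∀ r : Fin L.length, L.get r = l ↔ r = s ∨ r = t := by
    intro r
    have : r ∈ (Finset.univ.filter fun s : Fin L.length => L.get s = l) ↔ r = s ∨ r = t := by
      rw [hset]; simp
    simpa using this
  have hs : L.get s = l := (hmem s).2 (Or.inl rfl)
  have ht : L.get t = l := (hmem t).2 (Or.inr rfl)
  rw [hset, Finset.prod_pair hst.ne]
  simp only [Finset.prod_pair hst.ne, ← hM]
  have e1 : (∏ r, if s < r ∧ L.get s = L.get r then M (c s) (c r) else 1) = M (c s) (c t) := by
    rw [Finset.prod_eq_single t]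
    · rw [if_pos ⟨hst, hs.trans ht.symm⟩]
    · intro r _ hr
      rw [if_neg]
      rintro ⟨h3, h4⟩
      rcases (hmem r).1 (h4.symm.trans hs) with rfl | rfl
      · exact lt_irrefl _ h3
      · exact hr rfl
    · simp
  have e2 : (∏ r, if t < r ∧ L.get t = L.get r then M (c t) (c r) else 1) = 1 := by
    refine Finset.prod_eq_one fun r _ => ?_
    rw [if_neg]
    rintro ⟨h3, h4⟩
    rcases (hmem r).1 (h4.symm.trans ht) with rfl | rfl
    · exact absurd h3 (not_lt.2 hst.le)
    · exact lt_irrefl _ h3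
  rw [e1, e2, mul_one]

end Frame

/-! ### Values of contractions in an orthonormal frame -/

/-- The product of the components of the factors, for given values of the indices. -/
def prodVal {R : Type*} [CommMonoid R] {n : ℕ} (φ : Kind → List (Fin n) → R) (C : Contr)
    (c : ℕ → Fin n) : R :=
  (C.map fun F => φ F.kind (F.idx.map c)).prod

/-- The value of a complete contraction in terms of components in an orthonormal frame. -/
def val {n : ℕ} (φ : Kind → List (Fin n) → ℝ) (C : Contr) (c : ℕ → Fin n) : ℝ :=
  sumOver C.labels.dedup (prodVal φ C) c

/-- Rename the indices. -/
def Factor.relabel (σ : ℕ → ℕ) (F : Factor) : Factor := ⟨F.kind, F.idx.map σ⟩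

/-- Rename the indices. -/
def Contr.relabel (σ : ℕ → ℕ) (C : Contr) : Contr := C.map (Factor.relabel σ)

section Val

variable {n : ℕ} {φ : Kind → List (Fin n) → ℝ}

theorem Contr.labels_relabel (σ : ℕ → ℕ) (C : Contr) : (C.relabel σ).labels = C.labels.map σ := by
  simp [Contr.labels, Contr.relabel, Factor.relabel, List.flatMap_map, List.map_flatMap]

theorem Contr.labels_append (C D : Contr) : Contr.labels (C ++ D) = C.labels ++ D.labels := by
  simp [Contr.labels]

theorem Contr.labels_cons (F : Factor) (C : Contr) :
    Contr.labels (F :: C) = F.idx ++ Contr.labels C := by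
  simp [Contr.labels]

theorem prodVal_relabel {R : Type*} [CommMonoid R] (φ : Kind → List (Fin n) → R) (σ : ℕ → ℕ)
    (C : Contr) (c : ℕ → Fin n) : prodVal φ (C.relabel σ) c = prodVal φ C (c ∘ σ) := by
  simp [prodVal, Contr.relabel, Factor.relabel, Function.comp_def]

theorem prodVal_append {R : Type*} [CommMonoid R] (φ : Kind → List (Fin n) → R) (C D : Contr)
    (c : ℕ → Fin n) : prodVal φ (C ++ D) c = prodVal φ C c * prodVal φ D c := by
  simp [prodVal]

theorem prodVal_cons {R : Type*} [CommMonoid R] (φ : Kind → List (Fin n) → R) (F : Factor)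
    (C : Contr) (c : ℕ → Fin n) :
    prodVal φ (F :: C) c = φ F.kind (F.idx.map c) * prodVal φ C c := by
  simp [prodVal]

theorem prodVal_dependsOnly (φ : Kind → List (Fin n) → ℝ) (C : Contr) :
    DependsOnly (prodVal φ C) C.labels := by
  intro c d h
  unfold prodVal
  congr 1
  refine List.map_congr_left fun F hF => ?_
  congr 1
  refine List.map_congr_left fun l hl => h l ?_
  exact List.mem_flatMap.2 ⟨F, hF, hl⟩

theorem val_eq_sumOver {C : Contr} {A : List ℕ} (hA : A.Nodup) (h : ∀ l, l ∈ A ↔ l ∈ C.labels)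
    (c : ℕ → Fin n) : val φ C c = sumOver A (prodVal φ C) c := by
  refine sumOver_perm ?_ _ c
  rw [List.perm_ext_iff_of_nodup C.labels.nodup_dedup hA]
  intro l
  rw [List.mem_dedup, h]

theorem val_perm {C D : Contr} (h : C.Perm D) (c : ℕ → Fin n) : val φ C c = val φ D c := by
  have hl : ∀ l, l ∈ C.labels.dedup ↔ l ∈ D.labels := by
    intro l
    rw [List.mem_dedup]
    exact (h.flatMap_right _).mem_iff
  rw [val_eq_sumOver C.labels.nodup_dedup hl, val]
  refine sumOver_congr (fun d => ?_) c
  exact (h.map _).prod_eq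

theorem val_relabel {σ : ℕ → ℕ} (hσ : Function.Injective σ) (C : Contr) (c : ℕ → Fin n) :
    val φ (C.relabel σ) c = val φ C (c ∘ σ) := by
  have h := sumOver_map hσ C.labels.dedup (prodVal φ C) c
  rw [val, val, ← h, Contr.labels_relabel, List.dedup_map_of_injective hσ]
  exact sumOver_congr (fun d => prodVal_relabel φ σ C d) c

theorem val_indep (C : Contr) (c d : ℕ → Fin n) : val φ C c = val φ C d :=
  (prodVal_dependsOnly φ C).sumOver_eq fun _ hl hl' => absurd (List.mem_dedup.2 hl) hl'

end Val

namespace LocalMetric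

variable {n : ℕ} (G : LocalMetric n)

/-- The matrix `e` is an orthonormal frame at `x`, that is, `g^{ij} = ∑ e^i_a e^j_a`. -/
def IsFrame (x : E n) (e : Matrix (Fin n) (Fin n) ℝ) : Prop :=
  ∀ i j, G.ginv x i j = ∑ a, e i a * e j a

open scoped MatrixOrder in
open Matrix.Norms.L2Operator in
theorem exists_isFrame {x : E n} (hx : x ∈ G.U) : ∃ e, G.IsFrame x e := by
  have h : ((G.g x)⁻¹).PosSemidef := (G.posDef x hx).inv.posSemidef
  obtain ⟨B, hB⟩ := CStarAlgebra.nonneg_iff_eq_star_mul_self.1 h.nonneg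
  rw [Matrix.star_eq_conjTranspose] at hB
  refine ⟨B.conjTranspose, fun i j => ?_⟩
  rw [ginv, hB, Matrix.mul_apply]
  simp [Matrix.conjTranspose_apply]

theorem frame_metric {x : E n} (hx : x ∈ G.U) {e : Matrix (Fin n) (Fin n) ℝ} (he : G.IsFrame x e)
    (a b : Fin n) : ∑ u, e u a * ∑ w, e w b * G.g x u w = if a = b then 1 else 0 := by
  have h1 : (G.g x)⁻¹ = e * e.transpose := by
    ext i j
    rw [Matrix.mul_apply]
    exact he i j
  have h2 : G.g x * (e * e.transpose) = 1 := by
    rw [← h1]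
    exact Matrix.mul_nonsing_inv _ (G.isUnit_det hx)
  have h3 : e.transpose * (G.g x * e) = 1 := by
    rw [mul_eq_one_comm, Matrix.mul_assoc, h2]
  have h4 := congrFun (congrFun h3 a) b
  rw [Matrix.one_apply, Matrix.mul_apply] at h4
  rw [← h4]
  refine Finset.sum_congr rfl fun u _ => ?_
  rw [Matrix.mul_apply, Matrix.transpose_apply]
  congr 1
  exact Finset.sum_congr rfl fun w _ => mul_comm _ _

/-- The components of the factors in the frame `e` at the point `x`. -/
noncomputable def frameComp (ψ υ : E n → ℝ) (x : E n) (e : Matrix (Fin n) (Fin n) ℝ) (k : Kind)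
    (v : List (Fin n)) : ℝ :=
  frame e (fun w => G.comp ψ υ k w x) v

theorem frame_tensorProd (ψ υ : E n → ℝ) (x : E n) (e : Matrix (Fin n) (Fin n) ℝ) (C : Contr)
    (d : ℕ → Fin n) : frame e (fun w => G.tensorProd ψ υ C w x) ((Contr.labels C).map d) =
      prodVal (G.frameComp ψ υ x e) C d := by
  induction C with
  | nil => rfl
  | cons F C ih =>
    rw [Contr.labels_cons, List.map_append, prodVal_cons, ← ih]
    have := frame_mul e (fun w => G.comp ψ υ F.kind w x) (fun w => G.tensorProd ψ υ C w x)
      (F.idx.map d) ((Contr.labels C).map d)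
    rw [List.length_map] at this
    exact this

/-- The value of a complete contraction, computed in an orthonormal frame. -/
theorem eval_eq_val (ψ υ : E n → ℝ) {C : Contr} (hC : C.IsComplete) {x : E n}
    {e : Matrix (Fin n) (Fin n) ℝ} (he : G.IsFrame x e) (c : ℕ → Fin n) :
    G.eval ψ υ C x = val (G.frameComp ψ υ x e) C c := by
  have := sum_contract e he (fun w => G.tensorProd ψ υ C w x) hC.2 c
  unfold eval val
  rw [this]
  exact sumOver_congr (fun d => G.frame_tensorProd ψ υ x e C d) c

end LocalMetric
end RiemContr

namespace RiemContr

/-! ### Contractions with Kronecker deltas -/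

/-- The labels in a list of pairs. -/
def pairLabels (Δ : List (ℕ × ℕ)) : List ℕ := Δ.flatMap fun p => [p.1, p.2]

/-- The product of the Kronecker deltas `δ_{ij}` for the pairs `(i, j)` in the list `Δ`. -/
def deltaVal {n : ℕ} (Δ : List (ℕ × ℕ)) (c : ℕ → Fin n) : ℝ :=
  (Δ.map fun p => if c p.1 = c p.2 then (1 : ℝ) else 0).prod

section Delta

variable {n : ℕ}

theorem pairLabels_cons (p : ℕ × ℕ) (Δ : List (ℕ × ℕ)) :
    pairLabels (p :: Δ) = p.1 :: p.2 :: pairLabels Δ := rfl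

theorem pairLabels_append (Δ Δ' : List (ℕ × ℕ)) :
    pairLabels (Δ ++ Δ') = pairLabels Δ ++ pairLabels Δ' := by
  simp [pairLabels]

theorem pairLabels_map (σ : ℕ → ℕ) (Δ : List (ℕ × ℕ)) :
    pairLabels (Δ.map (Prod.map σ σ)) = (pairLabels Δ).map σ := by
  induction Δ with
  | nil => rfl
  | cons p Δ ih => simp [pairLabels_cons, ih]

theorem deltaVal_append (Δ Δ' : List (ℕ × ℕ)) (c : ℕ → Fin n) :
    deltaVal (Δ ++ Δ') c = deltaVal Δ c * deltaVal Δ' c := by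
  simp [deltaVal]

theorem deltaVal_map (σ : ℕ → ℕ) (Δ : List (ℕ × ℕ)) (c : ℕ → Fin n) :
    deltaVal (Δ.map (Prod.map σ σ)) c = deltaVal Δ (c ∘ σ) := by
  simp [deltaVal, Function.comp_def]

theorem deltaVal_dependsOnly (Δ : List (ℕ × ℕ)) :
    DependsOnly (deltaVal (n := n) Δ) (pairLabels Δ) := by
  intro c d h
  unfold deltaVal
  congr 1
  refine List.map_congr_left fun p hp => ?_
  rw [h p.1 (List.mem_flatMap.2 ⟨p, hp, by simp⟩), h p.2 (List.mem_flatMap.2 ⟨p, hp, by simp⟩)]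

theorem DependsOnly.mul {F H : (ℕ → Fin n) → ℝ} {s t : List ℕ} (hF : DependsOnly F s)
    (hH : DependsOnly H t) : DependsOnly (fun c => F c * H c) (s ++ t) := by
  intro c d h
  simp only
  rw [hF c d fun l hl => h l (List.mem_append_left _ hl),
    hH c d fun l hl => h l (List.mem_append_right _ hl)]

/-- Replace the index `x` by `y`. -/
def mergeLabel (x y : ℕ) : ℕ → ℕ := fun l => if l = x then y else l

theorem comp_mergeLabel (x y : ℕ) (c : ℕ → Fin n) :
    c ∘ mergeLabel x y = Function.update c x (c y) := by
  funext l
  by_cases h : l = x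
  · subst h; simp [mergeLabel]
  · simp [mergeLabel, h]

/-- A Kronecker delta with a bound index identifies the two indices. -/
theorem sumOver_delta {x y : ℕ} (hxy : x ≠ y) (F : (ℕ → Fin n) → ℝ) (c : ℕ → Fin n) :
    sumOver [x] (fun d => (if d x = d y then 1 else 0) * F d) c = F (c ∘ mergeLabel x y) := by
  simp only [sumOver, Function.update_self, Function.update_of_ne hxy.symm]
  simp [comp_mergeLabel]

theorem count_map_mergeLabel {x y : ℕ} (hxy : x ≠ y) (L : List ℕ) (l : ℕ) :
    (L.map (mergeLabel x y)).count l =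
      if l = x then 0 else if l = y then L.count x + L.count y else L.count l := by
  induction L with
  | nil => simp
  | cons a L ih =>
    rw [List.map_cons, List.count_cons, ih]
    by_cases hax : a = x
    · subst hax
      simp only [mergeLabel, if_true, List.count_cons, beq_iff_eq]
      split_ifs <;> omega
    · simp only [mergeLabel, if_neg hax, List.count_cons, beq_iff_eq]
      split_ifs <;> omega

end Delta

theorem Contr.relabel_id (C : Contr) : C.relabel id = C := by
  have : Factor.relabel id = id := by
    funext F
    simp [Factor.relabel]
  simp [Contr.relabel, this]

theorem Contr.relabel_relabel (σ τ : ℕ → ℕ) (C : Contr) :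
    (C.relabel σ).relabel τ = C.relabel (τ ∘ σ) := by
  simp [Contr.relabel, Factor.relabel, Function.comp_def]

theorem Contr.WellFormed.relabel {C : Contr} (h : C.WellFormed) (σ : ℕ → ℕ) :
    (C.relabel σ).WellFormed := by
  intro F hF
  obtain ⟨F', hF', rfl⟩ := List.mem_map.1 hF
  simpa [Factor.relabel] using h F' hF'

/-- Kronecker deltas can be eliminated from complete contractions. -/
theorem exists_eliminate_delta (n : ℕ) (Δ : List (ℕ × ℕ)) (C : Contr) (hwf : C.WellFormed)
    (hcount : ∀ l ∈ pairLabels Δ ++ C.labels, (pairLabels Δ ++ C.labels).count l = 2)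
    (A : List ℕ) (hA : A.Nodup) (hmem : ∀ l, l ∈ A ↔ l ∈ pairLabels Δ ++ C.labels) :
    ∃ (σ : ℕ → ℕ) (b : ℝ), Contr.IsComplete (C.relabel σ) ∧
      ∀ (φ : Kind → List (Fin n) → ℝ) (c : ℕ → Fin n),
        sumOver A (fun d => deltaVal Δ d * prodVal φ C d) c = b * val φ (C.relabel σ) c := by
  induction hΔ : Δ.length generalizing Δ C A with
  | zero =>
    obtain rfl : Δ = [] := List.length_eq_zero_iff.1 hΔ
    refine ⟨id, 1, ?_, fun φ c => ?_⟩
    · rw [Contr.relabel_id]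
      exact ⟨hwf, hcount⟩
    · rw [Contr.relabel_id, one_mul, val_eq_sumOver hA (by simpa [pairLabels] using hmem)]
      exact sumOver_congr (fun d => by simp [deltaVal]) c
  | succ k ih =>
    obtain ⟨⟨i, l⟩, Δ, rfl⟩ : ∃ p Δ', Δ = p :: Δ' := by
      rcases Δ with _ | ⟨p, Δ⟩
      · simp at hΔ
      · exact ⟨p, Δ, rfl⟩
    have hk : Δ.length = k := by simpa using hΔ
    simp only [pairLabels_cons, List.cons_append] at hcount hmem
    have hcnt : ∀ m, (i :: l :: (pairLabels Δ ++ C.labels)).count m = 2 ∨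
        (i :: l :: (pairLabels Δ ++ C.labels)).count m = 0 := by
      intro m
      by_cases hm : m ∈ i :: l :: (pairLabels Δ ++ C.labels)
      · exact Or.inl (hcount m hm)
      · exact Or.inr (List.count_eq_zero_of_not_mem hm)
    have hdelta : ∀ d : ℕ → Fin n, deltaVal ((i, l) :: Δ) d =
        (if d l = d i then 1 else 0) * deltaVal Δ d := by
      intro d
      simp [deltaVal, eq_comm]
    by_cases hil : i = l
    · subst hil
      have hi0 : (pairLabels Δ ++ C.labels).count i = 0 := by
        have := hcount i (by simp)
        simp only [List.count_cons_self] at this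
        omega
      have hi : i ∉ pairLabels Δ ++ C.labels := List.count_eq_zero.1 hi0
      have hiA : i ∈ A := (hmem i).2 (by simp)
      have hcount' : ∀ m ∈ pairLabels Δ ++ C.labels, (pairLabels Δ ++ C.labels).count m = 2 := by
        intro m hm
        have hmi : i ≠ m := by rintro rfl; exact hi hm
        have := hcount m (by simp only [List.mem_cons]; exact Or.inr (Or.inr hm))
        rwa [List.count_cons_of_ne hmi, List.count_cons_of_ne hmi] at this
      have hmem' : ∀ m, m ∈ A.erase i ↔ m ∈ pairLabels Δ ++ C.labels := by
        intro m
        rw [hA.mem_erase_iff, hmem]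
        constructor
        · rintro ⟨h1, h2⟩
          simpa [h1] using h2
        · intro h
          exact ⟨by rintro rfl; exact hi h, by simp only [List.mem_cons]; exact Or.inr (Or.inr h)⟩
      obtain ⟨σ, b, h1, h2⟩ := ih Δ C hwf hcount' (A.erase i) (hA.erase i) hmem' hk
      refine ⟨σ, n * b, h1, fun φ c => ?_⟩
      rw [sumOver_perm (List.perm_cons_erase hiA), sumOver]
      have h3 : ∀ d : ℕ → Fin n, deltaVal ((i, i) :: Δ) d * prodVal φ C d =
          deltaVal Δ d * prodVal φ C d := by
        intro d; rw [hdelta]; simp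
      have hdep := (deltaVal_dependsOnly (n := n) Δ).mul (prodVal_dependsOnly φ C)
      have h4 : ∀ v, sumOver (A.erase i) (fun d => deltaVal ((i, i) :: Δ) d * prodVal φ C d)
          (Function.update c i v) = b * val φ (C.relabel σ) c := by
        intro v
        rw [sumOver_congr h3, ← h2]
        refine hdep.sumOver_eq fun m hm _ => ?_
        rw [Function.update_of_ne]
        rintro rfl
        exact hi hm
      simp only [h4, Finset.sum_const, Finset.card_univ, Fintype.card_fin, nsmul_eq_mul]
      ring
    · have hlA : l ∈ A := (hmem l).2 (by simp)
      set ρ := mergeLabel l i with hρ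
      have hlab : pairLabels (Δ.map (Prod.map ρ ρ)) ++ (C.relabel ρ).labels =
          (pairLabels Δ ++ C.labels).map ρ := by
        rw [pairLabels_map, Contr.labels_relabel, List.map_append]
      have hci := hcount i (by simp)
      have hcl := hcount l (by simp)
      rw [List.count_cons_self, List.count_cons_of_ne (Ne.symm hil)] at hci
      rw [List.count_cons_of_ne hil, List.count_cons_self] at hcl
      have hcount' : ∀ m, ((pairLabels Δ ++ C.labels).map ρ).count m =
          if m ∈ A.erase l then 2 else 0 := by
        intro m
        rw [count_map_mergeLabel (Ne.symm hil)]
        simp only [hA.mem_erase_iff, hmem]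
        by_cases h1 : m = l
        · simp [h1]
        · by_cases h2 : m = i
          · subst h2
            rw [if_neg h1, if_pos rfl, if_pos ⟨h1, by simp⟩]
            omega
          · rw [if_neg h1, if_neg h2]
            have := hcnt m
            rw [List.count_cons_of_ne (Ne.symm h2), List.count_cons_of_ne (Ne.symm h1)] at this
            by_cases hm : m ∈ pairLabels Δ ++ C.labels
            · have h0 := List.count_pos_iff.2 hm
              rw [if_pos ⟨h1, by simp only [List.mem_cons]; exact Or.inr (Or.inr hm)⟩]
              omega
            · rw [if_neg, List.count_eq_zero_of_not_mem hm]
              rintro ⟨_, h4⟩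
              simp only [List.mem_cons] at h4
              exact h4.elim h2 fun h4 => h4.elim h1 hm
      obtain ⟨σ, b, h1, h2⟩ := ih (Δ.map (Prod.map ρ ρ)) (C.relabel ρ) (hwf.relabel ρ)
        (by
          rw [hlab]
          intro m hm
          have := hcount' m
          have h0 := List.count_pos_iff.2 hm
          split_ifs at this <;> omega) (A.erase l) (hA.erase l)
        (by
          intro m
          rw [hlab, ← List.count_pos_iff (l := (pairLabels Δ ++ C.labels).map ρ), hcount']
          split_ifs with h <;> simp [h]) (by simpa using hk)
      rw [Contr.relabel_relabel] at h1
      refine ⟨σ ∘ ρ, b, h1, fun φ c => ?_⟩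
      have hp : A.Perm (A.erase l ++ [l]) :=
        (List.perm_cons_erase hlA).trans (List.perm_append_singleton l _).symm
      rw [sumOver_perm hp, sumOver_append, ← Contr.relabel_relabel, ← h2]
      refine sumOver_congr (fun d => ?_) c
      have h3 : ∀ d : ℕ → Fin n, deltaVal ((i, l) :: Δ) d * prodVal φ C d =
          (if d l = d i then 1 else 0) * (deltaVal Δ d * prodVal φ C d) := by
        intro d; rw [hdelta]; ring
      rw [sumOver_congr h3, sumOver_delta (Ne.symm hil), deltaVal_map, prodVal_relabel]

/-! ### The normal form of tensor fields built from the curvature tensor -/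

/-- A partial contraction of curvature factors and Kronecker deltas, with a coefficient. The indices
in `bound` are summed over. -/
structure OpenTerm where
  coef : ℝ
  deltas : List (ℕ × ℕ)
  factors : Contr
  bound : List ℕ

/-- All the indices of a term. -/
def OpenTerm.labels (t : OpenTerm) : List ℕ := pairLabels t.deltas ++ t.factors.labels

/-- The value of a term, for given values of the free indices. -/
def OpenTerm.val {n : ℕ} (φ : Kind → List (Fin n) → ℝ) (t : OpenTerm) (c : ℕ → Fin n) : ℝ :=
  t.coef * sumOver t.bound (fun d => deltaVal t.deltas d * prodVal φ t.factors d) c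

/-- The term has `N` factors, all of them curvature factors, the free indices `L`, and its bound
indices are not in the list `av`. -/
structure OpenTerm.Valid (N : ℕ) (L av : List ℕ) (t : OpenTerm) : Prop where
  nodup : t.bound.Nodup
  fresh : ∀ b ∈ t.bound, b ∉ L ∧ b ∉ av
  len : t.factors.length = N
  kinds : ∀ F ∈ t.factors, F.kind = .R
  wf : t.factors.WellFormed
  count : ∀ l, t.labels.count l = L.count l + if l ∈ t.bound then 2 else 0

theorem OpenTerm.Valid.mem_labels {N : ℕ} {L av : List ℕ} {t : OpenTerm} (h : t.Valid N L av)
    {l : ℕ} (hl : l ∈ t.labels) : l ∈ L ∨ l ∈ t.bound := by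
  have h1 := List.count_pos_iff.2 hl
  rw [h.count] at h1
  by_cases hb : l ∈ t.bound
  · exact Or.inr hb
  · rw [if_neg hb, add_zero] at h1
    exact Or.inl (List.count_pos_iff.1 h1)

/-- The product of two terms. -/
def OpenTerm.mul (s t : OpenTerm) : OpenTerm :=
  ⟨s.coef * t.coef, s.deltas ++ t.deltas, s.factors ++ t.factors, s.bound ++ t.bound⟩

theorem OpenTerm.mul_val {n N M : ℕ} {L L' av av' : List ℕ} {s t : OpenTerm} (hs : s.Valid N L av)
    (ht : t.Valid M L' av') (h1 : ∀ b ∈ s.bound, b ∉ L') (h2 : ∀ b ∈ t.bound, b ∉ L ∧ b ∉ s.bound)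
    (φ : Kind → List (Fin n) → ℝ) (c : ℕ → Fin n) :
    (s.mul t).val φ c = s.val φ c * t.val φ c := by
  have e := sumOver_mul (A := s.bound) (B := t.bound)
    ((deltaVal_dependsOnly s.deltas).mul (prodVal_dependsOnly φ s.factors))
    ((deltaVal_dependsOnly t.deltas).mul (prodVal_dependsOnly φ t.factors))
    (fun l hl hb => (hs.mem_labels hl).elim (h2 l hb).1 (h2 l hb).2)
    (fun l hl hb => (ht.mem_labels hl).elim (h1 l hb) fun h => (h2 l h).2 hb) c
  unfold OpenTerm.val
  rw [mul_mul_mul_comm, e]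
  congr 1
  refine sumOver_congr (fun d => ?_) c
  simp only [OpenTerm.mul, deltaVal_append, prodVal_append]
  ring

theorem OpenTerm.mul_valid {N M : ℕ} {L L' av av' av'' : List ℕ} {s t : OpenTerm}
    (hs : s.Valid N L av) (ht : t.Valid M L' av') (h1 : ∀ b ∈ s.bound, b ∉ L' ∧ b ∉ av'')
    (h2 : ∀ b ∈ t.bound, b ∉ L ∧ b ∉ s.bound ∧ b ∉ av'') :
    (s.mul t).Valid (N + M) (L ++ L') av'' where
  nodup := by
    refine List.Nodup.append hs.nodup ht.nodup fun b hb hb' => (h2 b hb').2.1 hb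
  fresh := by
    intro b hb
    rcases List.mem_append.1 hb with hb | hb
    · exact ⟨by simp [(hs.fresh b hb).1, (h1 b hb).1], (h1 b hb).2⟩
    · exact ⟨by simp [(ht.fresh b hb).1, (h2 b hb).1], (h2 b hb).2.2⟩
  len := by simp [OpenTerm.mul, hs.len, ht.len]
  kinds := by
    intro F hF
    rcases List.mem_append.1 hF with h | h
    · exact hs.kinds F h
    · exact ht.kinds F h
  wf := by
    intro F hF
    rcases List.mem_append.1 hF with h | h
    · exact hs.wf F h
    · exact ht.wf F h
  count := by
    intro l
    have e : (s.mul t).labels.count l = s.labels.count l + t.labels.count l := by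
      simp only [OpenTerm.labels, OpenTerm.mul, pairLabels_append, Contr.labels_append,
        List.count_append]
      omega
    rw [e, hs.count, ht.count, List.count_append]
    simp only [OpenTerm.mul, List.mem_append]
    by_cases ha : l ∈ s.bound
    · have hb : l ∉ t.bound := fun hb => (h2 l hb).2.1 ha
      simp [ha, hb]; omega
    · by_cases hb : l ∈ t.bound <;> simp [ha, hb]
      omega

theorem exists_fresh (L : List ℕ) : ∃ a, a ∉ L := by
  obtain ⟨a, ha⟩ := Infinite.exists_notMem_finset L.toFinset
  exact ⟨a, by simpa using ha⟩

/-- In an orthonormal frame, the components of a tensor field built from the curvature tensor are a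
universal linear combination of partial contractions of curvature factors and Kronecker deltas. The
names `L` of the free indices need not be distinct. -/
theorem CurvField.exists_openTerms {n N r : ℕ} {X : LocalMetric n → Components n}
    (hX : CurvField N r X) (L : List ℕ) (hL : L.length = r) (av : List ℕ) :
    ∃ ts : List OpenTerm, (∀ t ∈ ts, t.Valid N L av) ∧
      ∀ (G : LocalMetric n) (ψ υ : E n → ℝ), ∀ x ∈ G.U, ∀ e, G.IsFrame x e → ∀ c : ℕ → Fin n,
        frame e (fun w => X G w x) (L.map c) =
          (ts.map fun t => t.val (G.frameComp ψ υ x e) c).sum := by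
  induction hX generalizing L av with
  | curv m =>
    refine ⟨[⟨1, [], [⟨.R, L⟩], []⟩], ?_, ?_⟩
    · intro t ht
      obtain rfl := List.mem_singleton.1 ht
      refine ⟨by simp, by simp, by simp, by simp, ?_, ?_⟩
      · intro F hF
        obtain rfl := List.mem_singleton.1 hF
        simp only [Kind.arity, hL]
        omega
      · intro l
        simp [OpenTerm.labels, pairLabels, Contr.labels]
    · intro G ψ υ x hx e he c
      simp only [List.map_singleton, List.sum_singleton, OpenTerm.val, sumOver, deltaVal, prodVal,
        List.map_nil, List.prod_nil, one_mul, List.prod_singleton]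
      refine frame_congr e fun w hw => ?_
      rw [G.comp_R ψ υ (by rw [hw, List.length_map, hL]) hx]
  | metric =>
    match L, hL with
    | [i, j], _ =>
      refine ⟨[⟨1, [(i, j)], [], []⟩], ?_, ?_⟩
      · intro t ht
        obtain rfl := List.mem_singleton.1 ht
        refine ⟨by simp, by simp, by simp, by simp, by intro F hF; simp at hF, ?_⟩
        intro l
        simp [OpenTerm.labels, pairLabels, Contr.labels]
      · intro G ψ υ x hx e he c
        simp only [List.sum_singleton, OpenTerm.val, sumOver, deltaVal, prodVal,
          List.map_nil, List.prod_nil, one_mul, List.prod_singleton, mul_one, List.map_cons, frame,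
          ← G.frame_metric hx he (c i) (c j)]
        rfl
  | zero =>
    refine ⟨[], by simp, fun G ψ υ x hx e he c => ?_⟩
    simp [frame_zero]
  | add _ _ i1 i2 =>
    obtain ⟨ts1, h1, h1'⟩ := i1 L hL av
    obtain ⟨ts2, h2, h2'⟩ := i2 L hL av
    refine ⟨ts1 ++ ts2, ?_, fun G ψ υ x hx e he c => ?_⟩
    · intro t ht
      exact (List.mem_append.1 ht).elim (h1 t) (h2 t)
    · rw [frame_add, h1' G ψ υ x hx e he, h2' G ψ υ x hx e he, List.map_append, List.sum_append]
  | smul b _ i1 =>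
    obtain ⟨ts1, h1, h1'⟩ := i1 L hL av
    refine ⟨ts1.map fun t => ⟨b * t.coef, t.deltas, t.factors, t.bound⟩, ?_,
      fun G ψ υ x hx e he c => ?_⟩
    · intro t ht
      obtain ⟨s, hs, rfl⟩ := List.mem_map.1 ht
      have := h1 s hs
      exact ⟨this.nodup, this.fresh, this.len, this.kinds, this.wf, this.count⟩
    · rw [frame_smul, h1' G ψ υ x hx e he, List.map_map, ← List.sum_map_mul_left]
      congr 1
      refine List.map_congr_left fun t _ => ?_
      simp only [OpenTerm.val, Function.comp_apply]
      ring
  | @mul N M r s X Y hX hY i1 i2 =>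
    obtain ⟨L1, L2, rfl, hL1⟩ : ∃ L1 L2, L = L1 ++ L2 ∧ L1.length = r :=
      ⟨L.take r, L.drop r, (List.take_append_drop _ L).symm, by simp; omega⟩
    have hL2 : L2.length = s := by simp at hL; omega
    obtain ⟨ts1, h1, h1'⟩ := i1 L1 hL1 (L2 ++ av)
    obtain ⟨ts2, h2, h2'⟩ := i2 L2 hL2 (L1 ++ ts1.flatMap OpenTerm.bound ++ av)
    have hd1 : ∀ s ∈ ts1, ∀ b ∈ s.bound, b ∉ L2 ∧ b ∉ av := by
      intro s hs b hb
      have := ((h1 s hs).fresh b hb).2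
      simpa using this
    have hd2 : ∀ s ∈ ts1, ∀ t ∈ ts2, ∀ b ∈ t.bound, b ∉ L1 ∧ b ∉ s.bound ∧ b ∉ av := by
      intro s hs t ht b hb
      have := ((h2 t ht).fresh b hb).2
      simp only [List.mem_append, List.mem_flatMap, not_or, not_exists, not_and] at this
      exact ⟨this.1.1, this.1.2 s hs, this.2⟩
    refine ⟨ts1.flatMap fun s => ts2.map fun t => s.mul t, ?_, fun G ψ υ x hx e he c => ?_⟩
    · intro t ht
      obtain ⟨s, hs, ht⟩ := List.mem_flatMap.1 ht
      obtain ⟨t', ht', rfl⟩ := List.mem_map.1 ht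
      exact OpenTerm.mul_valid (h1 s hs) (h2 t' ht') (hd1 s hs) (hd2 s hs t' ht')
    · have e1 := frame_mul e (fun w => X G w x) (fun w => Y G w x) (L1.map c) (L2.map c)
      rw [List.length_map, hL1] at e1
      rw [List.map_append, e1, h1' G ψ υ x hx e he, h2' G ψ υ x hx e he, List.flatMap_def, List.map_flatten,
        List.sum_flatten, List.map_map, List.map_map, ← List.sum_map_mul_right]
      congr 1
      refine List.map_congr_left fun s hs => ?_
      simp only [Function.comp_apply, List.map_map]
      rw [← List.sum_map_mul_left]
      congr 1
      refine List.map_congr_left fun t ht => ?_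
      exact (OpenTerm.mul_val (h1 s hs) (h2 t ht) (fun b hb => (hd1 s hs b hb).1)
        (fun b hb => ⟨(hd2 s hs t ht b hb).1, (hd2 s hs t ht b hb).2.1⟩) _ c).symm
  | @trAt N r X p hp hX i1 =>
    obtain ⟨a, ha⟩ := exists_fresh (L ++ av)
    simp only [List.mem_append, not_or] at ha
    obtain ⟨ts1, h1, h1'⟩ := i1 (L.take p ++ a :: a :: L.drop p)
      (by rw [LocalMetric.length_insert_pair, hL]) av
    have hcnt : ∀ l, (L.take p ++ a :: a :: L.drop p).count l =
        L.count l + if l = a then 2 else 0 := by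
      intro l
      conv_rhs => rw [← List.take_append_drop p L]
      simp only [List.count_append, List.count_cons, beq_iff_eq, eq_comm (a := a)]
      split_ifs <;> omega
    have hmem : ∀ l, l ∈ L.take p ++ a :: a :: L.drop p ↔ l ∈ L ∨ l = a := by
      intro l
      rw [← List.count_pos_iff, hcnt, ← List.count_pos_iff]
      split_ifs with h <;> simp [h]
    have hna : ∀ t ∈ ts1, a ∉ t.bound := fun t ht hb =>
      ((h1 t ht).fresh a hb).1 ((hmem a).2 (Or.inr rfl))
    refine ⟨ts1.map fun t => ⟨t.coef, t.deltas, t.factors, a :: t.bound⟩, ?_,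
      fun G ψ υ x hx e he c => ?_⟩
    · intro t ht
      obtain ⟨s, hs, rfl⟩ := List.mem_map.1 ht
      have hv := h1 s hs
      refine ⟨List.nodup_cons.2 ⟨hna s hs, hv.nodup⟩, ?_, hv.len, hv.kinds, hv.wf, ?_⟩
      · intro b hb
        rcases List.mem_cons.1 hb with rfl | hb
        · exact ha
        · have := hv.fresh b hb
          exact ⟨fun h => this.1 ((hmem b).2 (Or.inl h)), this.2⟩
      · intro l
        have := hv.count l
        rw [hcnt] at this
        refine this.trans ?_
        by_cases hla : l = a
        · subst hla; simp [hna s hs]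
        · simp [hla]
    · have e1 : frame e (fun w => G.trAt p (X G) w x) (L.map c) =
          ∑ v, frame e (fun w => X G w x) ((L.map c).take p ++ v :: v :: (L.map c).drop p) :=
        frame_trace e he p (fun w => X G w x) (L.map c)
      have e2 : ∀ v, (L.map c).take p ++ v :: v :: (L.map c).drop p =
          (L.take p ++ a :: a :: L.drop p).map (Function.update c a v) := by
        intro v
        have e3 : ∀ l ∈ L, Function.update c a v l = c l := fun l hl =>
          Function.update_of_ne (by rintro rfl; exact ha.1 hl) _ _
        simp only [List.map_append, List.map_cons, Function.update_self, ← List.map_take,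
          ← List.map_drop]
        rw [List.map_congr_left fun l hl => e3 l (List.mem_of_mem_take hl),
          List.map_congr_left (l := L.drop p) fun l hl => e3 l (List.mem_of_mem_drop hl)]
      rw [e1]
      simp only [e2, h1' G ψ υ x hx e he, List.map_map]
      have e4 : ∀ ts : List OpenTerm, ∑ v, (ts.map fun t => t.val (G.frameComp ψ υ x e)
          (Function.update c a v)).sum = (ts.map fun t => ∑ v, t.val (G.frameComp ψ υ x e)
          (Function.update c a v)).sum := by
        intro ts
        induction ts with
        | nil => simp
        | cons t ts ih => simp [Finset.sum_add_distrib, ih]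
      rw [e4]
      congr 1
      refine List.map_congr_left fun t _ => ?_
      simp only [OpenTerm.val, Function.comp_apply, sumOver, Finset.mul_sum]
  | swapAt p hX i1 =>
    obtain ⟨ts1, h1, h1'⟩ := i1 (RiemContr.swapAt p L) (by simpa using hL) av
    refine ⟨ts1, ?_, fun G ψ υ x hx e he c => ?_⟩
    · intro t ht
      have hv := h1 t ht
      refine ⟨hv.nodup, fun b hb => ?_, hv.len, hv.kinds, hv.wf, fun l => ?_⟩
      · rw [← (swapAt_perm p L).mem_iff]
        exact hv.fresh b hb
      · rw [hv.count, (swapAt_perm p L).count_eq]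
    · rw [← h1' G ψ υ x hx e he, map_swapAt, ← frame_swapAt]
  | congr hX h i1 =>
    obtain ⟨ts1, h1, h1'⟩ := i1 L hL av
    refine ⟨ts1, h1, fun G ψ υ x hx e he c => ?_⟩
    rw [← h1' G ψ υ x hx e he]
    exact frame_congr e fun w hw => h G w (by rw [hw, List.length_map, hL]) x hx

/-- A complete contraction of a tensor field with `N` curvature factors is a universal linear
combination of complete contractions of `N` curvature factors. -/
theorem CurvField.exists_linComb {n N r : ℕ} {X : LocalMetric n → Components n}
    (hX : CurvField N r X) {L : List ℕ} (hL : L.length = r) (hcount : ∀ l ∈ L, L.count l = 2) :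
    ∃ J : LinComb, (∀ C ∈ J.support, C.IsComplete ∧ C.length = N ∧ ∀ F ∈ C, F.kind = .R) ∧
      ∀ (G : LocalMetric n) (ψ υ : E n → ℝ), ∀ x ∈ G.U, ∀ e, G.IsFrame x e → ∀ c : ℕ → Fin n,
        sumOver L.dedup (fun d => frame e (fun w => X G w x) (L.map d)) c = G.evalLin ψ υ J x := by
  obtain ⟨ts, hts, hval⟩ := hX.exists_openTerms L hL []
  have key : ∀ t ∈ ts, ∃ (C : Contr) (b : ℝ), (C.IsComplete ∧ C.length = N ∧ ∀ F ∈ C, F.kind = .R) ∧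
      ∀ (φ : Kind → List (Fin n) → ℝ) (c : ℕ → Fin n),
        sumOver L.dedup (fun d => t.val φ d) c = b * RiemContr.val φ C c := by
    intro t ht
    have hv := hts t ht
    have hcnt : ∀ l ∈ t.labels, t.labels.count l = 2 := by
      intro l hl
      rw [hv.count]
      rcases hv.mem_labels hl with h | h
      · have : l ∉ t.bound := fun hb => (hv.fresh l hb).1 h
        simp [hcount l h, this]
      · simp [h, List.count_eq_zero_of_not_mem (hv.fresh l h).1]
    have hnd : (L.dedup ++ t.bound).Nodup :=
      List.Nodup.append L.nodup_dedup hv.nodup fun b hb hb' =>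
        (hv.fresh b hb').1 (List.mem_dedup.1 hb)
    have hmem : ∀ l, l ∈ L.dedup ++ t.bound ↔ l ∈ t.labels := by
      intro l
      constructor
      · intro hl
        rw [← List.count_pos_iff, hv.count]
        rcases List.mem_append.1 hl with h | h
        · have := List.count_pos_iff.2 (List.mem_dedup.1 h)
          omega
        · simp [h]
      · intro hl
        simpa using hv.mem_labels hl
    obtain ⟨σ, b, h1, h2⟩ := exists_eliminate_delta n t.deltas t.factors hv.wf hcnt _ hnd hmem
    refine ⟨t.factors.relabel σ, t.coef * b, ⟨h1, by simp [Contr.relabel, hv.len], ?_⟩,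
      fun φ c => ?_⟩
    · intro F hF
      obtain ⟨F', hF', rfl⟩ := List.mem_map.1 hF
      exact hv.kinds F' hF'
    · unfold OpenTerm.val
      rw [sumOver_mul_left, mul_assoc, ← h2, sumOver_append]
  clear hts
  classical
  have main : ∃ J : LinComb, (∀ C ∈ J.support, C.IsComplete ∧ C.length = N ∧ ∀ F ∈ C, F.kind = .R) ∧
      ∀ (G : LocalMetric n) (ψ υ : E n → ℝ), ∀ x ∈ G.U, ∀ e, G.IsFrame x e → ∀ c : ℕ → Fin n,
        sumOver L.dedup (fun d => (ts.map fun t => t.val (G.frameComp ψ υ x e) d).sum) c =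
          G.evalLin ψ υ J x := by
    clear hval
    induction ts with
    | nil =>
      refine ⟨0, by simp, fun G ψ υ x hx e he c => ?_⟩
      simp [LocalMetric.evalLin, sumOver_zero]
    | cons t ts ih =>
      obtain ⟨J, hJ, hJ'⟩ := ih fun t ht => key t (List.mem_cons_of_mem _ ht)
      obtain ⟨C, b, hC, hb⟩ := key t List.mem_cons_self
      refine ⟨Finsupp.single C b + J, ?_, fun G ψ υ x hx e he c => ?_⟩
      · intro D hD
        rcases Finset.mem_union.1 (Finsupp.support_add hD) with h | h
        · obtain rfl := Finset.mem_singleton.1 (Finsupp.support_single_subset h)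
          exact hC
        · exact hJ D h
      · have e1 : G.evalLin ψ υ (Finsupp.single C b + J) x =
            b * G.eval ψ υ C x + G.evalLin ψ υ J x := by
          unfold LocalMetric.evalLin
          rw [Finsupp.sum_add_index' (by simp) (by intros; ring), Finsupp.sum_single_index (by simp)]
        rw [e1, ← hJ' G ψ υ x hx e he c, G.eval_eq_val ψ υ hC.1 he c, ← hb, ← sumOver_add]
        simp only [List.map_cons, List.sum_cons]
  obtain ⟨J, hJ, hJ'⟩ := main
  refine ⟨J, hJ, fun G ψ υ x hx e he c => ?_⟩
  rw [← hJ' G ψ υ x hx e he c]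
  exact sumOver_congr (fun d => hval G ψ υ x hx e he d) c

end RiemContr

namespace RiemContr

/-! ### The curvature, Weyl and Schouten tensors in an orthonormal frame -/

/-- A sequence of transpositions of adjacent entries. -/
def swaps {α : Type*} : List ℕ → List α → List α
  | [], v => v
  | p :: ps, v => swaps ps (swapAt p v)

@[simp] theorem swaps_nil {α : Type*} (v : List α) : swaps [] v = v := rfl

@[simp] theorem swaps_cons {α : Type*} (p : ℕ) (ps : List ℕ) (v : List α) :
    swaps (p :: ps) v = swaps ps (swapAt p v) := rfl

theorem length_swaps {α : Type*} (ps : List ℕ) (v : List α) :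
    (swaps ps v).length = v.length := by
  induction ps generalizing v with
  | nil => rfl
  | cons p ps ih => rw [swaps, ih, length_swapAt]

theorem swaps_append {α : Type*} (ps : List ℕ) (a v : List α) :
    swaps (ps.map (· + a.length)) (a ++ v) = a ++ swaps ps v := by
  induction ps generalizing v with
  | nil => rfl
  | cons p ps ih => rw [List.map_cons, swaps, LocalMetric.swapAt_append_add, ih, swaps]

theorem frame_swaps {n : ℕ} (e : Matrix (Fin n) (Fin n) ℝ) (T : List (Fin n) → ℝ) (ps : List ℕ)
    (v : List (Fin n)) : frame e (fun w => T (swaps ps w)) v = frame e T (swaps ps v) := by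
  induction ps generalizing v with
  | nil => rfl
  | cons p ps ih =>
    simp only [swaps]
    rw [frame_swapAt e (fun w => T (swaps ps w)) p v, ih]

namespace LocalMetric

variable {n : ℕ} (G : LocalMetric n)

theorem nabla_iterate_swaps {r : ℕ} (T : Components n) (ps : List ℕ) (m : ℕ) :
    ∀ v : List (Fin n), v.length = r + m → ∀ x ∈ G.U,
      G.nabla^[m] (fun w => T (swaps ps w)) v x = G.nabla^[m] T (swaps (ps.map (· + m)) v) x := by
  induction ps with
  | nil => intros; rfl
  | cons p ps ih =>
    intro v hv x hx
    have := G.nabla_iterate_swapAt (r := r) (fun w => T (swaps ps w)) p m v hv x hx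
    refine this.trans ?_
    rw [ih _ (by simpa using hv) x hx]
    rfl

theorem SmoothComp.swaps {G : LocalMetric n} {r : ℕ} {T : Components n}
    (hT : G.SmoothComp r T) (ps : List ℕ) : G.SmoothComp r (fun v => T (swaps ps v)) :=
  fun v hv => hT _ (by rw [length_swaps, hv])

/-- Linear relations between the components of a tensor field with permuted indices persist for its
covariant derivatives, and for the components in a frame. -/
theorem frame_nabla_relation {r : ℕ} {T : Components n} (hT : G.SmoothComp r T)
    (rel : List (ℝ × List ℕ))
    (h : ∀ v : List (Fin n), v.length = r → ∀ x ∈ G.U,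
      (rel.map fun p => p.1 * T (swaps p.2 v) x).sum = 0)
    (e : Matrix (Fin n) (Fin n) ℝ) (α v : List (Fin n)) (hv : v.length = r) {x : E n}
    (hx : x ∈ G.U) :
    (rel.map fun p =>
      p.1 * frame e (fun w => G.nabla^[α.length] T w x) (α ++ swaps p.2 v)).sum = 0 := by
  have hsm : ∀ rel : List (ℝ × List ℕ),
      G.SmoothComp r (fun w y => (rel.map fun p => p.1 * T (swaps p.2 w) y).sum) := by
    intro rel
    induction rel with
    | nil => exact fun _ _ => contDiffOn_const
    | cons p rel ih =>
      simp only [List.map_cons, List.sum_cons]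
      exact SmoothComp.add (T := fun w y => p.1 * T (swaps p.2 w) y)
        (SmoothComp.smul (T := fun w => T (swaps p.2 w)) (hT.swaps p.2) p.1) ih
  have h1 : ∀ (m : ℕ) (rel : List (ℝ × List ℕ)) (w : List (Fin n)), w.length = r + m →
      G.nabla^[m] (fun w y => (rel.map fun p => p.1 * T (swaps p.2 w) y).sum) w x =
      (rel.map fun p => p.1 * G.nabla^[m] T (swaps (p.2.map (· + m)) w) x).sum := by
    intro m rel w hw
    induction rel with
    | nil =>
      simp only [List.map_nil, List.sum_nil]
      have := G.nabla_iterate_smul (T := fun _ _ => 0) (r := r) (fun _ _ => contDiffOn_const) 0 m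
        w hw x hx
      simpa using this
    | cons p rel ih =>
      simp only [List.map_cons, List.sum_cons]
      have s1 : G.SmoothComp r (fun w => T (swaps p.2 w)) := hT.swaps p.2
      rw [G.nabla_iterate_add (T := fun w y => p.1 * T (swaps p.2 w) y) (s1.smul _) (hsm rel) m w
        hw x hx, ih, G.nabla_iterate_smul s1 _ m w hw x hx,
        G.nabla_iterate_swaps (r := r) T p.2 m w hw x hx]
  have h2 : ∀ w : List (Fin n), w.length = r + α.length →
      (rel.map fun p => p.1 * G.nabla^[α.length] T (swaps (p.2.map (· + α.length)) w) x).sum = 0 := by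
    intro w hw
    rw [← h1 α.length rel w hw]
    have := G.nabla_iterate_congr (S := fun _ _ => 0) α.length h w hw x hx
    rw [this]
    have := G.nabla_iterate_smul (T := fun _ _ => 0) (r := r) (fun _ _ => contDiffOn_const) 0
      α.length w hw x hx
    simpa using this
  have h3 : ∀ rel : List (ℝ × List ℕ), frame e (fun w =>
      (rel.map fun p => p.1 * G.nabla^[α.length] T (swaps (p.2.map (· + α.length)) w) x).sum)
        (α ++ v) = (rel.map fun p =>
      p.1 * frame e (fun w => G.nabla^[α.length] T w x) (α ++ swaps p.2 v)).sum := by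
    intro rel
    induction rel with
    | nil => simp [frame_zero]
    | cons p rel ih =>
      simp only [List.map_cons, List.sum_cons]
      rw [frame_add, frame_smul, ih, frame_swaps e (fun w => G.nabla^[α.length] T w x),
        swaps_append]
  rw [← h3, ← frame_zero e (α ++ v)]
  exact frame_congr e fun w hw => h2 w (by rw [hw, List.length_append, hv, add_comm])

section FrameIdentities

variable (ψ υ : E n → ℝ) {x : E n} (hx : x ∈ G.U) {e : Matrix (Fin n) (Fin n) ℝ}

theorem frameComp_R_eq (hx : x ∈ G.U) (α v : List (Fin n)) (hv : v.length = 4) :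
    G.frameComp ψ υ x e .R (α ++ v) = frame e (fun w => G.nabla^[α.length] G.curv w x) (α ++ v) :=
  frame_congr e fun w hw => G.comp_R ψ υ (by rw [hw, List.length_append, hv, add_comm]) hx

theorem frameComp_R_antisymm_left (hx : x ∈ G.U) (α : List (Fin n)) (a b c d : Fin n) :
    G.frameComp ψ υ x e .R (α ++ [a, b, c, d]) = - G.frameComp ψ υ x e .R (α ++ [b, a, c, d]) := by
  have := G.frame_nabla_relation G.curv_smooth [(1, []), (1, [0])] (fun v hv y hy => by
    match v, hv with
    | [i, j, k, l], _ =>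
      have := G.riem_antisymm_left hy i j k l
      simp [curv]; linarith) e α [a, b, c, d] rfl hx
  rw [G.frameComp_R_eq ψ υ hx _ _ rfl, G.frameComp_R_eq ψ υ hx _ _ rfl]
  simp at this
  linarith

theorem frameComp_R_antisymm_right (hx : x ∈ G.U) (α : List (Fin n)) (a b c d : Fin n) :
    G.frameComp ψ υ x e .R (α ++ [a, b, c, d]) = - G.frameComp ψ υ x e .R (α ++ [a, b, d, c]) := by
  have := G.frame_nabla_relation G.curv_smooth [(1, []), (1, [2])] (fun v hv y hy => by
    match v, hv with
    | [i, j, k, l], _ =>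
      have := G.riem_antisymm_right i j k l y
      simp [curv]; linarith) e α [a, b, c, d] rfl hx
  rw [G.frameComp_R_eq ψ υ hx _ _ rfl, G.frameComp_R_eq ψ υ hx _ _ rfl]
  simp at this
  linarith

theorem frameComp_R_pair (hx : x ∈ G.U) (α : List (Fin n)) (a b c d : Fin n) :
    G.frameComp ψ υ x e .R (α ++ [a, b, c, d]) = G.frameComp ψ υ x e .R (α ++ [c, d, a, b]) := by
  have := G.frame_nabla_relation G.curv_smooth [(1, []), (-1, [1, 0, 2, 1])] (fun v hv y hy => by
    match v, hv with
    | [i, j, k, l], _ =>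
      have := G.riem_pair_symm hy i j k l
      simp [curv]; linarith) e α [a, b, c, d] rfl hx
  rw [G.frameComp_R_eq ψ υ hx _ _ rfl, G.frameComp_R_eq ψ υ hx _ _ rfl]
  simp at this
  linarith

theorem frameComp_R_bianchi (hx : x ∈ G.U) (α : List (Fin n)) (a b c d : Fin n) :
    G.frameComp ψ υ x e .R (α ++ [a, b, c, d]) + G.frameComp ψ υ x e .R (α ++ [a, c, d, b])
      + G.frameComp ψ υ x e .R (α ++ [a, d, b, c]) = 0 := by
  have := G.frame_nabla_relation G.curv_smooth [(1, []), (1, [1, 2]), (1, [2, 1])]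
    (fun v hv y hy => by
    match v, hv with
    | [i, j, k, l], _ =>
      have := G.riem_bianchi hy i j k l
      simp [curv]; linarith) e α [a, b, c, d] rfl hx
  rw [G.frameComp_R_eq ψ υ hx _ _ rfl, G.frameComp_R_eq ψ υ hx _ _ rfl,
    G.frameComp_R_eq ψ υ hx _ _ rfl]
  simp at this
  linarith

theorem nabla_curv_pair {y : E n} (hy : y ∈ G.U) (e i j k l : Fin n) :
    G.nabla G.curv [e, i, j, k, l] y = G.nabla G.curv [e, k, l, i, j] y := by
  have h := G.nabla_congr (T := G.curv) (S := fun w => G.curv (swaps [1, 0, 2, 1] w)) (r := 4)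
    (fun v hv z hz => by
    match v, hv with
    | [i, j, k, l], _ =>
      have := G.riem_pair_symm hz i j k l
      simpa [curv] using this) [e, i, j, k, l] rfl hy
  have h2 := G.nabla_iterate_swaps (r := 4) G.curv [1, 0, 2, 1] 1 [e, i, j, k, l] rfl y hy
  simp only [Function.iterate_one] at h2
  rw [h, h2]
  rfl

theorem frameComp_R_bianchi_second (hx : x ∈ G.U) (α : List (Fin n)) (f a b c d : Fin n) :
    G.frameComp ψ υ x e .R (α ++ [f, a, b, c, d]) + G.frameComp ψ υ x e .R (α ++ [a, b, f, c, d])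
      + G.frameComp ψ υ x e .R (α ++ [b, f, a, c, d]) = 0 := by
  have := G.frame_nabla_relation G.curv_smooth.nabla [(1, []), (1, [0, 1]), (1, [1, 0])]
    (fun v hv y hy => by
    match v, hv with
    | [f, i, j, k, l], _ =>
      have := G.nabla_curv_bianchi hy f k l i j
      rw [G.nabla_curv_pair hy, G.nabla_curv_pair hy i, G.nabla_curv_pair hy j] at this
      simp; linarith) e α [f, a, b, c, d] rfl hx
  have h : ∀ v : List (Fin n), v.length = 5 → G.frameComp ψ υ x e .R (α ++ v) =
      frame e (fun w => G.nabla^[α.length] (G.nabla G.curv) w x) (α ++ v) := by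
    intro v hv
    refine frame_congr e fun w hw => ?_
    rw [G.comp_R ψ υ (m := α.length + 1) (by rw [hw, List.length_append, hv]; omega) hx]
    rfl
  rw [h _ rfl, h _ rfl, h _ rfl]
  simp at this
  linarith

theorem frame_apply_metric (hx : x ∈ G.U) (he : G.IsFrame x e) (a b : Fin n) :
    frame e (fun w => G.metric w x) [a, b] = if a = b then 1 else 0 := by
  rw [← G.frame_metric hx he a b]
  simp [frame, metric]

theorem exists_append_of_length {α : Type*} {w : List α} {m k : ℕ} (h : w.length = m + k) :
    ∃ w1 w2, w = w1 ++ w2 ∧ w1.length = m ∧ w2.length = k :=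
  ⟨w.take m, w.drop m, (List.take_append_drop m w).symm, by simp; omega, by simp; omega⟩

/-- The Schouten tensor in an orthonormal frame. -/
theorem frameComp_P_eq (hx : x ∈ G.U) (he : G.IsFrame x e) (α : List (Fin n)) (a b : Fin n) :
    G.frameComp ψ υ x e .P (α ++ [a, b]) = 1 / ((n : ℝ) - 2) *
      ((∑ u, G.frameComp ψ υ x e .R (α ++ [a, u, b, u])) - 1 / (2 * ((n : ℝ) - 1)) *
        ((∑ v, ∑ u, G.frameComp ψ υ x e .R (α ++ [v, u, v, u])) * if a = b then 1 else 0)) := by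
  let Rc : List (Fin n) → ℝ := fun w => G.comp ψ υ .R w x
  let ric : List (Fin n) → ℝ := fun w => ∑ i, ∑ j, G.ginv x i j *
    Rc (swapAt (α.length + 2) (w.take (α.length + 1) ++ i :: j :: w.drop (α.length + 1)))
  have hric : ∀ (r : List (Fin n)) (i k : Fin n), r.length = α.length →
      ric (r ++ [i, k]) = ∑ j, ∑ l, G.ginv x j l * Rc (r ++ [i, j, k, l]) := by
    intro r i k hr
    refine Finset.sum_congr rfl fun j _ => Finset.sum_congr rfl fun l _ => ?_
    have e1 : (r ++ [i, k]).take (α.length + 1) = r ++ [i] := by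
      rw [← hr, List.take_length_add_append]; rfl
    have e2 : (r ++ [i, k]).drop (α.length + 1) = [k] := by
      rw [← hr, List.drop_length_add_append]; rfl
    rw [e1, e2, List.append_assoc, ← hr, add_comm r.length 2, swapAt_append_add]
    rfl
  have fric : ∀ a b : Fin n, frame e ric (α ++ [a, b]) =
      ∑ u, G.frameComp ψ υ x e .R (α ++ [a, u, b, u]) := by
    intro a b
    have := frame_trace e he (α.length + 1) (fun w => Rc (swapAt (α.length + 2) w)) (α ++ [a, b])
    refine this.trans (Finset.sum_congr rfl fun u _ => ?_)
    rw [frame_swapAt]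
    have e1 : (α ++ [a, b]).take (α.length + 1) = α ++ [a] := by
      rw [List.take_length_add_append]; rfl
    have e2 : (α ++ [a, b]).drop (α.length + 1) = [b] := by
      rw [List.drop_length_add_append]; rfl
    rw [e1, e2, List.append_assoc, add_comm α.length 2, swapAt_append_add]
    rfl
  let sc : List (Fin n) → ℝ := fun w => ∑ i, ∑ j, G.ginv x i j *
    ric (w.take α.length ++ i :: j :: w.drop α.length)
  have hsc : ∀ r : List (Fin n), r.length = α.length →
      sc r = ∑ i, ∑ j, G.ginv x i j * ric (r ++ [i, j]) := by
    intro r hr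
    refine Finset.sum_congr rfl fun j _ => Finset.sum_congr rfl fun l _ => ?_
    rw [← hr]; simp
  have fsc : frame e sc α = ∑ v, ∑ u, G.frameComp ψ υ x e .R (α ++ [v, u, v, u]) := by
    have := frame_trace e he α.length ric α
    refine this.trans (Finset.sum_congr rfl fun v _ => ?_)
    simp [fric]
  have h1 : G.frameComp ψ υ x e .P (α ++ [a, b]) = frame e (fun w => 1 / ((n : ℝ) - 2) *
      (ric w + (- (1 / (2 * ((n : ℝ) - 1)))) *
        (sc (w.take α.length) * G.metric (w.drop α.length) x))) (α ++ [a, b]) := by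
    refine frame_congr e fun w hw => ?_
    obtain ⟨r, s, rfl, hr, hs⟩ := exists_append_of_length (w := w) (m := α.length) (k := 2)
      (by rw [hw]; simp)
    match s, hs with
    | [i, k], _ =>
      rw [G.comp_P_eq ψ υ r i k hx, hric r i k hr]
      have e1 : (r ++ [i, k]).take α.length = r := by rw [← hr]; simp
      have e2 : (r ++ [i, k]).drop α.length = [i, k] := by rw [← hr]; simp
      rw [e1, e2, hsc r hr]
      simp only [hric r _ _ hr]
      simp only [metric, Rc]
      ring
  rw [h1, frame_smul, frame_add, frame_smul, fric, frame_mul e sc (fun w => G.metric w x), fsc,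
    G.frame_apply_metric hx he]
  ring

/-- The Weyl tensor in an orthonormal frame. -/
theorem frameComp_W_eq (hx : x ∈ G.U) (he : G.IsFrame x e) (α : List (Fin n)) (a b c d : Fin n) :
    G.frameComp ψ υ x e .W (α ++ [a, b, c, d]) = G.frameComp ψ υ x e .R (α ++ [a, b, c, d])
      + (G.frameComp ψ υ x e .P (α ++ [b, c]) * (if a = d then 1 else 0)
      + G.frameComp ψ υ x e .P (α ++ [a, d]) * (if b = c then 1 else 0)
      - G.frameComp ψ υ x e .P (α ++ [b, d]) * (if a = c then 1 else 0)
      - G.frameComp ψ υ x e .P (α ++ [a, c]) * (if b = d then 1 else 0)) := by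
  let m := α.length
  let Q : List (Fin n) → ℝ := fun w => G.comp ψ υ .P (w.take (2 + m)) x * G.metric (w.drop (2 + m)) x
  have hQ : ∀ (r : List (Fin n)) (i j k l : Fin n), r.length = m →
      Q (r ++ [i, j, k, l]) = G.comp ψ υ .P (r ++ [i, j]) x * G.g x k l := by
    intro r i j k l hr
    have e1 : (r ++ [i, j, k, l]).take (2 + m) = r ++ [i, j] := by
      rw [add_comm, ← hr, List.take_length_add_append]; rfl
    have e2 : (r ++ [i, j, k, l]).drop (2 + m) = [k, l] := by
      rw [add_comm, ← hr, List.drop_length_add_append]; rfl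
    simp only [Q, e1, e2, metric]
  have fQ : ∀ a b c d : Fin n, frame e Q (α ++ [a, b, c, d]) =
      G.frameComp ψ υ x e .P (α ++ [a, b]) * (if c = d then 1 else 0) := by
    intro a b c d
    have := frame_mul e (fun w => G.comp ψ υ .P w x) (fun w => G.metric w x) (α ++ [a, b]) [c, d]
    rw [G.frame_apply_metric hx he] at this
    rw [List.append_assoc] at this
    rw [show (α ++ [a, b]).length = 2 + m by simp [m, add_comm]] at this
    exact this
  have h1 : G.frameComp ψ υ x e .W (α ++ [a, b, c, d]) = frame e (fun w =>
      (((G.comp ψ υ .R w x + Q (swaps ([0, 1].map (· + m)) w)) + Q (swaps ([2, 1].map (· + m)) w))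
      + (-1) * Q (swaps ([0, 2, 1].map (· + m)) w)) + (-1) * Q (swaps ([1].map (· + m)) w))
      (α ++ [a, b, c, d]) := by
    refine frame_congr e fun w hw => ?_
    obtain ⟨r, s, rfl, hr, hs⟩ := exists_append_of_length (w := w) (m := α.length) (k := 4)
      (by rw [hw]; simp)
    match s, hs with
    | [i, j, k, l], _ =>
      rw [G.comp_W_eq ψ υ r i j k l hx]
      have hr' : m = r.length := hr.symm
      rw [hr']
      simp only [swaps_append]
      simp only [swaps_cons, swaps_nil, swapAt_zero_cons, swapAt_succ_cons, hQ _ _ _ _ _ hr]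
      ring
  rw [h1, frame_add, frame_add, frame_add, frame_add, frame_smul, frame_smul, frame_swaps,
    frame_swaps, frame_swaps, frame_swaps]
  simp only [m, swaps_append]
  simp only [swaps_cons, swaps_nil, swapAt_zero_cons, swapAt_succ_cons, fQ, frameComp]
  ring

end FrameIdentities

/-- The algebraic and differential identities between the components, in an orthonormal frame, of
the iterated covariant derivatives of the curvature, Weyl and Schouten tensors. -/
structure _root_.RiemContr.CurvId (n : ℕ) (φ : Kind → List (Fin n) → ℝ) : Prop where
  R_left : ∀ α a b c d, φ .R (α ++ [a, b, c, d]) = - φ .R (α ++ [b, a, c, d])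
  R_right : ∀ α a b c d, φ .R (α ++ [a, b, c, d]) = - φ .R (α ++ [a, b, d, c])
  R_pair : ∀ α a b c d, φ .R (α ++ [a, b, c, d]) = φ .R (α ++ [c, d, a, b])
  R_first : ∀ α a b c d, φ .R (α ++ [a, b, c, d]) + φ .R (α ++ [a, c, d, b])
    + φ .R (α ++ [a, d, b, c]) = 0
  R_second : ∀ α e a b c d, φ .R (α ++ [e, a, b, c, d]) + φ .R (α ++ [a, b, e, c, d])
    + φ .R (α ++ [b, e, a, c, d]) = 0
  P_eq : ∀ α a b, φ .P (α ++ [a, b]) = 1 / ((n : ℝ) - 2) *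
    ((∑ u, φ .R (α ++ [a, u, b, u])) - 1 / (2 * ((n : ℝ) - 1)) *
      ((∑ v, ∑ u, φ .R (α ++ [v, u, v, u])) * if a = b then 1 else 0))
  W_eq : ∀ α a b c d, φ .W (α ++ [a, b, c, d]) = φ .R (α ++ [a, b, c, d])
      + (φ .P (α ++ [b, c]) * (if a = d then 1 else 0)
      + φ .P (α ++ [a, d]) * (if b = c then 1 else 0)
      - φ .P (α ++ [b, d]) * (if a = c then 1 else 0)
      - φ .P (α ++ [a, c]) * (if b = d then 1 else 0))

theorem curvId (ψ υ : E n → ℝ) {x : E n} (hx : x ∈ G.U) {e : Matrix (Fin n) (Fin n) ℝ}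
    (he : G.IsFrame x e) : CurvId n (G.frameComp ψ υ x e) where
  R_left := G.frameComp_R_antisymm_left ψ υ hx
  R_right := G.frameComp_R_antisymm_right ψ υ hx
  R_pair := G.frameComp_R_pair ψ υ hx
  R_first := G.frameComp_R_bianchi ψ υ hx
  R_second := G.frameComp_R_bianchi_second ψ υ hx
  P_eq := G.frameComp_P_eq ψ υ hx he
  W_eq := G.frameComp_W_eq ψ υ hx he

end LocalMetric

namespace CurvId

variable {n : ℕ} {φ : Kind → List (Fin n) → ℝ} (h : CurvId n φ)

include h

theorem P_symm (α : List (Fin n)) (a b : Fin n) : φ .P (α ++ [a, b]) = φ .P (α ++ [b, a]) := by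
  have e : ∀ u, φ .R (α ++ [a, u, b, u]) = φ .R (α ++ [b, u, a, u]) := fun u => h.R_pair α a u b u
  rw [h.P_eq, h.P_eq]
  simp only [e, eq_comm (a := a)]

theorem W_left (α : List (Fin n)) (a b c d : Fin n) :
    φ .W (α ++ [a, b, c, d]) = - φ .W (α ++ [b, a, c, d]) := by
  rw [h.W_eq, h.W_eq, h.R_left]
  ring

theorem W_right (α : List (Fin n)) (a b c d : Fin n) :
    φ .W (α ++ [a, b, c, d]) = - φ .W (α ++ [a, b, d, c]) := by
  rw [h.W_eq, h.W_eq, h.R_right]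
  ring

theorem W_pair (α : List (Fin n)) (a b c d : Fin n) :
    φ .W (α ++ [a, b, c, d]) = φ .W (α ++ [c, d, a, b]) := by
  rw [h.W_eq, h.W_eq, h.R_pair, h.P_symm α b c, h.P_symm α a d, h.P_symm α b d, h.P_symm α a c]
  simp only [eq_comm (a := a), eq_comm (a := b)]
  ring

theorem W_first (α : List (Fin n)) (a b c d : Fin n) :
    φ .W (α ++ [a, b, c, d]) + φ .W (α ++ [a, c, d, b]) + φ .W (α ++ [a, d, b, c]) = 0 := by
  rw [h.W_eq, h.W_eq, h.W_eq, h.P_symm α c b, h.P_symm α d b, h.P_symm α d c]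
  simp only [eq_comm (a := c) (b := b), eq_comm (a := d) (b := b), eq_comm (a := d) (b := c)]
  linarith [h.R_first α a b c d]

/-- The trace of the Ricci tensor, from the trace of the Schouten tensor. -/
theorem sum_P (hn : 4 ≤ n) (α : List (Fin n)) :
    ∑ u, ∑ v, φ .R (α ++ [u, v, u, v]) = 2 * ((n : ℝ) - 1) * ∑ v, φ .P (α ++ [v, v]) := by
  have h4 : (4 : ℝ) ≤ n := by exact_mod_cast hn
  have h2 : (n : ℝ) - 2 ≠ 0 := by linarith
  have h1 : (n : ℝ) - 1 ≠ 0 := by linarith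
  simp only [h.P_eq, if_true, ← Finset.mul_sum, Finset.sum_sub_distrib, Finset.sum_const,
    Finset.card_univ, Fintype.card_fin, nsmul_eq_mul]
  field_simp
  ring

/-- The Ricci tensor in terms of the Schouten tensor: `Ric_{ab} = (n - 2) P_{ab} + P^v_v g_{ab}`. -/
theorem ricci_eq (hn : 4 ≤ n) (α : List (Fin n)) (a b : Fin n) :
    ∑ u, φ .R (α ++ [a, u, b, u]) = ((n : ℝ) - 2) * φ .P (α ++ [a, b])
      + (∑ v, φ .P (α ++ [v, v])) * if a = b then 1 else 0 := by
  have h4 : (4 : ℝ) ≤ n := by exact_mod_cast hn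
  have h2 : (n : ℝ) - 2 ≠ 0 := by linarith
  have h1 : (n : ℝ) - 1 ≠ 0 := by linarith
  have h3 := h.sum_P hn α
  rw [h.P_eq α a b, h3]
  field_simp
  ring

theorem W_trace (hn : 4 ≤ n) (α : List (Fin n)) (a b : Fin n) :
    ∑ u, φ .W (α ++ [a, u, b, u]) = 0 := by
  simp only [h.W_eq, Finset.sum_add_distrib, Finset.sum_sub_distrib, h.ricci_eq hn]
  simp only [mul_ite, mul_one, mul_zero, Finset.sum_ite_eq, Finset.sum_ite_eq', Finset.mem_univ,
    if_true, Finset.sum_const, Finset.card_univ, Fintype.card_fin, nsmul_eq_mul]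
  by_cases hab : a = b
  · simp [hab]; ring
  · simp [hab]; ring

/-- The contracted second Bianchi identity. -/
theorem div_R (α : List (Fin n)) (b c d : Fin n) :
    ∑ u, φ .R (α ++ [u, u, b, c, d]) =
      ∑ u, φ .R (α ++ [c, b, u, d, u]) - ∑ u, φ .R (α ++ [d, b, u, c, u]) := by
  rw [← Finset.sum_sub_distrib]
  refine Finset.sum_congr rfl fun u _ => ?_
  -- the second Bianchi identity for the last two indices
  have e1 := h.R_second α u c d u b
  have p := fun f a b c d => by
    have := h.R_pair (α ++ [f]) a b c d
    simpa using this
  have l := fun f a b c d => by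
    have := h.R_left (α ++ [f]) a b c d
    simpa using this
  have r := fun f a b c d => by
    have := h.R_right (α ++ [f]) a b c d
    simpa using this
  linarith [p u u b c d, p c d u u b, p d u c u b, l c u b d u, r c u b d u, l d u b c u,
    r d u b c u, l c b u d u, r c b u d u, p c u b d u, p c b u d u, p d u b u c, p d b u c u,
    l d b u u c, r d b u u c]

/-- The divergence of the Schouten tensor is the derivative of its trace. -/
theorem div_P (hn : 4 ≤ n) (α : List (Fin n)) (a : Fin n) :
    ∑ u, φ .P (α ++ [a, u, u]) = ∑ u, φ .P (α ++ [u, u, a]) := by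
  have h4 : (4 : ℝ) ≤ n := by exact_mod_cast hn
  have r := fun (f a b : Fin n) => by
    have := h.ricci_eq hn (α ++ [f]) a b
    simpa using this
  have R2 := fun (f a b c d : Fin n) => by
    have := h.R_right (α ++ [f]) a b c d
    simpa using this
  have p := fun (f a b c d : Fin n) => by
    have := h.R_pair (α ++ [f]) a b c d
    simpa using this
  -- contract the contracted Bianchi identity once more
  have e1 : ∑ b, ∑ u, φ .R (α ++ [u, u, b, a, b]) = ∑ b, ∑ u, φ .R (α ++ [a, b, u, b, u])
      - ∑ b, ∑ u, φ .R (α ++ [b, b, u, a, u]) := by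
    rw [← Finset.sum_sub_distrib]
    exact Finset.sum_congr rfl fun b _ => h.div_R α b a b
  rw [Finset.sum_comm] at e1
  have e2 : ∑ u, ∑ b, φ .R (α ++ [u, u, b, a, b]) = ((n : ℝ) - 2) * ∑ u, φ .P (α ++ [u, u, a])
      + ∑ v, φ .P (α ++ [a, v, v]) := by
    simp only [r, Finset.sum_add_distrib, ← Finset.mul_sum]
    simp
  have e3 : ∑ b, ∑ u, φ .R (α ++ [a, b, u, b, u]) = (2 * (n : ℝ) - 2) * ∑ v, φ .P (α ++ [a, v, v])
      := by
    simp only [r, Finset.sum_add_distrib, ← Finset.mul_sum]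
    simp
    ring
  have e5 : ((n : ℝ) - 2) * (∑ u, φ .P (α ++ [a, u, u]) - ∑ u, φ .P (α ++ [u, u, a])) = 0 := by
    rw [e2, e3] at e1
    linarith
  rcases mul_eq_zero.1 e5 with h5 | h5
  · linarith
  · linarith

/-- The divergence of the Weyl tensor is `n - 3` times the Cotton tensor. -/
theorem div_W (hn : 4 ≤ n) (α : List (Fin n)) (b c d : Fin n) :
    ∑ u, φ .W (α ++ [u, u, b, c, d]) =
      ((n : ℝ) - 3) * (φ .P (α ++ [c, b, d]) - φ .P (α ++ [d, b, c])) := by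
  have r := fun (f a b : Fin n) => by
    have := h.ricci_eq hn (α ++ [f]) a b
    simpa using this
  have w := fun (f a b c d : Fin n) => by
    have := h.W_eq (α ++ [f]) a b c d
    simpa using this
  have e0 := h.div_R α b c d
  have e1 := h.div_P hn α c
  have e2 := h.div_P hn α d
  simp only [r] at e0
  simp only [w, Finset.sum_add_distrib, Finset.sum_sub_distrib, e0]
  simp only [Finset.sum_ite_eq', Finset.mem_univ, if_true]
  have s1 := h.P_symm (α ++ [c]) d b
  have s2 := h.P_symm (α ++ [d]) c b
  simp only [List.append_assoc, List.cons_append, List.nil_append] at s1 s2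
  by_cases hbc : b = c <;> by_cases hbd : b = d
  · subst hbc; subst hbd; simp
  · subst hbc
    simp [hbd] at *
    linarith
  · subst hbd
    simp [hbc] at *
    linarith
  · simp [hbc, hbd]
    linarith

/-- The second Bianchi identity for the Weyl tensor. On the right stand products of the metric and of
the Cotton tensor. -/
theorem W_second (α : List (Fin n)) (e a b c d : Fin n) :
    φ .W (α ++ [e, a, b, c, d]) + φ .W (α ++ [a, b, e, c, d]) + φ .W (α ++ [b, e, a, c, d]) =
      (if a = d then 1 else 0) * (φ .P (α ++ [e, b, c]) - φ .P (α ++ [b, e, c]))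
      - (if a = c then 1 else 0) * (φ .P (α ++ [e, b, d]) - φ .P (α ++ [b, e, d]))
      + (if b = d then 1 else 0) * (φ .P (α ++ [a, e, c]) - φ .P (α ++ [e, a, c]))
      - (if b = c then 1 else 0) * (φ .P (α ++ [a, e, d]) - φ .P (α ++ [e, a, d]))
      + (if e = d then 1 else 0) * (φ .P (α ++ [b, a, c]) - φ .P (α ++ [a, b, c]))
      - (if e = c then 1 else 0) * (φ .P (α ++ [b, a, d]) - φ .P (α ++ [a, b, d])) := by
  have w := fun (f a b c d : Fin n) => by
    have := h.W_eq (α ++ [f]) a b c d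
    simp only [List.append_assoc, List.cons_append, List.nil_append] at this
    exact this
  rw [w, w, w]
  linarith [h.R_second α e a b c d]

end CurvId

end RiemContr

namespace RiemContr

/-! ### Linear combinations of contractions modulo longer contractions -/

namespace LocalMetric

variable {n : ℕ} (G : LocalMetric n) (ψ υ : E n → ℝ)

theorem evalLin_add (A B : LinComb) (x : E n) :
    G.evalLin ψ υ (A + B) x = G.evalLin ψ υ A x + G.evalLin ψ υ B x := by
  classical
  exact Finsupp.sum_add_index' (by simp) (by intros; ring)

theorem evalLin_smul (b : ℝ) (A : LinComb) (x : E n) :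
    G.evalLin ψ υ (b • A) x = b * G.evalLin ψ υ A x := by
  unfold evalLin
  rw [Finsupp.sum_smul_index (by simp), Finsupp.mul_sum]
  exact Finsupp.sum_congr fun C _ => by ring

theorem evalLin_zero (x : E n) : G.evalLin ψ υ 0 x = 0 := by simp [evalLin]

theorem evalLin_neg (A : LinComb) (x : E n) : G.evalLin ψ υ (-A) x = -G.evalLin ψ υ A x := by
  have := G.evalLin_smul ψ υ (-1) A x
  simpa using this

theorem evalLin_sub (A B : LinComb) (x : E n) :
    G.evalLin ψ υ (A - B) x = G.evalLin ψ υ A x - G.evalLin ψ υ B x := by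
  rw [sub_eq_add_neg, evalLin_add, evalLin_neg, sub_eq_add_neg]

theorem evalLin_single (C : Contr) (b : ℝ) (x : E n) :
    G.evalLin ψ υ (Finsupp.single C b) x = b * G.eval ψ υ C x := by
  simp [evalLin]

theorem comp_indep {k : Kind} (hk : k = .R ∨ k = .W ∨ k = .P) (v : List (Fin n)) (x : E n) :
    G.comp ψ υ k v x = G.comp 0 0 k v x := by
  have : G.base ψ υ k = G.base 0 0 k := by
    rcases hk with rfl | rfl | rfl <;> (funext v; unfold base; split <;> simp_all)
  simp only [comp, this]

theorem tensorProd_indep {K : Contr} (hK : ∀ F ∈ K, F.kind = .R ∨ F.kind = .W ∨ F.kind = .P)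
    (v : List (Fin n)) (x : E n) : G.tensorProd ψ υ K v x = G.tensorProd 0 0 K v x := by
  induction K generalizing v with
  | nil => rfl
  | cons F K ih =>
    simp only [tensorProd]
    rw [G.comp_indep ψ υ (hK F List.mem_cons_self), ih fun F' h => hK F' (List.mem_cons_of_mem _ h)]

end LocalMetric

/-- The linear combinations of complete contractions which are equal, for every metric, to a linear
combination of complete contractions of at least `N` curvature factors. -/
noncomputable def longPart (n N : ℕ) : Submodule ℝ LinComb where
  carrier := {L | ∃ J : LinComb, (∀ C ∈ J.support, C.IsComplete ∧ N ≤ C.length ∧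
    ∀ F ∈ C, F.kind ∈ ({.R} : Set Kind)) ∧ LocallyEqual n L J}
  zero_mem' := ⟨0, by simp, fun _ _ _ _ _ _ _ => rfl⟩
  add_mem' := by
    classical
    rintro A B ⟨J, hJ, h⟩ ⟨J', hJ', h'⟩
    refine ⟨J + J', fun C hC => ?_, fun G ψ υ hψ hυ x hx => ?_⟩
    · rcases Finset.mem_union.1 (Finsupp.support_add hC) with h | h
      exacts [hJ C h, hJ' C h]
    · rw [G.evalLin_add, G.evalLin_add, h G ψ υ hψ hυ x hx, h' G ψ υ hψ hυ x hx]
  smul_mem' := by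
    rintro b A ⟨J, hJ, h⟩
    refine ⟨b • J, fun C hC => hJ C (Finsupp.support_smul hC), fun G ψ υ hψ hυ x hx => ?_⟩
    rw [G.evalLin_smul, G.evalLin_smul, h G ψ υ hψ hυ x hx]

theorem equalModLength_iff {n N : ℕ} {A B : LinComb} :
    EqualModLength n {.R} N A B ↔ A - B ∈ longPart n N := by
  constructor
  · rintro ⟨J, hJ, h⟩
    refine ⟨J, hJ, fun G ψ υ hψ hυ x hx => ?_⟩
    rw [G.evalLin_sub, h G ψ υ hψ hυ x hx, G.evalLin_add]
    ring
  · rintro ⟨J, hJ, h⟩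
    refine ⟨J, hJ, fun G ψ υ hψ hυ x hx => ?_⟩
    rw [G.evalLin_add, ← h G ψ υ hψ hυ x hx, G.evalLin_sub]
    ring

/-- The class of a contraction modulo a space of linear combinations. -/
noncomputable def cls (S : Submodule ℝ LinComb) (C : Contr) : LinComb ⧸ S :=
  S.mkQ (Finsupp.single C 1)

theorem mkQ_single (S : Submodule ℝ LinComb) (C : Contr) (b : ℝ) :
    S.mkQ (Finsupp.single C b) = b • cls S C := by
  rw [cls, ← map_smul, Finsupp.smul_single, smul_eq_mul, mul_one]

theorem Contr.IsComplete.of_perm {C D : Contr} (hC : C.IsComplete) (hD : D.WellFormed)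
    (h : D.labels.Perm C.labels) : D.IsComplete :=
  ⟨hD, fun l hl => by rw [h.count_eq]; exact hC.2 l (h.mem_iff.1 hl)⟩

theorem Contr.IsComplete.perm {C D : Contr} (hC : C.IsComplete) (h : D.Perm C) : D.IsComplete :=
  hC.of_perm (fun F hF => hC.1 F (h.mem_iff.1 hF)) (h.flatMap_right _)

section Exact

variable {n N : ℕ} {S : Submodule ℝ LinComb}

/-- Relations which follow from the identities in an orthonormal frame hold exactly, hence modulo longer
contractions. -/
theorem sum_cls_eq_zero (hS : longPart n N ≤ S) (hn : 4 ≤ n) (rel : List (ℝ × Contr))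
    (hrel : ∀ t ∈ rel, t.2.IsComplete)
    (h : ∀ φ : Kind → List (Fin n) → ℝ, CurvId n φ → ∀ c : ℕ → Fin n,
      (rel.map fun t => t.1 * val φ t.2 c).sum = 0) :
    (rel.map fun t => t.1 • cls S t.2).sum = 0 := by
  have e1 : (rel.map fun t => t.1 • cls S t.2).sum =
      S.mkQ (rel.map fun t => Finsupp.single t.2 t.1).sum := by
    rw [map_list_sum, List.map_map]
    congr 1
    exact List.map_congr_left fun t _ => (mkQ_single S t.2 t.1).symm
  rw [e1, Submodule.mkQ_apply, Submodule.Quotient.mk_eq_zero]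
  refine hS ⟨0, by simp, fun G ψ υ hψ hυ x hx => ?_⟩
  obtain ⟨e, he⟩ := G.exists_isFrame hx
  rw [G.evalLin_zero, ← h _ (G.curvId ψ υ hx he) fun _ => ⟨0, by omega⟩]
  clear e1 h
  induction rel with
  | nil => simp [G.evalLin_zero]
  | cons t rel ih =>
    simp only [List.map_cons, List.sum_cons]
    rw [G.evalLin_add, G.evalLin_single, ih fun t ht => hrel t (List.mem_cons_of_mem _ ht),
      G.eval_eq_val ψ υ (hrel t List.mem_cons_self) he]

theorem cls_perm (hS : longPart n N ≤ S) (hn : 4 ≤ n) {C D : Contr} (hC : C.IsComplete)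
    (h : C.Perm D) : cls S C = cls S D := by
  have := sum_cls_eq_zero hS hn [(1, C), (-1, D)] (by
    intro t ht
    simp only [List.mem_cons, List.not_mem_nil, or_false] at ht
    rcases ht with rfl | rfl
    exacts [hC, hC.perm h.symm]) (fun φ _ c => by simp [val_perm h])
  simpa [sub_eq_zero, ← sub_eq_add_neg] using this

/-- Relations between contractions which differ in one factor, from linear relations between the
components of this factor; the indices `B` are contracted within the factor. -/
theorem sum_cls_cons_eq_zero (hS : longPart n N ≤ S) (hn : 4 ≤ n) {K : Contr} {A : List ℕ}
    (rel : List (ℝ × List ℕ × Factor))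
    (hrel : ∀ t ∈ rel, Contr.IsComplete (t.2.2 :: K) ∧ (A ++ t.2.1).Nodup ∧
      (∀ l ∈ t.2.1, l ∉ Contr.labels K) ∧ ∀ l, l ∈ A ++ t.2.1 ↔ l ∈ Contr.labels (t.2.2 :: K))
    (h : ∀ φ : Kind → List (Fin n) → ℝ, CurvId n φ → ∀ c : ℕ → Fin n,
      (rel.map fun t => t.1 * sumOver t.2.1 (fun d => φ t.2.2.kind (t.2.2.idx.map d)) c).sum = 0) :
    (rel.map fun t => t.1 • cls S (t.2.2 :: K)).sum = 0 := by
  have := sum_cls_eq_zero hS hn (rel.map fun t => (t.1, t.2.2 :: K)) (by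
    intro t ht
    obtain ⟨s, hs, rfl⟩ := List.mem_map.1 ht
    exact (hrel s hs).1) (fun φ hφ c => by
    rw [List.map_map]
    have e1 : ∀ t ∈ rel, (t.1 * val φ (t.2.2 :: K) c) = sumOver A (fun d =>
        (t.1 * sumOver t.2.1 (fun d => φ t.2.2.kind (t.2.2.idx.map d)) d) * prodVal φ K d) c := by
      intro t ht
      obtain ⟨h1, h2, h3, h4⟩ := hrel t ht
      rw [val_eq_sumOver h2 h4, sumOver_append]
      refine (sumOver_mul_left t.1 A _ c).symm.trans (sumOver_congr (fun d => ?_) c)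
      rw [mul_assoc]
      congr 1
      rw [mul_comm (sumOver t.2.1 _ d), ← sumOver_mul_left]
      refine sumOver_congr_of_eqOn (R := ℝ) fun d' hd' => ?_
      rw [prodVal_cons, mul_comm, prodVal_dependsOnly φ K d' d fun l hl => hd' l fun hl' => h3 l hl' hl]
    have e2 : (rel.map fun t => t.1 * val φ (t.2.2 :: K) c).sum = sumOver A (fun d =>
        (rel.map fun t => t.1 * sumOver t.2.1
          (fun d => φ t.2.2.kind (t.2.2.idx.map d)) d).sum * prodVal φ K d) c := by
      rw [List.map_congr_left e1]
      clear e1 h hrel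
      induction rel with
      | nil => simp [sumOver_zero]
      | cons t rel ih =>
        simp only [List.map_cons, List.sum_cons, ih, add_mul]
        rw [sumOver_add]
    refine e2.trans ?_
    simp only [h φ hφ, zero_mul, sumOver_zero])
  rw [List.map_map] at this
  exact this

/-- Relations between contractions which differ by a permutation of the indices of one factor. -/
theorem sum_cls_perm_eq_zero (hS : longPart n N ≤ S) (hn : 4 ≤ n) {K : Contr} {F₀ : Factor}
    (h₀ : Contr.IsComplete (F₀ :: K)) (rel : List (ℝ × Factor))
    (hrel : ∀ t ∈ rel, t.2.kind.arity ≤ t.2.idx.length ∧ t.2.idx.Perm F₀.idx)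
    (h : ∀ φ : Kind → List (Fin n) → ℝ, CurvId n φ → ∀ c : ℕ → Fin n,
      (rel.map fun t => t.1 * φ t.2.kind (t.2.idx.map c)).sum = 0) :
    (rel.map fun t => t.1 • cls S (t.2 :: K)).sum = 0 := by
  have := sum_cls_cons_eq_zero hS hn (K := K) (A := (Contr.labels (F₀ :: K)).dedup)
    (rel.map fun t => (t.1, [], t.2)) (by
    intro t ht
    obtain ⟨s, hs, rfl⟩ := List.mem_map.1 ht
    obtain ⟨h1, h2⟩ := hrel s hs
    have hp : (Contr.labels (s.2 :: K)).Perm (Contr.labels (F₀ :: K)) := by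
      rw [Contr.labels_cons, Contr.labels_cons]
      exact h2.append_right _
    refine ⟨h₀.of_perm ?_ hp, by simpa using List.nodup_dedup _, by simp, fun l => ?_⟩
    · intro F hF
      rcases List.mem_cons.1 hF with rfl | hF
      exacts [h1, h₀.1 F (List.mem_cons_of_mem _ hF)]
    · simp only [List.append_nil, List.mem_dedup]
      exact hp.mem_iff.symm) (fun φ hφ c => by
    rw [List.map_map]
    exact h φ hφ c)
  rw [List.map_map] at this
  exact this

theorem cls_W_left (hS : longPart n N ≤ S) (hn : 4 ≤ n) {K : Contr} {α : List ℕ} {a b c d : ℕ}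
    (h : Contr.IsComplete (⟨.W, α ++ [a, b, c, d]⟩ :: K)) :
    cls S (⟨.W, α ++ [a, b, c, d]⟩ :: K) = - cls S (⟨.W, α ++ [b, a, c, d]⟩ :: K) := by
  have := sum_cls_perm_eq_zero hS hn h [(1, ⟨.W, α ++ [a, b, c, d]⟩), (1, ⟨.W, α ++ [b, a, c, d]⟩)]
    (by
      simp only [List.forall_mem_cons, Kind.arity]
      refine ⟨⟨by simp, List.Perm.refl _⟩, ⟨by simp, ?_⟩, by simp⟩
      exact (List.Perm.swap a b _).append_left α)
    (fun φ hφ c => by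
      have := hφ.W_left (α.map c)
      simp [this (c a) (c b)])
  simpa [add_eq_zero_iff_eq_neg] using this

theorem cls_W_right (hS : longPart n N ≤ S) (hn : 4 ≤ n) {K : Contr} {α : List ℕ} {a b c d : ℕ}
    (h : Contr.IsComplete (⟨.W, α ++ [a, b, c, d]⟩ :: K)) :
    cls S (⟨.W, α ++ [a, b, c, d]⟩ :: K) = - cls S (⟨.W, α ++ [a, b, d, c]⟩ :: K) := by
  have := sum_cls_perm_eq_zero hS hn h [(1, ⟨.W, α ++ [a, b, c, d]⟩), (1, ⟨.W, α ++ [a, b, d, c]⟩)]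
    (by
      simp only [List.forall_mem_cons, Kind.arity]
      refine ⟨⟨by simp, List.Perm.refl _⟩, ⟨by simp, ?_⟩, by simp⟩
      exact (((List.Perm.swap c d []).cons b).cons a).append_left α)
    (fun φ hφ x => by
      have := hφ.W_right (α.map x) (x a) (x b) (x c) (x d)
      simp [this])
  simpa [add_eq_zero_iff_eq_neg] using this

theorem cls_W_pair (hS : longPart n N ≤ S) (hn : 4 ≤ n) {K : Contr} {α : List ℕ} {a b c d : ℕ}
    (h : Contr.IsComplete (⟨.W, α ++ [a, b, c, d]⟩ :: K)) :
    cls S (⟨.W, α ++ [a, b, c, d]⟩ :: K) = cls S (⟨.W, α ++ [c, d, a, b]⟩ :: K) := by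
  have := sum_cls_perm_eq_zero hS hn h [(1, ⟨.W, α ++ [a, b, c, d]⟩), (-1, ⟨.W, α ++ [c, d, a, b]⟩)]
    (by
      simp only [List.forall_mem_cons, Kind.arity]
      refine ⟨⟨by simp, List.Perm.refl _⟩, ⟨by simp, ?_⟩, by simp⟩
      exact (List.perm_append_comm (l₁ := [c, d]) (l₂ := [a, b])).append_left α)
    (fun φ hφ x => by
      have := hφ.W_pair (α.map x) (x a) (x b) (x c) (x d)
      simp [this])
  simpa [sub_eq_zero, ← sub_eq_add_neg] using this

theorem cls_W_first (hS : longPart n N ≤ S) (hn : 4 ≤ n) {K : Contr} {α : List ℕ} {a b c d : ℕ}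
    (h : Contr.IsComplete (⟨.W, α ++ [a, b, c, d]⟩ :: K)) :
    cls S (⟨.W, α ++ [a, b, c, d]⟩ :: K) + cls S (⟨.W, α ++ [a, c, d, b]⟩ :: K)
      + cls S (⟨.W, α ++ [a, d, b, c]⟩ :: K) = 0 := by
  have := sum_cls_perm_eq_zero hS hn h [(1, ⟨.W, α ++ [a, b, c, d]⟩),
      (1, ⟨.W, α ++ [a, c, d, b]⟩), (1, ⟨.W, α ++ [a, d, b, c]⟩)]
    (by
      simp only [List.forall_mem_cons, Kind.arity]
      refine ⟨⟨by simp, List.Perm.refl _⟩, ⟨by simp, ?_⟩, ⟨by simp, ?_⟩, by simp⟩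
      · exact ((List.perm_append_comm (l₁ := [c, d]) (l₂ := [b])).cons a).append_left α
      · exact ((List.perm_append_comm (l₁ := [d]) (l₂ := [b, c])).cons a).append_left α)
    (fun φ hφ x => by
      have := hφ.W_first (α.map x) (x a) (x b) (x c) (x d)
      simpa [add_assoc] using this)
  simpa [add_assoc] using this

theorem cls_P_symm (hS : longPart n N ≤ S) (hn : 4 ≤ n) {K : Contr} {α : List ℕ} {a b : ℕ}
    (h : Contr.IsComplete (⟨.P, α ++ [a, b]⟩ :: K)) :
    cls S (⟨.P, α ++ [a, b]⟩ :: K) = cls S (⟨.P, α ++ [b, a]⟩ :: K) := by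
  have := sum_cls_perm_eq_zero hS hn h [(1, ⟨.P, α ++ [a, b]⟩), (-1, ⟨.P, α ++ [b, a]⟩)]
    (by
      simp only [List.forall_mem_cons, Kind.arity]
      refine ⟨⟨by simp, List.Perm.refl _⟩, ⟨by simp, ?_⟩, by simp⟩
      exact (List.Perm.swap a b []).append_left α)
    (fun φ hφ x => by
      have := hφ.P_symm (α.map x) (x a) (x b)
      simp [this])
  simpa [sub_eq_zero, ← sub_eq_add_neg] using this

end Exact
end RiemContr

namespace RiemContr

/-! ### Traces and commutation of derivatives in a contraction -/

section Trace

variable {n N : ℕ} {S : Submodule ℝ LinComb}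

/-- If a name is borne by two indices of one factor, it does not occur elsewhere. -/
theorem Contr.IsComplete.of_internal {F : Factor} {K : Contr} {u : ℕ} {rest : List ℕ}
    (h : Contr.IsComplete (F :: K)) (hF : F.idx.Perm (u :: u :: rest)) :
    u ∉ rest ++ K.labels ∧ ∀ l ∈ rest ++ K.labels, (rest ++ K.labels).count l = 2 := by
  have hp : (Contr.labels (F :: K)).Perm (u :: u :: (rest ++ K.labels)) := by
    rw [Contr.labels_cons]
    exact hF.append_right _
  have hu : u ∉ rest ++ K.labels := by
    have h1 := h.2 u (hp.mem_iff.2 (by simp))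
    rw [hp.count_eq] at h1
    rw [← List.count_eq_zero]
    simp only [List.count_cons_self] at h1
    omega
  refine ⟨hu, fun l hl => ?_⟩
  have h1 := h.2 l (hp.mem_iff.2 (List.mem_cons_of_mem _ (List.mem_cons_of_mem _ hl)))
  rw [hp.count_eq] at h1
  have hne : u ≠ l := by rintro rfl; exact hu hl
  rwa [List.count_cons_of_ne hne, List.count_cons_of_ne hne] at h1

theorem map_update_of_notMem (c : ℕ → Fin n) {u : ℕ} {α : List ℕ} (h : u ∉ α) (v : Fin n) :
    α.map (Function.update c u v) = α.map c :=
  List.map_congr_left fun l hl => Function.update_of_ne (by rintro rfl; exact h hl) _ _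

/-- Relations between contractions which differ in one factor; the index `u` is contracted within the
factor in the first group of terms, and does not occur in the second group. -/
theorem sum_cls_trace_eq_zero (hS : longPart n N ≤ S) (hn : 4 ≤ n) {K : Contr} {u : ℕ}
    {rest : List ℕ} (hK : K.WellFormed) (hu : u ∉ rest ++ K.labels)
    (hcount : ∀ l ∈ rest ++ K.labels, (rest ++ K.labels).count l = 2)
    (rel₁ rel₂ : List (ℝ × Factor))
    (h₁ : ∀ t ∈ rel₁, t.2.kind.arity ≤ t.2.idx.length ∧ t.2.idx.Perm (u :: u :: rest))
    (h₂ : ∀ t ∈ rel₂, t.2.kind.arity ≤ t.2.idx.length ∧ t.2.idx.Perm rest)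
    (h : ∀ φ : Kind → List (Fin n) → ℝ, CurvId n φ → ∀ c : ℕ → Fin n,
      (rel₁.map fun t => t.1 * ∑ v, φ t.2.kind (t.2.idx.map (Function.update c u v))).sum +
      (rel₂.map fun t => t.1 * φ t.2.kind (t.2.idx.map c)).sum = 0) :
    (rel₁.map fun t => t.1 • cls S (t.2 :: K)).sum +
      (rel₂.map fun t => t.1 • cls S (t.2 :: K)).sum = 0 := by
  have huK : u ∉ K.labels := fun h => hu (List.mem_append_right _ h)
  have hwf : ∀ t : ℝ × Factor, t.2.kind.arity ≤ t.2.idx.length → Contr.WellFormed (t.2 :: K) := by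
    intro t ht F hF
    rcases List.mem_cons.1 hF with rfl | hF
    exacts [ht, hK F hF]
  have := sum_cls_cons_eq_zero hS hn (K := K) (A := (rest ++ K.labels).dedup)
    (rel₁.map (fun t => (t.1, [u], t.2)) ++ rel₂.map (fun t => (t.1, [], t.2))) (by
    intro t ht
    rcases List.mem_append.1 ht with ht | ht
    · obtain ⟨s, hs, rfl⟩ := List.mem_map.1 ht
      obtain ⟨h1, h2⟩ := h₁ s hs
      have hp : (Contr.labels (s.2 :: K)).Perm (u :: u :: (rest ++ K.labels)) := by
        rw [Contr.labels_cons]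
        exact h2.append_right _
      refine ⟨⟨hwf s h1, fun l hl => ?_⟩, ?_, by simpa using huK, fun l => ?_⟩
      · rw [hp.count_eq]
        by_cases hul : u = l
        · subst hul
          simp only [List.count_cons_self, List.count_eq_zero_of_not_mem hu]
        · rw [List.count_cons_of_ne hul, List.count_cons_of_ne hul]
          refine hcount l ?_
          have := hp.mem_iff.1 hl
          simpa [Ne.symm hul] using this
      · refine List.Nodup.append (List.nodup_dedup _) (List.nodup_singleton u) ?_
        intro l hl hl'
        rw [List.mem_singleton] at hl'
        subst hl'
        exact hu (List.mem_dedup.1 hl)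
      · rw [hp.mem_iff]
        simp only [List.mem_append, List.mem_dedup, List.mem_cons, List.not_mem_nil, or_false]
        tauto
    · obtain ⟨s, hs, rfl⟩ := List.mem_map.1 ht
      obtain ⟨h1, h2⟩ := h₂ s hs
      have hp : (Contr.labels (s.2 :: K)).Perm (rest ++ K.labels) := by
        rw [Contr.labels_cons]
        exact h2.append_right _
      refine ⟨⟨hwf s h1, fun l hl => ?_⟩, by simpa using List.nodup_dedup _, by simp, fun l => ?_⟩
      · rw [hp.count_eq]
        exact hcount l (hp.mem_iff.1 hl)
      · simp only [List.append_nil, List.mem_dedup]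
        exact hp.mem_iff.symm) (fun φ hφ c => by
    rw [List.map_append, List.sum_append, List.map_map, List.map_map]
    exact h φ hφ c)
  rw [List.map_append, List.sum_append, List.map_map, List.map_map] at this
  exact this

theorem perm_pair_middle (α β : List ℕ) (u : ℕ) : (α ++ u :: u :: β).Perm (u :: u :: (α ++ β)) :=
  List.perm_middle.trans (List.perm_middle.cons u)

theorem cls_W_trace (hS : longPart n N ≤ S) (hn : 4 ≤ n) {K : Contr} {α : List ℕ} {a b u : ℕ}
    (h : Contr.IsComplete (⟨.W, α ++ [a, u, b, u]⟩ :: K)) :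
    cls S (⟨.W, α ++ [a, u, b, u]⟩ :: K) = 0 := by
  have hp : (α ++ [a, u, b, u]).Perm (u :: u :: (α ++ [a, b])) := by
    refine List.Perm.trans ?_ (perm_pair_middle α [a, b] u)
    refine List.Perm.append_left α ?_
    rw [List.perm_iff_count]; intro l; simp only [List.count_cons, List.count_nil]; omega
  obtain ⟨h1, h2⟩ := h.of_internal hp
  have hα : u ∉ α := fun h => h1 (by simp [h])
  have ha : u ≠ a := fun h => h1 (by simp [h])
  have hb : u ≠ b := fun h => h1 (by simp [h])
  have := sum_cls_trace_eq_zero hS hn (fun F hF => h.1 F (List.mem_cons_of_mem _ hF)) h1 h2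
    [(1, ⟨.W, α ++ [a, u, b, u]⟩)] [] (by simpa [Kind.arity] using hp) (by simp)
    (fun φ hφ c => by
      have := hφ.W_trace hn (α.map c) (c a) (c b)
      simpa [map_update_of_notMem c hα, ha.symm, hb.symm] using this)
  simpa using this

theorem cls_P_div (hS : longPart n N ≤ S) (hn : 4 ≤ n) {K : Contr} {α : List ℕ} {a u : ℕ}
    (h : Contr.IsComplete (⟨.P, α ++ [a, u, u]⟩ :: K)) :
    cls S (⟨.P, α ++ [a, u, u]⟩ :: K) = cls S (⟨.P, α ++ [u, u, a]⟩ :: K) := by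
  have hp' : (α ++ [u, u, a]).Perm (u :: u :: (α ++ [a])) := perm_pair_middle α [a] u
  have hp : (α ++ [a, u, u]).Perm (u :: u :: (α ++ [a])) := by
    refine List.Perm.trans (List.Perm.append_left α ?_) hp'
    exact List.perm_append_comm (l₁ := [a]) (l₂ := [u, u])
  obtain ⟨h1, h2⟩ := h.of_internal hp
  have hα : u ∉ α := fun h => h1 (by simp [h])
  have ha : u ≠ a := fun h => h1 (by simp [h])
  have := sum_cls_trace_eq_zero hS hn (fun F hF => h.1 F (List.mem_cons_of_mem _ hF)) h1 h2
    [(1, ⟨.P, α ++ [a, u, u]⟩), (-1, ⟨.P, α ++ [u, u, a]⟩)] []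
    (by simpa [Kind.arity] using ⟨hp, hp'⟩) (by simp)
    (fun φ hφ c => by
      have := hφ.div_P hn (α.map c) (c a)
      simpa [map_update_of_notMem c hα, ha.symm, ← sub_eq_add_neg, sub_eq_zero] using this)
  simpa [← sub_eq_add_neg, sub_eq_zero] using this

/-- The divergence of the Weyl tensor is a multiple of the Cotton tensor. -/
theorem cls_W_div (hS : longPart n N ≤ S) (hn : 4 ≤ n) {K : Contr} {α : List ℕ} {b c d u : ℕ}
    (h : Contr.IsComplete (⟨.W, α ++ [u, u, b, c, d]⟩ :: K)) :
    cls S (⟨.W, α ++ [u, u, b, c, d]⟩ :: K) =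
      ((n : ℝ) - 3) • (cls S (⟨.P, α ++ [c, b, d]⟩ :: K) - cls S (⟨.P, α ++ [d, b, c]⟩ :: K)) := by
  have hp : (α ++ [u, u, b, c, d]).Perm (u :: u :: (α ++ [b, c, d])) :=
    perm_pair_middle α [b, c, d] u
  obtain ⟨h1, h2⟩ := h.of_internal hp
  have hα : u ∉ α := fun h => h1 (by simp [h])
  have hb : u ≠ b := fun h => h1 (by simp [h])
  have hc : u ≠ c := fun h => h1 (by simp [h])
  have hd : u ≠ d := fun h => h1 (by simp [h])
  have := sum_cls_trace_eq_zero hS hn (fun F hF => h.1 F (List.mem_cons_of_mem _ hF)) h1 h2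
    [(1, ⟨.W, α ++ [u, u, b, c, d]⟩)]
    [(-((n : ℝ) - 3), ⟨.P, α ++ [c, b, d]⟩), ((n : ℝ) - 3, ⟨.P, α ++ [d, b, c]⟩)]
    (by simpa [Kind.arity] using hp) (by
      simp only [List.forall_mem_cons, Kind.arity]
      refine ⟨⟨by simp, ?_⟩, ⟨by simp, ?_⟩, by simp⟩
      · exact (List.Perm.swap b c [d]).append_left α
      · exact (List.perm_append_comm (l₁ := [d]) (l₂ := [b, c])).append_left α)
    (fun φ hφ x => by
      have := hφ.div_W hn (α.map x) (x b) (x c) (x d)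
      simp only [List.map_cons, List.map_nil, List.map_append, List.sum_cons, List.sum_nil,
        map_update_of_notMem x hα, Function.update_self, Function.update_of_ne hb.symm,
        Function.update_of_ne hc.symm, Function.update_of_ne hd.symm, this]
      ring)
  simp only [List.map_cons, List.map_nil, List.sum_cons, List.sum_nil, one_smul, add_zero] at this
  rw [add_eq_zero_iff_eq_neg.1 this]
  module

end Trace

section Commute

variable {n N : ℕ} {S : Submodule ℝ LinComb}

theorem CurvField.comp_base {k : Kind} (hk : k = .R ∨ k = .W ∨ k = .P) : ∃ X : LocalMetric n →
    Components n, CurvField 1 k.arity X ∧ ∀ (G : LocalMetric n) (m : ℕ) (v : List (Fin n)),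
      v.length = k.arity + m → ∀ x ∈ G.U, G.comp 0 0 k v x = G.nabla^[m] (X G) v x := by
  rcases hk with rfl | rfl | rfl
  · exact ⟨_, CurvField.curv 0, fun G m v hv x hx => G.comp_R 0 0 hv hx⟩
  · exact ⟨_, CurvField.weylComp, fun G m v hv x hx => G.comp_W 0 0 hv hx⟩
  · exact ⟨_, CurvField.schoutenComp, fun G m v hv x hx => G.comp_P 0 0 hv hx⟩

theorem CurvField.mul_tensorProd {M r : ℕ} {X : LocalMetric n → Components n}
    (hX : CurvField M r X) {K : Contr} (hK : ∀ F ∈ K, F.kind = .R ∨ F.kind = .W ∨ F.kind = .P)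
    (hwf : K.WellFormed) : CurvField (M + K.length) (r + K.labels.length)
      (fun G v x => X G (v.take r) x * G.tensorProd 0 0 K (v.drop r) x) := by
  induction K generalizing M r X with
  | nil =>
    refine hX.congr fun G v hv x hx => ?_
    have hv : v.length = r := hv
    rw [LocalMetric.tensorProd, mul_one, ← hv, List.take_length]
  | cons F K ih =>
    obtain ⟨Y, hY, h⟩ := CurvField.comp_base (n := n) (hK F List.mem_cons_self)
    have hl := hwf F List.mem_cons_self
    have h1 := ih (hX.mul (hY.nabla_iterate (F.idx.length - F.kind.arity)))
      (fun F' h => hK F' (List.mem_cons_of_mem _ h)) fun F' h => hwf F' (List.mem_cons_of_mem _ h)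
    have e1 : M + 1 + K.length = M + (F :: K : Contr).length := by simp; omega
    have e2 : r + (F.kind.arity + (F.idx.length - F.kind.arity)) = r + F.idx.length := by omega
    have e3 : r + F.idx.length + (Contr.labels K).length = r + (Contr.labels (F :: K)).length := by
      rw [Contr.labels_cons, List.length_append]; omega
    rw [e1, e2, e3] at h1
    refine h1.congr fun G v hv x hx => ?_
    rw [Contr.labels_cons, List.length_append] at hv
    rw [LocalMetric.tensorProd, h G (F.idx.length - F.kind.arity) _ (by simp; omega) x hx,
      List.take_take, min_eq_left (by omega), ← mul_assoc, List.drop_drop, List.drop_take]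
    rw [Nat.add_sub_cancel_left]

/-- The order of two successive covariant derivatives does not matter modulo longer contractions: by the
Ricci identity the commutator is a tensor field with one more curvature factor. -/
theorem cls_deriv_swap (hS : longPart n N ≤ S) {k : Kind} (hk : k = .R ∨ k = .W ∨ k = .P)
    {K : Contr} (hK : ∀ F ∈ K, F.kind = .R ∨ F.kind = .W ∨ F.kind = .P) (hN : N ≤ K.length + 2)
    (hn : 4 ≤ n) {α β : List ℕ} {x y : ℕ} (hβ : k.arity ≤ β.length)
    (h : Contr.IsComplete (⟨k, α ++ x :: y :: β⟩ :: K)) :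
    cls S (⟨k, α ++ x :: y :: β⟩ :: K) = cls S (⟨k, α ++ y :: x :: β⟩ :: K) := by
  obtain ⟨X, hX, hXc⟩ := CurvField.comp_base (n := n) hk
  obtain ⟨m, hm⟩ := Nat.exists_eq_add_of_le hβ
  -- the difference is a field with `K.length + 2` curvature factors, to be contracted completely
  have hY := ((hX.nabla_iterate m).commutator).nabla_iterate α.length
  have hYK := hY.mul_tensorProd hK fun F hF => h.1 F (List.mem_cons_of_mem _ hF)
  set r := k.arity + m + 2 + α.length with hr
  have hidx : (α ++ x :: y :: β).length = r := by simp [hm, hr]; omega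
  have hlab : (Contr.labels (⟨k, α ++ x :: y :: β⟩ :: K)).length = r + K.labels.length := by
    rw [Contr.labels_cons, List.length_append, hidx]
  obtain ⟨J, hJ, hJv⟩ := hYK.exists_linComb hlab h.2
  have hp : (α ++ y :: x :: β).Perm (α ++ x :: y :: β) := (List.Perm.swap x y β).append_left α
  have hC' : Contr.IsComplete (⟨k, α ++ y :: x :: β⟩ :: K) := by
    refine h.of_perm ?_ ?_
    · intro F hF
      rcases List.mem_cons.1 hF with rfl | hF
      · have := h.1 _ List.mem_cons_self
        rw [hp.length_eq]
        exact this
      · exact h.1 F (List.mem_cons_of_mem _ hF)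
    · rw [Contr.labels_cons, Contr.labels_cons]
      exact hp.append_right _
  rw [← sub_eq_zero, cls, cls, ← map_sub, Submodule.mkQ_apply, Submodule.Quotient.mk_eq_zero]
  refine hS ⟨J, fun C hC => ⟨(hJ C hC).1, ?_, (hJ C hC).2.2⟩, fun G ψ υ hψ hυ z hz => ?_⟩
  · rw [(hJ C hC).2.1]; omega
  obtain ⟨e, he⟩ := G.exists_isFrame hz
  have c : ℕ → Fin n := fun _ => ⟨0, by omega⟩
  rw [← hJv G ψ υ z hz e he c, G.evalLin_sub, G.evalLin_single, G.evalLin_single, one_mul, one_mul,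
    G.eval_eq_val ψ υ h he c, G.eval_eq_val ψ υ hC' he c, val,
    val_eq_sumOver (C := (⟨k, α ++ y :: x :: β⟩ :: K : Contr))
      (A := (Contr.labels (⟨k, α ++ x :: y :: β⟩ :: K)).dedup) (List.nodup_dedup _) (fun l => by
        rw [List.mem_dedup, Contr.labels_cons, Contr.labels_cons]
        exact (hp.append_right _).mem_iff.symm), sub_eq_add_neg, neg_eq_neg_one_mul,
    ← sumOver_mul_left, ← sumOver_add]
  refine sumOver_congr (fun d => ?_) c
  have hK0 : prodVal (G.frameComp ψ υ z e) K d =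
      frame e (fun w => G.tensorProd 0 0 K w z) (K.labels.map d) := by
    rw [← G.frame_tensorProd]
    exact frame_congr e fun w _ => G.tensorProd_indep ψ υ hK w z
  have hF0 : ∀ w : List ℕ, w.length = r → G.frameComp ψ υ z e k (w.map d) =
      frame e (fun w => G.nabla^[α.length] (G.nabla (G.nabla (G.nabla^[m] (X G)))) w z) (w.map d) := by
    intro w hw
    refine frame_congr e fun w' hw' => ?_
    rw [G.comp_indep ψ υ hk, hXc G (m + 2 + α.length) w' (by
      rw [hw', List.length_map, hw]; omega) z hz, add_comm _ α.length, Function.iterate_add_apply,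
      add_comm m 2, Function.iterate_add_apply]
    rfl
  rw [prodVal_cons, prodVal_cons, hK0, Contr.labels_cons,
    show ((⟨k, α ++ x :: y :: β⟩ : Factor).idx ++ K.labels).map d =
      (α ++ x :: y :: β).map d ++ K.labels.map d from List.map_append]
  have e1 := frame_mul e (fun w => G.nabla^[α.length] (fun v x =>
    G.nabla (G.nabla (G.nabla^[m] (X G))) v x -
      G.nabla (G.nabla (G.nabla^[m] (X G))) (swapAt 0 v) x) w z)
    (fun w => G.tensorProd 0 0 K w z) ((α ++ x :: y :: β).map d) (K.labels.map d)
  rw [List.length_map, hidx] at e1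
  refine Eq.trans ?_ e1.symm
  have hsm : G.SmoothComp (k.arity + m + 2) (G.nabla (G.nabla (G.nabla^[m] (X G)))) :=
    ((hX.nabla_iterate m).nabla.nabla).smooth G
  have e2 : ∀ w : List (Fin n), w.length = r → G.nabla^[α.length] (fun v x =>
    G.nabla (G.nabla (G.nabla^[m] (X G))) v x -
      G.nabla (G.nabla (G.nabla^[m] (X G))) (swapAt 0 v) x) w z =
      G.nabla^[α.length] (G.nabla (G.nabla (G.nabla^[m] (X G)))) w z + (-1) *
      G.nabla^[α.length] (G.nabla (G.nabla (G.nabla^[m] (X G)))) (swapAt (0 + α.length) w) z := by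
    intro w hw
    have a1 := G.nabla_iterate_add hsm ((hsm.swapAt 0).smul (-1)) α.length w hw z hz
    have a2 := G.nabla_iterate_smul (hsm.swapAt 0) (-1) α.length w hw z hz
    have a3 := G.nabla_iterate_swapAt (r := k.arity + m + 2) (G.nabla (G.nabla (G.nabla^[m] (X G))))
      0 α.length w hw z hz
    rw [a2, a3] at a1
    rw [← a1]
    refine G.nabla_iterate_congr α.length (r := k.arity + m + 2) (fun v hv y hy => ?_) w hw z hz
    ring
  rw [frame_congr e (fun w hw => e2 w (by rw [hw, List.length_map, hidx])), frame_add, frame_smul,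
    frame_swapAt e (fun w => G.nabla^[α.length] (G.nabla (G.nabla (G.nabla^[m] (X G)))) w z)]
  have hF1 := hF0 _ hidx
  have hF2 := hF0 (α ++ y :: x :: β) (by rw [hp.length_eq, hidx])
  have e3 : swapAt (0 + α.length) ((α ++ x :: y :: β).map d) = (α ++ y :: x :: β).map d := by
    rw [List.map_append, ← List.length_map (f := d), LocalMetric.swapAt_append_add]
    simp
  rw [e3, ← hF1, ← hF2]
  ring

/-- Derivative indices may be permuted modulo longer contractions. -/
theorem cls_deriv_perm (hS : longPart n N ≤ S) {k : Kind} (hk : k = .R ∨ k = .W ∨ k = .P)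
    {K : Contr} (hK : ∀ F ∈ K, F.kind = .R ∨ F.kind = .W ∨ F.kind = .P) (hN : N ≤ K.length + 2)
    (hn : 4 ≤ n) {l l' : List ℕ} (hl : l.Perm l') {β : List ℕ} (hβ : k.arity ≤ β.length)
    (h : Contr.IsComplete (⟨k, l ++ β⟩ :: K)) :
    cls S (⟨k, l ++ β⟩ :: K) = cls S (⟨k, l' ++ β⟩ :: K) := by
  suffices H : ∀ α : List ℕ, Contr.IsComplete (⟨k, α ++ l ++ β⟩ :: K) →
      cls S (⟨k, α ++ l ++ β⟩ :: K) = cls S (⟨k, α ++ l' ++ β⟩ :: K) from H [] h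
  clear h
  induction hl with
  | nil => intros; rfl
  | cons a _ ih =>
    intro α h
    have := ih (α ++ [a]) (by simpa using h)
    simpa using this
  | swap a b l =>
    intro α h
    have := cls_deriv_swap hS hk hK hN hn (α := α) (β := l ++ β) (x := b) (y := a)
      (by simp; omega) (by simpa using h)
    simpa using this
  | @trans l₁ l₂ l₃ h1 h2 i1 i2 =>
    intro α h
    refine (i1 α h).trans (i2 α ?_)
    have hp : (α ++ l₂ ++ β).Perm (α ++ l₁ ++ β) := (h1.symm.append_left α).append_right β
    refine h.of_perm ?_ ?_
    · intro F hF
      rcases List.mem_cons.1 hF with rfl | hF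
      · simp only [List.length_append]; omega
      · exact h.1 F (List.mem_cons_of_mem _ hF)
    · rw [Contr.labels_cons, Contr.labels_cons]
      exact hp.append_right _

end Commute
end RiemContr

namespace RiemContr

/-! ### The second Bianchi identity for the Weyl tensor in a contraction -/

section SecondBianchi

variable {n N : ℕ} {S : Submodule ℝ LinComb}

/-- A Kronecker delta in a sum over all indices is absorbed by identifying two names. -/
theorem sumOver_delta_prodVal (φ : Kind → List (Fin n) → ℝ) {A : List ℕ} {x y : ℕ}
    (hxy : x ≠ y) {C : Contr} (h : ∀ l, l ∈ A ↔ l ∈ x :: y :: C.labels) (c : ℕ → Fin n) :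
    sumOver A (fun d => (if d x = d y then 1 else 0) * prodVal φ C d) c =
      sumOver (A.erase x) (prodVal φ (C.relabel (mergeLabel x y))) c := by
  have hx : x ∈ A := (h x).2 (by simp)
  have hp : A.Perm (A.erase x ++ [x]) :=
    (List.perm_cons_erase hx).trans (List.perm_append_comm (l₁ := [x]) (l₂ := A.erase x))
  rw [sumOver_perm hp, sumOver_append]
  refine sumOver_congr (fun d => ?_) c
  rw [sumOver_delta hxy, prodVal_relabel]

theorem Contr.IsComplete.merge {x y : ℕ} (hxy : x ≠ y) {C : Contr} (hwf : C.WellFormed)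
    (h : ∀ l ∈ x :: y :: C.labels, (x :: y :: C.labels).count l = 2) :
    (C.relabel (mergeLabel x y)).IsComplete := by
  refine ⟨hwf.relabel _, fun l hl => ?_⟩
  rw [Contr.labels_relabel] at hl ⊢
  have hx := h x (by simp)
  have hy := h y (by simp)
  simp only [List.count_cons_self, List.count_cons_of_ne hxy, List.count_cons_of_ne hxy.symm] at hx hy
  rw [count_map_mergeLabel hxy]
  have hlx : l ≠ x := by
    rintro rfl
    rw [← List.count_pos_iff, count_map_mergeLabel hxy] at hl
    simp at hl
  rw [if_neg hlx]
  split_ifs with hly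
  · omega
  · have hl' : l ∈ C.labels := by
      obtain ⟨l', hl', rfl⟩ := List.mem_map.1 hl
      by_cases hl'x : l' = x
      · simp [mergeLabel, hl'x] at hly
      · simpa [mergeLabel, hl'x] using hl'
    have := h l (by simp [hl'])
    rwa [List.count_cons_of_ne (Ne.symm hlx), List.count_cons_of_ne (Ne.symm hly)] at this

theorem mem_labels_merge {x y : ℕ} (hxy : x ≠ y) {C : Contr} 
    (h : ∀ l ∈ x :: y :: C.labels, (x :: y :: C.labels).count l = 2) (l : ℕ) :
    l ∈ (C.relabel (mergeLabel x y)).labels ↔ l ≠ x ∧ l ∈ x :: y :: C.labels := by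
  have hy := h y (by simp)
  simp only [List.count_cons_self, List.count_cons_of_ne hxy] at hy
  rw [← List.count_pos_iff, Contr.labels_relabel, count_map_mergeLabel hxy]
  split_ifs with h1 h2
  · simp [h1]
  · subst h2
    simp only [ne_eq, h1, not_false_eq_true, List.mem_cons, true_or, or_true, and_self, iff_true]
    omega
  · rw [List.count_pos_iff]
    simp [h1, h2]

/-- The second Bianchi identity for the Weyl tensor in a contraction. The terms with the metric have
two names identified. -/
theorem cls_W_second (hS : longPart n N ≤ S) (hn : 4 ≤ n) {K : Contr} {α : List ℕ} {e a b c d : ℕ}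
    (hnd : [e, a, b, c, d].Nodup)
    (h : Contr.IsComplete (⟨.W, α ++ [e, a, b, c, d]⟩ :: K)) :
    let g : ℕ → ℕ → ℕ → ℕ → ℕ → LinComb ⧸ S := fun x y p q r =>
      cls S (Contr.relabel (mergeLabel x y) (⟨.P, α ++ [p, q, r]⟩ :: K))
    cls S (⟨.W, α ++ [e, a, b, c, d]⟩ :: K) + cls S (⟨.W, α ++ [a, b, e, c, d]⟩ :: K)
      + cls S (⟨.W, α ++ [b, e, a, c, d]⟩ :: K) =
    (g a d e b c - g a d b e c) - (g a c e b d - g a c b e d) + (g b d a e c - g b d e a c)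
      - (g b c a e d - g b c e a d) + (g e d b a c - g e d a b c) - (g e c b a d - g e c a b d) := by
  intro g
  set A := (Contr.labels (⟨.W, α ++ [e, a, b, c, d]⟩ :: K)).dedup with hA
  have hK : K.WellFormed := fun F hF => h.1 F (List.mem_cons_of_mem _ hF)
  have hT : ∀ v : List ℕ, v.Perm [e, a, b, c, d] → Contr.IsComplete (⟨.W, α ++ v⟩ :: K) ∧
      ∀ (φ : Kind → List (Fin n) → ℝ) (x : ℕ → Fin n), val φ (⟨.W, α ++ v⟩ :: K) x =
        sumOver A (fun y => φ .W (α.map y ++ v.map y) * prodVal φ K y) x := by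
    intro v hv
    have hp : (Contr.labels (⟨.W, α ++ v⟩ :: K)).Perm
        (Contr.labels (⟨.W, α ++ [e, a, b, c, d]⟩ :: K)) := by
      rw [Contr.labels_cons, Contr.labels_cons]
      exact (hv.append_left α).append_right _
    refine ⟨h.of_perm ?_ hp, fun φ x => ?_⟩
    · intro F hF
      rcases List.mem_cons.1 hF with rfl | hF
      · simp [Kind.arity, hv.length_eq]
      · exact hK F hF
    · rw [val_eq_sumOver (A := A) (List.nodup_dedup _) fun l => by
        rw [hA, List.mem_dedup, hp.mem_iff]]
      refine sumOver_congr (fun y => ?_) x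
      rw [prodVal_cons, List.map_append]
  have hG : ∀ x y p q r : ℕ, [x, y, p, q, r].Perm [e, a, b, c, d] →
      (Contr.relabel (mergeLabel x y) (⟨.P, α ++ [p, q, r]⟩ :: K)).IsComplete ∧
      ∀ (φ : Kind → List (Fin n) → ℝ) (z : ℕ → Fin n),
        val φ (Contr.relabel (mergeLabel x y) (⟨.P, α ++ [p, q, r]⟩ :: K)) z =
        sumOver A (fun f => (if f x = f y then 1 else 0) *
          (φ .P (α.map f ++ [f p, f q, f r]) * prodVal φ K f)) z := by
    intro x y p q r hv
    have hxy : x ≠ y := by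
      have := hv.nodup_iff.2 hnd
      simp only [List.nodup_cons, List.mem_cons] at this
      tauto
    have hp : (x :: y :: Contr.labels (⟨.P, α ++ [p, q, r]⟩ :: K)).Perm
        (Contr.labels (⟨.W, α ++ [e, a, b, c, d]⟩ :: K)) := by
      rw [Contr.labels_cons, Contr.labels_cons, List.append_assoc, List.append_assoc]
      refine List.Perm.trans ?_ ((hv.append_right K.labels).append_left α)
      simp only [List.cons_append, List.nil_append]
      exact ((List.perm_middle (a := x) (l₁ := α) (l₂ := y :: p :: q :: r :: K.labels)).trans
        ((List.perm_middle (a := y) (l₁ := α) (l₂ := p :: q :: r :: K.labels)).cons x)).symm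
    have hcount : ∀ l ∈ x :: y :: Contr.labels (⟨.P, α ++ [p, q, r]⟩ :: K),
        (x :: y :: Contr.labels (⟨.P, α ++ [p, q, r]⟩ :: K)).count l = 2 := by
      intro l hl
      rw [hp.count_eq]
      exact h.2 l (hp.mem_iff.1 hl)
    have hmem : ∀ l, l ∈ A ↔ l ∈ x :: y :: Contr.labels (⟨.P, α ++ [p, q, r]⟩ :: K) := by
      intro l
      rw [hA, List.mem_dedup, hp.mem_iff]
    have hwf : Contr.WellFormed (⟨.P, α ++ [p, q, r]⟩ :: K) := by
      intro F hF
      rcases List.mem_cons.1 hF with rfl | hF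
      · simp [Kind.arity]
      · exact hK F hF
    refine ⟨Contr.IsComplete.merge hxy hwf hcount, fun φ z => ?_⟩
    have hAn : A.Nodup := List.nodup_dedup _
    rw [val_eq_sumOver (hAn.erase x) fun l => by
        rw [hAn.mem_erase_iff, hmem, mem_labels_merge hxy hcount],
      ← sumOver_delta_prodVal φ hxy hmem]
    refine sumOver_congr (fun f => ?_) z
    rw [prodVal_cons, List.map_append]
    rfl
  have p1 : [e, a, b, c, d].Perm [e, a, b, c, d] := List.Perm.refl _
  have p2 : [a, b, e, c, d].Perm [e, a, b, c, d] :=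
    (List.perm_append_comm (l₁ := [a, b]) (l₂ := [e])).append_right [c, d]
  have p3 : [b, e, a, c, d].Perm [e, a, b, c, d] :=
    (List.perm_append_comm (l₁ := [b]) (l₂ := [e, a])).append_right [c, d]
  have q : ∀ {x y p q r : ℕ}, (∀ l, [x, y, p, q, r].count l = [e, a, b, c, d].count l) →
      [x, y, p, q, r].Perm [e, a, b, c, d] := fun h => List.perm_iff_count.2 h
  have g1 := hG a d e b c (q fun l => by simp only [List.count_cons]; omega)
  have g2 := hG a d b e c (q fun l => by simp only [List.count_cons]; omega)
  have g3 := hG a c e b d (q fun l => by simp only [List.count_cons]; omega)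
  have g4 := hG a c b e d (q fun l => by simp only [List.count_cons]; omega)
  have g5 := hG b d a e c (q fun l => by simp only [List.count_cons]; omega)
  have g6 := hG b d e a c (q fun l => by simp only [List.count_cons]; omega)
  have g7 := hG b c a e d (q fun l => by simp only [List.count_cons]; omega)
  have g8 := hG b c e a d (q fun l => by simp only [List.count_cons]; omega)
  have g9 := hG e d b a c (q fun l => by simp only [List.count_cons]; omega)
  have g10 := hG e d a b c (q fun l => by simp only [List.count_cons]; omega)
  have g11 := hG e c b a d (q fun l => by simp only [List.count_cons]; omega)
  have g12 := hG e c a b d (q fun l => by simp only [List.count_cons]; omega)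
  have main := sum_cls_eq_zero hS hn [(1, _), (1, _), (1, _), (-1, _), (1, _), (1, _), (-1, _),
      (-1, _), (1, _), (1, _), (-1, _), (-1, _), (1, _), (1, _), (-1, _)]
    (by
      simp only [List.forall_mem_cons]
      exact ⟨(hT _ p1).1, (hT _ p2).1, (hT _ p3).1, g1.1, g2.1, g3.1, g4.1, g5.1, g6.1, g7.1, g8.1,
        g9.1, g10.1, g11.1, g12.1, by simp⟩)
    (fun φ hφ x => by
      simp only [List.map_cons, List.map_nil, List.sum_cons, List.sum_nil]
      rw [(hT _ p1).2, (hT _ p2).2, (hT _ p3).2, g1.2, g2.2, g3.2, g4.2, g5.2, g6.2, g7.2, g8.2,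
        g9.2, g10.2, g11.2, g12.2]
      simp only [← sumOver_mul_left, ← sumOver_add, add_zero]
      refine (sumOver_congr (fun f => ?_) x).trans (sumOver_zero (R := ℝ) A x)
      have := hφ.W_second (α.map f) (f e) (f a) (f b) (f c) (f d)
      simp only [List.map_cons, List.map_nil]
      linear_combination (prodVal φ K f) * this)
  simp only [List.map_cons, List.map_nil, List.sum_cons, List.sum_nil] at main
  rw [← sub_eq_zero, ← main]
  simp only [g]
  module

end SecondBianchi

/-! ### Normal forms -/

/-- The complete contractions of `τ` factors `∇^{(m)}W` and `∇^{(u)}P`, of weight `-w`, which have fewer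
than `q` factors `∇^{(u)}P`, or exactly `q` of them and at least `a + 1` internal contractions. The
order of the derivatives is arbitrary; a set `T` of names witnesses the internal contractions, so that
the condition is manifestly invariant under permutations of the indices of a factor. -/
structure IsError (τ q a w : ℕ) (C : Contr) : Prop where
  complete : C.IsComplete
  kinds : ∀ F ∈ C, F.kind = .W ∨ F.kind = .P
  len : C.length = τ
  wt : C.wt = w
  small : C.numKind .P < q ∨ C.numKind .P = q ∧
    ∃ T : Finset ℕ, a + 1 ≤ T.card ∧ ∀ l ∈ T, ∃ F ∈ C, F.idx.count l = 2

/-- The derivative indices can be rearranged so that those which repeat another index come first. -/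
theorem exists_perm_append (D t : List ℕ) (ht : t.Nodup) :
    ∃ f r, D.Perm (f ++ r) ∧ (r ++ t).Nodup ∧ ∀ l ∈ f, l ∈ r ++ t := by
  induction D with
  | nil => exact ⟨[], [], by simp, by simpa, by simp⟩
  | cons x D ih =>
    obtain ⟨f, r, h1, h2, h3⟩ := ih
    by_cases hx : x ∈ r ++ t
    · exact ⟨x :: f, r, h1.cons x, h2, by simpa using ⟨by simpa using hx, by simpa using h3⟩⟩
    · refine ⟨f, x :: r, (h1.cons x).trans List.perm_middle.symm, ?_, fun l hl => ?_⟩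
      · exact List.nodup_cons.2 ⟨hx, h2⟩
      · exact List.mem_cons_of_mem _ (h3 l hl)

section Normalize

variable {n N : ℕ} {S : Submodule ℝ LinComb}

theorem Contr.IsComplete.head_perm {F F' : Factor} {K : Contr} (h : Contr.IsComplete (F :: K))
    (hk : F'.kind = F.kind) (hp : F'.idx.Perm F.idx) : Contr.IsComplete (F' :: K) := by
  refine h.of_perm ?_ ?_
  · intro G hG
    rcases List.mem_cons.1 hG with rfl | hG
    · rw [hk, hp.length_eq]; exact h.1 _ List.mem_cons_self
    · exact h.1 G (List.mem_cons_of_mem _ hG)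
  · rw [Contr.labels_cons, Contr.labels_cons]
    exact hp.append_right _

theorem eq_zero_of_eq_neg {M : Type*} [AddCommGroup M] [Module ℝ M] {x : M} (h : x = -x) : x = 0 := by
  have h2 : (2 : ℝ) • x = 0 := by rw [two_smul]; nth_rewrite 2 [h]; simp
  exact (smul_eq_zero.1 h2).resolve_left two_ne_zero

/-- A factor `∇^{(m)}W` with a contraction between two of its internal indices vanishes. -/
theorem cls_W_eq_zero (hS : longPart n N ≤ S) (hn : 4 ≤ n) {K : Contr} {α : List ℕ} {a b c d : ℕ}
    (h : Contr.IsComplete (⟨.W, α ++ [a, b, c, d]⟩ :: K)) (hnd : ¬ [a, b, c, d].Nodup) :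
    cls S (⟨.W, α ++ [a, b, c, d]⟩ :: K) = 0 := by
  have hperm : ∀ v : List ℕ, v.Perm [a, b, c, d] → Contr.IsComplete (⟨.W, α ++ v⟩ :: K) :=
    fun v hv => h.head_perm rfl (hv.append_left α)
  have h1 : [b, a, c, d].Perm [a, b, c, d] := List.Perm.swap a b _
  have h2 : [a, b, d, c].Perm [a, b, c, d] := ((List.Perm.swap c d []).cons b).cons a
  have h3 : [b, a, d, c].Perm [a, b, c, d] := (List.Perm.swap a b _).trans h2
  have hcases : a = b ∨ c = d ∨ b = d ∨ a = c ∨ a = d ∨ b = c := by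
    by_contra hcon
    apply hnd
    push Not at hcon
    simp only [List.nodup_cons, List.mem_cons, List.not_mem_nil, or_false, not_or]
    tauto
  rcases hcases with rfl | rfl | rfl | rfl | rfl | rfl
  · exact eq_zero_of_eq_neg (cls_W_left hS hn h)
  · exact eq_zero_of_eq_neg (cls_W_right hS hn h)
  · exact cls_W_trace hS hn h
  · rw [cls_W_left hS hn h, cls_W_right hS hn (hperm _ h1), cls_W_trace hS hn (hperm _ h3)]
    simp
  · rw [cls_W_left hS hn h, cls_W_trace hS hn (hperm _ h1)]
    simp
  · rw [cls_W_right hS hn h, cls_W_trace hS hn (hperm _ h2)]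
    simp

theorem exists_append_four {l : List ℕ} (h : 4 ≤ l.length) :
    ∃ α a b c d, l = α ++ [a, b, c, d] := by
  obtain ⟨w1, w2, rfl, h1, h2⟩ := LocalMetric.exists_append_of_length (w := l) (m := l.length - 4)
    (k := 4) (by omega)
  match w2, h2 with
  | [a, b, c, d], _ => exact ⟨w1, a, b, c, d, rfl⟩

theorem exists_append_two {l : List ℕ} (h : 2 ≤ l.length) :
    ∃ α a b, l = α ++ [a, b] := by
  obtain ⟨w1, w2, rfl, h1, h2⟩ := LocalMetric.exists_append_of_length (w := l) (m := l.length - 2)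
    (k := 2) (by omega)
  match w2, h2 with
  | [a, b], _ => exact ⟨w1, a, b, rfl⟩

/-- Modulo longer contractions, a factor `∇^{(m)}W` or `∇^{(u)}P` vanishes or can be brought into the
second form by a permutation of its indices. -/
theorem cls_normalize_head (hS : longPart n N ≤ S) (hn : 4 ≤ n) {F : Factor} {K : Contr}
    (h : Contr.IsComplete (F :: K)) (hk : ∀ G ∈ (F :: K : Contr), G.kind = .W ∨ G.kind = .P)
    (hN : N ≤ K.length + 2) :
    cls S (F :: K) = 0 ∨ ∃ F' : Factor, F'.IsWeylForm ∧ F'.kind = F.kind ∧ F'.idx.Perm F.idx ∧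
      cls S (F :: K) = cls S (F' :: K) := by
  have hK : ∀ G ∈ K, G.kind = .R ∨ G.kind = .W ∨ G.kind = .P :=
    fun G hG => Or.inr (hk G (List.mem_cons_of_mem _ hG))
  have hl := h.1 F List.mem_cons_self
  -- permute the derivative indices, once the internal indices are distinct
  have main : ∀ (k : Kind) (D t : List ℕ), (k = .W ∨ k = .P) → t.length = k.arity → t.Nodup →
      Contr.IsComplete (⟨k, D ++ t⟩ :: K) → ∃ F' : Factor, F'.IsWeylForm ∧ F'.kind = k ∧
        F'.idx.Perm (D ++ t) ∧ cls S (⟨k, D ++ t⟩ :: K) = cls S (F' :: K) := by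
    intro k D t hk' ht hnd hc
    obtain ⟨f, r, h1, h2, h3⟩ := exists_perm_append D t hnd
    refine ⟨⟨k, f ++ r ++ t⟩, Or.inr ⟨hk', f, r ++ t, by simp, by simp [ht], h2, h3⟩, rfl,
      h1.symm.append_right t, ?_⟩
    exact cls_deriv_perm hS (Or.inr hk') hK hN hn h1 ht.ge hc
  obtain ⟨k, idx⟩ := F
  rcases hk _ List.mem_cons_self with rfl | rfl
  · obtain ⟨α, a, b, c, d, rfl⟩ := exists_append_four hl
    by_cases hnd : [a, b, c, d].Nodup
    · exact Or.inr (main .W α _ (Or.inl rfl) rfl hnd h)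
    · exact Or.inl (cls_W_eq_zero hS hn h hnd)
  · obtain ⟨α, a, b, rfl⟩ := exists_append_two hl
    right
    by_cases hab : a = b
    · subst hab
      rcases List.eq_nil_or_concat α with rfl | ⟨α, e, rfl⟩
      · exact ⟨⟨.P, [a, a]⟩, Or.inl ⟨rfl, a, rfl⟩, rfl, List.Perm.refl _, rfl⟩
      · -- `∇_e P^a_a = ∇^a P_{ae}` removes the contraction between the two internal indices
        simp only [List.concat_eq_append, List.append_assoc, List.cons_append,
          List.nil_append] at h ⊢
        have hp : (α ++ [a, a, e]).Perm (α ++ [e, a, a]) :=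
          (List.perm_append_comm (l₁ := [a, a]) (l₂ := [e])).append_left α
        have hc := h.head_perm (F' := ⟨.P, α ++ [a, a, e]⟩) rfl hp
        have hae : a ≠ e := by
          have := (hc.of_internal (perm_pair_middle α [e] a)).1
          rintro rfl
          simp at this
        obtain ⟨F', h1, h2, h3, h4⟩ := main .P (α ++ [a]) [a, e] (Or.inr rfl) rfl (by simpa using hae)
          (by simpa using hc)
        refine ⟨F', h1, h2, h3.trans (by simpa using hp), ?_⟩
        rw [cls_P_div hS hn h, ← h4]
        simp
    · exact main .P α [a, b] (Or.inr rfl) rfl (by simpa using hab) h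

/-- Modulo longer contractions, a contraction of factors `∇^{(m)}W` and `∇^{(u)}P` vanishes or can be
brought into the second form, factor by factor; the factors `K₁` are already treated. -/
theorem cls_normalize (hS : longPart n N ≤ S) (hn : 4 ≤ n) (K₂ : Contr) :
    ∀ K₁ : Contr, Contr.IsComplete (K₁ ++ K₂) → (∀ G ∈ K₁ ++ K₂, G.kind = .W ∨ G.kind = .P) →
      N ≤ (K₁ ++ K₂).length + 1 → cls S (K₁ ++ K₂) = 0 ∨ ∃ K₂' : Contr,
        List.Forall₂ (fun F F' : Factor => F'.IsWeylForm ∧ F'.kind = F.kind ∧ F'.idx.Perm F.idx) K₂ K₂'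
        ∧ Contr.IsComplete (K₁ ++ K₂') ∧ cls S (K₁ ++ K₂) = cls S (K₁ ++ K₂') := by
  induction K₂ with
  | nil => exact fun K₁ h _ _ => Or.inr ⟨[], List.Forall₂.nil, h, rfl⟩
  | cons F K₂ ih =>
    intro K₁ h hk hN
    have hp : (K₁ ++ F :: K₂).Perm (F :: (K₁ ++ K₂)) := List.perm_middle
    have hc := h.perm hp.symm
    rw [cls_perm hS hn h hp]
    rcases cls_normalize_head hS hn hc (fun G hG => hk G (hp.mem_iff.2 hG))
      (by rw [hp.length_eq] at hN; simpa using hN) with h0 | ⟨F', h1, h2, h3, h4⟩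
    · exact Or.inl h0
    · rw [h4]
      have hc' := hc.head_perm h2 h3
      have hp' : (F' :: (K₁ ++ K₂)).Perm (K₁ ++ [F'] ++ K₂) := by
        rw [List.append_assoc]; exact List.perm_middle.symm
      rw [cls_perm hS hn hc' hp']
      rcases ih (K₁ ++ [F']) (hc'.perm hp'.symm) (fun G hG => by
        rcases List.mem_cons.1 (hp'.mem_iff.2 hG) with rfl | hG
        · rw [h2]; exact hk F (by simp)
        · exact hk G (hp.mem_iff.2 (List.mem_cons_of_mem _ hG))) (by
        rw [← hp'.length_eq]; simpa [hp.length_eq] using hN) with h0 | ⟨K₂', h5, h6, h7⟩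
      · exact Or.inl h0
      · right
        refine ⟨F' :: K₂', List.Forall₂.cons ⟨h1, h2, h3⟩ h5, by simpa using h6, ?_⟩
        rw [h7]; simp

end Normalize

end RiemContr

namespace RiemContr

/-! ### The error terms -/

/-- A space of linear combinations of contractions which contains the contractions `C` with
`IsError τ q a w C` and all linear combinations equal to contractions of length at least `τ + 1`. -/
structure ErrorSpace (n τ q a w : ℕ) (S : Submodule ℝ LinComb) : Prop where
  long : longPart n (τ + 1) ≤ S
  cls_eq_zero : ∀ C, IsError τ q a w C → cls S C = 0

/-- Contractions in the second form with fewer than `q` factors `∇^{(u)}P`. -/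
def fewSchouten (τ q w : ℕ) : Set Contr :=
  {C | C.IsComplete ∧ C.IsWeylForm τ ∧ C.wt = w ∧ C.numKind .P < q}

/-- Contractions in the second form with `q` factors `∇^{(u)}P` and at least `a + 1` internal
contractions. -/
def manyInternal (τ q a w : ℕ) : Set Contr :=
  {C | C.IsComplete ∧ C.IsWeylForm τ ∧ C.wt = w ∧ C.numKind .P = q ∧
    a + 1 ≤ C.delta .W + C.delta .P}

/-- The span of the contractions in the second form with fewer than `q` factors `∇^{(u)}P` or with `q`
such factors and at least `a + 1` internal contractions, together with the longer contractions. -/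
noncomputable def errorSpace (n τ q a w : ℕ) : Submodule ℝ LinComb :=
  longPart n (τ + 1) ⊔ (Finsupp.supported ℝ ℝ (fewSchouten τ q w) ⊔
    Finsupp.supported ℝ ℝ (manyInternal τ q a w))

theorem card_le_delta {C : Contr} (hk : ∀ F ∈ C, F.kind = .W ∨ F.kind = .P) {T : Finset ℕ}
    (hT : ∀ l ∈ T, ∃ F ∈ C, F.idx.count l = 2) : T.card ≤ C.delta .W + C.delta .P := by
  induction C generalizing T with
  | nil =>
    have : T = ∅ := Finset.eq_empty_of_forall_notMem fun l hl => by
      obtain ⟨F, hF, _⟩ := hT l hl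
      simp at hF
    simp [this]
  | cons F C ih =>
    have h1 : Contr.delta .W (F :: C) + Contr.delta .P (F :: C) =
        F.numInternal + (Contr.delta .W C + Contr.delta .P C) := by
      rcases hk F List.mem_cons_self with h | h <;> simp [Contr.delta, h] <;> ring
    rw [h1, ← Finset.card_filter_add_card_filter_not (s := T) (fun l => F.idx.count l = 2)]
    refine Nat.add_le_add ?_ (ih (fun F' h => hk F' (List.mem_cons_of_mem _ h)) fun l hl => ?_)
    · refine Finset.card_le_card fun l hl => ?_
      have h2 := (Finset.mem_filter.1 hl).2
      refine Finset.mem_filter.2 ⟨?_, h2⟩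
      rw [List.mem_toFinset, ← List.count_pos_iff, h2]
      norm_num
    · obtain ⟨h2, h3⟩ := Finset.mem_filter.1 hl
      obtain ⟨F', hF', h4⟩ := hT l h2
      rcases List.mem_cons.1 hF' with rfl | hF'
      · exact absurd h4 h3
      · exact ⟨F', hF', h4⟩

theorem Factor.wt_eq_of_perm {F F' : Factor} (hk : F'.kind = F.kind) (hp : F'.idx.Perm F.idx) :
    F'.wt = F.wt := by
  unfold Factor.wt
  rw [hk, hp.length_eq]

theorem errorSpace_spec {n : ℕ} (hn : 4 ≤ n) (τ q a w : ℕ) :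
    ErrorSpace n τ q a w (errorSpace n τ q a w) := by
  have hlong : longPart n (τ + 1) ≤ errorSpace n τ q a w := le_sup_left
  refine ⟨hlong, fun C hC => ?_⟩
  rcases cls_normalize hlong hn C [] hC.complete hC.kinds (by simp [hC.len]) with h | ⟨C', h1, h2, h3⟩
  · exact h
  refine h3.trans ?_
  simp only [List.nil_append] at h2 ⊢
  have hlen : C'.length = C.length := h1.length_eq.symm
  have hform : ∀ F ∈ C', F.IsWeylForm := by
    clear h2 h3 hlen hC
    induction h1 with
    | nil => simp
    | cons h _ ih => exact List.forall_mem_cons.2 ⟨h.1, ih⟩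
  have hkinds : ∀ F ∈ C', F.kind = .W ∨ F.kind = .P := by
    intro F hF
    rcases hform F hF with h | h
    exacts [Or.inr h.1, h.1]
  have hwt : C'.wt = C.wt := by
    clear h2 h3 hlen hC hform hkinds
    unfold Contr.wt
    induction h1 with
    | nil => rfl
    | cons h _ ih => simp [ih, Factor.wt_eq_of_perm h.2.1 h.2.2]
  have hnum : C'.numKind .P = C.numKind .P := by
    clear h2 h3 hlen hC hform hkinds hwt
    unfold Contr.numKind
    induction h1 with
    | nil => rfl
    | cons h _ ih => simp [List.countP_cons, ih, h.2.1]
  rw [cls, Submodule.mkQ_apply, Submodule.Quotient.mk_eq_zero]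
  refine Submodule.mem_sup_right ?_
  have hW : Contr.IsWeylForm τ C' := ⟨by rw [hlen, hC.len], hform⟩
  rcases hC.small with h4 | ⟨h4, T, hT, hT'⟩
  · refine Submodule.mem_sup_left (Finsupp.single_mem_supported ℝ _ ?_)
    exact ⟨h2, hW, by rw [hwt, hC.wt], by rw [hnum]; exact h4⟩
  · refine Submodule.mem_sup_right (Finsupp.single_mem_supported ℝ _ ?_)
    refine ⟨h2, hW, by rw [hwt, hC.wt], by rw [hnum]; exact h4, hT.trans (card_le_delta hkinds ?_)⟩
    have hTC : ∀ l, (∃ F ∈ C, F.idx.count l = 2) → ∃ F ∈ C', F.idx.count l = 2 := by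
      clear h2 h3 hlen hC hform hkinds hwt hnum h4 hT' hW
      intro l
      induction h1 with
      | nil => exact id
      | @cons F F' _ _ h _ ih =>
        rintro ⟨G, hG, hl⟩
        rcases List.mem_cons.1 hG with rfl | hG
        · exact ⟨F', List.mem_cons_self, by rw [h.2.2.count_eq, hl]⟩
        · obtain ⟨G', hG', hl'⟩ := ih ⟨G, hG, hl⟩
          exact ⟨G', List.mem_cons_of_mem _ hG', hl'⟩
    exact fun l hl => hTC l (hT' l hl)

theorem mem_errorSpace {n τ q a w : ℕ} {L : LinComb} (h : L ∈ errorSpace n τ q a w) :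
    ∃ D₁ D₂ : LinComb, (∀ C ∈ D₁.support, C ∈ fewSchouten τ q w) ∧
      (∀ C ∈ D₂.support, C ∈ manyInternal τ q a w) ∧ L - (D₁ + D₂) ∈ longPart n (τ + 1) := by
  obtain ⟨Z, hZ, D, hD, rfl⟩ := Submodule.mem_sup.1 h
  obtain ⟨D₁, h1, D₂, h2, rfl⟩ := Submodule.mem_sup.1 hD
  refine ⟨D₁, D₂, fun C hC => (Finsupp.mem_supported ℝ _).1 h1 hC,
    fun C hC => (Finsupp.mem_supported ℝ _).1 h2 hC, ?_⟩
  rwa [add_sub_cancel_right]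

/-! ### The symmetries of a weylified factor modulo error terms -/

theorem Contr.wt_cons (F : Factor) (K : Contr) : Contr.wt (F :: K) = F.wt + K.wt := by
  simp [Contr.wt]

theorem Contr.numKind_cons (k : Kind) (F : Factor) (K : Contr) :
    Contr.numKind k (F :: K) = K.numKind k + if F.kind = k then 1 else 0 := by
  simp [Contr.numKind, List.countP_cons]

/-- Insert a pair of new contracted indices. -/
theorem Contr.IsComplete.insert_internal {F F' : Factor} {K : Contr} {v : ℕ}
    (h : Contr.IsComplete (F :: K)) (hv : v ∉ Contr.labels (F :: K))
    (hF : F'.kind.arity ≤ F'.idx.length) (hp : F'.idx.Perm (v :: v :: F.idx)) :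
    Contr.IsComplete (F' :: K) := by
  have hl : (Contr.labels (F' :: K)).Perm (v :: v :: Contr.labels (F :: K)) := by
    rw [Contr.labels_cons, Contr.labels_cons]
    exact hp.append_right _
  refine ⟨fun G hG => ?_, fun l hl' => ?_⟩
  · rcases List.mem_cons.1 hG with rfl | hG
    exacts [hF, h.1 G (List.mem_cons_of_mem _ hG)]
  · rw [hl.count_eq]
    by_cases hvl : v = l
    · subst hvl
      simp only [List.count_cons_self, List.count_eq_zero_of_not_mem hv]
    · rw [List.count_cons_of_ne hvl, List.count_cons_of_ne hvl]
      refine h.2 l ?_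
      have := hl.mem_iff.1 hl'
      simpa [Ne.symm hvl] using this

section

variable {n N : ℕ} {S : Submodule ℝ LinComb}

theorem three_lt_cast {n : ℕ} (hn : 4 ≤ n) : (n : ℝ) - 3 ≠ 0 := by
  have : (4 : ℝ) ≤ n := by exact_mod_cast hn
  linarith

/-- The Cotton tensor is a multiple of the divergence of the Weyl tensor. The name `v` is that of the
new pair of contracted indices. -/
theorem cls_cotton (hS : longPart n N ≤ S) (hn : 4 ≤ n) {K : Contr} {α : List ℕ} {x y z v : ℕ}
    (h : Contr.IsComplete (⟨.P, α ++ [x, y, z]⟩ :: K))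
    (hv : v ∉ Contr.labels (⟨.P, α ++ [x, y, z]⟩ :: K)) :
    Contr.IsComplete (⟨.W, α ++ [v, v, z, x, y]⟩ :: K) ∧
    cls S (⟨.P, α ++ [x, y, z]⟩ :: K) - cls S (⟨.P, α ++ [y, x, z]⟩ :: K) =
      ((n : ℝ) - 3)⁻¹ • cls S (⟨.W, α ++ [v, v, z, x, y]⟩ :: K) := by
  have hc : Contr.IsComplete (⟨.W, α ++ [v, v, z, x, y]⟩ :: K) := by
    refine h.insert_internal hv (by simp [Kind.arity]) ?_
    refine (perm_pair_middle α [z, x, y] v).trans ?_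
    refine ((List.Perm.append_left α ?_).cons v).cons v
    exact List.perm_append_comm (l₁ := [z]) (l₂ := [x, y])
  have hp : (α ++ [y, x, z]).Perm (α ++ [x, y, z]) := (List.Perm.swap x y [z]).append_left α
  have hp1 := cls_P_symm hS hn (α := α ++ [x]) (a := y) (b := z) (K := K) (by simpa using h)
  have hp2 := cls_P_symm hS hn (α := α ++ [y]) (a := x) (b := z) (K := K) (by
    simpa using h.head_perm (F' := ⟨.P, α ++ [y, x, z]⟩) rfl hp)
  simp only [List.append_assoc, List.cons_append, List.nil_append] at hp1 hp2
  refine ⟨hc, ?_⟩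
  rw [cls_W_div hS hn hc, smul_smul, inv_mul_cancel₀ (three_lt_cast hn), one_smul, hp1, hp2]

/-- Modulo error terms a factor `∇^{(u)}P` is symmetric in all its indices: the derivatives commute, the
Schouten tensor is symmetric, and the Cotton tensor is a divergence of the Weyl tensor, which leaves
one factor `∇^{(u)}P` less. -/
theorem ErrorSpace.cls_P_perm {τ q a w : ℕ} (hS : ErrorSpace n τ q a w S) (hn : 4 ≤ n) {K : Contr}
    (hK : ∀ F ∈ K, F.kind = .W ∨ F.kind = .P) (hlen : K.length + 1 = τ)
    {l l' : List ℕ} (hl : l.Perm l') (hwt : l.length + K.wt = w) (hq : K.numKind .P < q)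
    (h : Contr.IsComplete (⟨.P, l⟩ :: K)) : cls S (⟨.P, l⟩ :: K) = cls S (⟨.P, l'⟩ :: K) := by
  have hK' : ∀ G ∈ K, G.kind = .R ∨ G.kind = .W ∨ G.kind = .P := fun G hG => Or.inr (hK G hG)
  suffices H : ∀ α : List ℕ, (α ++ l).length + K.wt = w → Contr.IsComplete (⟨.P, α ++ l⟩ :: K) →
      cls S (⟨.P, α ++ l⟩ :: K) = cls S (⟨.P, α ++ l'⟩ :: K) from H [] hwt h
  clear h hwt
  induction hl with
  | nil => intros; rfl
  | cons a _ ih =>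
    intro α hwt h
    have := ih (α ++ [a]) (by simpa using hwt) (by simpa using h)
    simpa using this
  | @trans l₁ l₂ l₃ h1 h2 i1 i2 =>
    intro α hwt h
    have hp : (α ++ l₂).Perm (α ++ l₁) := h1.symm.append_left α
    refine (i1 α hwt h).trans (i2 α ?_ (h.head_perm rfl hp))
    rw [hp.length_eq, hwt]
  | swap x y l =>
    intro α hwt h
    rcases l with _ | ⟨z, l⟩
    · exact cls_P_symm hS.long hn h
    rcases l with _ | ⟨z', l⟩
    · obtain ⟨v, hv⟩ := exists_fresh (Contr.labels (⟨.P, α ++ [y, x, z]⟩ :: K))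
      obtain ⟨h1, h2⟩ := cls_cotton hS.long hn h hv
      rw [hS.cls_eq_zero _ ⟨h1, ?_, ?_, ?_, Or.inl ?_⟩, smul_zero, sub_eq_zero] at h2
      · exact h2
      · exact List.forall_mem_cons.2 ⟨Or.inl rfl, hK⟩
      · simpa using hlen
      · rw [Contr.wt_cons, ← hwt]
        simp [Factor.wt]
      · rw [Contr.numKind_cons]
        simpa using hq
    · exact cls_deriv_swap hS.long (Or.inr (Or.inr rfl)) hK' (by omega) hn (by simp [Kind.arity]) h

end

end RiemContr

namespace RiemContr

section

variable {n N : ℕ} {S : Submodule ℝ LinComb}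

theorem Contr.relabel_eq_self {σ : ℕ → ℕ} {C : Contr} (h : ∀ l ∈ C.labels, σ l = l) :
    C.relabel σ = C := by
  unfold Contr.relabel
  refine (List.map_congr_left fun F hF => ?_).trans (List.map_id C)
  obtain ⟨k, idx⟩ := F
  have : idx.map σ = idx := (List.map_congr_left fun l hl =>
    h l (List.mem_flatMap.2 ⟨_, hF, hl⟩)).trans (List.map_id idx)
  simp [Factor.relabel, this]

/-- The names of the contracted indices are irrelevant. -/
theorem cls_relabel (hS : longPart n N ≤ S) (hn : 4 ≤ n) {σ : ℕ → ℕ} (hσ : Function.Injective σ)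
    {C : Contr} (hC : C.IsComplete) : cls S (C.relabel σ) = cls S C := by
  have hC' : (C.relabel σ).IsComplete := by
    refine ⟨hC.1.relabel σ, fun l hl => ?_⟩
    rw [Contr.labels_relabel] at hl ⊢
    obtain ⟨l, hl', rfl⟩ := List.mem_map.1 hl
    rw [List.count_map_of_injective _ _ hσ, hC.2 l hl']
  have := sum_cls_eq_zero hS hn [(1, C.relabel σ), (-1, C)] (by simpa using ⟨hC', hC⟩)
    (fun φ _ c => by simp [val_relabel hσ, val_indep C (c ∘ σ) c])
  simpa [sub_eq_zero, ← sub_eq_add_neg] using this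

end

/-! ### A weylified curvature factor -/

/-- A factor `∇^{(m)}R` of a contraction in the first form, in which the names of the indices form
the list `Λ`, after `Weylify`: the names in `u` are those of the factors `∇υ`, and `K` consists of
the other factors. -/
structure WeylSlot (n τ q a w : ℕ) (S : Submodule ℝ LinComb) (u Λ : List ℕ) (K : Contr) : Prop where
  err : ErrorSpace n τ q a w S
  dim : 4 ≤ n
  nodup : Λ.Nodup
  complete : Contr.IsComplete (⟨.W, Λ.filter (· ∈ u) ++ Λ⟩ :: K)
  kinds : ∀ F ∈ K, F.kind = .W ∨ F.kind = .P
  len : K.length + 1 = τ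
  wt : (Λ.filter (· ∈ u) ++ Λ).length - 2 + K.wt = w
  num : K.numKind .P = q
  card : a ≤ u.toFinset.card
  internal : ∀ l ∈ u, l ∈ Λ ∨ ∃ F ∈ K, F.idx.count l = 2

/-- The class of the weylified contraction when the indices of the factor `∇^{(m)}R` are
rearranged. -/
noncomputable def slotCls (S : Submodule ℝ LinComb) (u Λ : List ℕ) (K : Contr) (D v : List ℕ) :
    LinComb ⧸ S :=
  cls S (⟨.W, Λ.filter (· ∈ u) ++ D ++ v⟩ :: K)

/-- The constant in `Weylify`, as a function of the internal indices of the factor. -/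
noncomputable def slotCoeff (n : ℕ) (u v : List ℕ) : ℝ :=
  if ∃ l ∈ v, l ∈ u then ((n : ℝ) - 2) / ((n : ℝ) - 3) else 1

namespace WeylSlot

theorem mem_of_perm {Λ D v : List ℕ} (hp : (D ++ v).Perm Λ) {x : ℕ} (hx : x ∈ v) : x ∈ Λ :=
  hp.mem_iff.1 (List.mem_append_right _ hx)

variable {n τ q a w : ℕ} {S : Submodule ℝ LinComb} {u Λ : List ℕ} {K : Contr}
  (h : WeylSlot n τ q a w S u Λ K)

include h

theorem wf : K.WellFormed := fun F hF => h.complete.1 F (List.mem_cons_of_mem _ hF)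

theorem kinds' : ∀ F ∈ K, F.kind = .R ∨ F.kind = .W ∨ F.kind = .P := fun F hF => Or.inr (h.kinds F hF)

theorem complete_of_perm {l : List ℕ} (hl : l.Perm (Λ.filter (· ∈ u) ++ Λ)) :
    Contr.IsComplete (⟨.W, l⟩ :: K) :=
  h.complete.head_perm rfl hl

theorem complete_slot {D v : List ℕ} (hp : (D ++ v).Perm Λ) :
    Contr.IsComplete (⟨.W, Λ.filter (· ∈ u) ++ D ++ v⟩ :: K) := by
  rw [List.append_assoc]
  exact h.complete_of_perm (hp.append_left _)

theorem cls_perm_left {l l' v : List ℕ} (hv : v.length = 4) (hl : l.Perm l')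
    (hp : (l ++ v).Perm (Λ.filter (· ∈ u) ++ Λ)) :
    cls S (⟨.W, l ++ v⟩ :: K) = cls S (⟨.W, l' ++ v⟩ :: K) :=
  cls_deriv_perm h.err.long (Or.inr (Or.inl rfl)) h.kinds' (by have := h.len; omega) h.dim hl hv.ge
    (h.complete_of_perm hp)

theorem slot_perm {D D' v : List ℕ} (hv : v.length = 4) (hp : (D ++ v).Perm Λ) (hD : D.Perm D') :
    slotCls S u Λ K D v = slotCls S u Λ K D' v :=
  h.cls_perm_left hv (hD.append_left _) (by rw [List.append_assoc]; exact hp.append_left _)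

theorem left {D : List ℕ} {a b c d : ℕ} (hp : (D ++ [a, b, c, d]).Perm Λ) :
    slotCls S u Λ K D [a, b, c, d] = - slotCls S u Λ K D [b, a, c, d] :=
  cls_W_left h.err.long h.dim (h.complete_slot hp)

theorem right {D : List ℕ} {a b c d : ℕ} (hp : (D ++ [a, b, c, d]).Perm Λ) :
    slotCls S u Λ K D [a, b, c, d] = - slotCls S u Λ K D [a, b, d, c] :=
  cls_W_right h.err.long h.dim (h.complete_slot hp)

theorem pair {D : List ℕ} {a b c d : ℕ} (hp : (D ++ [a, b, c, d]).Perm Λ) :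
    slotCls S u Λ K D [a, b, c, d] = slotCls S u Λ K D [c, d, a, b] :=
  cls_W_pair h.err.long h.dim (h.complete_slot hp)

theorem first {D : List ℕ} {a b c d : ℕ} (hp : (D ++ [a, b, c, d]).Perm Λ) :
    slotCls S u Λ K D [a, b, c, d] + slotCls S u Λ K D [a, c, d, b]
      + slotCls S u Λ K D [a, d, b, c] = 0 :=
  cls_W_first h.err.long h.dim (h.complete_slot hp)

theorem count_filter (l : ℕ) : (Λ.filter (· ∈ u)).count l = if l ∈ u ∧ l ∈ Λ then 1 else 0 := by
  have hnd : (Λ.filter (· ∈ u)).Nodup := h.nodup.filter _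
  split_ifs with hl
  · exact List.count_eq_one_of_mem hnd (by simp [hl.1, hl.2])
  · refine List.count_eq_zero_of_not_mem fun hm => hl ?_
    simpa [and_comm] using hm

theorem count_all (l : ℕ) : (Λ.filter (· ∈ u) ++ Λ).count l =
    if l ∈ Λ then (if l ∈ u then 2 else 1) else 0 := by
  rw [List.count_append, h.count_filter]
  by_cases h1 : l ∈ Λ
  · rw [List.count_eq_one_of_mem h.nodup h1]
    by_cases h2 : l ∈ u <;> simp [h1, h2]
  · rw [List.count_eq_zero_of_not_mem h1]
    simp [h1]

/-- A contraction which arises from the metric in the second Bianchi identity, when the metric has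
no index which is contracted against a factor `∇υ`, is symmetric modulo error terms: the Cotton
tensor is a divergence, and contains one more internal contraction. -/
theorem merge_symm {α : List ℕ} {x y i j k : ℕ}
    (hp : (α ++ [x, y, i, j, k]).Perm (Λ.filter (· ∈ u) ++ Λ)) (hx : x ∉ u) (hy : y ∉ u)
    (hxy : x ≠ y) :
    cls S (Contr.relabel (mergeLabel x y) (⟨.P, α ++ [i, j, k]⟩ :: K)) =
      cls S (Contr.relabel (mergeLabel x y) (⟨.P, α ++ [j, i, k]⟩ :: K)) := by
  set m := mergeLabel x y with hm
  have hlab : (x :: y :: Contr.labels (⟨.P, α ++ [i, j, k]⟩ :: K)).Perm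
      (Λ.filter (· ∈ u) ++ Λ ++ K.labels) := by
    refine List.Perm.trans ?_ (hp.append_right K.labels)
    rw [Contr.labels_cons, List.append_assoc, List.append_assoc]
    simp only [List.cons_append, List.nil_append]
    exact ((List.perm_middle (a := x) (l₁ := α) (l₂ := y :: i :: j :: k :: K.labels)).trans
      ((List.perm_middle (a := y) (l₁ := α) (l₂ := i :: j :: k :: K.labels)).cons x)).symm
  have hcount : ∀ l ∈ x :: y :: Contr.labels (⟨.P, α ++ [i, j, k]⟩ :: K),
      (x :: y :: Contr.labels (⟨.P, α ++ [i, j, k]⟩ :: K)).count l = 2 := by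
    intro l hl
    rw [hlab.count_eq]
    exact h.complete.2 l (hlab.mem_iff.1 hl)
  have hc := Contr.IsComplete.merge hxy (C := (⟨.P, α ++ [i, j, k]⟩ :: K)) (by
    intro F hF
    rcases List.mem_cons.1 hF with rfl | hF
    · simp [Kind.arity]
    · exact h.wf F hF) hcount
  have e1 : ∀ i j : ℕ, Contr.relabel m (⟨.P, α ++ [i, j, k]⟩ :: K) =
      (⟨.P, α.map m ++ [m i, m j, m k]⟩ :: K.relabel m : Contr) := by
    intro i j
    simp [Contr.relabel, Factor.relabel]
  rw [← hm, e1] at hc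
  rw [e1, e1]
  obtain ⟨v, hv⟩ := exists_fresh (Contr.labels (⟨.P, α.map m ++ [m i, m j, m k]⟩ :: K.relabel m))
  obtain ⟨h1, h2⟩ := cls_cotton h.err.long h.dim hc hv
  have hidx : (α.map m ++ [v, v, m k, m i, m j]).Perm (v :: v :: (α ++ [i, j, k]).map m) := by
    refine (perm_pair_middle (α.map m) [m k, m i, m j] v).trans (List.Perm.cons v (List.Perm.cons v ?_))
    rw [List.map_append]
    exact List.Perm.append_left _ (List.perm_append_comm (l₁ := [m k]) (l₂ := [m i, m j]))
  rw [Contr.labels_cons, List.mem_append, not_or] at hv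
  have hvc : ((α ++ [i, j, k]).map m).count v = 0 := by
    rw [List.count_eq_zero]
    simpa using hv.1
  have hucount : ∀ l ∈ u, (∀ L : List ℕ, (L.map m).count l = L.count l) := by
    intro l hl L
    rw [hm, count_map_mergeLabel hxy, if_neg (by rintro rfl; exact hx hl),
      if_neg (by rintro rfl; exact hy hl)]
  have hT : ∀ l ∈ u, l ∈ Λ → ((α ++ [i, j, k]).map m).count l = 2 := by
    intro l hl hlΛ
    rw [hucount l hl]
    have h3 := h.count_all l
    rw [if_pos hlΛ, if_pos hl, ← hp.count_eq] at h3
    have hlx : x ≠ l := by rintro rfl; exact hx hl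
    have hly : y ≠ l := by rintro rfl; exact hy hl
    rw [List.count_append, List.count_cons_of_ne hlx, List.count_cons_of_ne hly] at h3
    rw [List.count_append, h3]
  have hT' : ∀ l ∈ u, ∀ F ∈ K, F.idx.count l = 2 → (F.relabel m).idx.count l = 2 := by
    intro l hl F _ hF2
    rw [← hF2]
    exact hucount l hl F.idx
  have hvu : v ∉ u := by
    intro hvu
    rcases h.internal v hvu with h3 | ⟨F, hF, h3⟩
    · have := hT v hvu h3
      omega
    · apply hv.2
      rw [Contr.labels, List.mem_flatMap]
      refine ⟨F.relabel m, List.mem_map_of_mem hF, ?_⟩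
      rw [← List.count_pos_iff, hT' v hvu F hF h3]
      norm_num
  -- each name in `u` is that of an internal contraction, and so is the new name `v`
  rw [h.err.cls_eq_zero _ ⟨h1, ?_, ?_, ?_, Or.inr ⟨?_, insert v u.toFinset, ?_, ?_⟩⟩, smul_zero,
    sub_eq_zero] at h2
  · exact h2
  · refine List.forall_mem_cons.2 ⟨Or.inl rfl, fun F hF => ?_⟩
    obtain ⟨F', hF', rfl⟩ := List.mem_map.1 hF
    exact h.kinds F' hF'
  · rw [List.length_cons, Contr.relabel, List.length_map, h.len]
  · have hK : (K.relabel m).wt = K.wt := by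
      unfold Contr.wt Contr.relabel
      rw [List.map_map]
      congr 1
      refine List.map_congr_left fun F _ => ?_
      simp [Function.comp_apply, Factor.wt, Factor.relabel]
    rw [Contr.wt_cons, hK, ← h.wt, ← hp.length_eq]
    simp [Factor.wt]
  · rw [Contr.numKind_cons, ← h.num]
    simp [Contr.numKind, Contr.relabel, List.countP_map, Function.comp_def, Factor.relabel]
    rfl
  · rw [Finset.card_insert_of_notMem (by simpa using hvu)]
    have := h.card
    omega
  · intro l hl
    rcases Finset.mem_insert.1 hl with rfl | hl
    · refine ⟨_, List.mem_cons_self, ?_⟩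
      rw [hidx.count_eq, List.count_cons_self, List.count_cons_self, hvc]
    · have hl : l ∈ u := by simpa using hl
      rcases h.internal l hl with h3 | ⟨F, hF, h3⟩
      · refine ⟨_, List.mem_cons_self, ?_⟩
        have hlv : v ≠ l := by rintro rfl; exact hvu hl
        rw [hidx.count_eq, List.count_cons_of_ne hlv, List.count_cons_of_ne hlv, hT l hl h3]
      · exact ⟨_, List.mem_cons_of_mem _ (List.mem_map_of_mem hF), hT' l hl F hF h3⟩

/-- Two names which are contracted within the factor may be exchanged. -/
theorem slot_swap_names {D v : List ℕ} (hp : (D ++ v).Perm Λ) (hv : v.length = 4) {e b : ℕ}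
    (he : e ∈ u) (hb : b ∈ u) (heΛ : e ∈ Λ) (hbΛ : b ∈ Λ) :
    slotCls S u Λ K D v =
      slotCls S u Λ K (D.map (Equiv.swap e b)) (v.map (Equiv.swap e b)) := by
  set σ := Equiv.swap e b with hσ
  have hc := h.complete_slot hp
  have h1 := cls_relabel h.err.long h.dim σ.injective hc
  -- a name in `u` which occurs in `Λ` occurs twice in this factor, and so in no other factor
  have hK : ∀ l ∈ Contr.labels K, σ l = l := by
    intro l hl
    have hnot : ∀ x ∈ u, x ∈ Λ → l ≠ x := by
      rintro x hx hxΛ rfl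
      have h2 := h.complete.2 l (by rw [Contr.labels_cons]; exact List.mem_append_right _ hl)
      have h3 := h.count_all l
      rw [if_pos hxΛ, if_pos hx] at h3
      rw [Contr.labels_cons, List.count_append, h3] at h2
      have := List.count_pos_iff.2 hl
      omega
    exact Equiv.swap_apply_of_ne_of_ne (hnot e he heΛ) (hnot b hb hbΛ)
  have hf : ((Λ.filter (· ∈ u)).map σ).Perm (Λ.filter (· ∈ u)) := by
    have hnd : (Λ.filter (· ∈ u)).Nodup := h.nodup.filter _
    rw [List.perm_ext_iff_of_nodup (hnd.map σ.injective) hnd]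
    have hmem : ∀ l ∈ Λ.filter (· ∈ u), σ l ∈ Λ.filter (· ∈ u) := by
      intro l hl
      by_cases h1 : l = e
      · rw [h1, hσ, Equiv.swap_apply_left]; simp [hb, hbΛ]
      by_cases h2 : l = b
      · rw [h2, hσ, Equiv.swap_apply_right]; simp [he, heΛ]
      rwa [hσ, Equiv.swap_apply_of_ne_of_ne h1 h2]
    intro l
    constructor
    · intro hl
      obtain ⟨l', hl', rfl⟩ := List.mem_map.1 hl
      exact hmem l' hl'
    · intro hl
      exact List.mem_map.2 ⟨σ l, hmem l hl, by rw [hσ, Equiv.swap_apply_self]⟩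
  have hΛ : (Λ.map σ).Perm Λ := by
    rw [List.perm_ext_iff_of_nodup (h.nodup.map σ.injective) h.nodup]
    have hmem : ∀ l ∈ Λ, σ l ∈ Λ := by
      intro l hl
      by_cases h1 : l = e
      · rw [h1, hσ, Equiv.swap_apply_left]; exact hbΛ
      by_cases h2 : l = b
      · rw [h2, hσ, Equiv.swap_apply_right]; exact heΛ
      rwa [hσ, Equiv.swap_apply_of_ne_of_ne h1 h2]
    intro l
    constructor
    · intro hl
      obtain ⟨l', hl', rfl⟩ := List.mem_map.1 hl
      exact hmem l' hl'
    · intro hl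
      exact List.mem_map.2 ⟨σ l, hmem l hl, by rw [hσ, Equiv.swap_apply_self]⟩
  unfold slotCls
  rw [← h1]
  have h2 : Contr.relabel σ (⟨.W, Λ.filter (· ∈ u) ++ D ++ v⟩ :: K) =
      (⟨.W, (Λ.filter (· ∈ u)).map σ ++ D.map σ ++ v.map σ⟩ :: K : Contr) := by
    have := Contr.relabel_eq_self hK
    unfold Contr.relabel at this
    simp [Contr.relabel, Factor.relabel, this]
  rw [h2]
  refine h.cls_perm_left (by simpa using hv) (hf.append_right _) ?_
  have h3 := (hp.map σ).trans hΛ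
  rw [List.map_append] at h3
  rw [List.append_assoc]
  exact (hf.append_right _).trans (h3.append_left _)


/-- A factor `∇^{(m)}W` vanishes if two antisymmetric indices are contracted against derivatives. -/
theorem eq_zero_of_left {D : List ℕ} {a b c d : ℕ} (hp : (D ++ [a, b, c, d]).Perm Λ) (ha : a ∈ u)
    (hb : b ∈ u) : slotCls S u Λ K D [a, b, c, d] = 0 := by
  have hnd : (D ++ [a, b, c, d]).Nodup := hp.nodup_iff.2 h.nodup
  have h1 := h.slot_swap_names hp rfl ha hb (mem_of_perm hp (by simp)) (mem_of_perm hp (by simp))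
  have hD : D.map (Equiv.swap a b) = D := by
    refine (List.map_congr_left fun l hl => ?_).trans (List.map_id D)
    have := (List.nodup_append.1 hnd).2.2 l hl
    exact Equiv.swap_apply_of_ne_of_ne (this a (by simp)) (this b (by simp))
  have h4 := (List.nodup_append.1 hnd).2.1
  simp only [List.nodup_cons, List.mem_cons, List.not_mem_nil, or_false, not_or] at h4
  rw [hD, List.map_cons, List.map_cons, List.map_cons, List.map_cons, List.map_nil,
    Equiv.swap_apply_left, Equiv.swap_apply_right,
    Equiv.swap_apply_of_ne_of_ne (Ne.symm h4.1.2.1) (Ne.symm h4.2.1.1),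
    Equiv.swap_apply_of_ne_of_ne (Ne.symm h4.1.2.2) (Ne.symm h4.2.1.2), h.left (show (D ++ [b, a, c, d]).Perm Λ from
      (((List.Perm.swap a b _).append_left D)).trans hp)] at h1
  exact eq_zero_of_eq_neg h1

/-- Two of the terms of the second Bianchi identity cancel if the two names which they exchange are
contracted against derivatives. -/
theorem eq_neg_of_swap {D : List ℕ} {e a b c d : ℕ} (hp : (e :: D ++ [a, b, c, d]).Perm Λ)
    (he : e ∈ u) (ha : a ∈ u) :
    slotCls S u Λ K (e :: D) [a, b, c, d] = - slotCls S u Λ K (a :: D) [b, e, c, d] := by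
  have hnd : (e :: D ++ [a, b, c, d]).Nodup := hp.nodup_iff.2 h.nodup
  have h1 := h.slot_swap_names hp rfl he ha (hp.mem_iff.1 (by simp)) (mem_of_perm hp (by simp))
  have hD : D.map (Equiv.swap e a) = D := by
    refine (List.map_congr_left fun l hl => ?_).trans (List.map_id D)
    have h2 := (List.nodup_append.1 hnd).2.2 l (by simp [hl])
    refine Equiv.swap_apply_of_ne_of_ne ?_ (h2 a (by simp))
    have := (List.nodup_cons.1 hnd).1
    rintro rfl
    simp [hl] at this
  have h3 : e ∉ D ++ [a, b, c, d] := (List.nodup_cons.1 hnd).1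
  have h4 := (List.nodup_append.1 hnd).2.1
  simp only [List.nodup_cons, List.mem_cons, List.not_mem_nil, or_false, not_or, List.mem_append]
    at h3 h4
  rw [List.map_cons, hD, List.map_cons, List.map_cons, List.map_cons, List.map_cons, List.map_nil,
    Equiv.swap_apply_left, Equiv.swap_apply_right,
    Equiv.swap_apply_of_ne_of_ne (Ne.symm h3.2.2.1) (Ne.symm h4.1.1),
    Equiv.swap_apply_of_ne_of_ne (Ne.symm h3.2.2.2.1) (Ne.symm h4.1.2.1),
    Equiv.swap_apply_of_ne_of_ne (Ne.symm h3.2.2.2.2) (Ne.symm h4.1.2.2)] at h1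
  rw [h1]
  refine h.left (List.Perm.trans ?_ hp)
  rw [List.perm_iff_count]
  intro l
  simp only [List.count_append, List.count_cons, List.count_nil]
  omega

/-- A factor `∇^{(u)}P` which arises from a divergence of the factor `∇^{(m)}W` is symmetric in its
derivative indices and in its internal indices. -/
theorem cls_P_of_perm {e : ℕ} {l l' : List ℕ} (hl : l.Perm l') {b d : ℕ} 
    (hp : (e :: e :: (l ++ [b, d])).Perm (Λ.filter (· ∈ u) ++ Λ)) :
    cls S (⟨.P, l ++ [b, d]⟩ :: K) = cls S (⟨.P, l' ++ [b, d]⟩ :: K) ∧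
    cls S (⟨.P, l ++ [b, d]⟩ :: K) = cls S (⟨.P, l' ++ [d, b]⟩ :: K) := by
  have h1 := (h.complete.of_internal (F := ⟨.W, Λ.filter (· ∈ u) ++ Λ⟩) hp.symm).2
  have hc : Contr.IsComplete (⟨.P, l ++ [b, d]⟩ :: K) := by
    refine ⟨fun F hF => ?_, fun l' hl' => ?_⟩
    · rcases List.mem_cons.1 hF with rfl | hF
      · simp [Kind.arity]
      · exact h.wf F hF
    · rw [Contr.labels_cons] at hl' ⊢
      exact h1 l' hl'
  have h2 := cls_deriv_perm h.err.long (Or.inr (Or.inr rfl)) h.kinds' (by have := h.len; omega) h.dim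
    hl (β := [b, d]) le_rfl hc
  refine ⟨h2, h2.trans (cls_P_symm h.err.long h.dim (hc.head_perm rfl ?_))⟩
  exact hl.symm.append_right _

/-- The factor as a Cotton tensor, if its first internal index is contracted against a derivative. -/
theorem slot_eq_cotton {D L : List ℕ} {e b c d : ℕ} (hp : (D ++ [e, b, c, d]).Perm Λ)
    (hL : (Λ.filter (· ∈ u) ++ D).Perm (e :: L)) :
    slotCls S u Λ K D [e, b, c, d] = ((n : ℝ) - 3) • (cls S (⟨.P, c :: L ++ [b, d]⟩ :: K)
      - cls S (⟨.P, d :: L ++ [b, c]⟩ :: K)) := by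
  have hL' : (Λ.filter (· ∈ u) ++ D).Perm (L ++ [e]) :=
    hL.trans (List.perm_append_comm (l₁ := [e]) (l₂ := L))
  have hp' : (Λ.filter (· ∈ u) ++ D ++ [e, b, c, d]).Perm (Λ.filter (· ∈ u) ++ Λ) := by
    rw [List.append_assoc]
    exact hp.append_left _
  have e1 : slotCls S u Λ K D [e, b, c, d] = cls S (⟨.W, L ++ [e, e, b, c, d]⟩ :: K) := by
    have := h.cls_perm_left (v := [e, b, c, d]) rfl hL' hp'
    simpa [slotCls] using this
  have hp2 : (L ++ [e, e, b, c, d]).Perm (Λ.filter (· ∈ u) ++ Λ) := by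
    have := (hL'.symm.append_right [e, b, c, d]).trans hp'
    simpa using this
  rw [e1, cls_W_div h.err.long h.dim (h.complete_of_perm hp2)]
  have h1 := (h.cls_P_of_perm (e := e) (l := L ++ [c]) (l' := c :: L) (b := b) (d := d)
    (List.perm_append_comm (l₁ := L) (l₂ := [c])) (List.Perm.trans (by
      rw [List.perm_iff_count]; intro l
      simp only [List.count_append, List.count_cons, List.count_nil]; omega) hp2)).1
  have h2 := (h.cls_P_of_perm (e := e) (l := L ++ [d]) (l' := d :: L) (b := b) (d := c)
    (List.perm_append_comm (l₁ := L) (l₂ := [d])) (List.Perm.trans (by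
      rw [List.perm_iff_count]; intro l
      simp only [List.count_append, List.count_cons, List.count_nil]; omega) hp2)).1
  simp only [List.append_assoc, List.cons_append, List.nil_append] at h1 h2
  rw [h1, h2]
  rfl

end WeylSlot

end RiemContr

namespace RiemContr

/-! ### The second Bianchi identity of a weylified curvature factor -/

theorem slotCoeff_four (n : ℕ) (u : List ℕ) (x y z t : ℕ) : slotCoeff n u [x, y, z, t] =
    if x ∈ u ∨ y ∈ u ∨ z ∈ u ∨ t ∈ u then ((n : ℝ) - 2) / ((n : ℝ) - 3) else 1 := by
  simp [slotCoeff]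

namespace WeylSlot

variable {n τ q a w : ℕ} {S : Submodule ℝ LinComb} {u Λ : List ℕ} {K : Contr}
  (h : WeylSlot n τ q a w S u Λ K)

include h

/-- The second Bianchi identity when an index of the second antisymmetric pair is contracted against
a derivative: the factors are Cotton tensors. -/
theorem second_of_right {D : List ℕ} {e a b c d : ℕ} (hp : (e :: D ++ [a, b, c, d]).Perm Λ)
    (hc : c ∈ u) :
    slotCls S u Λ K (e :: D) [a, b, c, d] + slotCls S u Λ K (a :: D) [b, e, c, d]
      + slotCls S u Λ K (b :: D) [e, a, c, d] = 0 := by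
  have hcf : c ∈ Λ.filter (· ∈ u) := by simp [hc, mem_of_perm hp]
  obtain ⟨X, hX⟩ : ∃ X, (Λ.filter (· ∈ u) ++ D).Perm (c :: X) :=
    ⟨(Λ.filter (· ∈ u)).erase c ++ D, (List.perm_cons_erase hcf).append_right D⟩
  have hcot : ∀ e a b : ℕ, (e :: D ++ [a, b, c, d]).Perm Λ → slotCls S u Λ K (e :: D) [a, b, c, d] =
      ((n : ℝ) - 3) • (cls S (⟨.P, a :: e :: X ++ [d, b]⟩ :: K)
        - cls S (⟨.P, b :: e :: X ++ [d, a]⟩ :: K)) := by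
    intro e a b hp
    rw [h.pair hp]
    refine h.slot_eq_cotton (List.Perm.trans ?_ hp) ?_
    · rw [List.perm_iff_count]; intro l
      simp only [List.count_append, List.count_cons, List.count_nil]; omega
    · exact (List.perm_middle (a := e)).trans ((hX.cons e).trans (List.Perm.swap c e X))
  have hcomm : ∀ x y z : ℕ, (∀ l, [x, y, z].count l = [e, a, b].count l) →
      cls S (⟨.P, x :: y :: X ++ [d, z]⟩ :: K) = cls S (⟨.P, y :: x :: X ++ [d, z]⟩ :: K) := by
    intro x y z hl
    refine (h.cls_P_of_perm (e := c) (List.Perm.swap y x X) ?_).1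
    rw [List.perm_iff_count]; intro l
    have h1 := hX.count_eq l
    have h2 := hp.count_eq l
    have h3 := hl l
    simp only [List.count_append, List.count_cons, List.count_nil] at h1 h2 h3 ⊢
    omega
  have q2 : (a :: D ++ [b, e, c, d]).Perm Λ := List.Perm.trans (by
    rw [List.perm_iff_count]; intro l
    simp only [List.count_append, List.count_cons, List.count_nil]; omega) hp
  have q3 : (b :: D ++ [e, a, c, d]).Perm Λ := List.Perm.trans (by
    rw [List.perm_iff_count]; intro l
    simp only [List.count_append, List.count_cons, List.count_nil]; omega) hp
  rw [hcot _ _ _ hp, hcot _ _ _ q2, hcot _ _ _ q3,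
    hcomm e a b (fun l => rfl), hcomm b e a (fun l => by simp only [List.count_cons]; omega),
    hcomm a b e (fun l => by simp only [List.count_cons]; omega)]
  module

/-- The second Bianchi identity for the Weyl tensor, when of the five indices at most `e` is contracted
against a derivative. Of the terms with the metric only those with an index `e` on the metric remain. -/
theorem second_raw {D : List ℕ} {e a b c d : ℕ} (hp : (e :: D ++ [a, b, c, d]).Perm Λ) (hc : c ∉ u)
    (hd : d ∉ u) (ha : a ∉ u) (hb : b ∉ u) :
    slotCls S u Λ K (e :: D) [a, b, c, d] + slotCls S u Λ K (a :: D) [b, e, c, d]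
      + slotCls S u Λ K (b :: D) [e, a, c, d] =
    (cls S (Contr.relabel (mergeLabel e d) (⟨.P, (Λ.filter (· ∈ u) ++ D) ++ [b, a, c]⟩ :: K))
      - cls S (Contr.relabel (mergeLabel e d) (⟨.P, (Λ.filter (· ∈ u) ++ D) ++ [a, b, c]⟩ :: K)))
    - (cls S (Contr.relabel (mergeLabel e c) (⟨.P, (Λ.filter (· ∈ u) ++ D) ++ [b, a, d]⟩ :: K))
      - cls S (Contr.relabel (mergeLabel e c) (⟨.P, (Λ.filter (· ∈ u) ++ D) ++ [a, b, d]⟩ :: K))) := by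
  have hnd5 : [e, a, b, c, d].Nodup := by
    have h1 : (D ++ [e, a, b, c, d]).Perm Λ := List.Perm.trans (List.perm_middle.trans (by simp)) hp
    exact (List.nodup_append.1 (h1.nodup_iff.2 h.nodup)).2.1
  have hp5 : (Λ.filter (· ∈ u) ++ D ++ [e, a, b, c, d]).Perm (Λ.filter (· ∈ u) ++ Λ) := by
    rw [List.append_assoc]
    exact List.Perm.append_left _ (List.Perm.trans (List.perm_middle.trans (by simp)) hp)
  have hperm : ∀ x y z p r : ℕ, (∀ l, [x, y, z, p, r].count l = [e, a, b, c, d].count l) →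
      (Λ.filter (· ∈ u) ++ D ++ [x, y, z, p, r]).Perm (Λ.filter (· ∈ u) ++ Λ) := fun x y z p r hl =>
    ((List.perm_iff_count.2 hl).append_left _).trans hp5
  have hslot : ∀ x y z : ℕ, (∀ l, [x, y, z, c, d].count l = [e, a, b, c, d].count l) →
      slotCls S u Λ K (x :: D) [y, z, c, d] =
        cls S (⟨.W, Λ.filter (· ∈ u) ++ D ++ [x, y, z, c, d]⟩ :: K) := by
    intro x y z hl
    have h1 : (Λ.filter (· ∈ u) ++ x :: D).Perm (Λ.filter (· ∈ u) ++ D ++ [x]) := by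
      rw [List.append_assoc]
      exact (List.perm_append_comm (l₁ := [x]) (l₂ := D)).append_left _
    have := h.cls_perm_left (v := [y, z, c, d]) rfl h1
      ((h1.append_right _).trans (by simpa using hperm x y z c d hl))
    simpa [slotCls] using this
  have hW := cls_W_second h.err.long h.dim hnd5 (h.complete_of_perm hp5)
  simp only at hW
  have hne : ∀ x y p r s : ℕ, (∀ l, [x, y, p, r, s].count l = [e, a, b, c, d].count l) → x ≠ y := by
    intro x y p r s hl
    have := (List.perm_iff_count.2 hl).nodup_iff.2 hnd5
    simp only [List.nodup_cons, List.mem_cons] at this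
    tauto
  have hsym : ∀ x y p r s : ℕ, (∀ l, [x, y, p, r, s].count l = [e, a, b, c, d].count l) →
      x ∉ u → y ∉ u → cls S (Contr.relabel (mergeLabel x y)
        (⟨.P, (Λ.filter (· ∈ u) ++ D) ++ [p, r, s]⟩ :: K)) = cls S (Contr.relabel (mergeLabel x y)
        (⟨.P, (Λ.filter (· ∈ u) ++ D) ++ [r, p, s]⟩ :: K)) := fun x y p r s hl hx hy =>
    h.merge_symm (hperm x y p r s hl) hx hy (hne x y p r s hl)
  rw [hslot e a b fun l => rfl, hslot a b e fun l => by simp only [List.count_cons]; omega,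
    hslot b e a fun l => by simp only [List.count_cons]; omega, hW,
    hsym a d e b c (fun l => by simp only [List.count_cons]; omega) ha hd,
    hsym a c e b d (fun l => by simp only [List.count_cons]; omega) ha hc,
    hsym b d a e c (fun l => by simp only [List.count_cons]; omega) hb hd,
    hsym b c a e d (fun l => by simp only [List.count_cons]; omega) hb hc]
  abel

/-- If none of the five indices is contracted against a derivative, the terms with the metric have an
additional internal contraction. -/
theorem second_of_none {D : List ℕ} {e a b c d : ℕ} (hp : (e :: D ++ [a, b, c, d]).Perm Λ)
    (hc : c ∉ u) (hd : d ∉ u) (ha : a ∉ u) (hb : b ∉ u) (he : e ∉ u) :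
    slotCls S u Λ K (e :: D) [a, b, c, d] + slotCls S u Λ K (a :: D) [b, e, c, d]
      + slotCls S u Λ K (b :: D) [e, a, c, d] = 0 := by
  have hp5 : ∀ x y p r s : ℕ, (∀ l, [x, y, p, r, s].count l = [e, a, b, c, d].count l) →
      (Λ.filter (· ∈ u) ++ D ++ [x, y, p, r, s]).Perm (Λ.filter (· ∈ u) ++ Λ) := by
    intro x y p r s hl
    rw [List.append_assoc]
    refine List.Perm.append_left _ (List.Perm.trans ?_ hp)
    rw [List.perm_iff_count]; intro l
    have := hl l
    simp only [List.count_append, List.count_cons, List.count_nil] at this ⊢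
    omega
  have hnd := hp.nodup_iff.2 h.nodup
  rw [List.cons_append] at hnd
  have hed : e ≠ d := by rintro rfl; simp at hnd
  have hec : e ≠ c := by rintro rfl; simp at hnd
  rw [h.second_raw hp hc hd ha hb,
    h.merge_symm (hp5 e d b a c fun l => by simp only [List.count_cons]; omega) he hd hed,
    h.merge_symm (hp5 e c b a d fun l => by simp only [List.count_cons]; omega) he hc hec]
  abel

/-- The second Bianchi identity when just one of the three indices is contracted against a derivative.
The constant `(n - 2)/(n - 3)` compensates the terms with the metric. -/
theorem second_of_one {D : List ℕ} {e a b c d : ℕ} (hp : (e :: D ++ [a, b, c, d]).Perm Λ)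
    (hc : c ∉ u) (hd : d ∉ u) (ha : a ∉ u) (hb : b ∉ u) (he : e ∈ u) :
    slotCls S u Λ K (e :: D) [a, b, c, d] + (((n : ℝ) - 2) / ((n : ℝ) - 3)) •
      (slotCls S u Λ K (a :: D) [b, e, c, d] + slotCls S u Λ K (b :: D) [e, a, c, d]) = 0 := by
  have hef : e ∈ Λ.filter (· ∈ u) := by
    have : e ∈ Λ := hp.mem_iff.1 (by simp)
    simp [he, this]
  obtain ⟨X, hX⟩ : ∃ X, (Λ.filter (· ∈ u) ++ D).Perm (e :: X) :=
    ⟨(Λ.filter (· ∈ u)).erase e ++ D, (List.perm_cons_erase hef).append_right D⟩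
  have hnd : (e :: D ++ [a, b, c, d]).Nodup := hp.nodup_iff.2 h.nodup
  have heD : e ∉ D ++ [a, b, c, d] := (List.nodup_cons.1 hnd).1
  have heX : e ∉ X := by
    have h1 := hX.count_eq e
    rw [List.count_append, h.count_filter, if_pos ⟨he, hp.mem_iff.1 (by simp)⟩, List.count_cons_self,
      List.count_eq_zero_of_not_mem (fun hm => heD (List.mem_append_left _ hm))] at h1
    rw [← List.count_eq_zero]
    omega
  simp only [List.mem_append, List.mem_cons, List.not_mem_nil, or_false, not_or] at heD
  have heK : ∀ l ∈ Contr.labels K, l ≠ e := by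
    rintro l hl rfl
    have h2 := h.complete.2 l (by rw [Contr.labels_cons]; exact List.mem_append_right _ hl)
    have h3 := h.count_all l
    rw [if_pos (hp.mem_iff.1 (by simp)), if_pos he] at h3
    rw [Contr.labels_cons, List.count_append, h3] at h2
    have := List.count_pos_iff.2 hl
    omega
  have hP : ∀ x y z y' : ℕ, (∀ l, [x, y, z, y'].count l = [a, b, c, d].count l) →
      ∀ L : List ℕ, L.Perm (x :: y' :: X) →
        cls S (⟨.P, L ++ [y, z]⟩ :: K) = cls S (⟨.P, x :: y' :: X ++ [y, z]⟩ :: K) := by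
    intro x y z y' hl L hL
    refine ((h.cls_P_of_perm (e := e) hL.symm ?_).1).symm
    rw [List.perm_iff_count]; intro l
    have h1 := hX.count_eq l
    have h2 := hp.count_eq l
    have h3 := hl l
    simp only [List.count_append, List.count_cons, List.count_nil] at h1 h2 h3 ⊢
    omega
  -- identifying `e` with `y` replaces the derivative index `e` by `y`
  have hm : ∀ x y z y' : ℕ, (∀ l, [x, y, z, y'].count l = [a, b, c, d].count l) →
      cls S (Contr.relabel (mergeLabel e y') (⟨.P, (Λ.filter (· ∈ u) ++ D) ++ [x, y, z]⟩ :: K)) =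
        cls S (⟨.P, x :: y' :: X ++ [y, z]⟩ :: K) := by
    intro x y z y' hl
    have hfix : ∀ l, l ≠ e → mergeLabel e y' l = l := fun l hl => if_neg hl
    have hne : ∀ t ∈ [x, y, z, y'], t ≠ e := by
      rintro t ht rfl
      have := (List.perm_iff_count.2 hl).mem_iff.1 ht
      simp only [List.mem_cons, List.not_mem_nil, or_false] at this
      tauto
    have h1 := Contr.relabel_eq_self (σ := mergeLabel e y') (C := K) fun l hl => hfix l (heK l hl)
    unfold Contr.relabel at h1
    have h2 : Contr.relabel (mergeLabel e y') (⟨.P, (Λ.filter (· ∈ u) ++ D) ++ [x, y, z]⟩ :: K) =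
        (⟨.P, ((Λ.filter (· ∈ u) ++ D).map (mergeLabel e y') ++ [x]) ++ [y, z]⟩ :: K : Contr) := by
      simp [Contr.relabel, Factor.relabel, h1, hfix _ (hne x (by simp)), hfix _ (hne y (by simp)),
        hfix _ (hne z (by simp))]
    rw [h2]
    refine hP x y z y' hl _ ?_
    have h3 := hX.map (mergeLabel e y')
    have h4 : X.map (mergeLabel e y') = X := (List.map_congr_left fun l hl =>
      hfix l (by rintro rfl; exact heX hl)).trans (List.map_id X)
    rw [List.map_cons, h4, show mergeLabel e y' e = y' from if_pos rfl] at h3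
    exact (h3.append_right [x]).trans (List.perm_append_comm (l₁ := y' :: X) (l₂ := [x]))
  have q2 : (a :: D ++ [b, e, c, d]).Perm Λ := List.Perm.trans (by
    rw [List.perm_iff_count]; intro l
    simp only [List.count_append, List.count_cons, List.count_nil]; omega) hp
  have q2' : (a :: D ++ [e, b, c, d]).Perm Λ := List.Perm.trans (by
    rw [List.perm_iff_count]; intro l
    simp only [List.count_append, List.count_cons, List.count_nil]; omega) hp
  have q3 : (b :: D ++ [e, a, c, d]).Perm Λ := List.Perm.trans (by
    rw [List.perm_iff_count]; intro l
    simp only [List.count_append, List.count_cons, List.count_nil]; omega) hp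
  have hL : ∀ x, (Λ.filter (· ∈ u) ++ x :: D).Perm (e :: x :: X) := fun x =>
    (List.perm_middle (a := x)).trans ((hX.cons x).trans (List.Perm.swap e x X))
  have T2 : slotCls S u Λ K (a :: D) [b, e, c, d] = -(((n : ℝ) - 3) •
      (cls S (⟨.P, a :: c :: X ++ [b, d]⟩ :: K) - cls S (⟨.P, a :: d :: X ++ [b, c]⟩ :: K))) := by
    rw [h.left q2, h.slot_eq_cotton q2' (hL a),
      hP a b d c (fun l => by simp only [List.count_cons]; omega) _ (List.Perm.swap a c X),
      hP a b c d (fun l => by simp only [List.count_cons]) _ (List.Perm.swap a d X)]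
  have T3 : slotCls S u Λ K (b :: D) [e, a, c, d] = ((n : ℝ) - 3) •
      (cls S (⟨.P, b :: c :: X ++ [a, d]⟩ :: K) - cls S (⟨.P, b :: d :: X ++ [a, c]⟩ :: K)) := by
    rw [h.slot_eq_cotton q3 (hL b),
      hP b a d c (fun l => by simp only [List.count_cons]; omega) _ (List.Perm.swap b c X),
      hP b a c d (fun l => by simp only [List.count_cons]; omega) _ (List.Perm.swap b d X)]
  have T1 := h.second_raw hp hc hd ha hb
  rw [hm b a c d (fun l => by simp only [List.count_cons]; omega),
    hm a b c d (fun l => by simp only [List.count_cons]),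
    hm b a d c (fun l => by simp only [List.count_cons]; omega),
    hm a b d c (fun l => by simp only [List.count_cons]; omega)] at T1
  have hn3 := three_lt_cast h.dim
  generalize cls S (⟨.P, b :: d :: X ++ [a, c]⟩ :: K) = p1 at *
  generalize cls S (⟨.P, a :: d :: X ++ [b, c]⟩ :: K) = p2 at *
  generalize cls S (⟨.P, b :: c :: X ++ [a, d]⟩ :: K) = p3 at *
  generalize cls S (⟨.P, a :: c :: X ++ [b, d]⟩ :: K) = p4 at *
  have T23 : slotCls S u Λ K (a :: D) [b, e, c, d] + slotCls S u Λ K (b :: D) [e, a, c, d] =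
      ((n : ℝ) - 3) • (p3 - p1 - p4 + p2) := by
    rw [T2, T3]
    module
  have T1' : slotCls S u Λ K (e :: D) [a, b, c, d] = (p1 - p2) - (p3 - p4) -
      ((n : ℝ) - 3) • (p3 - p1 - p4 + p2) := by
    rw [← T23, ← T1]
    abel
  rw [T23, T1', smul_smul, div_mul_cancel₀ _ hn3]
  module

/-- The second Bianchi identity for a weylified factor `∇^{(m)}R`. -/
theorem second {D : List ℕ} {e a b c d : ℕ} (hp : (e :: D ++ [a, b, c, d]).Perm Λ) :
    slotCoeff n u [a, b, c, d] • slotCls S u Λ K (e :: D) [a, b, c, d]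
      + slotCoeff n u [b, e, c, d] • slotCls S u Λ K (a :: D) [b, e, c, d]
      + slotCoeff n u [e, a, c, d] • slotCls S u Λ K (b :: D) [e, a, c, d] = 0 := by
  have q2 : (a :: D ++ [b, e, c, d]).Perm Λ := List.Perm.trans (by
    rw [List.perm_iff_count]; intro l
    simp only [List.count_append, List.count_cons, List.count_nil]; omega) hp
  have q3 : (b :: D ++ [e, a, c, d]).Perm Λ := List.Perm.trans (by
    rw [List.perm_iff_count]; intro l
    simp only [List.count_append, List.count_cons, List.count_nil]; omega) hp
  simp only [slotCoeff_four]
  set κ := ((n : ℝ) - 2) / ((n : ℝ) - 3)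
  by_cases hc : c ∈ u
  · simp only [hc, true_or, or_true, if_true, ← smul_add, h.second_of_right hp hc, smul_zero]
  by_cases hd : d ∈ u
  · have hr : ∀ {e a b : ℕ}, (e :: D ++ [a, b, c, d]).Perm Λ → (e :: D ++ [a, b, d, c]).Perm Λ :=
      fun {e a b} hp => ((((List.Perm.swap c d []).cons b).cons a).append_left _).trans hp
    have := h.second_of_right (hr hp) hd
    simp only [hd, or_true, if_true, ← smul_add]
    rw [h.right hp, h.right q2, h.right q3, ← neg_add, ← neg_add, this, neg_zero, smul_zero]
  simp only [hc, hd, or_false]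
  -- if at least two of `e`, `a`, `b` are contracted against derivatives, the identity follows from the
  -- antisymmetry; all three constants are then equal
  by_cases he : e ∈ u <;> by_cases ha : a ∈ u <;> by_cases hb : b ∈ u <;>
    simp only [he, ha, hb, or_true, or_self, if_true, if_false, one_smul, or_false]
  · rw [h.eq_zero_of_left hp ha hb, h.eq_zero_of_left q2 hb he, h.eq_zero_of_left q3 he ha]
    simp
  · rw [h.eq_zero_of_left q3 he ha, h.eq_neg_of_swap hp he ha]
    simp
  · rw [h.eq_zero_of_left q2 hb he, h.eq_neg_of_swap q3 hb he]
    simp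
  · have := h.second_of_one hp hc hd ha hb he
    rw [← this]
    module
  · rw [h.eq_zero_of_left hp ha hb, h.eq_neg_of_swap q2 ha hb]
    simp
  · have := h.second_of_one q2 hc hd hb he ha
    rw [← this]
    module
  · have := h.second_of_one q3 hc hd he ha hb
    rw [← this]
    module
  · exact h.second_of_none hp hc hd ha hb he

end WeylSlot

end RiemContr

namespace RiemContr

/-! ### Reconstruction of a curvature-like function from its symmetrization -/

section PairSum

variable {α M : Type*} [DecidableEq α] [AddCommMonoid M]

/-- The sum over all ordered pairs of distinct elements `x`, `y` of `D`; the function is also given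
the remaining elements. -/
def pairSum (D : Multiset α) (g : α → α → Multiset α → M) : M :=
  (D.map fun x => ((D.erase x).map fun y => g x y ((D.erase x).erase y)).sum).sum

theorem pairSum_cons {b : α} {D : Multiset α} (hD : (b ::ₘ D).Nodup) (g : α → α → Multiset α → M) :
    pairSum (b ::ₘ D) g = (D.map fun y => g b y (D.erase y)).sum + (D.map fun y => g y b (D.erase y)).sum
      + pairSum D (fun x y E => g x y (b ::ₘ E)) := by
  have hb := (Multiset.nodup_cons.1 hD).1
  have hne : ∀ x ∈ D, b ≠ x := by rintro x hx rfl; exact hb hx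
  unfold pairSum
  rw [Multiset.map_cons, Multiset.sum_cons, Multiset.erase_cons_head, add_assoc]
  congr 1
  rw [← Multiset.sum_map_add]
  congr 1
  refine Multiset.map_congr rfl fun x hx => ?_
  rw [Multiset.erase_cons_tail _ (hne x hx), Multiset.map_cons, Multiset.sum_cons,
    Multiset.erase_cons_head]
  congr 1
  congr 1
  refine Multiset.map_congr rfl fun y hy => ?_
  rw [Multiset.erase_cons_tail _ (hne y (Multiset.mem_of_mem_erase hy))]

theorem pairSum_congr {D : Multiset α} {g g' : α → α → Multiset α → M}
    (h : ∀ x y E, x ::ₘ y ::ₘ E = D → g x y E = g' x y E) : pairSum D g = pairSum D g' := by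
  unfold pairSum
  congr 1
  refine Multiset.map_congr rfl fun x hx => ?_
  congr 1
  refine Multiset.map_congr rfl fun y hy => h x y _ ?_
  rw [Multiset.cons_erase hy, Multiset.cons_erase hx]

theorem pairSum_add (D : Multiset α) (g g' : α → α → Multiset α → M) :
    pairSum D (fun x y E => g x y E + g' x y E) = pairSum D g + pairSum D g' := by
  simp only [pairSum, Multiset.sum_map_add]

theorem map_pairSum {N : Type*} [AddCommMonoid N] (f : M →+ N) (D : Multiset α)
    (g : α → α → Multiset α → M) : f (pairSum D g) = pairSum D (fun x y E => f (g x y E)) := by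
  simp only [pairSum, map_multiset_sum, Multiset.map_map, Function.comp_def]

theorem pairSum_const (D : Multiset α) (c : M) :
    pairSum D (fun _ _ _ => c) = (D.card * (D.card - 1)) • c := by
  unfold pairSum
  have : ∀ x ∈ D, ((D.erase x).map fun _ => c).sum = (D.card - 1) • c := by
    intro x hx
    rw [Multiset.map_const', Multiset.sum_replicate, Multiset.card_erase_of_mem hx, Nat.pred_eq_sub_one]
  rw [Multiset.map_congr rfl this, Multiset.map_const', Multiset.sum_replicate, smul_smul]

end PairSum

/-- Functions of an ordered list of four out of finitely many names, which have the symmetries of the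
derivatives of the curvature tensor: the names in `D` are those of the derivative indices. -/
structure CurvLike {α M : Type*} [AddCommGroup M] (Λ : Multiset α)
    (T : Multiset α → α → α → α → α → M) : Prop where
  left : ∀ D a b c d, a ::ₘ b ::ₘ c ::ₘ d ::ₘ D = Λ → T D a b c d = - T D b a c d
  right : ∀ D a b c d, a ::ₘ b ::ₘ c ::ₘ d ::ₘ D = Λ → T D a b c d = - T D a b d c
  pair : ∀ D a b c d, a ::ₘ b ::ₘ c ::ₘ d ::ₘ D = Λ → T D a b c d = T D c d a b
  first : ∀ D a b c d, a ::ₘ b ::ₘ c ::ₘ d ::ₘ D = Λ → T D a b c d + T D a c d b + T D a d b c = 0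
  second : ∀ D e a b c d, e ::ₘ a ::ₘ b ::ₘ c ::ₘ d ::ₘ D = Λ →
    T (e ::ₘ D) a b c d + T (a ::ₘ D) b e c d + T (b ::ₘ D) e a c d = 0

namespace CurvLike

variable {α M : Type*} [DecidableEq α] [AddCommGroup M] {Λ : Multiset α}
  {T : Multiset α → α → α → α → α → M}

/-- The second Bianchi identity, solved for the term with the derivative index `x`. -/
theorem cocycle_left (hT : CurvLike Λ T) {B : Multiset α} {i j x c d : α}
    (h : x ::ₘ i ::ₘ j ::ₘ c ::ₘ d ::ₘ B = Λ) :
    T (j ::ₘ B) i x c d - T (i ::ₘ B) j x c d = T (x ::ₘ B) i j c d := by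
  have h1 := hT.second B x i j c d h
  rw [hT.left (j ::ₘ B) x i c d (by
    rw [← h]; ext; simp only [Multiset.count_cons]; omega)] at h1
  rw [← sub_eq_zero, ← neg_eq_zero, ← h1]
  abel

/-- The same for the second antisymmetric pair. -/
theorem cocycle_right (hT : CurvLike Λ T) {B : Multiset α} {a b k l y : α}
    (h : y ::ₘ a ::ₘ b ::ₘ k ::ₘ l ::ₘ B = Λ) :
    T (l ::ₘ B) a b k y - T (k ::ₘ B) a b l y = T (y ::ₘ B) a b k l := by
  have h1 := hT.cocycle_left (B := B) (i := k) (j := l) (x := y) (c := a) (d := b) (by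
    rw [← h]; ext; simp only [Multiset.count_cons]; omega)
  rw [hT.pair (l ::ₘ B) a b k y (by rw [← h]; ext; simp only [Multiset.count_cons]; omega),
    hT.pair (k ::ₘ B) a b l y (by rw [← h]; ext; simp only [Multiset.count_cons]; omega),
    hT.pair (y ::ₘ B) a b k l (by rw [← h]; ext; simp only [Multiset.count_cons]; omega), h1]

/-- The terms with both summation indices outside of `i`, `j`, `k`, `l`. -/
theorem four_outside (hT : CurvLike Λ T) {E : Multiset α} {i j k l x y : α}
    (h : x ::ₘ y ::ₘ i ::ₘ j ::ₘ k ::ₘ l ::ₘ E = Λ) :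
    T (j ::ₘ l ::ₘ E) i x k y - T (i ::ₘ l ::ₘ E) j x k y - T (j ::ₘ k ::ₘ E) i x l y
      + T (i ::ₘ k ::ₘ E) j x l y = T (x ::ₘ y ::ₘ E) i j k l := by
  have h1 := hT.cocycle_left (B := l ::ₘ E) (i := i) (j := j) (x := x) (c := k) (d := y) (by
    rw [← h]; ext; simp only [Multiset.count_cons]; omega)
  have h2 := hT.cocycle_left (B := k ::ₘ E) (i := i) (j := j) (x := x) (c := l) (d := y) (by
    rw [← h]; ext; simp only [Multiset.count_cons]; omega)
  have h3 := hT.cocycle_right (B := x ::ₘ E) (a := i) (b := j) (k := k) (l := l) (y := y) (by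
    rw [← h]; ext; simp only [Multiset.count_cons]; omega)
  rw [Multiset.cons_swap l x, Multiset.cons_swap k x, Multiset.cons_swap y x, ← h1, ← h2] at h3
  rw [← h3]
  abel

/-- The terms with one summation index outside of `i`, `j`, `k`, `l`. -/
theorem sixteen_terms (hT : CurvLike Λ T) {B : Multiset α} {i j k l y : α}
    (h : y ::ₘ i ::ₘ j ::ₘ k ::ₘ l ::ₘ B = Λ) :
    (T (l ::ₘ B) i j k y + T (l ::ₘ B) i y k j + T (j ::ₘ B) i l k y + T (j ::ₘ B) i y k l)
    - (T (l ::ₘ B) j i k y + T (l ::ₘ B) j y k i + T (i ::ₘ B) j l k y + T (i ::ₘ B) j y k l)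
    - (T (k ::ₘ B) i j l y + T (k ::ₘ B) i y l j + T (j ::ₘ B) i k l y + T (j ::ₘ B) i y l k)
    + (T (k ::ₘ B) j i l y + T (k ::ₘ B) j y l i + T (i ::ₘ B) j k l y + T (i ::ₘ B) j y l k) =
    6 • T (y ::ₘ B) i j k l := by
  have s1 := hT.left (l ::ₘ B) j i k y (by rw [← h]; ext; simp only [Multiset.count_cons]; omega)
  have s2 := hT.left (k ::ₘ B) j i l y (by rw [← h]; ext; simp only [Multiset.count_cons]; omega)
  have s3 := hT.cocycle_right (B := B) (a := i) (b := j) (k := k) (l := l) (y := y) h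
  have s4 := hT.right (l ::ₘ B) i y k j (by rw [← h]; ext; simp only [Multiset.count_cons]; omega)
  have t1 := hT.cocycle_right (B := B) (a := i) (b := y) (k := k) (l := l) (y := j) (by
    rw [← h]; ext; simp only [Multiset.count_cons]; omega)
  have t2 := hT.cocycle_right (B := B) (a := j) (b := y) (k := k) (l := l) (y := i) (by
    rw [← h]; ext; simp only [Multiset.count_cons]; omega)
  have t3 := hT.cocycle_left (B := B) (i := i) (j := j) (x := y) (c := k) (d := l) h
  have c1 := hT.cocycle_left (B := B) (i := i) (j := j) (x := l) (c := k) (d := y) (by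
    rw [← h]; ext; simp only [Multiset.count_cons]; omega)
  have c2 := hT.cocycle_left (B := B) (i := i) (j := j) (x := k) (c := l) (d := y) (by
    rw [← h]; ext; simp only [Multiset.count_cons]; omega)
  have r1 := hT.right (j ::ₘ B) i y l k (by rw [← h]; ext; simp only [Multiset.count_cons]; omega)
  have r2 := hT.right (i ::ₘ B) j y l k (by rw [← h]; ext; simp only [Multiset.count_cons]; omega)
  have p1 : T (l ::ₘ B) i y k j - T (k ::ₘ B) i y l j - (T (l ::ₘ B) j y k i - T (k ::ₘ B) j y l i)
      = T (y ::ₘ B) i j k l := by rw [t1, t2, t3]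
  have p2 : T (j ::ₘ B) i l k y - T (i ::ₘ B) j l k y - (T (j ::ₘ B) i k l y - T (i ::ₘ B) j k l y)
      = T (y ::ₘ B) i j k l := by rw [c1, c2, s3]
  rw [s1, s2, r1, r2]
  have e : 6 • T (y ::ₘ B) i j k l = 2 • (T (l ::ₘ B) i j k y - T (k ::ₘ B) i j l y) +
      (T (l ::ₘ B) i y k j - T (k ::ₘ B) i y l j - (T (l ::ₘ B) j y k i - T (k ::ₘ B) j y l i)) +
      (T (j ::ₘ B) i l k y - T (i ::ₘ B) j l k y - (T (j ::ₘ B) i k l y - T (i ::ₘ B) j k l y)) +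
      2 • (T (j ::ₘ B) i y k l - T (i ::ₘ B) j y k l) := by
    rw [s3, p1, p2, t3]
    abel
  rw [e]
  abel

/-- The terms with both summation indices among `i`, `j`, `k`, `l`. -/
theorem eight_terms (hT : CurvLike Λ T) {D : Multiset α} {i j k l : α}
    (h : i ::ₘ j ::ₘ k ::ₘ l ::ₘ D = Λ) :
    (T D i j k l + T D i l k j) - (T D j i k l + T D j l k i) - (T D i j l k + T D i k l j)
      + (T D j i l k + T D j k l i) = 6 • T D i j k l := by
  have a1 := hT.left D j i k l (by rw [← h]; ext; simp only [Multiset.count_cons]; omega)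
  have a2 := hT.right D i j l k (by rw [← h]; ext; simp only [Multiset.count_cons]; omega)
  have a3 := hT.left D j i l k (by rw [← h]; ext; simp only [Multiset.count_cons]; omega)
  have a4 := hT.pair D j l k i (by rw [← h]; ext; simp only [Multiset.count_cons]; omega)
  have a5 := hT.left D k i j l (by rw [← h]; ext; simp only [Multiset.count_cons]; omega)
  have a6 := hT.right D i k j l (by rw [← h]; ext; simp only [Multiset.count_cons]; omega)
  have a7 := hT.pair D j k l i (by rw [← h]; ext; simp only [Multiset.count_cons]; omega)
  have a8 := hT.left D l i j k (by rw [← h]; ext; simp only [Multiset.count_cons]; omega)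
  have a9 := hT.right D i l j k (by rw [← h]; ext; simp only [Multiset.count_cons]; omega)
  have b := hT.first D i j k l h
  rw [a3, a2, a1, a4, a5, a6, a7, a8, a9]
  rw [a9] at b
  have e : T D i k l j = - T D i j k l + T D i l k j := by
    rw [← sub_eq_zero, ← b]; abel
  rw [e]
  abel

/-- The symmetrization `U(a, c) = ∑_{x, y} T(a, x; c, y)`, over the pairs of distinct names which are
neither `a` nor `c`, determines `T`: up to a factor, `U` is a perturbation of the flat metric with
the linearized curvature `T`. The terms are sorted by the number of summation indices among `i`, `j`, `k`, `l`. -/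
theorem reconstruct (hT : CurvLike Λ T) {D : Multiset α} {i j k l : α} (hΛ : Λ.Nodup)
    (h : i ::ₘ j ::ₘ k ::ₘ l ::ₘ D = Λ) :
    pairSum (j ::ₘ l ::ₘ D) (fun x y E => T E i x k y)
      - pairSum (i ::ₘ l ::ₘ D) (fun x y E => T E j x k y)
      - pairSum (j ::ₘ k ::ₘ D) (fun x y E => T E i x l y)
      + pairSum (i ::ₘ k ::ₘ D) (fun x y E => T E j x l y) =
      ((D.card + 2) * (D.card + 3)) • T D i j k l := by
  have hU : ∀ a b c d, (a ::ₘ b ::ₘ c ::ₘ d ::ₘ D = Λ) →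
      pairSum (b ::ₘ d ::ₘ D) (fun x y E => T E a x c y) =
      (T D a b c d + T D a d c b) + (D.map fun y => T (d ::ₘ D.erase y) a b c y
        + T (d ::ₘ D.erase y) a y c b + T (b ::ₘ D.erase y) a d c y + T (b ::ₘ D.erase y) a y c d).sum
        + pairSum D (fun x y E => T (b ::ₘ d ::ₘ E) a x c y) := by
    intro a b c d hp
    have hnd : (a ::ₘ b ::ₘ c ::ₘ d ::ₘ D).Nodup := hp ▸ hΛ
    have hnd1 : (b ::ₘ d ::ₘ D).Nodup := by
      have h1 := (Multiset.nodup_cons.1 hnd).2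
      rw [Multiset.cons_swap c d, Multiset.cons_swap b d, Multiset.cons_swap b c,
        Multiset.cons_swap d c] at h1
      have h2 := (Multiset.nodup_cons.1 h1).2
      rwa [Multiset.cons_swap d b] at h2
    have hnd2 : (d ::ₘ D).Nodup := (Multiset.nodup_cons.1 hnd1).2
    have hd : ∀ x ∈ D, d ≠ x := by
      rintro x hx rfl; exact (Multiset.nodup_cons.1 hnd2).1 hx
    rw [pairSum_cons hnd1, pairSum_cons hnd2, Multiset.map_cons, Multiset.map_cons,
      Multiset.sum_cons, Multiset.sum_cons, Multiset.erase_cons_head]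
    have e1 : ∀ f : α → Multiset α → M, (D.map fun y => f y ((d ::ₘ D).erase y)) =
        D.map fun y => f y (d ::ₘ D.erase y) := fun f => Multiset.map_congr rfl fun y hy => by
      rw [Multiset.erase_cons_tail _ (hd y hy)]
    rw [e1 fun y E => T E a b c y, e1 fun y E => T E a y c b]
    simp only [Multiset.sum_map_add]
    abel
  rw [hU i j k l h, hU j i k l (by rw [← h]; ext; simp only [Multiset.count_cons]; omega),
    hU i j l k (by rw [← h]; ext; simp only [Multiset.count_cons]; omega),
    hU j i l k (by rw [← h]; ext; simp only [Multiset.count_cons]; omega)]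
  have h8 := hT.eight_terms h
  have h16 : ∀ y ∈ D,
      (T (l ::ₘ D.erase y) i j k y + T (l ::ₘ D.erase y) i y k j + T (j ::ₘ D.erase y) i l k y
        + T (j ::ₘ D.erase y) i y k l)
      - (T (l ::ₘ D.erase y) j i k y + T (l ::ₘ D.erase y) j y k i + T (i ::ₘ D.erase y) j l k y
        + T (i ::ₘ D.erase y) j y k l)
      - (T (k ::ₘ D.erase y) i j l y + T (k ::ₘ D.erase y) i y l j + T (j ::ₘ D.erase y) i k l y
        + T (j ::ₘ D.erase y) i y l k)
      + (T (k ::ₘ D.erase y) j i l y + T (k ::ₘ D.erase y) j y l i + T (i ::ₘ D.erase y) j k l y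
        + T (i ::ₘ D.erase y) j y l k) = 6 • T D i j k l := fun y hy => by
    have := hT.sixteen_terms (B := D.erase y) (i := i) (j := j) (k := k) (l := l) (y := y) (by
      rw [← h]
      conv_rhs => rw [← Multiset.cons_erase hy]
      ext; simp only [Multiset.count_cons]; omega)
    rw [Multiset.cons_erase hy] at this
    exact this
  have h4 : pairSum D (fun x y E => T (j ::ₘ l ::ₘ E) i x k y - T (i ::ₘ l ::ₘ E) j x k y
      - T (j ::ₘ k ::ₘ E) i x l y + T (i ::ₘ k ::ₘ E) j x l y) =
      pairSum D (fun _ _ _ => T D i j k l) := by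
    refine pairSum_congr fun x y E hE => ?_
    rw [← hE]
    refine hT.four_outside ?_
    rw [← h, ← hE]
    ext; simp only [Multiset.count_cons]; omega
  have hneg : ∀ g : α → α → Multiset α → M, pairSum D (fun x y E => - g x y E) = - pairSum D g :=
    fun g => (map_pairSum (-AddMonoidHom.id M) D g).symm
  have hs := Multiset.map_congr (rfl : D = D) h16
  have hs' := congrArg Multiset.sum hs
  simp only [sub_eq_add_neg, pairSum_add, hneg, pairSum_const, Multiset.sum_map_add,
    Multiset.sum_map_neg, Multiset.map_const', Multiset.sum_replicate, smul_smul] at h4 hs' h8 ⊢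
  have hcard : ((D.card + 2) * (D.card + 3)) • T D i j k l =
      6 • T D i j k l + (D.card * 6) • T D i j k l + (D.card * (D.card - 1)) • T D i j k l := by
    rw [← add_smul, ← add_smul]
    congr 1
    rcases D.card with _ | m
    · rfl
    · simp only [Nat.add_sub_cancel]; ring
  rw [hcard, ← h8, ← h4, ← hs']
  simp only [neg_add]
  abel

end CurvLike

end RiemContr

namespace RiemContr

/-! ### The weylification of a contraction -/

namespace Contr

theorem labels_perm_ups (C : Contr) :
    C.labels.Perm (Contr.labels (C.filter fun F => F.kind ≠ .ups) ++ C.upsLabels) := by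
  have h := (List.filter_append_perm (fun F : Factor => decide (F.kind ≠ .ups)) C).symm
  have h2 := h.flatMap_right Factor.idx
  rw [List.flatMap_append] at h2
  refine h2.trans (List.Perm.of_eq ?_)
  unfold upsLabels labels
  congr 3
  funext F
  simp

theorem upsLabels_cons {F : Factor} (hF : F.kind ≠ .ups) (K : Contr) :
    Contr.upsLabels (F :: K) = K.upsLabels := by
  simp [upsLabels, hF]

theorem weyl_cons {F : Factor} (hF : F.kind ≠ .ups) (K : Contr) :
    Contr.weyl (F :: K) = F.weyl K.upsLabels :: K.weyl := by
  simp [weyl, upsLabels_cons hF, hF]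

theorem weylCoeff_cons (n : ℕ) {F : Factor} (hF : F.kind ≠ .ups) (K : Contr) :
    Contr.weylCoeff n (F :: K) = F.weylCoeff n K.upsLabels * K.weylCoeff n := by
  simp [weylCoeff, upsLabels_cons hF]

theorem wt_add_two_mul {C : Contr} (hC : C.WellFormed) :
    C.wt + 2 * (C.numKind .R + C.numKind .W) = C.labels.length := by
  induction C with
  | nil => rfl
  | cons F C ih =>
    have h1 := ih fun F' h => hC F' (List.mem_cons_of_mem _ h)
    have h2 := hC F List.mem_cons_self
    rw [wt_cons, numKind_cons, numKind_cons, labels_cons, List.length_append, ← h1]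
    obtain ⟨k, idx⟩ := F
    cases k <;> simp only [Kind.arity, Factor.wt] at h2 ⊢ <;> simp <;> omega

end Contr

theorem Factor.count_weyl {F : Factor} (hF : F.kind = .R ∨ F.kind = .psi) (u : List ℕ) (l : ℕ) :
    (F.weyl u).idx.count l = (if l ∈ u then 2 else 1) * F.idx.count l := by
  have h : (F.weyl u).idx = F.idx.filter (fun l => l ∈ u) ++ F.idx := by
    unfold Factor.weyl
    rcases hF with h | h <;> rw [h]
  rw [h, List.count_append]
  by_cases hl : l ∈ u
  · rw [List.count_filter (by simpa using hl), if_pos hl]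
    ring
  · rw [if_neg hl, one_mul, List.count_eq_zero_of_not_mem (a := l), zero_add]
    simp [hl]

namespace Contr.IsCurvatureForm

variable {τ q a : ℕ} {C : Contr} (h : C.IsCurvatureForm τ q a)

include h

theorem kind_of_mem_filter {F : Factor} (hF : F ∈ C.filter fun F => F.kind ≠ .ups) :
    F ∈ C ∧ (F.kind = .R ∨ F.kind = .psi) := by
  obtain ⟨h1, h2⟩ := List.mem_filter.1 hF
  have h2 : F.kind ≠ .ups := by simpa using h2
  refine ⟨h1, ?_⟩
  rcases h.kinds F h1 with h3 | h3 | h3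
  exacts [Or.inl h3, Or.inr h3, absurd h3 h2]

theorem length_upsLabels : C.upsLabels.length = a := by
  rw [← h.num_ups]
  unfold upsLabels labels numKind
  rw [List.length_flatMap, List.countP_eq_length_filter]
  have : ∀ F ∈ C.filter (fun F => F.kind = .ups), F.idx.length = 1 := by
    intro F hF
    obtain ⟨h1, h2⟩ := List.mem_filter.1 hF
    exact h.ups_once F h1 (by simpa using h2)
  rw [List.map_congr_left this]
  simp

theorem card_upsLabels : C.upsLabels.toFinset.card = a := by
  rw [List.toFinset_card_of_nodup h.ups_apart, h.length_upsLabels]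

theorem count_filter_of_mem (h2 : ∀ l ∈ C.upsLabels, C.labels.count l = 2) {l : ℕ}
    (hl : l ∈ C.upsLabels) :
    (Contr.labels (C.filter fun F => F.kind ≠ .ups)).count l = 1 := by
  have h3 := h2 l hl
  rw [(labels_perm_ups C).count_eq, List.count_append, List.count_eq_one_of_mem h.ups_apart hl] at h3
  omega

/-- A name borne by a factor `∇υ` and by an index of another factor is, after `Weylify`, borne by two
indices of the latter. -/
theorem labels_weyl_perm (h2 : ∀ l ∈ C.upsLabels, C.labels.count l = 2) :
    C.weyl.labels.Perm C.labels := by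
  rw [List.perm_iff_count]
  intro l
  have h1 : C.weyl.labels.count l = (if l ∈ C.upsLabels then 2 else 1) *
      (Contr.labels (C.filter fun F => F.kind ≠ .ups)).count l := by
    unfold weyl
    generalize hL : C.filter (fun F => F.kind ≠ .ups) = L
    have hk : ∀ F ∈ L, F.kind = .R ∨ F.kind = .psi := fun F hF =>
      (h.kind_of_mem_filter (hL ▸ hF)).2
    clear hL
    induction L with
    | nil => simp [labels]
    | cons F L ih =>
      rw [List.map_cons, labels_cons, labels_cons, List.count_append, List.count_append,
        ih fun F' h => hk F' (List.mem_cons_of_mem _ h), Factor.count_weyl (hk F List.mem_cons_self)]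
      ring
  rw [h1]
  split_ifs with hl
  · rw [h.count_filter_of_mem h2 hl, h2 l hl]
  · rw [(labels_perm_ups C).count_eq, List.count_append, List.count_eq_zero_of_not_mem hl]
    ring

theorem mem_weyl {F : Factor} (hF : F ∈ C.weyl) : ∃ F' ∈ C, (F'.kind = .R ∨ F'.kind = .psi) ∧
    F = F'.weyl C.upsLabels := by
  obtain ⟨F', hF', rfl⟩ := List.mem_map.1 hF
  exact ⟨F', (h.kind_of_mem_filter hF').1, (h.kind_of_mem_filter hF').2, rfl⟩

theorem weyl_kinds {F : Factor} (hF : F ∈ C.weyl) : F.kind = .W ∨ F.kind = .P := by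
  obtain ⟨F', h1, h2, rfl⟩ := h.mem_weyl hF
  rcases h2 with h2 | h2
  · exact Or.inl (by rw [Factor.weyl, h2])
  · exact Or.inr (by rw [Factor.weyl, h2])

/-- The factors `∇^{(u)}P` have at least two indices, since a factor `∇_bψ` is contracted against a factor
`∇υ` and becomes `P^b_b`. -/
theorem weyl_wellFormed (hwf : C.WellFormed) : C.weyl.WellFormed := by
  intro F hF
  obtain ⟨F', h1, h2, rfl⟩ := h.mem_weyl hF
  rcases h2 with h2 | h2
  · have := hwf F' h1
    rw [h2] at this
    simp only [Factor.weyl, h2, List.length_append]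
    exact this.trans (Nat.le_add_left _ _)
  · simp only [Factor.weyl, h2, List.length_append, Kind.arity]
    by_cases hu : ∀ l ∈ F'.idx, l ∉ C.upsLabels
    · exact (h.psi_twice F' h1 h2 hu).trans (Nat.le_add_left _ _)
    · push Not at hu
      obtain ⟨l, hl, hl'⟩ := hu
      have h3 : 0 < (F'.idx.filter (fun l => l ∈ C.upsLabels)).length :=
        List.length_pos_of_mem (List.mem_filter.2 ⟨hl, by simpa using hl'⟩)
      have h4 := List.length_pos_of_mem hl
      omega

theorem numKind_weyl : C.weyl.numKind .P = q ∧ C.weyl.numKind .W = C.numKind .R ∧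
    C.weyl.numKind .R = 0 ∧ C.weyl.length = C.numKind .R + q := by
  rw [← h.num_psi]
  unfold weyl
  generalize C.upsLabels = u
  have hk := h.kinds
  clear h
  induction C with
  | nil => simp [numKind]
  | cons F C ih =>
    obtain ⟨i1, i2, i3, i4⟩ := ih fun F' h => hk F' (List.mem_cons_of_mem _ h)
    rw [numKind_cons, numKind_cons]
    rcases hk F List.mem_cons_self with h | h | h
    · have e : List.filter (fun F => F.kind ≠ .ups) (F :: C) = F :: C.filter fun F => F.kind ≠ .ups := by
        simp [h]
      rw [e, List.map_cons, numKind_cons, numKind_cons, numKind_cons, i1, i2, i3, List.length_cons, i4]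
      simp [Factor.weyl, h]
      omega
    · have e : List.filter (fun F => F.kind ≠ .ups) (F :: C) = F :: C.filter fun F => F.kind ≠ .ups := by
        simp [h]
      rw [e, List.map_cons, numKind_cons, numKind_cons, numKind_cons, i1, i2, i3, List.length_cons, i4]
      simp [Factor.weyl, h]
      omega
    · have e : List.filter (fun F => F.kind ≠ .ups) (F :: C) = C.filter fun F => F.kind ≠ .ups := by
        simp [h]
      rw [e, i1, i2, i3, i4]
      simp [h]

theorem numKind_R_add : C.numKind .R + q = τ ∧ C.numKind .W = 0 := by
  have h1 : C.numKind .R + C.numKind .psi + C.numKind .ups = C.length ∧ C.numKind .W = 0 := by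
    have hk := h.kinds
    clear h
    induction C with
    | nil => simp [numKind]
    | cons F C ih =>
      have := ih fun F' h => hk F' (List.mem_cons_of_mem _ h)
      rw [numKind_cons, numKind_cons, numKind_cons, numKind_cons, List.length_cons, ← this.1]
      rcases hk F List.mem_cons_self with h | h | h <;> simp [h, this.2] <;> omega
  rw [h.num_psi, h.num_ups, h.len] at h1
  omega

theorem length_weyl : C.weyl.length = τ := by
  rw [h.numKind_weyl.2.2.2, h.numKind_R_add.1]

theorem wt_weyl (hwf : C.WellFormed) (h2 : ∀ l ∈ C.upsLabels, C.labels.count l = 2) :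
    C.weyl.wt = C.wt := by
  have e1 := wt_add_two_mul (h.weyl_wellFormed hwf)
  have e2 := wt_add_two_mul hwf
  rw [(h.labels_weyl_perm h2).length_eq, ← e2, h.numKind_weyl.2.1, h.numKind_weyl.2.2.1,
    h.numKind_R_add.2] at e1
  omega

/-- Each factor `∇υ` turns into an internal contraction. -/
theorem internal_weyl (h2 : ∀ l ∈ C.upsLabels, C.labels.count l = 2) {l : ℕ}
    (hl : l ∈ C.upsLabels) : ∃ F ∈ C.weyl, F.idx.count l = 2 := by
  have h1 := h.count_filter_of_mem h2 hl
  have h3 : l ∈ Contr.labels (C.filter fun F => F.kind ≠ .ups) := by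
    rw [← List.count_pos_iff, h1]; norm_num
  obtain ⟨F, hF, hlF⟩ := List.mem_flatMap.1 h3
  refine ⟨F.weyl C.upsLabels, List.mem_map_of_mem hF, ?_⟩
  rw [Factor.count_weyl (h.kind_of_mem_filter hF).2, if_pos hl,
    List.count_eq_one_of_mem (h.no_internal F (h.kind_of_mem_filter hF).1) hlF]

end Contr.IsCurvatureForm

/-- The complete contractions in the first form, of weight `-w`. -/
structure Contr.IsAdmissible (τ q a w : ℕ) (C : Contr) : Prop where
  complete : C.IsComplete
  form : C.IsCurvatureForm τ q a
  wt : C.wt = w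

namespace Contr.IsAdmissible

variable {τ q a w : ℕ} {C : Contr} (h : C.IsAdmissible τ q a w)

include h

theorem count_ups : ∀ l ∈ C.upsLabels, C.labels.count l = 2 := fun l hl =>
  h.complete.2 l ((labels_perm_ups C).mem_iff.2 (List.mem_append_right _ hl))

theorem weyl_complete : C.weyl.IsComplete :=
  h.complete.of_perm (h.form.weyl_wellFormed h.complete.1)
    (h.form.labels_weyl_perm h.count_ups)

theorem wt_weyl : C.weyl.wt = w := by
  rw [h.form.wt_weyl h.complete.1 h.count_ups, h.wt]

end Contr.IsAdmissible

/-- The form is invariant under permutations of the factors and of the indices in each factor. -/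
theorem Contr.IsAdmissible.of_forall₂ {τ q a w : ℕ} {C C' : Contr} (h : C.IsAdmissible τ q a w)
    (hC : List.Forall₂ (fun F F' : Factor => F'.kind = F.kind ∧ F'.idx.Perm F.idx) C C') :
    C'.IsAdmissible τ q a w := by
  have hmem : ∀ F' ∈ C', ∃ F ∈ C, F'.kind = F.kind ∧ F'.idx.Perm F.idx := by
    clear h
    induction hC with
    | nil => simp
    | cons h1 _ ih =>
      intro F' hF'
      rcases List.mem_cons.1 hF' with rfl | hF'
      · exact ⟨_, List.mem_cons_self, h1⟩
      · obtain ⟨F, hF, h2⟩ := ih F' hF'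
        exact ⟨F, List.mem_cons_of_mem _ hF, h2⟩
  have hlab : C'.labels.Perm C.labels := by
    clear h hmem
    induction hC with
    | nil => exact List.Perm.refl _
    | cons h1 _ ih =>
      rw [labels_cons, labels_cons]
      exact h1.2.append ih
  have hups : C'.upsLabels.Perm C.upsLabels := by
    clear h hmem hlab
    induction hC with
    | nil => exact List.Perm.refl _
    | @cons F F' K K' h1 _ ih =>
      by_cases hk : F.kind = .ups
      · have hk' : F'.kind = .ups := h1.1.trans hk
        simp only [upsLabels, hk, hk', decide_true, List.filter_cons_of_pos, labels_cons] at ih ⊢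
        exact h1.2.append ih
      · rw [upsLabels_cons hk, upsLabels_cons (by rwa [h1.1])]
        exact ih
  have hnum : ∀ k, C'.numKind k = C.numKind k := by
    intro k
    clear h hmem hlab hups
    induction hC with
    | nil => rfl
    | cons h1 _ ih => rw [numKind_cons, numKind_cons, ih, h1.1]
  have hwt : C'.wt = C.wt := by
    clear h hmem hlab hups hnum
    induction hC with
    | nil => rfl
    | cons h1 _ ih => rw [wt_cons, wt_cons, ih, Factor.wt_eq_of_perm h1.1 h1.2]
  refine ⟨h.complete.of_perm ?_ hlab, ⟨?_, ?_, ?_, ?_, ?_, ?_, ?_, ?_, ?_⟩, hwt.trans h.wt⟩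
  · intro F' hF'
    obtain ⟨F, hF, h1, h2⟩ := hmem F' hF'
    rw [h1, h2.length_eq]
    exact h.complete.1 F hF
  · intro F' hF'
    obtain ⟨F, hF, h1, h2⟩ := hmem F' hF'
    rw [h1]
    exact h.form.kinds F hF
  · intro F' hF' hk
    obtain ⟨F, hF, h1, h2⟩ := hmem F' hF'
    rw [h2.length_eq]
    exact h.form.ups_once F hF (h1 ▸ hk)
  · rw [hnum, h.form.num_psi]
  · rw [hnum, h.form.num_ups]
  · rw [← hC.length_eq, h.form.len]
  · intro F' hF'
    obtain ⟨F, hF, h1, h2⟩ := hmem F' hF'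
    exact h2.nodup_iff.2 (h.form.no_internal F hF)
  · exact hups.nodup_iff.2 h.form.ups_apart
  · intro l hl
    rw [hlab.count_eq]
    exact h.form.ups_not_free l (hups.mem_iff.1 hl)
  · intro F' hF' hk hl
    obtain ⟨F, hF, h1, h2⟩ := hmem F' hF'
    rw [h2.length_eq]
    exact h.form.psi_twice F hF (h1 ▸ hk) fun l hl' hl'' =>
      hl l (h2.mem_iff.2 hl') (hups.mem_iff.2 hl'')

end RiemContr

namespace RiemContr

/-! ### The class of a weylified contraction -/

theorem Factor.weyl_congr {u u' : List ℕ} (h : ∀ l, l ∈ u ↔ l ∈ u') : Factor.weyl u = Factor.weyl u' := by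
  funext F
  simp only [Factor.weyl, h]

theorem Factor.weylCoeff_congr (n : ℕ) {u u' : List ℕ} (h : ∀ l, l ∈ u ↔ l ∈ u') :
    Factor.weylCoeff n u = Factor.weylCoeff n u' := by
  funext F
  simp only [Factor.weylCoeff, h]

namespace Contr

variable {C D : Contr}

theorem upsLabels_perm (h : C.Perm D) : C.upsLabels.Perm D.upsLabels :=
  (h.filter _).flatMap_right _

theorem weyl_perm (h : C.Perm D) : C.weyl.Perm D.weyl := by
  unfold weyl
  rw [Factor.weyl_congr fun l => (upsLabels_perm h).mem_iff]
  exact (h.filter _).map _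

theorem weylCoeff_perm (n : ℕ) (h : C.Perm D) : C.weylCoeff n = D.weylCoeff n := by
  unfold weylCoeff
  rw [Factor.weylCoeff_congr n fun l => (upsLabels_perm h).mem_iff]
  exact (h.map _).prod_eq

theorem IsCurvatureForm.perm {τ q a : ℕ} (hC : C.IsCurvatureForm τ q a) (h : D.Perm C) :
    D.IsCurvatureForm τ q a where
  kinds F hF := hC.kinds F (h.mem_iff.1 hF)
  ups_once F hF := hC.ups_once F (h.mem_iff.1 hF)
  num_psi := (h.countP_eq _).trans hC.num_psi
  num_ups := (h.countP_eq _).trans hC.num_ups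
  len := h.length_eq.trans hC.len
  no_internal F hF := hC.no_internal F (h.mem_iff.1 hF)
  ups_apart := (upsLabels_perm h).nodup_iff.2 hC.ups_apart
  ups_not_free l hl := by
    rw [show D.labels.count l = C.labels.count l from (h.flatMap_right Factor.idx).count_eq l]
    exact hC.ups_not_free l ((upsLabels_perm h).mem_iff.1 hl)
  psi_twice F hF hk hl := hC.psi_twice F (h.mem_iff.1 hF) hk
    fun l h1 h2 => hl l h1 ((upsLabels_perm h).mem_iff.2 h2)

theorem IsAdmissible.perm {τ q a w : ℕ} (hC : C.IsAdmissible τ q a w) (h : D.Perm C) :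
    D.IsAdmissible τ q a w :=
  ⟨hC.complete.perm h, hC.form.perm h, ((h.map _).sum_eq).trans hC.wt⟩

section Relabel

variable {σ : ℕ → ℕ}

theorem upsLabels_relabel (σ : ℕ → ℕ) (C : Contr) : (C.relabel σ).upsLabels = C.upsLabels.map σ := by
  unfold upsLabels
  rw [← labels_relabel]
  unfold relabel
  rw [List.filter_map]
  rfl

theorem relabel_congr {σ' : ℕ → ℕ} (h : ∀ l ∈ C.labels, σ l = σ' l) : C.relabel σ = C.relabel σ' := by
  refine List.map_congr_left fun F hF => ?_
  have : F.idx.map σ = F.idx.map σ' := List.map_congr_left fun l hl =>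
    h l (List.mem_flatMap.2 ⟨F, hF, hl⟩)
  rw [Factor.relabel, Factor.relabel, this]

theorem wt_relabel (σ : ℕ → ℕ) (C : Contr) : (C.relabel σ).wt = C.wt := by
  unfold wt relabel
  rw [List.map_map]
  congr 1
  refine List.map_congr_left fun F _ => ?_
  simp [Factor.wt, Factor.relabel]

theorem numKind_relabel (σ : ℕ → ℕ) (C : Contr) (k : Kind) :
    (C.relabel σ).numKind k = C.numKind k := by
  unfold numKind relabel
  rw [List.countP_map]
  rfl

theorem IsAdmissible.relabel_iff (hσ : Function.Injective σ) {τ q a w : ℕ} :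
    (C.relabel σ).IsAdmissible τ q a w ↔ C.IsAdmissible τ q a w := by
  have key : ∀ p : Factor → Prop, (∀ F ∈ C.relabel σ, p F) ↔ ∀ F ∈ C, p (F.relabel σ) := by
    intro p
    simp [relabel]
  have h1 : (C.relabel σ).IsComplete ↔ C.IsComplete := by
    unfold IsComplete WellFormed
    rw [key, labels_relabel]
    simp only [Factor.relabel, List.length_map, List.forall_mem_map,
      List.count_map_of_injective _ _ hσ]
  have h2 : (C.relabel σ).length = C.length := by simp [relabel]
  constructor
  · intro h
    refine ⟨h1.1 h.complete, ⟨(key _).1 h.form.kinds, fun F hF hk => ?_, ?_, ?_, ?_, fun F hF => ?_, ?_,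
      fun l hl => ?_, fun F hF hk hl => ?_⟩, ?_⟩
    · simpa [Factor.relabel] using (key _).1 h.form.ups_once F hF hk
    · rw [← h.form.num_psi, numKind_relabel]
    · rw [← h.form.num_ups, numKind_relabel]
    · rw [← h.form.len, h2]
    · exact (List.nodup_map_iff hσ).1 ((key _).1 h.form.no_internal F hF)
    · have := h.form.ups_apart
      rwa [upsLabels_relabel, List.nodup_map_iff hσ] at this
    · have := h.form.ups_not_free (σ l) (by rw [upsLabels_relabel]; exact List.mem_map_of_mem hl)
      rwa [labels_relabel, List.count_map_of_injective _ _ hσ] at this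
    · have := (key _).1 h.form.psi_twice F hF hk
      rw [upsLabels_relabel] at this
      simp only [Factor.relabel, List.length_map, List.forall_mem_map,
        List.mem_map_of_injective hσ] at this
      exact this hl
    · rw [← h.wt, wt_relabel]
  · intro h
    refine ⟨h1.2 h.complete, ⟨(key _).2 h.form.kinds, (key _).2 fun F hF hk => ?_, ?_, ?_, ?_,
      (key _).2 fun F hF => ?_, ?_, fun l hl => ?_, (key _).2 fun F hF hk hl => ?_⟩, ?_⟩
    · simpa [Factor.relabel] using h.form.ups_once F hF hk
    · rw [numKind_relabel, h.form.num_psi]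
    · rw [numKind_relabel, h.form.num_ups]
    · rw [h2, h.form.len]
    · exact (List.nodup_map_iff hσ).2 (h.form.no_internal F hF)
    · rw [upsLabels_relabel, List.nodup_map_iff hσ]
      exact h.form.ups_apart
    · rw [upsLabels_relabel] at hl
      obtain ⟨l', hl', rfl⟩ := List.mem_map.1 hl
      rw [labels_relabel, List.count_map_of_injective _ _ hσ]
      exact h.form.ups_not_free l' hl'
    · rw [upsLabels_relabel] at hl
      simp only [Factor.relabel, List.length_map, List.forall_mem_map,
        List.mem_map_of_injective hσ] at hl ⊢
      exact h.form.psi_twice F hF hk hl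
    · rw [wt_relabel, h.wt]

theorem weyl_relabel (hσ : Function.Injective σ) (C : Contr) : (C.relabel σ).weyl = C.weyl.relabel σ := by
  unfold weyl
  rw [upsLabels_relabel]
  generalize C.upsLabels = u
  unfold relabel
  rw [List.filter_map, List.map_map, List.map_map]
  refine List.map_congr_left fun F _ => ?_
  obtain ⟨k, idx⟩ := F
  have : (idx.map σ).filter (fun l => l ∈ u.map σ) = (idx.filter fun l => l ∈ u).map σ := by
    rw [List.filter_map]
    congr 2
    funext l
    simp only [Function.comp_apply, List.mem_map_of_injective hσ]
  cases k <;> simp only [Function.comp_apply, Factor.weyl, Factor.relabel, List.map_append, this]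

theorem weylCoeff_relabel (hσ : Function.Injective σ) (n : ℕ) (C : Contr) :
    (C.relabel σ).weylCoeff n = C.weylCoeff n := by
  unfold weylCoeff
  rw [upsLabels_relabel]
  generalize C.upsLabels = u
  unfold relabel
  rw [List.map_map]
  congr 1
  refine List.map_congr_left fun F _ => ?_
  have : (F.relabel σ).internal = F.internal.map σ := by
    simp [Factor.internal, Factor.relabel, List.map_drop]
  have h2 : (∃ l ∈ F.internal.map σ, l ∈ u.map σ) ↔ ∃ l ∈ F.internal, l ∈ u := by
    constructor
    · rintro ⟨l, hl, hl'⟩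
      obtain ⟨l, h3, rfl⟩ := List.mem_map.1 hl
      exact ⟨l, h3, (List.mem_map_of_injective hσ).1 hl'⟩
    · rintro ⟨l, hl, hl'⟩
      exact ⟨σ l, List.mem_map_of_mem hl, List.mem_map_of_mem hl'⟩
  simp only [Function.comp_apply, Factor.weylCoeff, this, h2]
  rfl

end Relabel

/-- An injective renaming of the indices of a contraction extends to an injective map. -/
theorem exists_injective_extension {σ : ℕ → ℕ} (hσ : ∀ l ∈ C.labels, ∀ l' ∈ C.labels, σ l = σ l' → l = l') :
    ∃ σ' : ℕ → ℕ, Function.Injective σ' ∧ ∀ l ∈ C.labels, σ l = σ' l := by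
  classical
  obtain ⟨M, hM⟩ : ∃ M, ∀ l ∈ C.labels, σ l < M := by
    refine ⟨(C.labels.map σ).sum + 1, fun l hl => ?_⟩
    have := List.single_le_sum (l := C.labels.map σ) (by simp) (σ l) (List.mem_map_of_mem hl)
    omega
  refine ⟨fun l => if l ∈ C.labels then σ l else l + M, fun l l' h => ?_, fun l hl => by simp [hl]⟩
  simp only at h
  split_ifs at h with h1 h2 h2
  · exact hσ l h1 l' h2 h
  · have := hM l h1; omega
  · have := hM l' h2; omega
  · omega

end Contr

open Classical in
/-- The class of `Weylify[C]` for the complete contractions `C` in the first form of weight `-w`, and `0`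
for all other contractions. -/
noncomputable def weylCls (n τ q a w : ℕ) (S : Submodule ℝ LinComb) (C : Contr) : LinComb ⧸ S :=
  if C.IsAdmissible τ q a w then C.weylCoeff n • cls S C.weyl else 0

section WeylCls

variable {n τ q a w : ℕ} {S : Submodule ℝ LinComb} (hS : ErrorSpace n τ q a w S) (hn : 4 ≤ n)

theorem weylCls_of_not {C : Contr} (h : ¬ C.IsAdmissible τ q a w) : weylCls n τ q a w S C = 0 :=
  if_neg h

theorem weylCls_of {C : Contr} (h : C.IsAdmissible τ q a w) :
    weylCls n τ q a w S C = C.weylCoeff n • cls S C.weyl :=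
  if_pos h

theorem Contr.IsAdmissible.head_perm {k : Kind} {l l' : List ℕ} {K : Contr} (hl : l'.Perm l)
    (h : Contr.IsAdmissible τ q a w (⟨k, l⟩ :: K)) : Contr.IsAdmissible τ q a w (⟨k, l'⟩ :: K) :=
  h.of_forall₂ (List.Forall₂.cons ⟨rfl, hl⟩ (List.forall₂_same.2 fun _ _ => ⟨rfl, List.Perm.refl _⟩))

/-- The factors `∇υ` have only one index. -/
theorem weylCls_ups_perm {l l' : List ℕ} {K : Contr} (hl : l.Perm l') :
    weylCls n τ q a w S (⟨.ups, l⟩ :: K) = weylCls n τ q a w S (⟨.ups, l'⟩ :: K) := by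
  by_cases hC : Contr.IsAdmissible τ q a w (⟨.ups, l⟩ :: K)
  · have h1 := hC.form.ups_once _ List.mem_cons_self rfl
    obtain ⟨x, rfl⟩ := List.length_eq_one_iff.1 h1
    rw [List.singleton_perm.1 hl]
  · rw [weylCls_of_not hC, weylCls_of_not fun hD => hC (hD.head_perm hl)]

include hS hn

theorem weylCls_perm {C D : Contr} (h : C.Perm D) : weylCls n τ q a w S C = weylCls n τ q a w S D := by
  by_cases hC : C.IsAdmissible τ q a w
  · rw [weylCls_of hC, weylCls_of (hC.perm h.symm), Contr.weylCoeff_perm n h,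
      cls_perm hS.long hn hC.weyl_complete (Contr.weyl_perm h)]
  · rw [weylCls_of_not hC, weylCls_of_not fun hD => hC (hD.perm h)]

/-- Only injectivity on the names which occur is needed. -/
theorem weylCls_relabel {C : Contr} {σ : ℕ → ℕ}
    (hσ : ∀ l ∈ C.labels, ∀ l' ∈ C.labels, σ l = σ l' → l = l') :
    weylCls n τ q a w S (C.relabel σ) = weylCls n τ q a w S C := by
  obtain ⟨σ', h1, h2⟩ := Contr.exists_injective_extension hσ
  rw [Contr.relabel_congr h2]
  by_cases hC : C.IsAdmissible τ q a w
  · rw [weylCls_of hC, weylCls_of ((Contr.IsAdmissible.relabel_iff h1).2 hC),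
      Contr.weylCoeff_relabel h1, Contr.weyl_relabel h1, cls_relabel hS.long hn h1 hC.weyl_complete]
  · rw [weylCls_of_not hC, weylCls_of_not fun hD => hC ((Contr.IsAdmissible.relabel_iff h1).1 hD)]

/-- The factors `∇^{(u)}P` which arise from the factors `∇^{(p)}ψ` are symmetric in their indices. -/
theorem cls_weyl_psi_perm {l l' : List ℕ} {K : Contr} (h : Contr.IsAdmissible τ q a w (⟨.psi, l⟩ :: K))
    (hl : (l.filter (fun x => x ∈ K.upsLabels) ++ l).Perm l') :
    cls S (⟨.P, l.filter (fun x => x ∈ K.upsLabels) ++ l⟩ :: K.weyl) = cls S (⟨.P, l'⟩ :: K.weyl) := by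
  have hc := h.weyl_complete
  have hw := h.wt_weyl
  have hlen := h.form.length_weyl
  have hnum := h.form.numKind_weyl.1
  have hk : ∀ F ∈ K.weyl, F.kind = .W ∨ F.kind = .P := fun F hF =>
    h.form.weyl_kinds (by rw [Contr.weyl_cons (by simp)]; exact List.mem_cons_of_mem _ hF)
  rw [Contr.weyl_cons (by simp)] at hc hw hlen hnum
  rw [Contr.wt_cons] at hw
  rw [Contr.numKind_cons] at hnum
  simp only [Factor.weyl, Factor.wt, List.length_cons, if_true] at hc hw hlen hnum ⊢
  exact hS.cls_P_perm hn hk hlen hl hw (by omega) hc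

/-- The factors `∇^{(p)}ψ` are symmetric in their indices. -/
theorem weylCls_psi_perm {l l' : List ℕ} {K : Contr} (hl : l.Perm l') :
    weylCls n τ q a w S (⟨.psi, l⟩ :: K) = weylCls n τ q a w S (⟨.psi, l'⟩ :: K) := by
  by_cases hC : Contr.IsAdmissible τ q a w (⟨.psi, l⟩ :: K)
  · rw [weylCls_of hC, weylCls_of (hC.head_perm hl.symm), Contr.weylCoeff_cons _ (by simp),
      Contr.weylCoeff_cons _ (by simp), Contr.weyl_cons (by simp), Contr.weyl_cons (by simp)]
    simp only [Factor.weyl]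
    rw [cls_weyl_psi_perm hS hn hC ((hl.filter fun x => decide (x ∈ K.upsLabels)).append hl)]
    simp [Factor.weylCoeff]
  · rw [weylCls_of_not hC, weylCls_of_not fun hD => hC (hD.head_perm hl)]

theorem weylSlot_of_admissible {Λ : List ℕ} {K : Contr}
    (h : Contr.IsAdmissible τ q a w (⟨.R, Λ⟩ :: K)) :
    WeylSlot n τ q a w S K.upsLabels Λ K.weyl := by
  have hR : (⟨.R, Λ⟩ : Factor).kind ≠ .ups := by simp
  have hc := h.weyl_complete
  have hw := h.wt_weyl
  have hlen := h.form.length_weyl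
  have hnum := h.form.numKind_weyl.1
  have hk := fun F => h.form.weyl_kinds (F := F)
  have hint := fun l => h.form.internal_weyl h.count_ups (l := l)
  have hcard := h.form.card_upsLabels
  rw [Contr.upsLabels_cons hR] at hcard
  simp only [Contr.upsLabels_cons hR, Contr.weyl_cons hR] at hc hw hlen hnum hk hint
  rw [Contr.wt_cons] at hw
  rw [Contr.numKind_cons] at hnum
  simp only [Factor.weyl, Factor.wt, List.length_cons] at hc hw hlen hnum hint
  refine ⟨hS, hn, h.form.no_internal _ List.mem_cons_self, hc,
    fun F hF => hk F (List.mem_cons_of_mem _ hF), hlen, hw, by simpa using hnum, hcard.ge,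
    fun l hl => ?_⟩
  obtain ⟨F, hF, h2⟩ := hint l hl
  rcases List.mem_cons.1 hF with rfl | hF
  · left
    by_contra hΛ
    simp [hΛ, List.count_eq_zero_of_not_mem] at h2
  · exact Or.inr ⟨F, hF, h2⟩

theorem weylCls_slot {Λ D v : List ℕ} {K : Contr} (h : Contr.IsAdmissible τ q a w (⟨.R, Λ⟩ :: K))
    (hv : v.length = 4) (hp : (D ++ v).Perm Λ) :
    weylCls n τ q a w S (⟨.R, D ++ v⟩ :: K) =
      K.weylCoeff n • slotCoeff n K.upsLabels v • slotCls S K.upsLabels Λ K.weyl D v := by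
  have hs := weylSlot_of_admissible hS hn h
  rw [weylCls_of (h.head_perm hp), Contr.weylCoeff_cons _ (by simp), Contr.weyl_cons (by simp), mul_comm,
    mul_smul]
  congr 2
  · simp [Factor.weylCoeff, slotCoeff, Factor.internal, Kind.arity, hv]
  · have h1 := (hp.filter fun l => decide (l ∈ K.upsLabels)).append_right D
    have h2 := hs.cls_perm_left hv h1 (by
      rw [List.append_assoc]
      exact (hp.filter _).append hp)
    simp only [Factor.weyl, slotCls, ← List.append_assoc] at h2 ⊢
    exact h2

/-- Modulo error terms the factors `∇^{(m)}R`, weylified, satisfy the Bianchi identities and are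
symmetric in the derivative indices. -/
theorem weylCls_curvLike {Λ : List ℕ} {K : Contr} (h : Contr.IsAdmissible τ q a w (⟨.R, Λ⟩ :: K)) :
    CurvLike (Λ : Multiset ℕ) fun D x y z t =>
      weylCls n τ q a w S (⟨.R, D.toList ++ [x, y, z, t]⟩ :: K) := by
  have hs := weylSlot_of_admissible hS hn h
  have hperm : ∀ (D : Multiset ℕ) (L v : List ℕ), (L : Multiset ℕ) = D → (v : Multiset ℕ) + D = Λ →
      (L ++ v).Perm Λ := by
    intro D L v h1 h2
    rw [← Multiset.coe_eq_coe, ← h2, ← h1, ← Multiset.coe_add, add_comm]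
  have hval : ∀ (D : Multiset ℕ) (L v : List ℕ), v.length = 4 → (L : Multiset ℕ) = D →
      (v : Multiset ℕ) + D = Λ → weylCls n τ q a w S (⟨.R, D.toList ++ v⟩ :: K) =
        K.weylCoeff n • slotCoeff n K.upsLabels v • slotCls S K.upsLabels Λ K.weyl L v := by
    intro D L v hv h1 h2
    rw [weylCls_slot hS hn h hv (hperm D _ v D.coe_toList h2),
      hs.slot_perm hv (hperm D _ v D.coe_toList h2)]
    rw [← Multiset.coe_eq_coe, D.coe_toList, h1]
  have hcons : ∀ (x y z t : ℕ) (D : Multiset ℕ), x ::ₘ y ::ₘ z ::ₘ t ::ₘ D = Λ →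
      (([x, y, z, t] : List ℕ) : Multiset ℕ) + D = Λ := by
    intro x y z t D hD
    rw [← hD]
    simp [← Multiset.cons_coe]
  have hv : ∀ {D : Multiset ℕ} {v v' : List ℕ}, (v : Multiset ℕ) + D = Λ →
      (∀ l, v'.count l = v.count l) → (v' : Multiset ℕ) + D = Λ := by
    intro D v v' h1 h2
    rw [← h1, Multiset.coe_eq_coe.2 (List.perm_iff_count.2 h2)]
  have hcoeff : ∀ {v v' : List ℕ}, (∀ l, v'.count l = v.count l) →
      slotCoeff n K.upsLabels v' = slotCoeff n K.upsLabels v := by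
    intro v v' h2
    simp only [slotCoeff, (List.perm_iff_count.2 h2).mem_iff]
  refine ⟨fun D x y z t hD => ?_, fun D x y z t hD => ?_, fun D x y z t hD => ?_,
    fun D x y z t hD => ?_, fun D e x y z t hD => ?_⟩
  · have h1 := hcons _ _ _ _ _ hD
    have c1 : ∀ l, [y, x, z, t].count l = [x, y, z, t].count l := fun l => by
      simp only [List.count_cons]; omega
    rw [hval D D.toList _ rfl D.coe_toList h1, hval D D.toList _ rfl D.coe_toList (hv h1 c1), hcoeff c1,
      hs.left (hperm D _ _ D.coe_toList h1), smul_neg, smul_neg]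
  · have h1 := hcons _ _ _ _ _ hD
    have c1 : ∀ l, [x, y, t, z].count l = [x, y, z, t].count l := fun l => by
      simp only [List.count_cons]; omega
    rw [hval D D.toList _ rfl D.coe_toList h1, hval D D.toList _ rfl D.coe_toList (hv h1 c1), hcoeff c1,
      hs.right (hperm D _ _ D.coe_toList h1), smul_neg, smul_neg]
  · have h1 := hcons _ _ _ _ _ hD
    have c1 : ∀ l, [z, t, x, y].count l = [x, y, z, t].count l := fun l => by
      simp only [List.count_cons]; omega
    rw [hval D D.toList _ rfl D.coe_toList h1, hval D D.toList _ rfl D.coe_toList (hv h1 c1), hcoeff c1,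
      hs.pair (hperm D _ _ D.coe_toList h1)]
  · have h1 := hcons _ _ _ _ _ hD
    have c1 : ∀ l, [x, z, t, y].count l = [x, y, z, t].count l := fun l => by
      simp only [List.count_cons]; omega
    have c2 : ∀ l, [x, t, y, z].count l = [x, y, z, t].count l := fun l => by
      simp only [List.count_cons]; omega
    rw [hval D D.toList _ rfl D.coe_toList h1, hval D D.toList _ rfl D.coe_toList (hv h1 c1), hcoeff c1,
      hval D D.toList _ rfl D.coe_toList (hv h1 c2), hcoeff c2, ← smul_add, ← smul_add, ← smul_add,
      ← smul_add, hs.first (hperm D _ _ D.coe_toList h1), smul_zero, smul_zero]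
  · have hL : ∀ p : ℕ, ((p :: D.toList : List ℕ) : Multiset ℕ) = p ::ₘ D := fun p => by
      rw [← Multiset.cons_coe, D.coe_toList]
    have h1 : (([x, y, z, t] : List ℕ) : Multiset ℕ) + (e ::ₘ D) = Λ := by
      rw [← hD]
      simp [← Multiset.cons_coe]
    have h2 : (([y, e, z, t] : List ℕ) : Multiset ℕ) + (x ::ₘ D) = Λ := by
      rw [← h1]
      ext l
      simp only [Multiset.count_add, Multiset.coe_count, List.count_cons, Multiset.count_cons]
      simp only [beq_iff_eq, eq_comm (a := l)]
      omega
    have h3 : (([e, x, z, t] : List ℕ) : Multiset ℕ) + (y ::ₘ D) = Λ := by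
      rw [← h1]
      ext l
      simp only [Multiset.count_add, Multiset.coe_count, List.count_cons, Multiset.count_cons]
      simp only [beq_iff_eq, eq_comm (a := l)]
      omega
    rw [hval _ (e :: D.toList) _ rfl (hL e) h1, hval _ (x :: D.toList) _ rfl (hL x) h2,
      hval _ (y :: D.toList) _ rfl (hL y) h3, ← smul_add, ← smul_add,
      hs.second (hperm _ _ _ (hL e) h1), smul_zero]

end WeylCls

end RiemContr

namespace RiemContr

/-! ### Recovering a contraction from its leading part -/

theorem pairSum_swap {α M : Type*} [DecidableEq α] [AddCommMonoid M] {D : Multiset α} (hD : D.Nodup)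
    (g : α → α → Multiset α → M) : pairSum D g = pairSum D fun x y E => g y x E := by
  induction D using Multiset.induction generalizing g with
  | empty => rfl
  | cons b D ih =>
    rw [pairSum_cons hD, pairSum_cons hD, ih (Multiset.nodup_cons.1 hD).2,
      add_comm (D.map fun y => g b y (D.erase y)).sum]

theorem CurvLike.pairSum_symm {α M : Type*} [DecidableEq α] [AddCommGroup M] {Λ : Multiset α}
    {T : Multiset α → α → α → α → α → M} (hT : CurvLike Λ T) (hΛ : Λ.Nodup) {A : Multiset α} {a c : α}
    (h : a ::ₘ c ::ₘ A = Λ) :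
    pairSum A (fun x y E => T E c x a y) = pairSum A (fun x y E => T E a x c y) := by
  have hA : A.Nodup := by
    rw [← h] at hΛ
    exact (Multiset.nodup_cons.1 (Multiset.nodup_cons.1 hΛ).2).2
  rw [pairSum_swap hA]
  refine pairSum_congr fun x y E hE => hT.pair _ _ _ _ _ ?_
  rw [← h, ← hE, Multiset.cons_swap y a, Multiset.cons_swap y x, Multiset.cons_swap c a,
    Multiset.cons_swap c x]

/-- The partial derivatives, at one point, of functions `k_{ac}`, of `ψ` and of `υ`. The metric is
perturbed by `k_{ac} + k_{ca}`, so that no symmetry has to be imposed on the variables. -/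
inductive JetVar (n : ℕ) where
  | metric (D : Multiset (Fin n)) (a c : Fin n)
  | psi (D : Multiset (Fin n))
  | ups (D : Multiset (Fin n))

section Reconstruction

open MvPolynomial

variable {n : ℕ}

/-- The partial derivatives of the perturbation of the metric. -/
noncomputable def metricJet (D : Multiset (Fin n)) (a c : Fin n) : MvPolynomial (JetVar n) ℝ :=
  X (.metric D a c) + X (.metric D c a)

/-- The linearization of `∇^{(m)}R_{ijkl}`; the derivative indices form the multiset `D`. -/
noncomputable def curvatureJet (D : Multiset (Fin n)) (i j k l : Fin n) : MvPolynomial (JetVar n) ℝ :=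
  C (1 / 2) * (metricJet (j ::ₘ k ::ₘ D) i l - metricJet (i ::ₘ k ::ₘ D) j l
    - metricJet (j ::ₘ l ::ₘ D) i k + metricJet (i ::ₘ l ::ₘ D) j k)

/-- The leading part of a component of a factor. -/
noncomputable def leading : Kind → List (Fin n) → MvPolynomial (JetVar n) ℝ
  | .R, v =>
    match v.drop (v.length - 4) with
    | [i, j, k, l] => curvatureJet (v.take (v.length - 4)) i j k l
    | _ => 0
  | .psi, v => X (.psi v)
  | .ups, v => X (.ups v)
  | _, _ => 0

theorem leading_R (D : List (Fin n)) (i j k l : Fin n) :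
    leading .R (D ++ [i, j, k, l]) = curvatureJet D i j k l := by
  simp [leading]

/-- The derivatives of a metric in terms of the derivatives of its curvature. The variables of the polynomial ring are all possible factors of contractions, where
the values of the indices serve as their names. With `|D| = m + 2` the constant is
`-1 / ((m + 2) (m + 3))`, which cancels the factor in `CurvLike.reconstruct`. -/
noncomputable def recover : JetVar n → MvPolynomial Factor ℝ
  | .metric D a c => C (-1 / ((D.card : ℝ) * (D.card + 1))) * pairSum (D.map Fin.val)
      fun x y E => X ⟨.R, E.toList ++ [(a : ℕ), x, (c : ℕ), y]⟩
  | .psi D => X ⟨.psi, (D.map Fin.val).toList⟩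
  | .ups D => X ⟨.ups, (D.map Fin.val).toList⟩

/-- The linear map which sends a product of factors to the class of its weylification, and products
which are not complete contractions in the first form to `0`. -/
noncomputable def weylMap (n τ q a w : ℕ) (S : Submodule ℝ LinComb) :
    MvPolynomial Factor ℝ →ₗ[ℝ] LinComb ⧸ S :=
  (basisMonomials Factor ℝ).constr ℝ fun m => weylCls n τ q a w S (Finsupp.toMultiset m).toList

variable {τ q a w : ℕ} {S : Submodule ℝ LinComb}

theorem weylMap_monomial (m : Factor →₀ ℕ) : weylMap n τ q a w S (monomial m 1) =
    weylCls n τ q a w S (Finsupp.toMultiset m).toList := by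
  have h := (basisMonomials Factor ℝ).constr_basis ℝ
    (fun m => weylCls n τ q a w S (Finsupp.toMultiset m).toList) m
  rwa [coe_basisMonomials] at h

section

variable (hS : ErrorSpace n τ q a w S) (hn : 4 ≤ n)

include hS hn

theorem weylMap_X_mul (F : Factor) (m : Factor →₀ ℕ) :
    weylMap n τ q a w S (X F * monomial m 1) =
      weylCls n τ q a w S (F :: (Finsupp.toMultiset m).toList) := by
  rw [X, monomial_mul, one_mul, weylMap_monomial]
  refine weylCls_perm hS hn ?_
  rw [← Multiset.coe_eq_coe, Multiset.coe_toList, ← Multiset.cons_coe, Multiset.coe_toList, map_add,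
    Finsupp.toMultiset_single, one_smul, Multiset.singleton_add]

theorem weylMap_prod (K : Contr) : weylMap n τ q a w S (K.map X).prod = weylCls n τ q a w S K := by
  have h : ∀ K : Contr, ∃ m : Factor →₀ ℕ, (K.map X).prod = (monomial m 1 : MvPolynomial Factor ℝ) ∧
      Finsupp.toMultiset m = (K : Multiset Factor) := by
    intro K
    induction K with
    | nil => exact ⟨0, rfl, by simp⟩
    | cons F K ih =>
      obtain ⟨m, h1, h2⟩ := ih
      refine ⟨Finsupp.single F 1 + m, ?_, ?_⟩
      · rw [List.map_cons, List.prod_cons, h1, X, monomial_mul, one_mul]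
      · rw [map_add, h2, Finsupp.toMultiset_single, one_smul, Multiset.singleton_add, Multiset.cons_coe]
  obtain ⟨m, h1, h2⟩ := h K
  rw [h1, weylMap_monomial]
  refine weylCls_perm hS hn ?_
  rw [← Multiset.coe_eq_coe, Multiset.coe_toList, h2]

theorem weylCls_R_perm {L L' v : List ℕ} (hL : L.Perm L') (hv : v.length = 4) (K : Contr) :
    weylCls n τ q a w S (⟨.R, L ++ v⟩ :: K) = weylCls n τ q a w S (⟨.R, L' ++ v⟩ :: K) := by
  by_cases h : Contr.IsAdmissible τ q a w (⟨.R, L ++ v⟩ :: K)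
  · rw [weylCls_slot hS hn h hv (List.Perm.refl _), weylCls_slot hS hn h hv (hL.symm.append_right v),
      (weylSlot_of_admissible hS hn h).slot_perm hv (List.Perm.refl _) hL]
  · rw [weylCls_of_not h, weylCls_of_not fun h' => h (h'.head_perm (hL.append_right v))]

/-- The curvature can be replaced by its expression through the derivatives of the metric, since
weylified factors are curvature-like. -/
theorem weylMap_curvatureJet (D : List (Fin n)) (i j k l : Fin n) (m : Factor →₀ ℕ) :
    weylMap n τ q a w S (aeval recover (curvatureJet D i j k l) * monomial m 1) =
      weylMap n τ q a w S (X ⟨.R, (D ++ [i, j, k, l]).map Fin.val⟩ * monomial m 1) := by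
  set K := (Finsupp.toMultiset m).toList with hK
  set Λ : List ℕ := (D ++ [i, j, k, l]).map Fin.val with hΛ
  set T : Multiset ℕ → ℕ → ℕ → ℕ → ℕ → LinComb ⧸ S := fun E x y z t =>
    weylCls n τ q a w S (⟨.R, E.toList ++ [x, y, z, t]⟩ :: K) with hT
  set B : Multiset ℕ := (D : Multiset (Fin n)).map Fin.val with hB
  have hΛ' : (i : ℕ) ::ₘ (j : ℕ) ::ₘ (k : ℕ) ::ₘ (l : ℕ) ::ₘ B = Λ := by
    rw [hΛ, hB, List.map_append, ← Multiset.coe_add, Multiset.map_coe, add_comm]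
    simp [← Multiset.cons_coe]
  have hright : weylMap n τ q a w S (X ⟨.R, Λ⟩ * monomial m 1) = T B i j k l := by
    rw [weylMap_X_mul hS hn, hΛ, List.map_append]
    refine weylCls_R_perm hS hn ?_ rfl K
    rw [← Multiset.coe_eq_coe, Multiset.coe_toList, hB, Multiset.map_coe]
  have hleft : ∀ (A : Multiset (Fin n)) (a' c : Fin n), A.card = D.length + 2 →
      weylMap n τ q a w S (aeval recover (metricJet A a' c) * monomial m 1) =
      (-1 / (((D.length : ℝ) + 2) * (D.length + 3))) •
        (pairSum (A.map Fin.val) (fun x y E => T E a' x c y)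
          + pairSum (A.map Fin.val) (fun x y E => T E c x a' y)) := by
    intro A a' c hA
    have h1 : ∀ a' c : Fin n, weylMap n τ q a w S (recover (.metric A a' c) * monomial m 1) =
        (-1 / (((D.length : ℝ) + 2) * (D.length + 3))) •
          pairSum (A.map Fin.val) (fun x y E => T E a' x c y) := by
      intro a' c
      have h2 := map_pairSum (((weylMap n τ q a w S).comp
        (LinearMap.mulRight ℝ (monomial m (1 : ℝ)))).toAddMonoidHom) (A.map Fin.val)
        (fun x y E => X ⟨.R, E.toList ++ [(a' : ℕ), x, (c : ℕ), y]⟩)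
      simp only [LinearMap.toAddMonoidHom_coe, LinearMap.comp_apply, LinearMap.mulRight_apply,
        weylMap_X_mul hS hn] at h2
      rw [recover, mul_assoc, ← smul_eq_C_mul, map_smul, h2, hA]
      congr 2
      push_cast
      ring
    rw [metricJet, map_add, aeval_X, aeval_X, add_mul, map_add, h1, h1, smul_add]
  rw [hright, curvatureJet, ← smul_eq_C_mul, map_smul (aeval recover), smul_mul_assoc, map_smul]
  simp only [map_add, map_sub, add_mul, sub_mul]
  rw [hleft _ _ _ (by simp), hleft _ _ _ (by simp), hleft _ _ _ (by simp), hleft _ _ _ (by simp)]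
  simp only [Multiset.map_cons, ← hB]
  have hmem : ∀ x y z t : ℕ, (∀ p, Multiset.count p {x, y, z, t} =
      Multiset.count p {(i : ℕ), (j : ℕ), (k : ℕ), (l : ℕ)}) →
      x ::ₘ y ::ₘ z ::ₘ t ::ₘ B = Λ := by
    intro x y z t hp
    rw [← hΛ']
    have := Multiset.ext.2 hp
    have h2 := congrArg (· + B) this
    simpa [Multiset.insert_eq_cons] using h2
  by_cases h : Contr.IsAdmissible τ q a w (⟨.R, Λ⟩ :: K)
  · have hcl : CurvLike (Λ : Multiset ℕ) T := weylCls_curvLike hS hn h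
    have hnd : (Λ : Multiset ℕ).Nodup := h.form.no_internal _ List.mem_cons_self
    have hBc : B.card = D.length := by simp [hB]
    rw [hcl.pairSum_symm hnd (hmem i l j k fun p => by
        simp only [Multiset.insert_eq_cons, Multiset.count_cons, Multiset.count_singleton]; omega),
      hcl.pairSum_symm hnd (hmem j l i k fun p => by
        simp only [Multiset.insert_eq_cons, Multiset.count_cons, Multiset.count_singleton]; omega),
      hcl.pairSum_symm hnd (hmem i k j l fun p => by
        simp only [Multiset.insert_eq_cons, Multiset.count_cons, Multiset.count_singleton]; omega),
      hcl.pairSum_symm hnd (hmem j k i l fun p => by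
        simp only [Multiset.insert_eq_cons, Multiset.count_cons, Multiset.count_singleton]; omega)]
    have hrec := hcl.reconstruct hnd hΛ'
    rw [hBc, ← Nat.cast_smul_eq_nsmul ℝ] at hrec
    have hN : (((D.length + 2) * (D.length + 3) : ℕ) : ℝ) =
      ((D.length : ℝ) + 2) * (D.length + 3) := by push_cast; ring
    rw [hN] at hrec
    have hne : ((D.length : ℝ) + 2) * (D.length + 3) ≠ 0 := by positivity
    have hT' : T B i j k l = (((D.length : ℝ) + 2) * (D.length + 3))⁻¹ •
        ((((D.length : ℝ) + 2) * (D.length + 3)) • T B i j k l) := by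
      rw [smul_smul, inv_mul_cancel₀ hne, one_smul]
    rw [hT', ← hrec, neg_div, one_div]
    module
  · -- all terms have the same names as indices, and vanish
    have hz : ∀ (A : Multiset ℕ) (x y : ℕ), x ::ₘ y ::ₘ A = Λ →
        pairSum A (fun x' y' E => T E x x' y y') = 0 ∧ pairSum A (fun x' y' E => T E y x' x y') = 0 := by
      intro A x y hA
      have h0 : ∀ x y : ℕ, x ::ₘ y ::ₘ A = Λ → pairSum A (fun x' y' E => T E x x' y y') = 0 := by
        intro x y hA
        rw [pairSum_congr (g' := fun _ _ _ => 0), pairSum_const, smul_zero]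
        intro x' y' E hE
        refine weylCls_of_not fun h' => h (h'.head_perm ?_)
        rw [← Multiset.coe_eq_coe, ← Multiset.coe_add, Multiset.coe_toList, ← hA, ← hE]
        ext p
        simp only [Multiset.count_add, Multiset.coe_count, List.count_cons, Multiset.count_cons,
          List.count_nil, beq_iff_eq, eq_comm (a := p)]
        omega
      exact ⟨h0 x y hA, h0 y x (by rw [Multiset.cons_swap, hA])⟩
    obtain ⟨a1, a2⟩ := hz _ _ _ (hmem i l j k fun p => by
        simp only [Multiset.insert_eq_cons, Multiset.count_cons, Multiset.count_singleton]; omega)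
    obtain ⟨b1, b2⟩ := hz _ _ _ (hmem j l i k fun p => by
        simp only [Multiset.insert_eq_cons, Multiset.count_cons, Multiset.count_singleton]; omega)
    obtain ⟨c1, c2⟩ := hz _ _ _ (hmem i k j l fun p => by
        simp only [Multiset.insert_eq_cons, Multiset.count_cons, Multiset.count_singleton]; omega)
    obtain ⟨d1, d2⟩ := hz _ _ _ (hmem j k i l fun p => by
        simp only [Multiset.insert_eq_cons, Multiset.count_cons, Multiset.count_singleton]; omega)
    rw [a1, a2, b1, b2, c1, c2, d1, d2]
    have : T B i j k l = 0 := by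
      refine weylCls_of_not fun h' => h (h'.head_perm ?_)
      rw [← Multiset.coe_eq_coe, ← Multiset.coe_add, Multiset.coe_toList, ← hΛ']
      ext p
      simp only [Multiset.count_add, Multiset.coe_count, List.count_cons, Multiset.count_cons,
        List.count_nil, beq_iff_eq, eq_comm (a := p)]
      omega
    simp [this]

end

end Reconstruction

end RiemContr

namespace RiemContr

/-! ### Weylified contractions as functions of the leading part -/

section Counting

variable {n : ℕ}

theorem length_eq_two_mul_dedup {α : Type*} [DecidableEq α] {L : List α} (h : ∀ l ∈ L, L.count l = 2) :
    L.length = 2 * L.dedup.length := by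
  rw [← List.sum_map_count_dedup_eq_length L,
    List.map_congr_left fun l hl => h l (List.mem_dedup.1 hl)]
  simp [mul_comm]

/-- The sum over the values of the names in `A` of the indicator function of injectivity, when the
names in `B` have given values. -/
theorem sumOver_nodup {M : Type*} [AddCommMonoid M] (x : M) (A B : List ℕ) (hAB : (A ++ B).Nodup)
    (c : ℕ → Fin n) :
    sumOver A (fun d => if ((A ++ B).map d).Nodup then x else 0) c =
      if (B.map c).Nodup then ((n - B.length).descFactorial A.length) • x else 0 := by
  induction A generalizing B c with
  | nil => simp [sumOver]
  | cons b A ih =>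
    have hp : (A ++ b :: B).Perm (b :: A ++ B) := List.perm_middle
    have h1 : ∀ d : ℕ → Fin n, (if ((b :: A ++ B).map d).Nodup then x else 0) =
        if ((A ++ b :: B).map d).Nodup then x else 0 := by
      intro d
      exact if_congr (hp.map d).nodup_iff.symm rfl rfl
    rw [sumOver_congr h1, sumOver]
    have hb : b ∉ B := by
      have := (List.nodup_cons.1 (show (b :: (A ++ B)).Nodup from hAB)).1
      simp only [List.mem_append, not_or] at this
      exact this.2
    have h2 : ∀ v, (b :: B).map (Function.update c b v) = v :: B.map c := by
      intro v
      rw [List.map_cons, Function.update_self, map_update_of_notMem c hb v]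
    simp only [ih (b :: B) (hp.nodup_iff.2 hAB), h2, List.nodup_cons, List.length_cons]
    by_cases hB : (B.map c).Nodup
    · simp only [hB, and_true, if_true]
      rw [← Finset.sum_filter, Finset.sum_const, smul_smul]
      have hcard : (Finset.univ.filter fun v => v ∉ B.map c).card = n - B.length := by
        have := Finset.card_compl (B.map c).toFinset
        rw [List.toFinset_card_of_nodup hB, List.length_map, Fintype.card_fin] at this
        rw [← this]
        congr 1
        ext v
        simp
      rw [hcard]
      congr 1
      rcases Nat.eq_zero_or_pos (n - B.length) with h0 | h0
      · rw [h0, Nat.zero_descFactorial_succ, zero_mul]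
      · obtain ⟨k, hk⟩ := Nat.exists_eq_succ_of_ne_zero h0.ne'
        rw [hk, Nat.succ_eq_add_one, Nat.succ_descFactorial_succ, show n - (B.length + 1) = k by omega]
    · simp [hB]

end Counting

section Reconstruction

open MvPolynomial

variable {n τ q a w : ℕ} {S : Submodule ℝ LinComb}

theorem exists_eq_append_four {α : Type*} {v : List α} (hv : 4 ≤ v.length) :
    ∃ D i j k l, v = D ++ [i, j, k, l] := by
  have h1 : (v.drop (v.length - 4)).length = 4 := by
    rw [List.length_drop]
    omega
  obtain ⟨i, j, k, l, h2⟩ := List.length_eq_four.1 h1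
  exact ⟨_, i, j, k, l, by rw [← h2, List.take_append_drop]⟩

/-- The leading part of a complete contraction, as a polynomial in the derivatives of the metric, of
`ψ` and of `υ`. -/
noncomputable def leadingPart (K : Contr) (c : ℕ → Fin n) : MvPolynomial (JetVar n) ℝ :=
  sumOver K.labels.dedup (prodVal leading K) c

theorem linearMap_mul_congr {σ M : Type*} [AddCommGroup M] [Module ℝ M] (f : MvPolynomial σ ℝ →ₗ[ℝ] M)
    {p p' : MvPolynomial σ ℝ} (h : ∀ m, f (p * monomial m 1) = f (p' * monomial m 1))
    (r : MvPolynomial σ ℝ) : f (p * r) = f (p' * r) := by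
  induction r using MvPolynomial.induction_on' with
  | monomial m b =>
    have : monomial m b = b • monomial m (1 : ℝ) := by rw [smul_monomial, smul_eq_mul, mul_one]
    rw [this, mul_smul_comm, mul_smul_comm, map_smul, map_smul, h]
  | add r s hr hs => rw [mul_add, mul_add, map_add, map_add, hr, hs]

variable (hS : ErrorSpace n τ q a w S) (hn : 4 ≤ n)

include hS hn

/-- Every factor can be recovered from its leading part. -/
theorem weylMap_leading {k : Kind} (hk : k = .R ∨ k = .psi ∨ k = .ups) {v : List (Fin n)}
    (hv : k.arity ≤ v.length) (r : MvPolynomial Factor ℝ) :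
    weylMap n τ q a w S (aeval recover (leading k v) * r) =
      weylMap n τ q a w S (X ⟨k, v.map Fin.val⟩ * r) := by
  refine linearMap_mul_congr _ (fun m => ?_) r
  rcases hk with rfl | rfl | rfl
  · obtain ⟨D, i, j, k, l, rfl⟩ := exists_eq_append_four hv
    rw [leading_R, weylMap_curvatureJet hS hn]
  · rw [leading, aeval_X, recover, weylMap_X_mul hS hn, weylMap_X_mul hS hn]
    refine weylCls_psi_perm hS hn ?_
    rw [← Multiset.coe_eq_coe, Multiset.coe_toList, Multiset.map_coe]
  · rw [leading, aeval_X, recover, weylMap_X_mul hS hn, weylMap_X_mul hS hn]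
    refine weylCls_ups_perm ?_
    rw [← Multiset.coe_eq_coe, Multiset.coe_toList, Multiset.map_coe]

theorem weylMap_prodVal {K : Contr} (hK : K.WellFormed)
    (hk : ∀ F ∈ K, F.kind = .R ∨ F.kind = .psi ∨ F.kind = .ups) (d : ℕ → Fin n) :
    weylMap n τ q a w S (aeval recover (prodVal leading K d)) =
      weylCls n τ q a w S (K.relabel fun l => d l) := by
  rw [← weylMap_prod hS hn]
  suffices H : ∀ r, weylMap n τ q a w S (aeval recover (prodVal leading K d) * r) =
      weylMap n τ q a w S (((K.relabel fun l => (d l : ℕ)).map X).prod * r) by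
    simpa using H 1
  induction K with
  | nil => intro r; simp [prodVal, Contr.relabel]
  | cons F K ih =>
    intro r
    rw [prodVal_cons, map_mul (aeval recover), mul_assoc, weylMap_leading hS hn (hk F List.mem_cons_self)
      (by rw [List.length_map]; exact hK F List.mem_cons_self), mul_left_comm,
      ih (fun G hG => hK G (List.mem_cons_of_mem _ hG)) fun G hG => hk G (List.mem_cons_of_mem _ hG)]
    rw [mul_left_comm, ← mul_assoc]
    simp [Contr.relabel, Factor.relabel, Function.comp_def]

/-- The leading part of a contraction is a sum over all values of its indices. A term in which two names
have the same value is not a complete contraction and is sent to `0`; the other terms are contractions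
which differ from the given one only in the names. -/
theorem weylMap_leadingPart {K : Contr} (hK : K.IsAdmissible τ q a w) (c : ℕ → Fin n) :
    weylMap n τ q a w S (aeval recover (leadingPart K c)) =
      (n.descFactorial K.labels.dedup.length) • weylCls n τ q a w S K := by
  have h1 := map_sumOver (((weylMap n τ q a w S).comp
    (aeval (R := ℝ) (recover (n := n))).toLinearMap).toAddMonoidHom) K.labels.dedup (prodVal leading K) c
  simp only [LinearMap.toAddMonoidHom_coe, LinearMap.comp_apply, AlgHom.toLinearMap_apply,
    weylMap_prodVal hS hn hK.complete.1 hK.form.kinds] at h1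
  have h2 : ∀ d : ℕ → Fin n, weylCls n τ q a w S (K.relabel fun l => d l) =
      if ((K.labels.dedup ++ []).map d).Nodup then weylCls n τ q a w S K else 0 := by
    intro d
    rw [List.append_nil]
    split_ifs with h
    · refine weylCls_relabel hS hn fun l hl l' hl' hd => ?_
      exact List.inj_on_of_nodup_map h (List.mem_dedup.2 hl) (List.mem_dedup.2 hl') (Fin.ext hd)
    · refine weylCls_of_not fun h' => h ?_
      have e1 := length_eq_two_mul_dedup h'.complete.2
      rw [Contr.labels_relabel, List.length_map, length_eq_two_mul_dedup hK.complete.2] at e1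
      have e2 : (K.labels.map fun l => (d l : ℕ)).dedup.length =
          ((K.labels.dedup.map d).toFinset).card := by
        rw [← List.toFinset_card_of_nodup (List.nodup_dedup _), ← Finset.card_map Fin.valEmbedding]
        congr 1
        ext x
        simp
      have e3 := (Multiset.toFinset_card_eq_card_iff_nodup
        (m := ((K.labels.dedup.map d : List (Fin n)) : Multiset (Fin n)))).1
      rw [Multiset.coe_card, List.length_map] at e3
      refine e3 (Eq.trans ?_ (Eq.trans e2.symm (by omega)))
      rfl
  rw [leadingPart, h1, sumOver_congr h2, sumOver_nodup _ _ _ (by simpa using K.labels.nodup_dedup)]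
  simp

end Reconstruction

theorem Contr.two_mul_numKind_R_le {K : Contr} (hK : K.WellFormed) : 2 * K.numKind .R ≤ K.wt := by
  induction K with
  | nil => simp [numKind]
  | cons F K ih =>
    have h1 := ih fun G hG => hK G (List.mem_cons_of_mem _ hG)
    have h2 := hK F List.mem_cons_self
    rw [numKind_cons, wt_cons]
    split_ifs with h
    · simp only [h, Kind.arity] at h2
      simp only [Factor.wt, h]
      omega
    · omega

/-- The number of contracted pairs is determined by the weight, and is at most `w`, since each factor
`∇^{(m)}R` contributes at least `2` to the weight. -/
theorem Contr.IsAdmissible.length_dedup {τ q a w : ℕ} {K : Contr} (hK : K.IsAdmissible τ q a w) :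
    2 * K.labels.dedup.length = w + 2 * (τ - q) ∧ 2 * (τ - q) ≤ w := by
  have h1 := length_eq_two_mul_dedup hK.complete.2
  have h2 := Contr.wt_add_two_mul hK.complete.1
  have h3 := hK.form.numKind_R_add
  have h4 := Contr.two_mul_numKind_R_le hK.complete.1
  rw [hK.wt] at h2 h4
  omega

/-- A linear combination with vanishing leading part is, weylified, a combination of error terms. -/
theorem mkQ_weylify_eq_zero {n τ q a w : ℕ} {S : Submodule ℝ LinComb} (hS : ErrorSpace n τ q a w S)
    (hn : 4 ≤ n) (hw : w ≤ n) {L : LinComb} (hL : ∀ K ∈ L.support, K.IsAdmissible τ q a w)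
    (c : ℕ → Fin n) (h : (L.sum fun K b => b • leadingPart K c) = 0) : S.mkQ (L.weylify n) = 0 := by
  have h1 : (L.sum fun K b => b • (n.descFactorial K.labels.dedup.length) •
      weylCls n τ q a w S K) = 0 := by
    have := congrArg (fun p => weylMap n τ q a w S (MvPolynomial.aeval recover p)) h
    simp only [map_zero, Finsupp.sum, map_sum, map_smul] at this
    rw [← this]
    refine Finset.sum_congr rfl fun K hK => ?_
    rw [weylMap_leadingPart hS hn (hL K hK)]
  have h2 : S.mkQ (L.weylify n) = L.sum fun K b => b • weylCls n τ q a w S K := by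
    simp only [LinComb.weylify, Finsupp.sum, map_sum, mkQ_single, mul_smul]
    exact Finset.sum_congr rfl fun K hK => by rw [weylCls_of (hL K hK)]
  have h3 : (n.descFactorial ((w + 2 * (τ - q)) / 2)) • S.mkQ (L.weylify n) = 0 := by
    rw [h2, ← h1, Finsupp.sum, Finset.smul_sum]
    refine Finset.sum_congr rfl fun K hK => ?_
    have := (hL K hK).length_dedup.1
    rw [smul_comm]
    dsimp only
    rw [show K.labels.dedup.length = (w + 2 * (τ - q)) / 2 by omega]
  -- as there are at most `w ≤ n` contracted pairs, injective values of the names exist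
  by_cases hL0 : L = 0
  · rw [h2, hL0, Finsupp.sum_zero_index]
  obtain ⟨K, hK⟩ := Finsupp.support_nonempty_iff.2 hL0
  have h4 := (hL K hK).length_dedup.2
  rw [← Nat.cast_smul_eq_nsmul ℝ] at h3
  refine (smul_eq_zero.1 h3).resolve_left ?_
  exact Nat.cast_ne_zero.2 (Nat.descFactorial_pos.2 (by omega)).ne'

end RiemContr

namespace RiemContr

/-! ### Functions with prescribed derivatives at the origin -/

section Taylor

variable {n : ℕ}

theorem pd_coord (k i : Fin n) (x : E n) : pd k (fun y => y i) x = if i = k then 1 else 0 := by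
  have h : fderiv ℝ (fun y : E n => y i) x = EuclideanSpace.proj i :=
    (EuclideanSpace.proj i : E n →L[ℝ] ℝ).fderiv
  rw [pd, h]
  simp [eq_comm]

/-- The homogeneous polynomial of degree `N` whose derivatives of order `N` are the values of `ζ`. -/
noncomputable def homogeneous : ℕ → (Multiset (Fin n) → ℝ) →ₗ[ℝ] (E n → ℝ)
  | 0 => LinearMap.pi fun _ => LinearMap.proj 0
  | N + 1 => ((N : ℝ) + 1)⁻¹ • ∑ i : Fin n,
      (LinearMap.mulLeft ℝ (fun x : E n => x i)).comp
        ((homogeneous N).comp (LinearMap.funLeft ℝ ℝ (Multiset.cons i)))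

theorem homogeneous_succ (N : ℕ) (ζ : Multiset (Fin n) → ℝ) (x : E n) :
    homogeneous (N + 1) ζ x =
      ((N : ℝ) + 1)⁻¹ * ∑ i, x i * homogeneous N (fun A => ζ (i ::ₘ A)) x := by
  simp only [homogeneous, LinearMap.smul_apply, LinearMap.sum_apply, Pi.smul_apply, Finset.sum_apply,
    LinearMap.comp_apply, LinearMap.mulLeft_apply, Pi.mul_apply, smul_eq_mul]
  rfl

theorem homogeneous_contDiff (N : ℕ) (ζ : Multiset (Fin n) → ℝ) : ContDiff ℝ ∞ (homogeneous N ζ) := by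
  induction N generalizing ζ with
  | zero => exact contDiff_const
  | succ N ih =>
    rw [funext (homogeneous_succ N ζ)]
    refine contDiff_const.mul (ContDiff.sum fun i _ => ContDiff.mul ?_ (ih _))
    exact (EuclideanSpace.proj i : E n →L[ℝ] ℝ).contDiff

theorem homogeneous_differentiable (N : ℕ) (ζ : Multiset (Fin n) → ℝ) (x : E n) :
    DifferentiableAt ℝ (homogeneous N ζ) x :=
  (homogeneous_contDiff N ζ).differentiable (by simp) x

theorem pd_homogeneous (N : ℕ) (ζ : Multiset (Fin n) → ℝ) (k : Fin n) (x : E n) :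
    pd k (homogeneous (N + 1) ζ) x = homogeneous N (fun A => ζ (k ::ₘ A)) x := by
  have hc : ∀ i : Fin n, DifferentiableAt ℝ (fun y : E n => y i) x := fun i =>
    (EuclideanSpace.proj i : E n →L[ℝ] ℝ).differentiableAt
  have hstep : ∀ (N : ℕ) (ζ : Multiset (Fin n) → ℝ), pd k (homogeneous (N + 1) ζ) x =
      ((N : ℝ) + 1)⁻¹ * (homogeneous N (fun A => ζ (k ::ₘ A)) x +
        ∑ i, x i * pd k (homogeneous N fun A => ζ (i ::ₘ A)) x) := by
    intro N ζ
    have hm : ∀ i : Fin n, DifferentiableAt ℝ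
        (fun y : E n => y i * homogeneous N (fun A => ζ (i ::ₘ A)) y) x := fun i =>
      (hc i).mul (homogeneous_differentiable N _ x)
    rw [funext (homogeneous_succ N ζ), pd_const_mul (DifferentiableAt.fun_sum fun i _ => hm i),
      pd_sum _ fun i _ => hm i]
    congr 1
    rw [Finset.sum_congr rfl fun i _ => pd_mul (hc i) (homogeneous_differentiable N _ x) k,
      Finset.sum_add_distrib]
    congr 1
    simp [pd_coord]
  induction N generalizing ζ with
  | zero =>
    have h0 : ∀ ξ : Multiset (Fin n) → ℝ, pd k (homogeneous 0 ξ) x = 0 := fun ξ => pd_const _ k x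
    rw [hstep]
    simp [h0]
  | succ N ih =>
    rw [hstep]
    simp only [ih]
    have h1 := homogeneous_succ N (fun A => ζ (k ::ₘ A)) x
    simp only [Multiset.cons_swap _ k] at h1 ⊢
    have hN : (N : ℝ) + 1 ≠ 0 := by positivity
    have hN' : (N : ℝ) + 1 + 1 ≠ 0 := by positivity
    have h2 : ∑ i, x i * homogeneous N (fun A => ζ (k ::ₘ i ::ₘ A)) x =
        ((N : ℝ) + 1) * homogeneous (N + 1) (fun A => ζ (k ::ₘ A)) x := by
      rw [h1]; field_simp
    rw [h2]
    push_cast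
    field_simp
    ring

/-- The Taylor polynomial of degree `N` whose derivatives at the origin are the values of `ζ`. -/
noncomputable def taylor (N : ℕ) : (Multiset (Fin n) → ℝ) →ₗ[ℝ] (E n → ℝ) :=
  ∑ k ∈ Finset.range (N + 1), homogeneous k

theorem taylor_apply (N : ℕ) (ζ : Multiset (Fin n) → ℝ) (x : E n) :
    taylor N ζ x = ∑ k ∈ Finset.range (N + 1), homogeneous k ζ x := by
  simp [taylor, LinearMap.sum_apply]

theorem taylor_contDiff (N : ℕ) (ζ : Multiset (Fin n) → ℝ) : ContDiff ℝ ∞ (taylor N ζ) := by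
  rw [funext (taylor_apply N ζ)]
  exact ContDiff.sum fun k _ => homogeneous_contDiff k ζ

theorem pd_taylor (N : ℕ) (ζ : Multiset (Fin n) → ℝ) (k : Fin n) (x : E n) :
    pd k (taylor (N + 1) ζ) x = taylor N (fun A => ζ (k ::ₘ A)) x := by
  rw [funext (taylor_apply (N + 1) ζ), pd_sum _ fun i _ => homogeneous_differentiable i _ x,
    Finset.sum_range_succ', taylor_apply, Finset.sum_congr rfl fun i _ => pd_homogeneous i ζ k x]
  have : pd k (homogeneous 0 ζ) x = 0 := pd_const _ k x
  rw [this, add_zero]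

theorem taylor_zero (N : ℕ) (ζ : Multiset (Fin n) → ℝ) : taylor N ζ 0 = ζ 0 := by
  rw [taylor_apply, Finset.sum_range_succ', Finset.sum_eq_zero fun i _ => ?_, zero_add]
  · rfl
  · rw [homogeneous_succ]
    simp

end Taylor

/-! ### Leading terms of one-parameter families -/

section Leading

variable {n : ℕ} {Ω : Set (ℝ × E n)}

/-- The family of functions `F t` has the form `t ^ k * g t` on `Ω`, with `g` smooth and
`g 0 = f`. -/
def HasLeading (Ω : Set (ℝ × E n)) (k : ℕ) (F : ℝ → E n → ℝ) (f : E n → ℝ) : Prop :=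
  ∃ g : ℝ × E n → ℝ, ContDiffOn ℝ ∞ g Ω ∧ (∀ p ∈ Ω, F p.1 p.2 = p.1 ^ k * g p) ∧ ∀ x, g (0, x) = f x

namespace HasLeading

variable {k l : ℕ} {F H : ℝ → E n → ℝ} {f h : E n → ℝ}

theorem congr_limit (hF : HasLeading Ω k F f) (hf : ∀ x, f x = h x) : HasLeading Ω k F h := by
  rwa [← funext hf]

theorem add (hF : HasLeading Ω k F f) (hH : HasLeading Ω k H h) :
    HasLeading Ω k (fun t x => F t x + H t x) (fun x => f x + h x) := by
  obtain ⟨g, g1, g2, g3⟩ := hF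
  obtain ⟨g', g1', g2', g3'⟩ := hH
  exact ⟨fun p => g p + g' p, g1.add g1', fun p hp => by simp only [g2 p hp, g2' p hp]; ring,
    fun x => by simp only [g3, g3']⟩

theorem mul (hF : HasLeading Ω k F f) (hH : HasLeading Ω l H h) :
    HasLeading Ω (k + l) (fun t x => F t x * H t x) (fun x => f x * h x) := by
  obtain ⟨g, g1, g2, g3⟩ := hF
  obtain ⟨g', g1', g2', g3'⟩ := hH
  exact ⟨fun p => g p * g' p, g1.mul g1', fun p hp => by simp only [g2 p hp, g2' p hp]; ring,
    fun x => by simp only [g3, g3']⟩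

theorem of_contDiff (hf : ContDiff ℝ ∞ f) : HasLeading Ω 0 (fun _ => f) f :=
  ⟨fun p => f p.2, (hf.comp contDiff_snd).contDiffOn, fun p _ => by simp, fun _ => rfl⟩

theorem mul_parameter (hF : HasLeading Ω k F f) : HasLeading Ω (k + 1) (fun t x => t * F t x) f := by
  obtain ⟨g, g1, g2, g3⟩ := hF
  exact ⟨g, g1, fun p hp => by simp only [g2 p hp]; ring, g3⟩

theorem const_mul (hF : HasLeading Ω k F f) (b : ℝ) :
    HasLeading Ω k (fun t x => b * F t x) (fun x => b * f x) := by
  simpa using (of_contDiff (Ω := Ω) (contDiff_const (c := b))).mul hF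

theorem sub (hF : HasLeading Ω k F f) (hH : HasLeading Ω k H h) :
    HasLeading Ω k (fun t x => F t x - H t x) (fun x => f x - h x) := by
  simpa [sub_eq_add_neg] using hF.add (hH.const_mul (-1))

/-- A higher power of the parameter makes the leading term vanish. -/
theorem weaken (hF : HasLeading Ω (k + 1) F f) : HasLeading Ω k F 0 := by
  obtain ⟨g, g1, g2, g3⟩ := hF
  exact ⟨fun p => p.1 * g p, contDiff_fst.contDiffOn.mul g1, fun p hp => by simp only [g2 p hp]; ring,
    fun x => by simp⟩

theorem zero : HasLeading Ω k (fun _ _ => 0) fun _ => 0 :=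
  ⟨fun _ => 0, contDiffOn_const, fun _ _ => by simp, fun _ => rfl⟩

theorem sum {ι : Type*} (s : Finset ι) {F : ι → ℝ → E n → ℝ} {f : ι → E n → ℝ}
    (hF : ∀ i ∈ s, HasLeading Ω k (F i) (f i)) :
    HasLeading Ω k (fun t x => ∑ i ∈ s, F i t x) (fun x => ∑ i ∈ s, f i x) := by
  classical
  induction s using Finset.induction_on with
  | empty => simpa using (zero : HasLeading Ω k (fun _ _ => 0) (fun _ => 0))
  | insert i s hi ih =>
    simp only [Finset.sum_insert hi]
    exact (hF i (Finset.mem_insert_self i s)).add (ih fun j hj => hF j (Finset.mem_insert_of_mem hj))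

theorem pd (hΩ : IsOpen Ω) (h0 : ∀ x, (0, x) ∈ Ω) (hF : HasLeading Ω k F f) (i : Fin n) :
    HasLeading Ω k (fun t => pd i (F t)) (pd i f) := by
  obtain ⟨g, g1, g2, g3⟩ := hF
  have hd : ∀ p ∈ Ω, HasFDerivAt (fun y => g (p.1, y))
      ((fderiv ℝ g p).comp (ContinuousLinearMap.inr ℝ ℝ (E n))) p.2 := by
    intro p hp
    have h1 : HasFDerivAt g (fderiv ℝ g p) (p.1, p.2) :=
      ((g1.contDiffAt (hΩ.mem_nhds hp)).differentiableAt (by simp)).hasFDerivAt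
    exact h1.comp p.2 (hasFDerivAt_prodMk_right p.1 p.2)
  refine ⟨fun p => fderiv ℝ g p (0, EuclideanSpace.single i 1),
    (g1.fderiv_of_isOpen hΩ (by simp)).clm_apply contDiffOn_const, fun p hp => ?_, fun x => ?_⟩
  · have h2 : RiemContr.pd i (F p.1) p.2 = RiemContr.pd i (fun y => p.1 ^ k * g (p.1, y)) p.2 := by
      refine pd_congr (U := {y | (p.1, y) ∈ Ω}) (hΩ.preimage (by fun_prop))
        (fun y hy => g2 (p.1, y) hy) hp i
    dsimp only
    rw [h2, pd_const_mul (hd p hp).differentiableAt, RiemContr.pd, (hd p hp).fderiv]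
    rfl
  · rw [RiemContr.pd, ← funext g3, (hd (0, x) (h0 x)).fderiv]
    rfl

/-- At the origin, the quotient by the power of the parameter has a limit. -/
theorem tendsto (hΩ : IsOpen Ω) (h0 : (0, 0) ∈ Ω) (hF : HasLeading Ω k F f) :
    Filter.Tendsto (fun t => F t 0 / t ^ k) (nhdsWithin 0 {0}ᶜ) (nhds (f 0)) := by
  obtain ⟨g, g1, g2, g3⟩ := hF
  have hc : ContinuousAt (fun t : ℝ => g (t, 0)) 0 :=
    (g1.contDiffAt (hΩ.mem_nhds h0)).continuousAt.comp (f := fun t : ℝ => ((t, 0) : ℝ × E n))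
      (by fun_prop)
  rw [← g3]
  refine (hc.tendsto.mono_left nhdsWithin_le_nhds).congr' ?_
  have h1 : ∀ᶠ t : ℝ in nhds 0, ((t, 0) : ℝ × E n) ∈ Ω :=
    (Continuous.continuousAt (f := fun t : ℝ => ((t, 0) : ℝ × E n)) (by fun_prop)).eventually
      (hΩ.mem_nhds h0)
  filter_upwards [nhdsWithin_le_nhds h1, self_mem_nhdsWithin] with t ht ht0
  rw [g2 (t, 0) ht, mul_div_cancel_left₀ _ (pow_ne_zero k ht0)]

end HasLeading

end Leading

end RiemContr

namespace RiemContr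

/-! ### Perturbations of the flat metric -/

section Perturbation

variable {n : ℕ} (H : Fin n → Fin n → E n → ℝ)

/-- The points of `ℝ × ℝⁿ` at which the perturbation `t H` is small. -/
def smallSet : Set (ℝ × E n) := {p | ∑ i, ∑ j, |p.1 * H i j p.2| < 1 / 2}

variable (hH : ∀ i j, ContDiff ℝ ∞ (H i j)) (hsymm : ∀ i j x, H i j x = H j i x)

theorem zero_mem_smallSet (x : E n) : ((0 : ℝ), x) ∈ smallSet H := by simp [smallSet]

include hH in
theorem isOpen_smallSet : IsOpen (smallSet H) := by
  refine isOpen_lt (continuous_finsetSum _ fun i _ => continuous_finsetSum _ fun j _ => ?_)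
    continuous_const
  exact (continuous_fst.mul ((hH i j).continuous.comp continuous_snd)).abs

include hsymm in
theorem posDef_of_mem_smallSet {t : ℝ} {x : E n} (hx : (t, x) ∈ smallSet H) :
    (Matrix.of fun i j => (if i = j then 1 else 0) + t * H i j x : Matrix (Fin n) (Fin n) ℝ).PosDef := by
  refine Matrix.PosDef.of_dotProduct_mulVec_pos ?_ fun v hv => ?_
  · ext i j
    simp [hsymm i j, eq_comm]
  have h1 : star v ⬝ᵥ (Matrix.of fun i j => (if i = j then 1 else 0) + t * H i j x :
      Matrix (Fin n) (Fin n) ℝ).mulVec v = v ⬝ᵥ v + ∑ i, ∑ j, t * H i j x * (v i * v j) := by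
    simp only [dotProduct, Matrix.mulVec, Matrix.of_apply, star_trivial, add_mul,
      Finset.sum_add_distrib, mul_add, ite_mul, one_mul, zero_mul, Finset.sum_ite_eq, Finset.mem_univ,
      if_true, Finset.mul_sum]
    congr 1
    exact Finset.sum_congr rfl fun i _ => Finset.sum_congr rfl fun j _ => by ring
  have h2 : 0 < v ⬝ᵥ v := by
    obtain ⟨i, hi⟩ := Function.ne_iff.1 hv
    refine Finset.sum_pos' (fun i _ => mul_self_nonneg _) ⟨i, Finset.mem_univ i, ?_⟩
    exact mul_self_pos.2 hi
  -- `|v i * v j| ≤ v ⬝ᵥ v`, and the coefficients have sum less than `1 / 2` in absolute value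
  have h3 : |∑ i, ∑ j, t * H i j x * (v i * v j)| ≤ (1 / 2) * (v ⬝ᵥ v) := by
    refine (Finset.abs_sum_le_sum_abs _ _).trans ?_
    refine (Finset.sum_le_sum fun i _ => Finset.abs_sum_le_sum_abs _ _).trans ?_
    have hle : ∀ i, v i * v i ≤ v ⬝ᵥ v := fun i =>
      Finset.single_le_sum (f := fun i => v i * v i) (fun i _ => mul_self_nonneg _) (Finset.mem_univ i)
    have hterm : ∀ i j, |t * H i j x * (v i * v j)| ≤ |t * H i j x| * (v ⬝ᵥ v) := by
      intro i j
      rw [abs_mul]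
      refine mul_le_mul_of_nonneg_left (abs_le.2 ⟨?_, ?_⟩) (abs_nonneg _)
      · nlinarith [hle i, hle j, sq_nonneg (v i + v j)]
      · nlinarith [hle i, hle j, sq_nonneg (v i - v j)]
    refine (Finset.sum_le_sum fun i _ => Finset.sum_le_sum fun j _ => hterm i j).trans ?_
    simp only [← Finset.sum_mul]
    exact mul_le_mul_of_nonneg_right (le_of_lt hx) h2.le
  rw [h1]
  have := (abs_le.1 h3).1
  linarith

/-- The metric `δ_{ij} + t H_{ij}`. -/
noncomputable def perturbed (t : ℝ) : LocalMetric n where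
  U := {x | (t, x) ∈ smallSet H}
  isOpen := (isOpen_smallSet H hH).preimage (by fun_prop)
  g x := Matrix.of fun i j => (if i = j then 1 else 0) + t * H i j x
  smooth i j := (contDiff_const.add (contDiff_const.mul (hH i j))).contDiffOn
  posDef _ hx := posDef_of_mem_smallSet H hsymm hx

theorem perturbed_g (i j : Fin n) : HasLeading (smallSet H) 0
    (fun t x => (perturbed H hH hsymm t).g x i j) fun _ => if i = j then 1 else 0 := by
  have h1 : HasLeading (smallSet H) 0 (fun _ => fun _ : E n => if i = j then (1 : ℝ) else 0)
    fun _ => if i = j then 1 else 0 := HasLeading.of_contDiff contDiff_const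
  have h2 := h1.add (HasLeading.of_contDiff (hH i j)).mul_parameter.weaken
  exact h2.congr_limit fun x => add_zero _

theorem perturbed_ginv (i j : Fin n) : HasLeading (smallSet H) 0
    (fun t x => (perturbed H hH hsymm t).ginv x i j) fun _ => if i = j then 1 else 0 := by
  refine ⟨fun p => ((perturbed H hH hsymm p.1).g p.2)⁻¹ i j, ?_, fun p _ => by simp [LocalMetric.ginv],
    fun x => ?_⟩
  · refine contDiffOn_inv_apply (A := fun p : ℝ × E n => (perturbed H hH hsymm p.1).g p.2)
      (fun i j => ?_) (fun p hp => ?_) i j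
    · exact (contDiff_const.add (contDiff_fst.mul ((hH i j).comp contDiff_snd))).contDiffOn
    · exact ((perturbed H hH hsymm p.1).isUnit_det hp).ne_zero
  · have : (perturbed H hH hsymm 0).g x = 1 := by
      ext i j
      simp [perturbed, Matrix.one_apply]
    dsimp only
    rw [this, inv_one, Matrix.one_apply]

theorem pd_perturbed_g (l i j : Fin n) : HasLeading (smallSet H) 1
    (fun t => pd l (fun y => (perturbed H hH hsymm t).g y i j)) (pd l (H i j)) := by
  have h1 := ((HasLeading.of_contDiff (Ω := smallSet H) (hH i j)).mul_parameter).pd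
    (isOpen_smallSet H hH) (zero_mem_smallSet H) l
  have h2 : (fun t => pd l (fun y => (perturbed H hH hsymm t).g y i j)) =
      fun t => pd l (fun y => t * H i j y) := by
    funext t y
    have h3 := fderiv_const_add (𝕜 := ℝ) (f := fun y => t * H i j y) (x := y) (if i = j then 1 else 0)
    exact congrArg (fun A => A (EuclideanSpace.single l 1)) h3
  rw [h2]
  exact h1

/-- The linearization of the Christoffel symbols. -/
theorem perturbed_christoffel (k i j : Fin n) : HasLeading (smallSet H) 1
    (fun t => (perturbed H hH hsymm t).christoffel k i j)
    (fun x => (1 / 2) * (pd i (H j k) x + pd j (H i k) x - pd k (H i j) x)) := by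
  have h1 := (HasLeading.sum Finset.univ fun l _ => (perturbed_ginv H hH hsymm k l).mul
    (((pd_perturbed_g H hH hsymm i j l).add (pd_perturbed_g H hH hsymm j i l)).sub
      (pd_perturbed_g H hH hsymm l i j))).const_mul (1 / 2)
  exact h1.congr_limit fun x => by simp

/-- The linearization of the curvature tensor. -/
theorem perturbed_riem (i j k l : Fin n) : HasLeading (smallSet H) 1
    (fun t => (perturbed H hH hsymm t).riem i j k l)
    (fun x => pd k (fun x => (1 / 2) * (pd l (H j i) x + pd j (H l i) x - pd i (H l j) x)) x
      - pd l (fun x => (1 / 2) * (pd k (H j i) x + pd j (H k i) x - pd i (H k j) x)) x) := by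
  have hc := perturbed_christoffel H hH hsymm
  have hp := fun a b c d => (hc a b c).pd (isOpen_smallSet H hH) (zero_mem_smallSet H) d
  have h1 := HasLeading.sum Finset.univ fun m _ => (perturbed_g H hH hsymm i m).mul
    (((hp m l j k).sub (hp m k j l)).add (HasLeading.sum Finset.univ fun p _ =>
      (((hc m k p).mul (hc p l j)).sub ((hc m l p).mul (hc p k j))).weaken))
  exact h1.congr_limit fun x => by simp

/-- To leading order covariant derivatives are partial derivatives. -/
theorem perturbed_nabla {ψ : ℝ → Components n} {f : List (Fin n) → E n → ℝ} {r : ℕ}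
    (hψ : ∀ v, v.length = r → HasLeading (smallSet H) 1 (fun t => ψ t v) (f v)) (k : Fin n)
    {v : List (Fin n)} (hv : v.length = r) : HasLeading (smallSet H) 1
      (fun t => (perturbed H hH hsymm t).nabla (ψ t) (k :: v)) (pd k (f v)) := by
  have h1 := ((hψ v hv).pd (isOpen_smallSet H hH) (zero_mem_smallSet H) k).sub
    (HasLeading.sum Finset.univ fun s : Fin v.length => fun _ => HasLeading.sum Finset.univ fun l _ =>
      ((perturbed_christoffel H hH hsymm l k (v.get s)).mul
        (hψ (v.set s l) (by rw [List.length_set, hv]))).weaken)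
  exact h1.congr_limit fun x => by simp

end Perturbation

section Jets

variable {n : ℕ} (N : ℕ) (z : JetVar n → ℝ)

/-- A perturbation of the metric with prescribed partial derivatives at the origin. -/
noncomputable def jetMetric (i j : Fin n) : E n → ℝ :=
  taylor (N + 2) fun A => MvPolynomial.eval z (metricJet A i j)

theorem jetMetric_contDiff (i j : Fin n) : ContDiff ℝ ∞ (jetMetric N z i j) := taylor_contDiff _ _

theorem jetMetric_symm (i j : Fin n) (x : E n) : jetMetric N z i j x = jetMetric N z j i x := by
  simp only [jetMetric, metricJet, add_comm]

/-- A metric with prescribed leading terms of the curvature at the origin. -/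
noncomputable def jetLocalMetric (t : ℝ) : LocalMetric n :=
  perturbed (jetMetric N z) (jetMetric_contDiff N z) (jetMetric_symm N z) t

theorem pd_jetMetric (k i j : Fin n) : pd k (jetMetric N z i j) =
    taylor (N + 1) fun A => MvPolynomial.eval z (metricJet (k ::ₘ A) i j) :=
  funext fun x => pd_taylor (N + 1) _ k x

theorem leading_perm {k : Kind} (hk : k = .R ∨ k = .psi ∨ k = .ups) {L L' v : List (Fin n)}
    (h : L.Perm L') (hv : k.arity ≤ v.length) : leading k (L ++ v) = leading k (L' ++ v) := by
  rcases hk with rfl | rfl | rfl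
  · obtain ⟨D, i, j, k, l, rfl⟩ := exists_eq_append_four hv
    rw [← List.append_assoc, ← List.append_assoc, leading_R, leading_R,
      Multiset.coe_eq_coe.2 (h.append_right D)]
  · rw [leading, leading, Multiset.coe_eq_coe.2 (h.append_right v)]
  · rw [leading, leading, Multiset.coe_eq_coe.2 (h.append_right v)]

/-- The leading term of the curvature tensor. -/
theorem jet_riem (i j k l : Fin n) : HasLeading (smallSet (jetMetric N z)) 1
    (fun t => (jetLocalMetric N z t).riem i j k l)
    (taylor N fun A => MvPolynomial.eval z (curvatureJet A i j k l)) := by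
  refine (perturbed_riem _ (jetMetric_contDiff N z) (jetMetric_symm N z) i j k l).congr_limit fun x => ?_
  set h : Multiset (Fin n) → Fin n → Fin n → ℝ := fun A i j => MvPolynomial.eval z (metricJet A i j)
    with hh
  have hs : ∀ A i j, h A i j = h A j i := fun A i j => by simp only [hh, metricJet, add_comm]
  have h1 : ∀ a b c a1 a2 b1 b2 c1 c2 : Fin n, (fun x => (1 / 2) * (pd a (jetMetric N z a1 a2) x
      + pd b (jetMetric N z b1 b2) x - pd c (jetMetric N z c1 c2) x)) =
      taylor (N + 1) ((1 / 2 : ℝ) • ((fun A => h (a ::ₘ A) a1 a2) + (fun A => h (b ::ₘ A) b1 b2)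
        - fun A => h (c ::ₘ A) c1 c2)) := by
    intro a b c a1 a2 b1 b2 c1 c2
    funext x
    rw [map_smul, map_sub, map_add, pd_jetMetric, pd_jetMetric, pd_jetMetric]
    rfl
  rw [h1, h1, pd_taylor, pd_taylor, ← Pi.sub_apply, ← map_sub]
  refine congrArg (fun ζ => taylor N ζ x) (funext fun A => ?_)
  simp only [Pi.sub_apply, Pi.smul_apply, Pi.add_apply, smul_eq_mul, curvatureJet, map_mul, map_add,
    map_sub, MvPolynomial.eval_C]
  rw [Multiset.cons_swap l k, hs _ l i, hs _ l j, hs _ k i, hs _ k j]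
  ring

/-- The leading terms of the components of a factor. -/
theorem jet_comp {k : Kind} (hk : k = .R ∨ k = .psi ∨ k = .ups) {v : List (Fin n)}
    (hv : k.arity ≤ v.length) (hvN : v.length ≤ N) : HasLeading (smallSet (jetMetric N z)) 1
      (fun t => (jetLocalMetric N z t).comp (fun x => t * taylor N (fun A => z (.psi A)) x)
        (fun x => t * taylor N (fun A => z (.ups A)) x) k v)
      (taylor (N - (v.length - k.arity))
        fun A => MvPolynomial.eval z (leading k ((A.toList ++ v)))) := by
  set G := jetLocalMetric N z with hG
  set B : ℝ → Components n := fun t => (G t).base (fun x => t * taylor N (fun A => z (.psi A)) x)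
        (fun x => t * taylor N (fun A => z (.ups A)) x) k with hB
  have hbase : ∀ v : List (Fin n), v.length = k.arity → HasLeading (smallSet (jetMetric N z)) 1
      (fun t => B t v) (taylor N fun A => MvPolynomial.eval z (leading k (A.toList ++ v))) := by
    intro v hv
    rcases hk with rfl | rfl | rfl
    · match v, hv with
      | [i, j, k, l], _ =>
        simp only [leading_R, Multiset.coe_toList]
        exact jet_riem N z i j k l
    · obtain rfl := List.length_eq_zero_iff.1 hv
      simp only [leading, List.append_nil, Multiset.coe_toList, MvPolynomial.eval_X]
      exact (HasLeading.of_contDiff (taylor_contDiff N _)).mul_parameter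
    · obtain rfl := List.length_eq_zero_iff.1 hv
      simp only [leading, List.append_nil, Multiset.coe_toList, MvPolynomial.eval_X]
      exact (HasLeading.of_contDiff (taylor_contDiff N _)).mul_parameter
  have hstep : ∀ (m : ℕ) (v : List (Fin n)), v.length = k.arity + m → m ≤ N →
      HasLeading (smallSet (jetMetric N z)) 1 (fun t => ((G t).nabla)^[m] (B t) v)
        (taylor (N - m) fun A => MvPolynomial.eval z (leading k (A.toList ++ v))) := by
    intro m
    induction m with
    | zero => exact fun v hv _ => hbase v hv
    | succ m ih =>
      intro v hv hm
      rcases v with _ | ⟨i, v⟩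
      · simp at hv
      have hv' : v.length = k.arity + m := by simp at hv; omega
      simp only [Function.iterate_succ_apply']
      refine (perturbed_nabla _ _ _ (fun v hv => ih v hv (by omega)) i hv').congr_limit fun x => ?_
      rw [show N - m = N - (m + 1) + 1 by omega, pd_taylor]
      refine congrArg (fun ζ => taylor (N - (m + 1)) ζ x) (funext fun A => ?_)
      rw [List.append_cons]
      refine congrArg _ (leading_perm hk (List.Perm.trans ?_ (List.perm_append_singleton i _).symm)
        (by omega))
      rw [← Multiset.coe_eq_coe, Multiset.coe_toList, ← Multiset.cons_coe, Multiset.coe_toList]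
  exact hstep (v.length - k.arity) v (by omega) (by omega)

end Jets

end RiemContr

namespace RiemContr

/-! ### The leading term of a complete contraction -/

section Limit

open Filter

variable {n : ℕ} (N : ℕ) (z : JetVar n → ℝ)

/-- A function `ψ` with prescribed derivatives at the origin, scaled by `t`. -/
noncomputable def jetPsi (t : ℝ) (x : E n) : ℝ := t * taylor N (fun A => z (.psi A)) x

/-- A function `υ` with prescribed derivatives at the origin, scaled by `t`. -/
noncomputable def jetUps (t : ℝ) (x : E n) : ℝ := t * taylor N (fun A => z (.ups A)) x

theorem tendsto_comp {F : Factor} (hk : F.kind = .R ∨ F.kind = .psi ∨ F.kind = .ups)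
    {v : List (Fin n)} (hF : F.kind.arity ≤ v.length) (hN : v.length ≤ N) :
    Tendsto (fun t => (jetLocalMetric N z t).comp (jetPsi N z t) (jetUps N z t) F.kind v 0 / t)
      (nhdsWithin 0 {0}ᶜ) (nhds (MvPolynomial.eval z (leading F.kind v))) := by
  have := (jet_comp N z hk hF hN).tendsto (isOpen_smallSet _ (jetMetric_contDiff N z))
    (zero_mem_smallSet _ 0)
  simp only [taylor_zero, Multiset.toList_zero, List.nil_append, pow_one] at this
  exact this

/-- The tensor product of the leading terms of the factors. -/
noncomputable def leadingTensor : Contr → List (Fin n) → ℝ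
  | [], _ => 1
  | F :: C, v => MvPolynomial.eval z (leading F.kind (v.take F.idx.length)) *
      leadingTensor C (v.drop F.idx.length)

theorem leadingTensor_map (C : Contr) (d : ℕ → Fin n) :
    leadingTensor z C (C.labels.map d) = MvPolynomial.eval z (prodVal leading C d) := by
  induction C with
  | nil => simp [leadingTensor, prodVal]
  | cons F C ih =>
    rw [leadingTensor, prodVal_cons, map_mul, Contr.labels_cons, List.map_append,
      List.take_left' (List.length_map ..), List.drop_left' (List.length_map ..), ih]

theorem tendsto_tensorProd {C : Contr} (hC : C.WellFormed)
    (hk : ∀ F ∈ C, F.kind = .R ∨ F.kind = .psi ∨ F.kind = .ups) (hN : C.labels.length ≤ N)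
    {v : List (Fin n)} (hv : v.length = C.labels.length) :
    Tendsto (fun t => (jetLocalMetric N z t).tensorProd (jetPsi N z t) (jetUps N z t) C v 0 /
      t ^ C.length) (nhdsWithin 0 {0}ᶜ) (nhds (leadingTensor z C v)) := by
  induction C generalizing v with
  | nil => simp [LocalMetric.tensorProd, leadingTensor]
  | cons F C ih =>
    rw [Contr.labels_cons, List.length_append] at hN hv
    have h1 : (v.take F.idx.length).length = F.idx.length := by
      rw [List.length_take]; omega
    have h2 := tendsto_comp N z (hk F List.mem_cons_self) (v := v.take F.idx.length)
      (by rw [h1]; exact hC F List.mem_cons_self) (by omega)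
    have h3 := ih (fun G hG => hC G (List.mem_cons_of_mem _ hG))
      (fun G hG => hk G (List.mem_cons_of_mem _ hG)) (by omega) (v := v.drop F.idx.length)
      (by rw [List.length_drop]; omega)
    refine (h2.mul h3).congr fun t => ?_
    rw [div_mul_div_comm, List.length_cons, pow_succ']
    rfl

theorem tendsto_eval {C : Contr} (hC : C.IsComplete)
    (hk : ∀ F ∈ C, F.kind = .R ∨ F.kind = .psi ∨ F.kind = .ups) (hN : C.labels.length ≤ N)
    (c : ℕ → Fin n) :
    Tendsto (fun t => (jetLocalMetric N z t).eval (jetPsi N z t) (jetUps N z t) C 0 / t ^ C.length)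
      (nhdsWithin 0 {0}ᶜ) (nhds (MvPolynomial.eval z (leadingPart C c))) := by
  have h1 : MvPolynomial.eval z (leadingPart C c) =
      ∑ c' : Fin C.labels.length → Fin n, (∏ s, ∏ t, if s < t ∧ C.labels.get s = C.labels.get t then
        (if c' s = c' t then (1 : ℝ) else 0) else 1) * leadingTensor z C (List.ofFn c') := by
    rw [sum_contract (1 : Matrix (Fin n) (Fin n) ℝ) (M := fun i j => if i = j then 1 else 0)
      (fun i j => by simp [Matrix.one_apply]) (leadingTensor z C) hC.2 c]
    simp only [frame_one, leadingTensor_map]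
    exact map_sumOver (MvPolynomial.eval z).toAddMonoidHom _ _ c
  rw [h1]
  simp only [LocalMetric.eval, Finset.sum_div, mul_div_assoc]
  refine tendsto_finsetSum _ fun c' _ => Tendsto.mul ?_ ?_
  · refine tendsto_finsetProd _ fun s _ => tendsto_finsetProd _ fun t _ => ?_
    by_cases hst : s < t ∧ C.labels.get s = C.labels.get t
    · simp only [if_pos hst]
      have h2 := (perturbed_ginv _ (jetMetric_contDiff N z) (jetMetric_symm N z) (c' s) (c' t)).tendsto
        (isOpen_smallSet _ (jetMetric_contDiff N z)) (zero_mem_smallSet _ 0)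
      simp only [pow_zero, div_one] at h2
      exact h2
    · simp only [if_neg hst]
      exact tendsto_const_nhds
  · exact tendsto_tensorProd N z hC.1 hk hN (List.length_ofFn ..)

end Limit

/-- If an equation holds modulo longer contractions, then its leading part vanishes identically, as one
sees from the metrics `δ + t H` and the functions `t ψ`, `t υ` as `t` tends to `0`. -/
theorem leadingPart_eq_zero {n M : ℕ} {A : LinComb} (hA : ∀ C ∈ A.support, C.IsComplete ∧
      (∀ F ∈ C, F.kind = .R ∨ F.kind = .psi ∨ F.kind = .ups) ∧ C.length = M)
    (h : EqualModLength n {.R, .psi, .ups} (M + 1) A 0) (c : ℕ → Fin n) :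
    (A.sum fun K b => b • leadingPart K c) = 0 := by
  classical
  obtain ⟨J, hJ, hAJ⟩ := h
  refine MvPolynomial.funext fun z => ?_
  -- no contraction which occurs involves derivatives of order greater than `N`
  set N := ∑ C ∈ A.support ∪ J.support, C.labels.length with hN
  have hle : ∀ C ∈ A.support ∪ J.support, C.labels.length ≤ N := fun C hC =>
    Finset.single_le_sum (f := fun C : Contr => C.labels.length) (fun _ _ => Nat.zero_le _) hC
  have hlimA : Filter.Tendsto (fun t => (jetLocalMetric N z t).evalLin (jetPsi N z t) (jetUps N z t) A 0
      / t ^ M) (nhdsWithin 0 {0}ᶜ)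
      (nhds (MvPolynomial.eval z (A.sum fun K b => b • leadingPart K c))) := by
    simp only [LocalMetric.evalLin, Finsupp.sum, Finset.sum_div, map_sum, MvPolynomial.smul_eval,
      mul_div_assoc]
    refine tendsto_finsetSum _ fun C hC => tendsto_const_nhds.mul ?_
    obtain ⟨h1, h2, rfl⟩ := hA C hC
    exact tendsto_eval N z h1 h2 (hle C (Finset.mem_union_left _ hC)) c
  have hlimJ : Filter.Tendsto (fun t => (jetLocalMetric N z t).evalLin (jetPsi N z t) (jetUps N z t) J 0
      / t ^ M) (nhdsWithin 0 {0}ᶜ) (nhds 0) := by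
    simp only [LocalMetric.evalLin, Finsupp.sum, Finset.sum_div, mul_div_assoc]
    suffices H : ∀ C ∈ J.support, Filter.Tendsto (fun t => J C * ((jetLocalMetric N z t).eval
        (jetPsi N z t) (jetUps N z t) C 0 / t ^ M)) (nhdsWithin 0 {0}ᶜ) (nhds 0) by
      simpa only [Finset.sum_const_zero] using tendsto_finsetSum _ H
    intro C hC
    obtain ⟨h1, h2, h3⟩ := hJ C hC
    have h4 := tendsto_eval N z h1 (fun F hF => by simpa using h3 F hF)
      (hle C (Finset.mem_union_right _ hC)) c
    obtain ⟨m, hm⟩ := Nat.exists_eq_add_of_le h2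
    have h5 : Filter.Tendsto (fun t : ℝ => t ^ (m + 1)) (nhdsWithin 0 {0}ᶜ) (nhds 0) := by
      have : ContinuousAt (fun t : ℝ => t ^ (m + 1)) 0 := by fun_prop
      simpa using this.tendsto.mono_left (nhdsWithin_le_nhds (s := {0}ᶜ))
    have h6 := (h4.mul h5).const_mul (J C)
    rw [mul_zero, mul_zero] at h6
    refine h6.congr' ?_
    filter_upwards [self_mem_nhdsWithin] with t ht
    have ht' : t ≠ 0 := ht
    -- division by `t ^ M` leaves a positive power of `t` for the longer contractions
    rw [hm, show M + 1 + m = M + (m + 1) by ring, pow_add]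
    field_simp
  have hev : ∀ᶠ t in nhdsWithin 0 {0}ᶜ, (jetLocalMetric N z t).evalLin (jetPsi N z t) (jetUps N z t) A 0 / t ^ M =
      (jetLocalMetric N z t).evalLin (jetPsi N z t) (jetUps N z t) J 0 / t ^ M := by
    have h1 : ∀ᶠ t : ℝ in nhds 0, ((t, 0) : ℝ × E n) ∈ smallSet (jetMetric N z) :=
      (Continuous.continuousAt (f := fun t : ℝ => ((t, 0) : ℝ × E n)) (by fun_prop)).eventually
        ((isOpen_smallSet _ (jetMetric_contDiff N z)).mem_nhds (zero_mem_smallSet _ 0))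
    filter_upwards [nhdsWithin_le_nhds h1] with t ht
    have := hAJ (jetLocalMetric N z t) (jetPsi N z t) (jetUps N z t)
      (contDiff_const.mul (taylor_contDiff N _)).contDiffOn
      (contDiff_const.mul (taylor_contDiff N _)).contDiffOn 0 ht
    rw [this, zero_add]
  rw [map_zero]
  exact tendsto_nhds_unique hlimA (hlimJ.congr' (hev.mono fun t ht => ht.symm))

end RiemContr

namespace RiemContr

/-! ### Divergences of weylified vector fields -/

/-- A factor hit by the derivative `∇_i`. -/
def Factor.hit (F : Factor) : Factor := ⟨F.kind, 0 :: F.idx⟩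

theorem Contr.IsVector.perm {C D : Contr} (hC : C.IsVector) (h : D.Perm C) : D.IsVector := by
  have hl : D.labels.Perm C.labels := h.flatMap_right _
  refine ⟨fun F hF => hC.1 F (h.mem_iff.1 hF), by rw [hl.count_eq, hC.2.1], fun l hl' h0 => ?_⟩
  rw [hl.count_eq]
  exact hC.2.2 l (hl.mem_iff.1 hl') h0

/-- The vector fields in the first form whose divergence has weight `-w`. -/
structure IsVectorForm (τ q a w : ℕ) (C : Contr) : Prop where
  vector : C.IsVector
  form : C.IsCurvatureForm τ q a
  wt : C.wt + 1 = w

namespace IsVectorForm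

variable {τ q a w : ℕ}

theorem perm {C D : Contr} (hC : IsVectorForm τ q a w C) (h : D.Perm C) : IsVectorForm τ q a w D :=
  ⟨hC.vector.perm h, hC.form.perm h, by rw [← hC.wt, Contr.wt, ((h.map _).sum_eq)]; rfl⟩

theorem zero_notMem_ups {C : Contr} (h : IsVectorForm τ q a w C) : 0 ∉ C.upsLabels := fun h0 =>
  h.form.ups_not_free 0 h0 h.vector.2.1

theorem count_ups {C : Contr} (h : IsVectorForm τ q a w C) :
    ∀ l ∈ C.upsLabels, C.labels.count l = 2 := fun l hl =>
  h.vector.2.2 l ((Contr.labels_perm_ups C).mem_iff.2 (List.mem_append_right _ hl))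
    fun h0 => h.zero_notMem_ups (h0 ▸ hl)

variable {F : Factor} {K : Contr} (h : IsVectorForm τ q a w (F :: K)) (hF : F.kind ≠ .ups)

include h

theorem count_hit (l : ℕ) (hl : l ∈ 0 :: Contr.labels (F :: K)) :
    (0 :: Contr.labels (F :: K)).count l = 2 := by
  by_cases h0 : l = 0
  · rw [h0, List.count_cons_self, h.vector.2.1]
  · rw [List.count_cons_of_ne (Ne.symm h0)]
    exact h.vector.2.2 l ((List.mem_cons.1 hl).resolve_left h0) h0

include hF

/-- If the factor without the free index is hit, the result is in the first form. -/
theorem hit_admissible (h0 : 0 ∉ F.idx) : Contr.IsAdmissible τ q a w (F.hit :: K) := by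
  have hc : Contr.IsComplete (F.hit :: K) := by
    refine ⟨fun G hG => ?_, h.count_hit⟩
    rcases List.mem_cons.1 hG with rfl | hG
    · exact (h.vector.1 F List.mem_cons_self).trans (Nat.le_succ _)
    · exact h.vector.1 G (List.mem_cons_of_mem _ hG)
  have hu : Contr.upsLabels (F.hit :: K) = Contr.upsLabels (F :: K) := by
    rw [Contr.upsLabels_cons hF, Contr.upsLabels_cons (show F.hit.kind ≠ .ups from hF)]
  have hnum : ∀ k, Contr.numKind k (F.hit :: K) = Contr.numKind k (F :: K) := fun k => by
    rw [Contr.numKind_cons, Contr.numKind_cons]; rfl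
  refine ⟨hc, ⟨fun G hG => ?_, fun G hG hk => ?_, ?_, ?_, ?_, fun G hG => ?_, ?_, fun l hl => ?_,
    fun G hG hk hl => ?_⟩, ?_⟩
  · rcases List.mem_cons.1 hG with rfl | hG
    exacts [h.form.kinds F List.mem_cons_self, h.form.kinds G (List.mem_cons_of_mem _ hG)]
  · rcases List.mem_cons.1 hG with rfl | hG
    exacts [absurd hk hF, h.form.ups_once G (List.mem_cons_of_mem _ hG) hk]
  · rw [hnum, h.form.num_psi]
  · rw [hnum, h.form.num_ups]
  · exact h.form.len
  · rcases List.mem_cons.1 hG with rfl | hG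
    exacts [List.nodup_cons.2 ⟨h0, h.form.no_internal F List.mem_cons_self⟩,
      h.form.no_internal G (List.mem_cons_of_mem _ hG)]
  · rw [hu]
    exact h.form.ups_apart
  · rw [hc.2 l ((Contr.labels_perm_ups _).mem_iff.2 (List.mem_append_right _ hl))]
    norm_num
  · rw [hu] at hl
    rcases List.mem_cons.1 hG with rfl | hG
    · exact (h.form.psi_twice F List.mem_cons_self hk fun l hl' =>
        hl l (List.mem_cons_of_mem _ hl')).trans (Nat.le_succ _)
    · exact h.form.psi_twice G (List.mem_cons_of_mem _ hG) hk hl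
  · have h1 := h.wt
    have h2 := h.vector.1 F List.mem_cons_self
    have h3 := h.form.kinds F List.mem_cons_self
    rw [Contr.wt_cons] at h1 ⊢
    obtain ⟨k, idx⟩ := F
    rcases h3 with rfl | rfl | rfl <;>
      simp only [Factor.hit, Factor.wt, Kind.arity, List.length_cons] at h1 h2 ⊢ <;> omega

theorem hit_complete : Contr.IsComplete ((F.weyl K.upsLabels).hit :: K.weyl) := by
  have hwf := h.form.weyl_wellFormed h.vector.1
  have hperm := h.form.labels_weyl_perm h.count_ups
  rw [Contr.weyl_cons hF K] at hwf hperm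
  have hl : (Contr.labels ((F.weyl K.upsLabels).hit :: K.weyl)).Perm (0 :: Contr.labels (F :: K)) :=
    hperm.cons 0
  refine ⟨fun G hG => ?_, fun l hl' => ?_⟩
  · rcases List.mem_cons.1 hG with rfl | hG
    · exact (hwf _ List.mem_cons_self).trans (Nat.le_succ _)
    · exact hwf G (List.mem_cons_of_mem _ hG)
  · rw [hl.count_eq]
    exact h.count_hit l (hl.mem_iff.1 hl')

/-- If the factor with the free index is hit, a new internal contraction arises. -/
theorem hit_isError (h0 : 0 ∈ F.idx) :
    IsError τ q a w ((F.weyl K.upsLabels).hit :: K.weyl) := by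
  have hu := Contr.upsLabels_cons hF K
  have hw := Contr.weyl_cons hF K
  have hzero := h.zero_notMem_ups
  have hlen := h.form.length_weyl
  have hnum := h.form.numKind_weyl.1
  have hwf := h.form.weyl_wellFormed h.vector.1
  have hwt := h.form.wt_weyl h.vector.1 h.count_ups
  have hint := fun l => h.form.internal_weyl h.count_ups (l := l)
  have hkinds := fun G => h.form.weyl_kinds (F := G)
  have hcard := h.form.card_upsLabels
  rw [hw] at hlen hnum hwf hwt
  simp only [hu, hw] at hint hkinds hzero hcard
  refine ⟨h.hit_complete hF, fun G hG => ?_, hlen, ?_, Or.inr ⟨?_, ?_⟩⟩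
  · rcases List.mem_cons.1 hG with rfl | hG
    exacts [hkinds (F.weyl K.upsLabels) List.mem_cons_self, hkinds G (List.mem_cons_of_mem _ hG)]
  · rw [← h.wt, ← hwt, Contr.wt_cons, Contr.wt_cons]
    have h2 := hwf _ List.mem_cons_self
    rcases hkinds _ List.mem_cons_self with hk | hk <;>
      simp only [Factor.hit, Factor.wt, hk, Kind.arity, List.length_cons] at h2 ⊢ <;> omega
  · rw [← hnum, Contr.numKind_cons, Contr.numKind_cons]
    rfl
  · -- the names of the factors `∇υ`, and the free index
    refine ⟨insert 0 K.upsLabels.toFinset, ?_, fun l hl => ?_⟩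
    · rw [Finset.card_insert_of_notMem (by simpa using hzero), hcard]
    · rcases Finset.mem_insert.1 hl with rfl | hl
      · refine ⟨_, List.mem_cons_self, ?_⟩
        have hk : F.kind = .R ∨ F.kind = .psi := by
          rcases h.form.kinds F List.mem_cons_self with hk | hk | hk
          exacts [Or.inl hk, Or.inr hk, absurd hk hF]
        rw [Factor.hit, List.count_cons_self, Factor.count_weyl hk, if_neg hzero,
          List.count_eq_one_of_mem (h.form.no_internal F List.mem_cons_self) h0]
      · have hl : l ∈ K.upsLabels := by simpa using hl
        obtain ⟨G, hG, h2⟩ := hint l hl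
        rcases List.mem_cons.1 hG with rfl | hG
        · refine ⟨_, List.mem_cons_self, ?_⟩
          rw [Factor.hit, List.count_cons_of_ne (by rintro rfl; exact hzero hl), h2]
        · exact ⟨G, List.mem_cons_of_mem _ hG, h2⟩

/-- The divergence commutes with `Weylify` as long as the factor with the free index is not hit. The
two sides differ in the position of `∇_i` among the derivatives of the factor. -/
theorem cls_hit {n : ℕ} {S : Submodule ℝ LinComb} (hS : ErrorSpace n τ q a w S) (hn : 4 ≤ n)
    (h0 : 0 ∉ F.idx) : Contr.weylCoeff n (F.hit :: K) • cls S (Contr.weyl (F.hit :: K)) =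
      Contr.weylCoeff n (F :: K) • cls S ((F.weyl K.upsLabels).hit :: K.weyl) := by
  have hadm := h.hit_admissible hF h0
  have hF' : F.hit.kind ≠ .ups := hF
  have hzero := h.zero_notMem_ups
  rw [Contr.upsLabels_cons hF] at hzero
  have hf : (0 :: F.idx).filter (fun l => l ∈ K.upsLabels) = F.idx.filter (fun l => l ∈ K.upsLabels) := by
    rw [List.filter_cons_of_neg (by simpa using hzero)]
  have hcoeff : F.hit.weylCoeff n K.upsLabels = F.weylCoeff n K.upsLabels := by
    have h2 := h.vector.1 F List.mem_cons_self
    have : F.hit.internal = F.internal := by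
      simp only [Factor.hit, Factor.internal, List.length_cons]
      rw [Nat.succ_sub h2, List.drop_succ_cons]
    simp only [Factor.weylCoeff, this]
    rfl
  rw [Contr.weylCoeff_cons n hF, Contr.weylCoeff_cons n hF', hcoeff, Contr.weyl_cons hF']
  congr 1
  obtain ⟨k, idx⟩ := F
  rcases h.form.kinds _ List.mem_cons_self with hk | hk | hk
  · obtain rfl : k = .R := hk
    obtain ⟨D, i, j, k, l, rfl⟩ := exists_eq_append_four (h.vector.1 _ List.mem_cons_self)
    simp only [Factor.hit, Factor.weyl, hf]
    have h1 := (weylSlot_of_admissible hS hn hadm).cls_perm_left (v := [i, j, k, l]) rfl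
      (List.perm_middle (a := 0) (l₁ := (D ++ [i, j, k, l]).filter (fun l => l ∈ K.upsLabels)) (l₂ := D))
      (by rw [hf]; simp)
    simpa using h1
  · obtain rfl : k = .psi := hk
    have h1 := cls_weyl_psi_perm hS hn hadm
      (l' := 0 :: (idx.filter (fun l => l ∈ K.upsLabels) ++ idx)) (by rw [hf]; exact List.perm_middle)
    simp only [Factor.hit, Factor.weyl, hf] at h1 ⊢
    exact h1
  · exact absurd hk hF

end IsVectorForm

/-- The divergence of a weylified contraction, as a sum over the factors before `Weylify`. -/
theorem sum_hit_map_filter {M : Type*} [AddCommMonoid M] (f : Factor → Factor) (C : Contr)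
    (g : Contr → M) :
    ∑ p : Fin ((C.filter fun F => F.kind ≠ .ups).map f).length,
      g (Contr.hit ((C.filter fun F => F.kind ≠ .ups).map f) p) =
    ∑ p : Fin C.length, if (C.get p).kind = .ups then 0 else
      g (((C.take p).filter fun F => F.kind ≠ .ups).map f ++
        (f (C.get p)).hit :: ((C.drop (p + 1)).filter fun F => F.kind ≠ .ups).map f) := by
  induction C generalizing g with
  | nil => rfl
  | cons F C ih =>
    refine Eq.trans ?_ (Fin.sum_univ_succ (n := C.length) _).symm
    by_cases hF : F.kind = .ups
    · have h1 : (F :: C).filter (fun F => F.kind ≠ .ups) = C.filter fun F => F.kind ≠ .ups := by simp [hF]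
      rw [h1, ih]
      simp [hF]
    · have h1 : (F :: C).filter (fun F => F.kind ≠ .ups) = F :: C.filter fun F => F.kind ≠ .ups := by
        simp [hF]
      rw [h1, List.map_cons]
      have h2 := ih (fun K => g (f F :: K))
      have h3 := Fin.sum_univ_succ fun p : Fin (f F :: (C.filter fun F => F.kind ≠ .ups).map f).length =>
        g (Contr.hit (f F :: (C.filter fun F => F.kind ≠ .ups).map f) p)
      refine h3.trans ?_
      refine congrArg₂ _ ?_ (Eq.trans h2 ?_)
      · simp [Contr.hit, Factor.hit, hF]
      · refine Finset.sum_congr rfl fun p _ => ?_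
        simp [hF]

theorem hit_eq (C : Contr) (p : Fin C.length) :
    C.hit p = C.take p ++ (C.get p).hit :: C.drop (p + 1) := by
  rw [Contr.hit, List.modify_eq_take_cons_drop p.2]
  rfl

section

variable {n τ q a w : ℕ} {S : Submodule ℝ LinComb}

/-- A term of the divergence which hits the factor with the free index is an error term; the terms which
hit a factor `∇υ` have no counterpart after `Weylify`. -/
theorem mkQ_div_weyl (hS : ErrorSpace n τ q a w S) (hn : 4 ≤ n) {C : Contr}
    (hC : IsVectorForm τ q a w C) : C.weylCoeff n • S.mkQ C.weyl.div =
      ∑ p : Fin C.length, if 0 ∈ (C.get p).idx ∨ (C.get p).kind = .ups then 0 else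
        (C.hit p).weylCoeff n • cls S (C.hit p).weyl := by
  have h1 := sum_hit_map_filter (Factor.weyl C.upsLabels) C (cls S)
  have h2 : S.mkQ C.weyl.div = ∑ p : Fin C.weyl.length, cls S (C.weyl.hit p) := by
    rw [Contr.div, map_sum]; rfl
  rw [h2]
  refine (congrArg _ h1).trans ?_
  rw [Finset.smul_sum]
  refine Finset.sum_congr rfl fun p _ => ?_
  by_cases hF : (C.get p).kind = .ups
  · simp only [hF, or_true, if_true, smul_zero]
  simp only [hF, or_false, if_false]
  set F := C.get p with hFdef
  set K : Contr := C.take p ++ C.drop (p + 1) with hK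
  have hCp : (F :: K).Perm C := by
    have : C = C.take p ++ F :: C.drop (p + 1) := by
      rw [hFdef, List.get_eq_getElem, List.cons_getElem_drop_succ, List.take_append_drop]
    conv_rhs => rw [this]
    exact List.perm_middle.symm
  have hv : IsVectorForm τ q a w (F :: K) := hC.perm hCp
  have hw : Factor.weyl C.upsLabels = Factor.weyl K.upsLabels := Factor.weyl_congr fun l => by
    rw [← (Contr.upsLabels_perm hCp).mem_iff, Contr.upsLabels_cons hF]
  have hterm : ((F.weyl K.upsLabels).hit :: K.weyl).Perm
      (((C.take p).filter fun F => F.kind ≠ .ups).map (Factor.weyl C.upsLabels) ++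
        (F.weyl C.upsLabels).hit :: ((C.drop (p + 1)).filter fun F => F.kind ≠ .ups).map
          (Factor.weyl C.upsLabels)) := by
    rw [hw]
    refine List.Perm.trans (List.Perm.of_eq ?_) List.perm_middle.symm
    rw [Contr.weyl, hK, List.filter_append, List.map_append]
  have hhit : (F.hit :: K).Perm (C.hit p) := by
    rw [hit_eq]
    exact List.perm_middle.symm
  split_ifs with h0
  · have he := hv.hit_isError hF h0
    rw [← cls_perm hS.long hn he.complete hterm, hS.cls_eq_zero _ he, smul_zero]
  · have h3 := hv.cls_hit hF hS hn h0
    rw [← cls_perm hS.long hn (hv.hit_complete hF) hterm, ← Contr.weylCoeff_perm n hCp, ← h3,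
      Contr.weylCoeff_perm n hhit, cls_perm hS.long hn (hv.hit_admissible hF h0).weyl_complete
        (Contr.weyl_perm hhit)]

/-- The class of the weylification of a linear combination. -/
noncomputable def weylifyCls (n : ℕ) (S : Submodule ℝ LinComb) : LinComb →ₗ[ℝ] LinComb ⧸ S :=
  Finsupp.linearCombination ℝ fun C => C.weylCoeff n • cls S C.weyl

theorem mkQ_weylify (n : ℕ) (S : Submodule ℝ LinComb) (L : LinComb) :
    S.mkQ (L.weylify n) = weylifyCls n S L := by
  simp only [LinComb.weylify, Finsupp.sum, map_sum, mkQ_single, mul_smul, weylifyCls,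
    Finsupp.linearCombination_apply]

/-- `Weylify` commutes with divergences, up to error terms. -/
theorem mkQ_div_weylify (hS : ErrorSpace n τ q a w S) (hn : 4 ≤ n) {L : LinComb}
    (hL : ∀ C ∈ L.support, IsVectorForm τ q a w C) :
    S.mkQ (L.weylify n).div = weylifyCls n S L.xdiv := by
  have h1 : ∀ L : LinComb, S.mkQ L.div = Finsupp.linearCombination ℝ (fun C => S.mkQ C.div) L := by
    intro L
    simp only [LinComb.div, Finsupp.sum, map_sum, map_smul, Finsupp.linearCombination_apply]
  rw [h1, LinComb.weylify, Finsupp.sum, map_sum, LinComb.xdiv, Finsupp.sum, map_sum]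
  refine Finset.sum_congr rfl fun C hC => ?_
  rw [Finsupp.linearCombination_single, mul_smul, mkQ_div_weyl hS hn (hL C hC), map_smul, Contr.xdiv,
    map_sum]
  congr 1
  refine Finset.sum_congr rfl fun p _ => ?_
  split_ifs
  · rw [map_zero]
  · rw [weylifyCls, Finsupp.linearCombination_single, one_smul]

theorem xdiv_support_admissible {L : LinComb} (hL : ∀ C ∈ L.support, IsVectorForm τ q a w C) :
    ∀ C ∈ L.xdiv.support, C.IsAdmissible τ q a w := by
  have h1 : L.xdiv ∈ Finsupp.supported ℝ ℝ {C | C.IsAdmissible τ q a w} := by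
    refine Submodule.sum_mem _ fun C hC => Submodule.smul_mem _ _ (Submodule.sum_mem _ fun p _ => ?_)
    split_ifs with h
    · exact Submodule.zero_mem _
    · push Not at h
      refine Finsupp.single_mem_supported ℝ _ ?_
      have hCp : (C.get p :: (C.take p ++ C.drop (p + 1))).Perm C := by
        have : C = C.take p ++ C.get p :: C.drop (p + 1) := by
          rw [List.get_eq_getElem, List.cons_getElem_drop_succ, List.take_append_drop]
        conv_rhs => rw [this]
        exact List.perm_middle.symm
      refine (((hL C hC).perm hCp).hit_admissible h.2 h.1).perm ?_
      rw [hit_eq]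
      exact List.perm_middle
  exact fun C hC => (Finsupp.mem_supported ℝ _).1 h1 hC

end

end RiemContr

theorem lemma4p1 (n : ℕ) (hn : 4 ≤ n) (τ q a w : ℕ) (hw : w ≤ n)
    (Cs Vs : RiemContr.LinComb)
    (hCs : ∀ C ∈ Cs.support, C.IsComplete ∧ C.IsCurvatureForm τ q a ∧ C.wt = w)
    (hVs : ∀ C ∈ Vs.support, C.IsVector ∧ C.IsCurvatureForm τ q a ∧ C.wt + 1 = w)
    (h : RiemContr.EqualModLength n {.R, .psi, .ups} (τ + a + 1) (Cs - Vs.xdiv) 0) :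
    ∃ D₁ D₂ : RiemContr.LinComb,
      (∀ C ∈ D₁.support, C.IsComplete ∧ C.IsWeylForm τ ∧ C.wt = w ∧ C.numKind .P < q) ∧
      (∀ C ∈ D₂.support, C.IsComplete ∧ C.IsWeylForm τ ∧ C.wt = w ∧ C.numKind .P = q ∧
        a + 1 ≤ C.delta .W + C.delta .P) ∧
      RiemContr.EqualModLength n {.R} (τ + 1)
        (Cs.weylify n - (Vs.weylify n).div) (D₁ + D₂) := by
  classical
  have hS := RiemContr.errorSpace_spec hn τ q a w
  set S := RiemContr.errorSpace n τ q a w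
  have hV : ∀ C ∈ Vs.support, RiemContr.IsVectorForm τ q a w C := fun C hC =>
    ⟨(hVs C hC).1, (hVs C hC).2.1, (hVs C hC).2.2⟩
  have hA : ∀ C ∈ (Cs - Vs.xdiv).support, C.IsAdmissible τ q a w := by
    intro C hC
    rcases Finset.mem_union.1 (Finsupp.support_sub hC) with h1 | h1
    · exact ⟨(hCs C h1).1, (hCs C h1).2.1, (hCs C h1).2.2⟩
    · exact RiemContr.xdiv_support_admissible hV C h1
  have h1 := RiemContr.mkQ_weylify_eq_zero hS hn hw hA (fun _ => ⟨0, by omega⟩)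
    (RiemContr.leadingPart_eq_zero (fun C hC =>
      ⟨(hA C hC).complete, (hA C hC).form.kinds, (hA C hC).form.len⟩) h _)
  have h2 : Cs.weylify n - (Vs.weylify n).div ∈ S := by
    rw [← Submodule.Quotient.mk_eq_zero, ← Submodule.mkQ_apply, map_sub,
      RiemContr.mkQ_div_weylify hS hn hV, RiemContr.mkQ_weylify, ← map_sub, ← RiemContr.mkQ_weylify, h1]
  obtain ⟨D₁, D₂, h3, h4, h5⟩ := RiemContr.mem_errorSpace h2
  exact ⟨D₁, D₂, h3, h4, RiemContr.equalModLength_iff.2 h5⟩
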